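/- **Proposition 2.7.** There are absolute constants $C>0$ and $D_0$ such that the following holds for every integer $D\ge D_0$ and every real primitive Dirichlet character $\chi$ modulo $D$ satisfying $$L(1,\chi)<(\log D)^{-17}(\log\log D)^{-1}.\tag{A1}$$ Put $\mathcal L=\log D$, $Q=\exp(\mathcal L^2)$, $\alpha=\mathcal L^{-2}$, $s_0=\tfrac12+iD$, and $$\Omega_1=\{s:\ -2\alpha^{1/2}<\Re(s-s_0)<1,\ |\Im(s-s_0)|<1+20\mathcal L\},$$ $$\Omega_2=\{s:\ -\tfrac1{10}\alpha\log\mathcal L<\Re(s-s_0)<\tfrac12,\ |\Im(s-s_0)|<1+10\mathcal L\}.$$ Let $\nu(n)$ and $\upsilon(n)$ be defined by $\sum_n\nu(n)n^{-s}=\zeta(s)L(s,\chi)$ and $\sum_n\upsilon(n)n^{-s}=\zeta(s)^{-1}L(s,\chi)^{-1}$ for $\Re s>1$. Let $\Psi$ be the set of all primitive characters $\psi$ modulo $q$, where $q$ runs over the squarefree integers with $Q<q<2Q$ and $(q,6)=1$, such that $\psi\chi$ is a primitive character modulo $[q,D]$. For $\psi\in\Psi$ put $$F(s,\psi)=\sum_{n\le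 D^5}\frac{\nu(n)\psi(n)}{n^s},\qquad G(s,\psi)=\sum_{n\le D^5}\frac{\upsilon(n)\psi(n)}{n^s},$$ $$\mathcal F(s,\psi)=F(s,\psi)+\Delta(s,\psi)\Delta(s,\psi\chi)F(1-s,\bar\psi),$$ where, for a primitive character $\theta$, $\Delta(s,\theta)$ is the meromorphic function $L(s,\theta)/L(1-s,\bar\theta)$. Let $\Psi^*$ be the set of $\psi\in\Psi$ for which all three of the following inequalities hold: $$\sup_{s\in\Omega_1}\big\{|F(s,\psi)|+|G(s,\psi)|\big\}<\mathcal L^3\log\mathcal L,\tag{I1}$$ $$\sup_{s\in\Omega_1}\big|F(s,\psi)G(s,\psi)-1\big|<\tfrac12,\tag{I2}$$ $$\sup_{s\in\Omega_2}\big|L(s,\psi)L(s,\psi\chi)-\mathcal F(s,\psi)\big|<\mathcal L^{-24/5}.\tag{I3}$$ Then the set $\Psi\setminus\Psi^*$ is finite and $$\#(\Psi\setminus\Psi^*)\le C\,(\log\mathcal L)^{-1}Q^2 .$$ -/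

import Mathlib

namespace LandauSiegel

noncomputable section

instance neZero_lcm {m n : ℕ} [NeZero m] [NeZero n] : NeZero (Nat.lcm m n) :=
  ⟨Nat.lcm_ne_zero (NeZero.ne m) (NeZero.ne n)⟩

/-- The parameter `𝓛 = log D`. -/
def ell (D : ℕ) : ℝ := Real.log D

/-- The parameter `Q = exp(𝓛²)`. -/
def bigQ (D : ℕ) : ℝ := Real.exp (ell D ^ 2)

/-- The parameter `α = 𝓛⁻²`. -/
def alpha (D : ℕ) : ℝ := (ell D ^ 2)⁻¹

/-- The point `s₀ = 1/2 + iD`. -/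
def sZero (D : ℕ) : ℂ := 1 / 2 + Complex.I * D

/-- The domain `Ω₁`. -/
def Omega1 (D : ℕ) : Set ℂ :=
  {s | -2 * √(alpha D) < (s - sZero D).re ∧ (s - sZero D).re < 1 ∧
    |(s - sZero D).im| < 1 + 20 * ell D}

/-- The domain `Ω₂`. -/
def Omega2 (D : ℕ) : Set ℂ :=
  {s | -(1 / 10) * alpha D * Real.log (ell D) < (s - sZero D).re ∧ (s - sZero D).re < 1 / 2 ∧
    |(s - sZero D).im| < 1 + 10 * ell D}

/-- The supremum of `f` over `S` is finite and strictly less than `B`. -/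
def SupLT (S : Set ℂ) (f : ℂ → ℝ) (B : ℝ) : Prop :=
  BddAbove (f '' S) ∧ sSup (f '' S) < B

/-- The coefficients `ν(n) = ∑_{d ∣ n} χ(d)` of `ζ(s) L(s, χ)`. -/
def nu {D : ℕ} (χ : DirichletCharacter ℂ D) (n : ℕ) : ℂ :=
  ∑ p ∈ n.divisorsAntidiagonal, χ p.2

/-- The coefficients `υ(n) = ∑_{ab = n} μ(a) μ(b) χ(b)` of `ζ(s)⁻¹ L(s, χ)⁻¹`. -/
def upsilon {D : ℕ} (χ : DirichletCharacter ℂ D) (n : ℕ) : ℂ :=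
  ∑ p ∈ n.divisorsAntidiagonal,
    (ArithmeticFunction.moebius p.1 : ℂ) * (χ p.2 * (ArithmeticFunction.moebius p.2 : ℂ))

open LSeries.notation in
/-- `ν` is the coefficient sequence of `ζ(s) L(s, χ)`. -/
theorem lSeriesHasSum_nu {D : ℕ} [NeZero D] (χ : DirichletCharacter ℂ D) {s : ℂ}
    (hs : 1 < s.re) :
    LSeriesHasSum (nu χ) s (riemannZeta s * DirichletCharacter.LFunction χ s) := by
  have h1 : LSeriesSummable 1 s := LSeriesSummable_one_iff.mpr hs
  have h2 := DirichletCharacter.LSeriesSummable_of_one_lt_re χ hs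
  have h := h1.LSeriesHasSum.convolution h2.LSeriesHasSum
  have e : nu χ = (1 : ℕ → ℂ) ⍟ (fun n : ℕ => χ n) := by
    rw [LSeries.convolution_def]
    funext n
    simp [nu]
  rw [e, DirichletCharacter.LFunction_eq_LSeries χ hs, ← LSeries_one_eq_riemannZeta hs]
  exact h

open LSeries.notation in
/-- `υ` is the coefficient sequence of `ζ(s)⁻¹ L(s, χ)⁻¹`. -/
theorem lSeriesHasSum_upsilon {D : ℕ} [NeZero D] (χ : DirichletCharacter ℂ D) {s : ℂ}
    (hs : 1 < s.re) :
    LSeriesHasSum (upsilon χ) s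
      ((riemannZeta s)⁻¹ * (DirichletCharacter.LFunction χ s)⁻¹) := by
  have h1 := ArithmeticFunction.LSeriesSummable_moebius_iff.mpr hs
  have h2 := (DirichletCharacter.LSeriesSummable_mul χ h1)
  have h := h1.LSeriesHasSum.convolution h2.LSeriesHasSum
  have z1 := ArithmeticFunction.LSeries_zeta_mul_Lseries_moebius hs
  rw [ArithmeticFunction.LSeries_zeta_eq_riemannZeta hs] at z1
  have z2 := DirichletCharacter.LSeries.mul_mu_eq_one χ hs
  rw [← DirichletCharacter.LFunction_eq_LSeries χ hs] at z2
  have e : upsilon χ = (fun n : ℕ => (ArithmeticFunction.moebius n : ℂ)) ⍟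
      ((fun n : ℕ => χ n) * fun n : ℕ => (ArithmeticFunction.moebius n : ℂ)) := by
    rw [LSeries.convolution_def]
    funext n
    simp [upsilon]
  rw [e, inv_eq_of_mul_eq_one_right z1,
    inv_eq_of_mul_eq_one_right z2]
  exact h

/-- `F(s, ψ) = ∑_{n ≤ D⁵} ν(n) ψ(n) n⁻ˢ`. -/
def bigF {D q : ℕ} (χ : DirichletCharacter ℂ D) (s : ℂ) (ψ : DirichletCharacter ℂ q) : ℂ :=
  ∑ n ∈ Finset.Icc 1 (D ^ 5), nu χ n * ψ n / (n : ℂ) ^ s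

/-- `G(s, ψ) = ∑_{n ≤ D⁵} υ(n) ψ(n) n⁻ˢ`. -/
def bigG {D q : ℕ} (χ : DirichletCharacter ℂ D) (s : ℂ) (ψ : DirichletCharacter ℂ q) : ℂ :=
  ∑ n ∈ Finset.Icc 1 (D ^ 5), upsilon χ n * ψ n / (n : ℂ) ^ s

/-- The meromorphic function `Δ(s, ψ) = L(s, ψ) / L(1 - s, ψ̄)`. The pointwise quotient has the
junk value `0` at zeros of the denominator; the normal form replaces it by the value of the
meromorphic function wherever that function is regular. -/
def Delta {k : ℕ} [NeZero k] (ψ : DirichletCharacter ℂ k) : ℂ → ℂ :=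
  toMeromorphicNFOn
    (fun s => DirichletCharacter.LFunction ψ s / DirichletCharacter.LFunction (star ψ) (1 - s))
    Set.univ

/-- `Δ₁(s, ψ) = Δ(s, ψ) Δ(s, ψχ)`, where `ψ.mul χ` is the product character, of modulus the
least common multiple of the two moduli. -/
def Delta1 {D q : ℕ} [NeZero D] [NeZero q] (χ : DirichletCharacter ℂ D) (s : ℂ)
    (ψ : DirichletCharacter ℂ q) : ℂ :=
  Delta ψ s * Delta (ψ.mul χ) s

/-- `𝓕(s, ψ) = F(s, ψ) + Δ₁(s, ψ) F(1 - s, ψ̄)`. -/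
def calF {D q : ℕ} [NeZero D] [NeZero q] (χ : DirichletCharacter ℂ D) (s : ℂ)
    (ψ : DirichletCharacter ℂ q) : ℂ :=
  bigF χ s ψ + Delta1 χ s ψ * bigF χ (1 - s) (star ψ)

/-- The set `𝒬` of squarefree `q` coprime to `6` with `Q < q < 2Q`. -/
def calQ (D : ℕ) : Set ℕ+ :=
  {q | bigQ D < ((q : ℕ) : ℝ) ∧ ((q : ℕ) : ℝ) < 2 * bigQ D ∧ Nat.Coprime 6 q ∧
    Squarefree (q : ℕ)}

/-- The family `Ψ` of primitive characters `ψ (mod q)`, `q ∈ 𝒬`, such that `ψχ` is a primitive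
character modulo `[q, D]`. A member is recorded together with its modulus. -/
def Psi {D : ℕ} (χ : DirichletCharacter ℂ D) :
    Set (Σ q : ℕ+, DirichletCharacter ℂ (q : ℕ)) :=
  {p | p.1 ∈ calQ D ∧ p.2.IsPrimitive ∧ (p.2.mul χ).IsPrimitive}

/-- The inequality `sup_{s ∈ Ω₁} (|F(s, ψ)| + |G(s, ψ)|) < 𝓛³ log 𝓛`. -/
def I1 {D q : ℕ} (χ : DirichletCharacter ℂ D) (ψ : DirichletCharacter ℂ q) : Prop :=
  SupLT (Omega1 D) (fun s => ‖bigF χ s ψ‖ + ‖bigG χ s ψ‖) (ell D ^ 3 * Real.log (ell D))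

/-- The inequality `sup_{s ∈ Ω₁} |F(s, ψ) G(s, ψ) - 1| < 1/2`. -/
def I2 {D q : ℕ} (χ : DirichletCharacter ℂ D) (ψ : DirichletCharacter ℂ q) : Prop :=
  SupLT (Omega1 D) (fun s => ‖bigF χ s ψ * bigG χ s ψ - 1‖) (1 / 2)

/-- The inequality `sup_{s ∈ Ω₂} |L(s, ψ) L(s, ψχ) - 𝓕(s, ψ)| < 𝓛^(-24/5)`. -/
def I3 {D q : ℕ} [NeZero D] [NeZero q] (χ : DirichletCharacter ℂ D)
    (ψ : DirichletCharacter ℂ q) : Prop :=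
  SupLT (Omega2 D)
    (fun s => ‖DirichletCharacter.LFunction ψ s * DirichletCharacter.LFunction (ψ.mul χ) s
      - calF χ s ψ‖)
    (ell D ^ (-(24 / 5) : ℝ))

/-- The set `Ψ*` of the `ψ ∈ Ψ` that satisfy all three inequalities. -/
def PsiStar {D : ℕ} [NeZero D] (χ : DirichletCharacter ℂ D) :
    Set (Σ q : ℕ+, DirichletCharacter ℂ (q : ℕ)) :=
  {p | p ∈ Psi χ ∧ I1 χ p.2 ∧ I2 χ p.2 ∧ I3 χ p.2}

/-- The complement `Ψ**` of `Ψ*` in `Ψ`. -/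
def PsiStarStar {D : ℕ} [NeZero D] (χ : DirichletCharacter ℂ D) :
    Set (Σ q : ℕ+, DirichletCharacter ℂ (q : ℕ)) :=
  Psi χ \ PsiStar χ

/-- The assumption `L(1, χ) < (log D)⁻¹⁷ (log log D)⁻¹`; `L(1, χ)` is real for real `χ`. -/
def A1 {D : ℕ} [NeZero D] (χ : DirichletCharacter ℂ D) : Prop :=
  (DirichletCharacter.LFunction χ 1).re
    < (Real.log D ^ 17)⁻¹ * (Real.log (Real.log D))⁻¹

end

end LandauSiegel

/-!
Each of the three inequalities asks for a pointwise bound of a Dirichlet polynomial (for the third,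
up to a negligible error) on a rectangle near the critical line. The bounds hold in mean square over
the family, by the large sieve, and Chebyshev's inequality bounds the number of characters for which
they fail.

**Smallness of `ν`.** The sum of `ν(n)/n` over `D^(5/8) < n ≤ N` is, by the hyperbola method and the
Pólya–Vinogradov inequality, at most `L(1, χ) log N` up to an error that saves a power of `D`
(`logSum_nuR_le`, `polya_vinogradov`). When `L(1, χ)` is tiny, the nonnegative function `ν` is thus
small on average beyond `D^(5/8)`. Since `ν²` and `(ν * ν)²` are dominated by the convolution powers
`ν^{*2}` and `ν^{*8}` (`nuR_pow_sq_le`), and one factor of a large product must be large, the mean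
squares beyond `D⁵` inherit this saving (`exists_energy_le`).

**From points to mean squares.** A Dirichlet polynomial with nonnegative exponents is recovered in a
half-plane from its values on a vertical line by the Poisson kernel (`norm_dirPoly_sq_le`). Its
supremum over a rectangle is thereby bounded by one weighted mean square on a line slightly to the
left, and `large_sieve` bounds the sum of these over the primitive characters of modulus at most
`2Q` by `Q²` times the energy of the coefficients, as long as the length is at most `Q²`
(`card_lt_meanSq_le`).

**The three inequalities.** For the first this is applied to `F` and to `G`. For the second, `ν` and
`υ` are inverse to each other under convolution, so `F G - 1` is a Dirichlet polynomial supported on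
`D⁵ < n ≤ D¹⁰`, with coefficients bounded by `ν * ν` (`bigF_mul_bigG_sub_one`). For the third, the
functional equation and a Perron integral with a Gaussian kernel, cut off at `Q^(3/2)`, represent
`L(s, ψ) L(s, ψχ)` by a direct and a dual sum (`exists_norm_Lprod_sub_calF_le`). The terms with
`n ≤ D⁵` make up `𝓕(s, ψ)`; what remains are a direct sum and two dual sums over `n > D⁵`, which are
small in mean square. The dual sum is divided at `Q^(1/1000)`. For the part beyond this point the
integral is estimated on a line at distance `α` from the pole of the Perron kernel, which costs a
factor `log 𝓛`; since `Ω₂` extends to the left of the critical line by a multiple of `α log 𝓛`,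
the terms with `n > Q^(1/1000)` carry an additional negative power of `𝓛`, which pays for this.
-/

namespace LandauSiegel

/-! ### The coefficients `ν` and `υ` -/

open ArithmeticFunction PowerSeries in
/-- The Bell series `∑ f(pᵏ) Xᵏ` of an arithmetic function at `p`. -/
noncomputable def bell (p : ℕ) (f : ArithmeticFunction ℝ) : PowerSeries ℝ :=
  PowerSeries.mk fun k => f (p ^ k)

lemma coeff_bell (p : ℕ) (f : ArithmeticFunction ℝ) (k : ℕ) :
    PowerSeries.coeff k (bell p f) = f (p ^ k) := by
  simp [bell]

lemma bell_mul {p : ℕ} (hp : p.Prime) (f g : ArithmeticFunction ℝ) :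
    bell p (f * g) = bell p f * bell p g := by
  ext k
  rw [coeff_bell, ArithmeticFunction.mul_apply, PowerSeries.coeff_mul,
    Nat.sum_divisorsAntidiagonal (fun i j => f i * g j), Nat.sum_divisors_prime_pow hp,
    Finset.Nat.sum_antidiagonal_eq_sum_range_succ_mk]
  refine Finset.sum_congr rfl fun i hi => ?_
  rw [coeff_bell, coeff_bell, Nat.pow_div (by simpa [Nat.lt_succ_iff] using hi) hp.pos]

lemma bell_pow {p : ℕ} (hp : p.Prime) (f : ArithmeticFunction ℝ) (m : ℕ) :
    bell p (f ^ (m + 1)) = bell p f ^ (m + 1) := by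
  induction m with
  | zero => simp
  | succ m ih => rw [pow_succ, bell_mul hp, ih, pow_succ _ (m + 1)]

/-- A multiplicative function is dominated by another one as soon as it is so at prime powers. -/
lemma abs_le_of_prime_pow {f g : ArithmeticFunction ℝ} (hf : f.IsMultiplicative)
    (hg : g.IsMultiplicative)
    (h : ∀ p k : ℕ, p.Prime → |f (p ^ k)| ≤ g (p ^ k)) (n : ℕ) : |f n| ≤ g n := by
  rcases eq_or_ne n 0 with rfl | hn
  · simp
  rw [hf.multiplicative_factorization f hn, hg.multiplicative_factorization g hn, Finsupp.prod,
    Finsupp.prod, Finset.abs_prod]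
  refine Finset.prod_le_prod (fun _ _ => abs_nonneg _) fun p hp => h p _ ?_
  exact Nat.prime_of_mem_primeFactors (by simpa using hp)

/-- `τ_a(pⁿ)² ≤ τ_{a²}(pⁿ)` with `a = d + 1`. -/
lemma choose_add_sq_le (d e n : ℕ) (h : e + 1 = (d + 1) ^ 2) :
    (Nat.choose (d + n) d : ℝ) ^ 2 ≤ Nat.choose (e + n) e := by
  induction n with
  | zero => simp
  | succ n ih =>
    have key : ∀ m : ℕ, (Nat.choose (m + (n + 1)) m : ℝ) * (n + 1) =
        Nat.choose (m + n) m * (m + n + 1) := by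
      intro m
      have h1 := Nat.choose_mul_succ_eq (m + n) m
      have h2 : m + n + 1 - m = n + 1 := by omega
      rw [h2] at h1
      exact_mod_cast h1.symm
    have hd := key d
    have he := key e
    have hn : (0 : ℝ) < n + 1 := by positivity
    have h' : (e : ℝ) + 1 = (d + 1) ^ 2 := by exact_mod_cast h
    have h3 : ((d : ℝ) + n + 1) ^ 2 ≤ (e + n + 1) * (n + 1) := by
      nlinarith [sq_nonneg (d : ℝ), mul_nonneg (sq_nonneg (d : ℝ)) hn.le]
    have h4 : ((Nat.choose (d + (n + 1)) d : ℝ) * (n + 1)) ^ 2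
        ≤ (Nat.choose (e + (n + 1)) e : ℝ) * (n + 1) ^ 2 := by
      rw [hd, mul_pow, pow_two ((n : ℝ) + 1), ← mul_assoc, he]
      calc (Nat.choose (d + n) d : ℝ) ^ 2 * (d + n + 1) ^ 2
          ≤ (Nat.choose (e + n) e : ℝ) * ((e + n + 1) * (n + 1)) := by gcongr
        _ = _ := by ring
    rw [mul_pow] at h4
    exact le_of_mul_le_mul_right h4 (by positivity)

lemma choose_add_mono {d e : ℕ} (h : d ≤ e) (n : ℕ) :
    (Nat.choose (d + n) d : ℝ) ≤ Nat.choose (e + n) e := by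
  rw [Nat.choose_symm_add, Nat.choose_symm_add]
  exact_mod_cast Nat.choose_le_choose n (by omega)

section quadratic

variable {D : ℕ} {χ : DirichletCharacter ℂ D}

/-- A quadratic character as a real arithmetic function. -/
noncomputable def chiR (χ : DirichletCharacter ℂ D) : ArithmeticFunction ℝ :=
  ⟨fun n => if n = 0 then 0 else (χ n).re, by simp⟩

lemma chiR_apply {n : ℕ} (hn : n ≠ 0) : chiR χ n = (χ n).re := by
  simp [chiR, hn]

lemma chiR_cast (hχ : χ.IsQuadratic) {n : ℕ} (hn : n ≠ 0) : ((chiR χ n : ℝ) : ℂ) = χ n := by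
  rw [chiR_apply hn]
  rcases hχ n with h | h | h <;> simp [h]

lemma chiR_values (hχ : χ.IsQuadratic) (n : ℕ) :
    chiR χ n = 0 ∨ chiR χ n = 1 ∨ chiR χ n = -1 := by
  rcases eq_or_ne n 0 with rfl | hn
  · simp
  rw [chiR_apply hn]
  rcases hχ n with h | h | h <;> simp [h]

lemma chiR_mul (hχ : χ.IsQuadratic) {m n : ℕ} (hm : m ≠ 0) (hn : n ≠ 0) :
    chiR χ (m * n) = chiR χ m * chiR χ n := by
  have : ((chiR χ (m * n) : ℝ) : ℂ) = ((chiR χ m * chiR χ n : ℝ) : ℂ) := by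
    rw [chiR_cast hχ (mul_ne_zero hm hn), Complex.ofReal_mul, chiR_cast hχ hm, chiR_cast hχ hn]
    simp
  exact_mod_cast this

lemma chiR_pow (hχ : χ.IsQuadratic) {p : ℕ} (hp : p.Prime) (k : ℕ) :
    chiR χ (p ^ k) = chiR χ p ^ k := by
  induction k with
  | zero => simp [chiR_apply]
  | succ k ih => rw [pow_succ, chiR_mul hχ (pow_ne_zero _ hp.ne_zero) hp.ne_zero, ih, pow_succ]

lemma chiR_isMultiplicative (hχ : χ.IsQuadratic) : (chiR χ).IsMultiplicative := by
  refine ArithmeticFunction.IsMultiplicative.iff_ne_zero.mpr ⟨by simp [chiR_apply], ?_⟩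
  intro m n hm hn _
  exact chiR_mul hχ hm hn

/-- `ν` as a real arithmetic function. -/
noncomputable def nuR (χ : DirichletCharacter ℂ D) : ArithmeticFunction ℝ :=
  ((ArithmeticFunction.zeta : ArithmeticFunction ℕ) : ArithmeticFunction ℝ) * chiR χ

/-- `υ` as a real arithmetic function. -/
noncomputable def upsilonR (χ : DirichletCharacter ℂ D) : ArithmeticFunction ℝ :=
  ((ArithmeticFunction.moebius : ArithmeticFunction ℤ) : ArithmeticFunction ℝ) *
    (chiR χ).pmul ((ArithmeticFunction.moebius : ArithmeticFunction ℤ) : ArithmeticFunction ℝ)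

lemma nu_eq (hχ : χ.IsQuadratic) (n : ℕ) : nu χ n = (nuR χ n : ℂ) := by
  rw [nu, nuR, ArithmeticFunction.mul_apply, Complex.ofReal_sum]
  refine Finset.sum_congr rfl fun p hp => ?_
  obtain ⟨h1, h2⟩ := Nat.ne_zero_of_mem_divisorsAntidiagonal hp
  rw [Complex.ofReal_mul, chiR_cast hχ h2]
  simp [h1]

lemma upsilon_eq (hχ : χ.IsQuadratic) (n : ℕ) : upsilon χ n = (upsilonR χ n : ℂ) := by
  rw [upsilon, upsilonR, ArithmeticFunction.mul_apply, Complex.ofReal_sum]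
  refine Finset.sum_congr rfl fun p hp => ?_
  obtain ⟨h1, h2⟩ := Nat.ne_zero_of_mem_divisorsAntidiagonal hp
  rw [ArithmeticFunction.pmul_apply, Complex.ofReal_mul, Complex.ofReal_mul, chiR_cast hχ h2]
  simp

lemma nuR_isMultiplicative (hχ : χ.IsQuadratic) : (nuR χ).IsMultiplicative :=
  ArithmeticFunction.isMultiplicative_zeta.natCast.mul (chiR_isMultiplicative hχ)

lemma upsilonR_isMultiplicative (hχ : χ.IsQuadratic) : (upsilonR χ).IsMultiplicative :=
  ArithmeticFunction.isMultiplicative_moebius.intCast.mul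
    ((chiR_isMultiplicative hχ).pmul ArithmeticFunction.isMultiplicative_moebius.intCast)

/-- The Bell series of `ν` at a split, ramified or inert prime. -/
lemma bell_nuR (hχ : χ.IsQuadratic) {p : ℕ} (hp : p.Prime) :
    (chiR χ p = 1 ∧ bell p (nuR χ) = PowerSeries.mk 1 ^ 2) ∨
    (chiR χ p = 0 ∧ bell p (nuR χ) = PowerSeries.mk 1 ^ 1) ∨
    (chiR χ p = -1 ∧ bell p (nuR χ) = PowerSeries.expand 2 two_ne_zero (PowerSeries.mk 1 ^ 1)) := by
  have hz : bell p ((ArithmeticFunction.zeta : ArithmeticFunction ℕ) : ArithmeticFunction ℝ) =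
      PowerSeries.mk 1 := by
    ext k
    simp [coeff_bell, hp.ne_zero]
  have hc : bell p (chiR χ) = PowerSeries.mk fun k => chiR χ p ^ k := by
    ext k
    simp [coeff_bell, chiR_pow hχ hp]
  rw [nuR, bell_mul hp, hz, hc]
  rcases chiR_values hχ p with h | h | h <;> rw [h]
  · refine Or.inr (Or.inl ⟨rfl, ?_⟩)
    have : (PowerSeries.mk fun k => (0 : ℝ) ^ k) = 1 := by
      ext k
      cases k <;> simp [PowerSeries.coeff_one]
    rw [this]
    simp
  · refine Or.inl ⟨rfl, ?_⟩
    have : (PowerSeries.mk fun k => (1 : ℝ) ^ k) = PowerSeries.mk 1 := by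
      ext k
      simp
    rw [this, sq]
  · refine Or.inr (Or.inr ⟨rfl, ?_⟩)
    ext k
    rw [PowerSeries.coeff_mul, Finset.Nat.sum_antidiagonal_eq_sum_range_succ_mk, pow_one,
      PowerSeries.coeff_expand]
    simp only [PowerSeries.coeff_mk, Pi.one_apply, one_mul]
    have := Finset.sum_range_reflect (fun i => (-1 : ℝ) ^ i) (k + 1)
    simp only [add_tsub_cancel_right, Nat.succ_eq_add_one] at this ⊢
    rw [this, neg_one_geom_sum]
    rcases Nat.even_or_odd k with hk | hk
    · have h2 : 2 ∣ k := hk.two_dvd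
      simp [h2, hk]
    · have h2 : ¬ 2 ∣ k := hk.not_two_dvd_nat
      simp [h2, hk]

lemma coeff_mk_one_pow (d k : ℕ) :
    PowerSeries.coeff k (PowerSeries.mk (1 : ℕ → ℝ) ^ (d + 1)) = Nat.choose (d + k) d := by
  rw [PowerSeries.mk_one_pow_eq_mk_choose_add, PowerSeries.coeff_mk]

lemma nuR_prime_pow_nonneg (hχ : χ.IsQuadratic) {p : ℕ} (hp : p.Prime) (k : ℕ) :
    0 ≤ nuR χ (p ^ k) := by
  rw [← coeff_bell]
  rcases bell_nuR hχ hp with ⟨-, h⟩ | ⟨-, h⟩ | ⟨-, h⟩ <;> rw [h]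
  · rw [coeff_mk_one_pow 1]; positivity
  · rw [coeff_mk_one_pow 0]; positivity
  · rw [PowerSeries.coeff_expand, coeff_mk_one_pow 0]
    positivity

lemma nuR_nonneg (hχ : χ.IsQuadratic) (n : ℕ) : 0 ≤ nuR χ n := by
  rcases eq_or_ne n 0 with rfl | hn
  · simp
  rw [(nuR_isMultiplicative hχ).multiplicative_factorization _ hn]
  exact Finset.prod_nonneg fun p hp =>
    nuR_prime_pow_nonneg hχ (Nat.prime_of_mem_primeFactors (by simpa using hp)) _

lemma abs_upsilonR_le (hχ : χ.IsQuadratic) (n : ℕ) : |upsilonR χ n| ≤ nuR χ n := by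
  refine abs_le_of_prime_pow (upsilonR_isMultiplicative hχ) (nuR_isMultiplicative hχ) ?_ n
  intro p k hp
  have hm : bell p ((ArithmeticFunction.moebius : ArithmeticFunction ℤ) : ArithmeticFunction ℝ) =
      1 - PowerSeries.X := by
    ext k
    rw [coeff_bell, map_sub, PowerSeries.coeff_one, PowerSeries.coeff_X]
    rcases k with _ | _ | k
    · simp
    · simp [ArithmeticFunction.moebius_apply_prime hp]
    · simp [ArithmeticFunction.moebius_apply_prime_pow hp]
  have hc : bell p ((chiR χ).pmul
      ((ArithmeticFunction.moebius : ArithmeticFunction ℤ) : ArithmeticFunction ℝ)) =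
      1 - PowerSeries.C (chiR χ p) * PowerSeries.X := by
    ext k
    rw [coeff_bell, map_sub, PowerSeries.coeff_one, PowerSeries.coeff_C_mul, PowerSeries.coeff_X]
    rcases k with _ | _ | k
    · simp [chiR_apply]
    · simp [ArithmeticFunction.moebius_apply_prime hp]
    · simp [ArithmeticFunction.moebius_apply_prime_pow hp]
  have hu : upsilonR χ (p ^ k) = PowerSeries.coeff k ((1 : PowerSeries ℝ)
      - PowerSeries.C (1 + chiR χ p) * PowerSeries.X ^ 1
      + PowerSeries.C (chiR χ p) * PowerSeries.X ^ 2) := by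
    rw [← coeff_bell, upsilonR, bell_mul hp, hm, hc, map_add PowerSeries.C, map_one]
    congr 1
    ring
  rw [hu, map_add, map_sub, PowerSeries.coeff_C_mul_X_pow, PowerSeries.coeff_C_mul_X_pow,
    PowerSeries.coeff_one]
  by_cases hk : 3 ≤ k
  · rw [if_neg (by omega), if_neg (by omega), if_neg (by omega)]
    simpa using nuR_prime_pow_nonneg hχ hp k
  rw [← coeff_bell]
  rcases bell_nuR hχ hp with ⟨h1, h⟩ | ⟨h1, h⟩ | ⟨h1, h⟩ <;> rw [h, h1]
  · rw [coeff_mk_one_pow 1]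
    interval_cases k <;> norm_num
  · rw [coeff_mk_one_pow 0]
    interval_cases k <;> norm_num
  · rw [PowerSeries.coeff_expand]
    interval_cases k <;> norm_num [coeff_mk_one_pow 0]

/-- The comparison of squares with convolution powers, from `τ_a² ≤ τ_{a²}` at prime powers. -/
lemma nuR_pow_sq_le (hχ : χ.IsQuadratic) {a b : ℕ} (ha : a ≠ 0) (h : 2 * a ^ 2 ≤ b) (n : ℕ) :
    (nuR χ ^ a) n ^ 2 ≤ (nuR χ ^ b) n := by
  have hm := nuR_isMultiplicative hχ
  have ha1 : (nuR χ ^ a).IsMultiplicative := hm.pow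
  have hb1 : (nuR χ ^ b).IsMultiplicative := hm.pow
  have := abs_le_of_prime_pow (ha1.pmul ha1) hb1 ?_ n
  · rw [ArithmeticFunction.pmul_apply, ← sq, abs_of_nonneg (sq_nonneg _)] at this
    exact this
  intro p k hp
  rw [ArithmeticFunction.pmul_apply, ← sq, abs_of_nonneg (sq_nonneg _), ← coeff_bell, ← coeff_bell]
  obtain ⟨a, rfl⟩ := Nat.exists_eq_succ_of_ne_zero ha
  obtain ⟨b, rfl⟩ := Nat.exists_eq_succ_of_ne_zero (show b ≠ 0 by
    rintro rfl
    have : 0 < 2 * (a.succ) ^ 2 := by positivity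
    omega)
  simp only [Nat.succ_eq_add_one] at h ⊢
  rw [bell_pow hp, bell_pow hp]
  have main : ∀ c d k : ℕ, (c + 1) ^ 2 ≤ d + 1 →
      (PowerSeries.coeff k (PowerSeries.mk (1 : ℕ → ℝ) ^ (c + 1))) ^ 2 ≤
        PowerSeries.coeff k (PowerSeries.mk (1 : ℕ → ℝ) ^ (d + 1)) := by
    intro c d k hcd
    rw [coeff_mk_one_pow, coeff_mk_one_pow]
    refine (choose_add_sq_le c ((c + 1) ^ 2 - 1) k ?_).trans (choose_add_mono (by omega) k)
    have : 0 < (c + 1) ^ 2 := by positivity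
    omega
  rcases bell_nuR hχ hp with ⟨-, h1⟩ | ⟨-, h1⟩ | ⟨-, h1⟩ <;> rw [h1]
  · rw [← pow_mul, ← pow_mul]
    have := main (2 * a + 1) (2 * b + 1) k (by nlinarith)
    rwa [show 2 * (a + 1) = 2 * a + 1 + 1 by ring, show 2 * (b + 1) = 2 * b + 1 + 1 by ring]
  · rw [pow_one]
    exact main a b k (by nlinarith)
  · rw [pow_one, ← map_pow (PowerSeries.expand 2 two_ne_zero) _ (a + 1),
      ← map_pow (PowerSeries.expand 2 two_ne_zero) _ (b + 1), PowerSeries.coeff_expand,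
      PowerSeries.coeff_expand]
    split_ifs
    · exact main a b _ (by nlinarith)
    · simp

end quadratic

/-! ### Gauss sums and the Pólya–Vinogradov inequality -/

open ZMod in
lemma sum_zmod_eq_sum_range {q : ℕ} [NeZero q] {M : Type*} [AddCommMonoid M] (f : ZMod q → M) :
    ∑ a : ZMod q, f a = ∑ a ∈ Finset.range q, f a := by
  refine Finset.sum_nbij' (fun a => a.val) (fun n => (n : ZMod q)) ?_ ?_ ?_ ?_ ?_
  · intro a _; simpa using ZMod.val_lt a
  · intro n _; simp
  · intro a _; simp
  · intro n hn; exact ZMod.val_cast_of_lt (by simpa using hn)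
  · intro a _; simp

lemma star_mulChar_apply {q : ℕ} (χ : DirichletCharacter ℂ q) [NeZero q] (a : ZMod q) :
    χ⁻¹ a = starRingEnd ℂ (χ a) := by
  rw [← MulChar.star_eq_inv, MulChar.star_apply]; rfl

lemma isPrimitive_inv {q : ℕ} {χ : DirichletCharacter ℂ q} (h : χ.IsPrimitive) :
    χ⁻¹.IsPrimitive := by
  rwa [DirichletCharacter.isPrimitive_def, DirichletCharacter.conductor_inv]

lemma normSq_apply_of_isUnit {q : ℕ} (χ : DirichletCharacter ℂ q) {a : ZMod q} (ha : IsUnit a) :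
    ‖χ a‖ = 1 := by
  obtain ⟨u, rfl⟩ := ha
  exact DirichletCharacter.unit_norm_eq_one χ u

lemma norm_gaussSum_sq {q : ℕ} [NeZero q] {χ : DirichletCharacter ℂ q} (h : χ.IsPrimitive) :
    ‖gaussSum χ (ZMod.stdAddChar (N := q))‖ ^ 2 = q := by
  classical
  set e := ZMod.stdAddChar (N := q)
  set A : ℂ := ∑ a : ZMod q, χ a * starRingEnd ℂ (χ a) with hA
  have h1 : ∀ a : ZMod q, gaussSum χ (e.mulShift a) * starRingEnd ℂ (gaussSum χ (e.mulShift a))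
      = (χ a * starRingEnd ℂ (χ a)) * (gaussSum χ e * starRingEnd ℂ (gaussSum χ e)) := by
    intro a
    rw [gaussSum_mulShift_of_isPrimitive e h, star_mulChar_apply, map_mul, Complex.conj_conj]
    ring
  have h2 : ∑ a : ZMod q, gaussSum χ (e.mulShift a) *
      starRingEnd ℂ (gaussSum χ (e.mulShift a)) = q * A := by
    have h3 : ∀ a : ZMod q, gaussSum χ (e.mulShift a) *
        starRingEnd ℂ (gaussSum χ (e.mulShift a)) =
        ∑ x : ZMod q, ∑ y : ZMod q, χ x * starRingEnd ℂ (χ y) * e (a * (x - y)) := by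
      intro a
      rw [gaussSum, map_sum, Finset.sum_mul_sum]
      refine Finset.sum_congr rfl fun x _ => Finset.sum_congr rfl fun y _ => ?_
      rw [map_mul, AddChar.mulShift_apply, AddChar.mulShift_apply, ← AddChar.map_neg_eq_conj,
        mul_sub, sub_eq_add_neg, AddChar.map_add_eq_mul]
      ring
    simp_rw [h3]
    rw [Finset.sum_comm, hA, Finset.mul_sum]
    refine Finset.sum_congr rfl fun x _ => ?_
    rw [Finset.sum_comm]
    simp_rw [← Finset.mul_sum, e, AddChar.sum_mulShift _ (ZMod.isPrimitive_stdAddChar q)]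
    rw [Finset.sum_eq_single x]
    · simp [ZMod.card]; ring
    · intro y _ hy
      rw [if_neg (sub_ne_zero.mpr (Ne.symm hy))]; simp
    · simp
  have hA0 : A ≠ 0 := by
    have h4 : A = ((∑ a : ZMod q, ‖χ a‖ ^ 2 : ℝ) : ℂ) := by
      rw [hA, Complex.ofReal_sum]
      exact Finset.sum_congr rfl fun a _ => by rw [Complex.mul_conj']; norm_cast
    rw [h4, Complex.ofReal_ne_zero]
    have h5 : ‖χ 1‖ ^ 2 ≤ ∑ a : ZMod q, ‖χ a‖ ^ 2 :=
      Finset.single_le_sum (f := fun a => ‖χ a‖ ^ 2) (fun a _ => sq_nonneg _) (Finset.mem_univ 1)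
    have : ‖χ 1‖ = 1 := by simp
    rw [this] at h5
    linarith
  rw [Finset.sum_congr rfl fun a _ => h1 a, ← Finset.sum_mul, mul_comm (q : ℂ) A] at h2
  have h6 := mul_left_cancel₀ hA0 h2
  rw [Complex.mul_conj'] at h6
  exact_mod_cast h6

/-- A primitive character is a linear combination of additive characters. -/
lemma primitive_apply_mul_gaussSum {q : ℕ} [NeZero q] {χ : DirichletCharacter ℂ q}
    (h : χ.IsPrimitive) (n : ℕ) :
    χ n * gaussSum χ⁻¹ (ZMod.stdAddChar (N := q)) =
      ∑ a : ZMod q, χ⁻¹ a * ZMod.stdAddChar ((n : ZMod q) * a) := by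
  have := gaussSum_mulShift_of_isPrimitive (ZMod.stdAddChar (N := q)) (isPrimitive_inv h) n
  rw [inv_inv] at this
  rw [← this, gaussSum]
  simp [AddChar.mulShift_apply]

lemma stdAddChar_natCast_mul {q : ℕ} [NeZero q] (n a : ℕ) :
    ZMod.stdAddChar ((n : ZMod q) * (a : ZMod q)) =
      Complex.exp (Complex.I * (2 * Real.pi * (a / q) : ℝ)) ^ n := by
  have := ZMod.stdAddChar_coe (N := q) (n * a)
  push_cast at this
  rw [this, ← Complex.exp_nat_mul]
  congr 1
  push_cast
  ring

lemma norm_geom_sum_le {z : ℂ} (hz : ‖z‖ = 1) (h1 : z ≠ 1) (M N : ℕ) :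
    ‖∑ n ∈ Finset.Ioc M N, z ^ n‖ ≤ 2 / ‖z - 1‖ := by
  rcases le_or_gt N M with h | h
  · rw [Finset.Ioc_eq_empty (by omega), Finset.sum_empty, norm_zero]
    positivity
  have h2 : Finset.Ioc M N = Finset.Ico (M + 1) (N + 1) := by ext; simp; try omega
  rw [h2, geom_sum_Ico h1 (by omega), norm_div]
  have h3 : 0 < ‖z - 1‖ := norm_pos_iff.mpr (sub_ne_zero.mpr h1)
  gcongr
  calc _ ≤ ‖z ^ (N + 1)‖ + ‖z ^ (M + 1)‖ := norm_sub_le _ _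
    _ = 2 := by rw [norm_pow, norm_pow, hz]; norm_num

/-- The Pólya–Vinogradov inequality. -/
lemma polya_vinogradov {q : ℕ} [NeZero q] {χ : DirichletCharacter ℂ q} (h : χ.IsPrimitive)
    (hq : 1 < q) (M N : ℕ) :
    ‖∑ n ∈ Finset.Ioc M N, χ n‖ ≤ √q * (1 + Real.log q) := by
  have hq0 : (0 : ℝ) < q := by exact_mod_cast (by omega : 0 < q)
  set g := gaussSum χ⁻¹ (ZMod.stdAddChar (N := q)) with hg
  have hgn : ‖g‖ ^ 2 = q := norm_gaussSum_sq (isPrimitive_inv h)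
  have hgs : ‖g‖ = √q := by rw [← hgn, Real.sqrt_sq (norm_nonneg _)]
  set z : ℕ → ℂ := fun a => Complex.exp (Complex.I * (2 * Real.pi * (a / q) : ℝ)) with hzdef
  -- expand `χ` in additive characters; the sum over `n` becomes geometric
  have h1 : (∑ n ∈ Finset.Ioc M N, χ n) * g =
      ∑ a ∈ Finset.range q, χ⁻¹ a * ∑ n ∈ Finset.Ioc M N, z a ^ n := by
    rw [Finset.sum_mul]
    simp_rw [hg, primitive_apply_mul_gaussSum h, sum_zmod_eq_sum_range, stdAddChar_natCast_mul,
      Finset.mul_sum]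
    exact Finset.sum_comm
  -- `|e(a/q) - 1| = 2 sin(πa/q)` is at least `4 min(a, q - a) / q`, and the minimum is bounded
  -- below by the harmonic expression `1 / (1/a + 1/(q - a))`, symmetric in `a` and `q - a`
  have h2 : ∀ a ∈ Finset.range q, ‖χ⁻¹ (a : ZMod q) * ∑ n ∈ Finset.Ioc M N, z a ^ n‖ ≤
      if a = 0 then 0 else (q : ℝ) / 2 * (1 / a + 1 / (q - a : ℕ)) := by
    intro a ha
    have haq : a < q := by simpa using ha
    split_ifs with h0
    · subst h0
      have : χ⁻¹ ((0 : ℕ) : ZMod q) = 0 := by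
        rw [Nat.cast_zero]
        have : Fact (1 < q) := ⟨hq⟩
        exact MulChar.map_nonunit _ not_isUnit_zero
      rw [this]; simp
    rw [norm_mul]
    have ha0 : (0 : ℝ) < a := by exact_mod_cast Nat.pos_of_ne_zero h0
    have hb0 : (0 : ℝ) < (q - a : ℕ) := by exact_mod_cast (by omega : 0 < q - a)
    have hab : (a : ℝ) + (q - a : ℕ) = q := by exact_mod_cast (by omega : a + (q - a) = q)
    have hzn : ‖z a‖ = 1 := by
      rw [hzdef]; simp only [mul_comm Complex.I]; exact Complex.norm_exp_ofReal_mul_I _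
    have hsin : ∀ x y : ℝ, 0 < x → 0 < y → x + y = q → x ≤ y →
        2 * (x / q) ≤ Real.sin (Real.pi * (x / q)) := by
      intro x y hx hy hxy hle
      have h4 : x / q ≤ 1 / 2 := by rw [div_le_div_iff₀ hq0 two_pos]; linarith
      have := Real.mul_le_sin (x := Real.pi * (x / q)) (by positivity)
        (by nlinarith [Real.pi_pos])
      calc 2 * (x / q) = 2 / Real.pi * (Real.pi * (x / q)) := by field_simp
        _ ≤ _ := this
    have hz1 : ‖z a - 1‖ = ‖2 * Real.sin (Real.pi * (a / q))‖ := by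
      rw [hzdef]; simp only
      rw [Complex.norm_exp_I_mul_ofReal_sub_one]
      congr 3; ring
    have hlow : 4 / q * (1 / (1 / (a : ℝ) + 1 / (q - a : ℕ))) ≤ ‖z a - 1‖ := by
      rw [hz1, Real.norm_eq_abs]
      refine le_trans ?_ (le_abs_self _)
      rcases le_total (a : ℝ) (q - a : ℕ) with hle | hle
      · have h5 := hsin a _ ha0 hb0 hab hle
        have h6 : 1 / (1 / (a : ℝ) + 1 / (q - a : ℕ)) ≤ a := by
          rw [div_le_iff₀ (by positivity), mul_add, mul_one_div_cancel ha0.ne']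
          have : 0 ≤ (a : ℝ) * (1 / (q - a : ℕ)) := by positivity
          linarith
        calc _ ≤ 4 / q * (a : ℝ) := by gcongr
          _ = 2 * (2 * (a / q)) := by ring
          _ ≤ _ := by linarith
      · have h5 := hsin _ a hb0 ha0 (by linarith) hle
        have h6 : 1 / (1 / (a : ℝ) + 1 / (q - a : ℕ)) ≤ (q - a : ℕ) := by
          rw [div_le_iff₀ (by positivity), mul_add, mul_one_div_cancel hb0.ne']
          have : 0 ≤ ((q - a : ℕ) : ℝ) * (1 / a) := by positivity
          linarith
        have h7 : Real.sin (Real.pi * (a / q)) = Real.sin (Real.pi * ((q - a : ℕ) / q)) := by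
          rw [← Real.sin_pi_sub]
          congr 1
          rw [← hab]
          have : (a : ℝ) + (q - a : ℕ) ≠ 0 := by positivity
          field_simp
          ring
        rw [h7]
        calc _ ≤ 4 / q * ((q - a : ℕ) : ℝ) := by gcongr
          _ = 2 * (2 * ((q - a : ℕ) / q)) := by ring
          _ ≤ _ := by linarith
    have hpos : 0 < 4 / q * (1 / (1 / (a : ℝ) + 1 / (q - a : ℕ))) := by positivity
    have hz0 : z a ≠ 1 := by
      intro h8
      rw [h8, sub_self, norm_zero] at hlow
      linarith
    calc ‖χ⁻¹ (a : ZMod q)‖ * ‖∑ n ∈ Finset.Ioc M N, z a ^ n‖ ≤ 1 * (2 / ‖z a - 1‖) := by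
          gcongr
          · exact DirichletCharacter.norm_le_one _ _
          · exact norm_geom_sum_le hzn hz0 M N
      _ ≤ 1 * (2 / (4 / q * (1 / (1 / (a : ℝ) + 1 / (q - a : ℕ))))) := by gcongr
      _ = _ := by field_simp; ring
  have hH : ∑ a ∈ Finset.range (q - 1), 1 / ((a : ℝ) + 1) ≤ 1 + Real.log q := by
    have h9 := harmonic_le_one_add_log (q - 1)
    rw [harmonic] at h9
    push_cast at h9
    calc _ = ∑ i ∈ Finset.range (q - 1), ((i : ℝ) + 1)⁻¹ := by simp
      _ ≤ 1 + Real.log ((q - 1 : ℕ) : ℝ) := h9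
      _ ≤ _ := by
        gcongr
        · exact_mod_cast (by omega : 0 < q - 1)
        · omega
  have h3 : ‖(∑ n ∈ Finset.Ioc M N, χ n) * g‖ ≤ q * (1 + Real.log q) := by
    rw [h1]
    refine (norm_sum_le_of_le _ h2).trans ?_
    obtain ⟨m, rfl⟩ : ∃ m, q = m + 1 := ⟨q - 1, by omega⟩
    rw [Finset.sum_range_succ']
    simp only [Nat.add_eq_zero_iff, one_ne_zero, and_false, if_false, if_true, add_zero]
    rw [← Finset.mul_sum, Finset.sum_add_distrib]
    have h10 : ∑ a ∈ Finset.range m, 1 / ((m + 1 - (a + 1) : ℕ) : ℝ) =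
        ∑ a ∈ Finset.range m, 1 / ((a : ℝ) + 1) := by
      rw [← Finset.sum_range_reflect]
      refine Finset.sum_congr rfl fun a ha => ?_
      have : a < m := by simpa using ha
      congr 1
      exact_mod_cast (by omega : m + 1 - (m - 1 - a + 1) = a + 1)
    rw [h10]
    simp only [Nat.add_sub_cancel] at hH
    push_cast at hH ⊢
    nlinarith
  rw [norm_mul, hgs] at h3
  have h11 : (q : ℝ) = √q * √q := (Real.mul_self_sqrt hq0.le).symm
  have h12 : 0 < √(q : ℝ) := Real.sqrt_pos.mpr hq0
  refine le_of_mul_le_mul_right ?_ h12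
  calc _ ≤ q * (1 + Real.log q) := h3
    _ = √q * √q * (1 + Real.log q) := by rw [← h11]
    _ = _ := by ring

/-! ### Sums of `ν(n)/n` and the size of `L(1, χ)` -/

/-- Sums over `n ≤ N` of sums over factorizations `n = ab`, as double sums. -/
lemma sum_divisorsAntidiagonal_eq_double_sum {M : Type*} [AddCommMonoid M] (N : ℕ)
    (F : ℕ → ℕ → M) :
    ∑ n ∈ Finset.Icc 1 N, ∑ p ∈ n.divisorsAntidiagonal, F p.1 p.2 =
      ∑ a ∈ Finset.Icc 1 N, ∑ b ∈ Finset.Icc 1 N, if a * b ≤ N then F a b else 0 := by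
  classical
  rw [← Finset.sum_product', ← Finset.sum_filter, Finset.sum_sigma']
  refine Finset.sum_nbij' (fun x => x.2) (fun p => ⟨p.1 * p.2, p⟩) ?_ ?_ ?_ ?_ ?_
  · rintro ⟨n, a, b⟩ h
    simp only [Finset.mem_sigma, Finset.mem_Icc, Nat.mem_divisorsAntidiagonal] at h
    obtain ⟨⟨h1, h2⟩, rfl, h3⟩ := h
    have ha : 0 < a := Nat.pos_of_ne_zero fun h => h3 (by simp [h])
    have hb : 0 < b := Nat.pos_of_ne_zero fun h => h3 (by simp [h])
    simp only [Finset.mem_filter, Finset.mem_product, Finset.mem_Icc]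
    refine ⟨⟨⟨ha, ?_⟩, hb, ?_⟩, h2⟩
    · exact (Nat.le_mul_of_pos_right a hb).trans h2
    · exact (Nat.le_mul_of_pos_left b ha).trans h2
  · rintro ⟨a, b⟩ h
    simp only [Finset.mem_filter, Finset.mem_product, Finset.mem_Icc] at h
    obtain ⟨⟨⟨h1, -⟩, h2, -⟩, h3⟩ := h
    simp only [Finset.mem_sigma, Finset.mem_Icc, Nat.mem_divisorsAntidiagonal]
    exact ⟨⟨Nat.mul_pos h1 h2, h3⟩, trivial, (Nat.mul_pos h1 h2).ne'⟩
  · rintro ⟨n, a, b⟩ h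
    simp only [Finset.mem_sigma, Finset.mem_Icc, Nat.mem_divisorsAntidiagonal] at h
    obtain ⟨-, rfl, -⟩ := h
    rfl
  · rintro ⟨a, b⟩ _; rfl
  · rintro ⟨n, a, b⟩ _; rfl

/-- The sum of `f(n)/n` over `x < n ≤ N`. -/
noncomputable def logSum (f : ArithmeticFunction ℝ) (x : ℝ) (N : ℕ) : ℝ :=
  ∑ n ∈ Finset.Icc 1 N, if x < n then f n / n else 0

lemma logSum_nonneg {f : ArithmeticFunction ℝ} (hf : ∀ n, 0 ≤ f n) (x : ℝ) (N : ℕ) :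
    0 ≤ logSum f x N :=
  Finset.sum_nonneg fun n _ => by split_ifs <;> [exact div_nonneg (hf n) (by positivity); rfl]

lemma logSum_mono {f g : ArithmeticFunction ℝ} (h : ∀ n, f n ≤ g n) (x : ℝ) (N : ℕ) :
    logSum f x N ≤ logSum g x N :=
  Finset.sum_le_sum fun n _ => by
    split_ifs
    · exact div_le_div_of_nonneg_right (h n) (by positivity)
    · rfl

lemma logSum_zero (f : ArithmeticFunction ℝ) (N : ℕ) :
    logSum f 0 N = ∑ n ∈ Finset.Icc 1 N, f n / n := by
  refine Finset.sum_congr rfl fun n hn => if_pos ?_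
  exact_mod_cast (Finset.mem_Icc.mp hn).1

lemma logSum_mul_eq (f g : ArithmeticFunction ℝ) (x : ℝ) (N : ℕ) :
    logSum (f * g) x N = ∑ a ∈ Finset.Icc 1 N, ∑ b ∈ Finset.Icc 1 N,
      if a * b ≤ N then (if x < (a * b : ℕ) then f a / a * (g b / b) else 0) else 0 := by
  rw [← sum_divisorsAntidiagonal_eq_double_sum N
    (fun a b => if x < (a * b : ℕ) then f a / a * (g b / b) else 0), logSum]
  refine Finset.sum_congr rfl fun n _ => ?_
  rw [ArithmeticFunction.mul_apply]
  split_ifs with h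
  · rw [Finset.sum_div]
    refine Finset.sum_congr rfl fun p hp => ?_
    rw [Nat.mem_divisorsAntidiagonal] at hp
    rw [hp.1, if_pos h, ← hp.1]
    push_cast
    rw [mul_div_mul_comm]
  · symm
    refine Finset.sum_eq_zero fun p hp => ?_
    rw [Nat.mem_divisorsAntidiagonal] at hp
    rw [hp.1, if_neg h]

/-- If `ab > xy` then `a > x` or `b > y`. -/
lemma logSum_mul_le {f g : ArithmeticFunction ℝ} (hf : ∀ n, 0 ≤ f n) (hg : ∀ n, 0 ≤ g n)
    {x y : ℝ} (hx : 0 ≤ x) (N : ℕ) :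
    logSum (f * g) (x * y) N ≤ logSum f x N * logSum g 0 N + logSum f 0 N * logSum g y N := by
  rw [logSum_mul_eq, logSum_zero, logSum_zero, logSum, logSum, Finset.sum_mul_sum,
    Finset.sum_mul_sum, ← Finset.sum_add_distrib]
  refine Finset.sum_le_sum fun a _ => ?_
  rw [← Finset.sum_add_distrib]
  refine Finset.sum_le_sum fun b _ => ?_
  have h1 : 0 ≤ f a / a := div_nonneg (hf a) (by positivity)
  have h2 : 0 ≤ g b / b := div_nonneg (hg b) (by positivity)
  have h3 := mul_nonneg h1 h2
  by_cases hab : x * y < (a * b : ℕ)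
  · by_cases ha : x < a
    · simp only [hab, ha, if_true]
      split_ifs <;> simp <;> positivity
    · have hb : y < b := by
        by_contra hb
        push_cast at hab
        have := mul_le_mul (not_lt.mp ha) (not_lt.mp hb) (by positivity) hx
        linarith
      simp only [hab, ha, hb, if_true, if_false]
      split_ifs <;> simp <;> positivity
  · simp only [hab, if_false, ite_self]
    split_ifs <;> simp <;> positivity

lemma logSum_mul_zero_le {f g : ArithmeticFunction ℝ} (hf : ∀ n, 0 ≤ f n) (hg : ∀ n, 0 ≤ g n)
    (N : ℕ) : logSum (f * g) 0 N ≤ logSum f 0 N * logSum g 0 N := by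
  rw [logSum_mul_eq, logSum_zero, logSum_zero, Finset.sum_mul_sum]
  refine Finset.sum_le_sum fun a _ => Finset.sum_le_sum fun b _ => ?_
  have h1 : 0 ≤ f a / a := div_nonneg (hf a) (by positivity)
  have h2 : 0 ≤ g b / b := div_nonneg (hg b) (by positivity)
  have h3 := mul_nonneg h1 h2
  split_ifs <;> linarith

lemma convPow_nonneg {f : ArithmeticFunction ℝ} (hf : ∀ n, 0 ≤ f n) (m : ℕ) (n : ℕ) :
    0 ≤ (f ^ m) n := by
  induction m generalizing n with
  | zero => rw [pow_zero, ArithmeticFunction.one_apply]; split_ifs <;> simp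
  | succ m ih =>
    rw [pow_succ, ArithmeticFunction.mul_apply]
    exact Finset.sum_nonneg fun p _ => mul_nonneg (ih _) (hf _)

lemma logSum_pow_zero_le {f : ArithmeticFunction ℝ} (hf : ∀ n, 0 ≤ f n) (m : ℕ) (N : ℕ) :
    logSum (f ^ (m + 1)) 0 N ≤ logSum f 0 N ^ (m + 1) := by
  induction m with
  | zero => simp
  | succ m ih =>
    rw [pow_succ f, pow_succ (logSum f 0 N)]
    exact (logSum_mul_zero_le (convPow_nonneg hf _) hf N).trans
      (mul_le_mul_of_nonneg_right ih (logSum_nonneg hf _ _))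

/-- One of the factors of `n = n₁ ⋯ n_m > zᵐ` exceeds `z`. -/
lemma logSum_pow_le {f : ArithmeticFunction ℝ} (hf : ∀ n, 0 ≤ f n) {z : ℝ} (hz : 0 ≤ z) (m : ℕ)
    (N : ℕ) :
    logSum (f ^ (m + 1)) (z ^ (m + 1)) N ≤ (m + 1) * logSum f 0 N ^ m * logSum f z N := by
  induction m with
  | zero => simp
  | succ m ih =>
    have h0 := logSum_nonneg hf 0 N
    have h1 := logSum_nonneg hf z N
    rw [pow_succ f, pow_succ z]
    refine (logSum_mul_le (convPow_nonneg hf _) hf (by positivity) N).trans ?_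
    have h2 := mul_le_mul_of_nonneg_right ih h0
    have h3 := mul_le_mul_of_nonneg_right (logSum_pow_zero_le hf m N) h1
    push_cast
    calc _ ≤ (m + 1) * logSum f 0 N ^ m * logSum f z N * logSum f 0 N +
        logSum f 0 N ^ (m + 1) * logSum f z N := add_le_add h2 h3
      _ = _ := by ring

lemma sum_Ioc_inv_le_log {m n : ℕ} (hm : 1 ≤ m) (hmn : m ≤ n) :
    ∑ a ∈ Finset.Ioc m n, (1 : ℝ) / a ≤ Real.log n - Real.log m := by
  induction n, hmn using Nat.le_induction with
  | base => simp
  | succ n hmn ih =>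
    rw [Finset.sum_Ioc_succ_top hmn]
    have hn : (0 : ℝ) < n := by exact_mod_cast (by omega : 0 < n)
    have h : (1 : ℝ) / (n + 1) ≤ Real.log (n + 1) - Real.log n := by
      rw [← Real.log_div (by positivity) hn.ne']
      have := Real.one_sub_inv_le_log_of_pos (x := ((n : ℝ) + 1) / n) (by positivity)
      refine le_trans (le_of_eq ?_) this
      field_simp
      ring
    push_cast
    linarith

lemma log_le_sum_Ioc_inv {m n : ℕ} (hmn : m ≤ n) :
    Real.log (n + 1) - Real.log (m + 1) ≤ ∑ a ∈ Finset.Ioc m n, (1 : ℝ) / a := by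
  induction n, hmn using Nat.le_induction with
  | base => simp
  | succ n hmn ih =>
    rw [Finset.sum_Ioc_succ_top hmn]
    have h : Real.log (n + 1 + 1) - Real.log (n + 1) ≤ (1 : ℝ) / (n + 1) := by
      rw [← Real.log_div (by positivity) (by positivity)]
      have := Real.log_le_sub_one_of_pos (x := ((n : ℝ) + 1 + 1) / (n + 1)) (by positivity)
      refine this.trans (le_of_eq ?_)
      field_simp
      ring
    push_cast
    linarith

/-- The harmonic sum over `u < a ≤ v` is `log (v/u)` up to `2/u`. -/
lemma abs_sum_inv_sub_log_le {u v : ℝ} (hu : 1 ≤ u) (huv : u ≤ v) :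
    |∑ a ∈ Finset.Ioc ⌊u⌋₊ ⌊v⌋₊, (1 : ℝ) / a - Real.log (v / u)| ≤ 2 / u := by
  have hu0 : 0 < u := by linarith
  have hv0 : 0 < v := by linarith
  have h1 : 1 ≤ ⌊u⌋₊ := Nat.one_le_floor_iff u |>.mpr hu
  have h2 : ⌊u⌋₊ ≤ ⌊v⌋₊ := Nat.floor_mono huv
  have h1' : (1 : ℝ) ≤ ⌊u⌋₊ := by exact_mod_cast h1
  have h2' : (1 : ℝ) ≤ ⌊v⌋₊ := by exact_mod_cast h1.trans h2
  have hfu := Nat.floor_le hu0.le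
  have hfv := Nat.floor_le hv0.le
  have hlu := Nat.lt_floor_add_one u
  have hlv := Nat.lt_floor_add_one v
  rw [Real.log_div hv0.ne' hu0.ne', abs_le]
  constructor
  · have h3 := log_le_sum_Ioc_inv h2
    have h4 : Real.log v ≤ Real.log (⌊v⌋₊ + 1) := Real.log_le_log hv0 hlv.le
    have h5 : Real.log (⌊u⌋₊ + 1) - Real.log u ≤ 1 / u := by
      rw [← Real.log_div (by positivity) hu0.ne']
      refine (Real.log_le_sub_one_of_pos (by positivity)).trans ?_
      rw [div_sub_one hu0.ne']
      gcongr
      linarith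
    have h6 : 1 / u ≤ 2 / u := by gcongr; norm_num
    linarith
  · have h3 := sum_Ioc_inv_le_log h1 h2
    have h4 : Real.log ⌊v⌋₊ ≤ Real.log v := Real.log_le_log (by linarith) hfv
    have h5 : Real.log u - Real.log ⌊u⌋₊ ≤ 2 / u := by
      rw [← Real.log_div hu0.ne' (by positivity)]
      refine (Real.log_le_sub_one_of_pos (by positivity)).trans ?_
      rw [div_sub_one (by positivity), div_le_div_iff₀ (by positivity) hu0]
      nlinarith
    linarith

/-- Summation by parts against a decreasing weight. -/
lemma norm_sum_mul_antitone_le {a : ℕ → ℂ} {w : ℕ → ℝ} {B : ℝ} {y : ℕ}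
    (hB : ∀ m, ‖∑ n ∈ Finset.Ioc y m, a n‖ ≤ B) (hw : ∀ n, y < n → w (n + 1) ≤ w n)
    (hw0 : ∀ n, y < n → 0 ≤ w n) (z : ℕ) :
    ‖∑ n ∈ Finset.Ioc y z, a n * (w n : ℂ)‖ ≤ B * w (y + 1) := by
  have hB0 : 0 ≤ B := (norm_nonneg _).trans (hB 0)
  rcases lt_or_ge z y with h | h
  · rw [Finset.Ioc_eq_empty (by omega), Finset.sum_empty, norm_zero]
    exact mul_nonneg hB0 (hw0 _ (by omega))
  have key : ‖∑ n ∈ Finset.Ioc y z, a n * (w n : ℂ)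
      - (∑ n ∈ Finset.Ioc y z, a n) * (w (z + 1) : ℂ)‖ ≤ B * (w (y + 1) - w (z + 1)) := by
    induction z, h using Nat.le_induction with
    | base => simp
    | succ z hz ih =>
      have e : ∑ n ∈ Finset.Ioc y (z + 1), a n * (w n : ℂ)
          - (∑ n ∈ Finset.Ioc y (z + 1), a n) * (w (z + 1 + 1) : ℂ) =
          (∑ n ∈ Finset.Ioc y z, a n * (w n : ℂ) -
            (∑ n ∈ Finset.Ioc y z, a n) * (w (z + 1) : ℂ)) +
          (∑ n ∈ Finset.Ioc y (z + 1), a n) * ((w (z + 1) - w (z + 1 + 1) : ℝ) : ℂ) := by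
        rw [Finset.sum_Ioc_succ_top hz, Finset.sum_Ioc_succ_top hz]
        push_cast
        ring
      rw [e]
      refine (norm_add_le _ _).trans ?_
      have h1 : ‖(∑ n ∈ Finset.Ioc y (z + 1), a n) * ((w (z + 1) - w (z + 1 + 1) : ℝ) : ℂ)‖ ≤
          B * (w (z + 1) - w (z + 1 + 1)) := by
        have h2 := hw (z + 1) (by omega)
        rw [norm_mul, Complex.norm_of_nonneg (by linarith)]
        exact mul_le_mul_of_nonneg_right (hB _) (by linarith)
      linarith
  have h1 : ‖(∑ n ∈ Finset.Ioc y z, a n) * (w (z + 1) : ℂ)‖ ≤ B * w (z + 1) := by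
    have h2 := hw0 (z + 1) (by omega)
    rw [norm_mul, Complex.norm_of_nonneg h2]
    exact mul_le_mul_of_nonneg_right (hB _) h2
  have h3 := norm_add_le (∑ n ∈ Finset.Ioc y z, a n * (w n : ℂ)
      - (∑ n ∈ Finset.Ioc y z, a n) * (w (z + 1) : ℂ))
      ((∑ n ∈ Finset.Ioc y z, a n) * (w (z + 1) : ℂ))
  rw [sub_add_cancel] at h3
  linarith

open Filter Topology in
/-- The partial sums of the conditionally convergent series `L(1, χ) = ∑ χ(n)/n`. -/
lemma norm_LFunction_one_sub_le {D : ℕ} [NeZero D] {χ : DirichletCharacter ℂ D} (hχ : χ ≠ 1)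
    {B : ℝ} {y : ℕ} (hB : ∀ m : ℕ, ‖∑ n ∈ Finset.Ioc y m, χ n‖ ≤ B) :
    ‖DirichletCharacter.LFunction χ 1 -
      ∑ n ∈ Finset.Icc (1 : ℕ) y, χ (n : ℕ) * ((1 / (n : ℝ) : ℝ) : ℂ)‖
      ≤ B * (1 / (y + 1)) := by
  have hB0 : 0 ≤ B := (norm_nonneg _).trans (hB 0)
  have step : ∀ s : ℝ, 1 < s →
      ‖DirichletCharacter.LFunction χ s -
        ∑ n ∈ Finset.Icc (1 : ℕ) y, χ (n : ℕ) * (((n : ℝ) ^ (-s) : ℝ) : ℂ)‖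
      ≤ B * (1 / (y + 1)) := by
    intro s hs
    have hs' : 1 < (s : ℂ).re := by simpa using hs
    have h1 := (DirichletCharacter.LSeriesSummable_of_one_lt_re χ hs').hasSum
    have h2 : Tendsto (fun N => ∑ n ∈ Finset.Icc 1 N, χ (n : ℕ) * (((n : ℝ) ^ (-s) : ℝ) : ℂ)) atTop
        (𝓝 (DirichletCharacter.LFunction χ s)) := by
      rw [DirichletCharacter.LFunction_eq_LSeries χ hs']
      have h3 := (h1.tendsto_sum_nat).comp (tendsto_add_atTop_nat 1)
      refine h3.congr fun N => ?_
      rw [Function.comp_apply, Finset.range_eq_Ico, Finset.sum_eq_sum_Ico_succ_bot (by omega)]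
      rw [LSeries.term_zero, zero_add]
      have : Finset.Ico (0 + 1) (N + 1) = Finset.Icc 1 N := by ext; simp
      rw [this]
      refine Finset.sum_congr rfl fun n hn => ?_
      have hn0 : n ≠ 0 := by have := (Finset.mem_Icc.mp hn).1; omega
      rw [LSeries.term_of_ne_zero hn0, Complex.ofReal_cpow (by positivity), div_eq_mul_inv,
        ← Complex.cpow_neg]
      push_cast
      rfl
    refine le_of_tendsto ((h2.sub tendsto_const_nhds).norm) ?_
    filter_upwards [eventually_ge_atTop y] with N hN
    have h4 : ∑ n ∈ Finset.Icc 1 N, χ (n : ℕ) * (((n : ℝ) ^ (-s) : ℝ) : ℂ) -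
        ∑ n ∈ Finset.Icc (1 : ℕ) y, χ (n : ℕ) * (((n : ℝ) ^ (-s) : ℝ) : ℂ) =
        ∑ n ∈ Finset.Ioc y N, χ (n : ℕ) * (((n : ℝ) ^ (-s) : ℝ) : ℂ) := by
      rw [sub_eq_iff_eq_add, add_comm, ← Finset.sum_union]
      · congr 1
        ext; simp; omega
      · rw [Finset.disjoint_left]
        intro n hn hn'
        simp at hn hn'
        omega
    rw [h4]
    refine (norm_sum_mul_antitone_le (w := fun n => (n : ℝ) ^ (-s)) hB ?_ ?_ N).trans ?_
    · intro n hn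
      refine Real.rpow_le_rpow_of_nonpos ?_ ?_ (by linarith)
      · exact_mod_cast (by omega : 0 < n)
      · push_cast; linarith
    · intro n _; positivity
    · gcongr
      push_cast
      rw [one_div, ← Real.rpow_neg_one]
      exact Real.rpow_le_rpow_of_exponent_le (by linarith [(Nat.cast_nonneg y : (0 : ℝ) ≤ y)])
        (by linarith)
  have hcont : Tendsto (fun s : ℝ => ‖DirichletCharacter.LFunction χ s -
      ∑ n ∈ Finset.Icc (1 : ℕ) y, χ (n : ℕ) * (((n : ℝ) ^ (-s) : ℝ) : ℂ)‖) (𝓝[>] 1)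
      (𝓝 ‖DirichletCharacter.LFunction χ (1 : ℝ) -
        ∑ n ∈ Finset.Icc (1 : ℕ) y, χ (n : ℕ) * (((n : ℝ) ^ (-(1 : ℝ)) : ℝ) : ℂ)‖) := by
    refine Tendsto.mono_left (ContinuousAt.tendsto ?_) nhdsWithin_le_nhds
    refine ContinuousAt.norm (ContinuousAt.sub ?_ ?_)
    · exact ((DirichletCharacter.differentiable_LFunction hχ).continuous.comp
        Complex.continuous_ofReal).continuousAt
    · refine tendsto_finsetSum _ fun n hn => ?_
      have hn0 : (n : ℝ) ≠ 0 := by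
        have := (Finset.mem_Icc.mp hn).1
        exact_mod_cast (by omega : n ≠ 0)
      refine ContinuousAt.mul continuousAt_const (Complex.continuous_ofReal.continuousAt.comp ?_)
      exact ContinuousAt.rpow continuousAt_const continuousAt_id.neg (Or.inl hn0)
  have := le_of_tendsto hcont (by
    filter_upwards [self_mem_nhdsWithin] with s hs using step s hs)
  simpa [Real.rpow_neg_one] using this

/-- The hyperbola method for `∑ ν(n)/n`: the sum over `x < n ≤ N` is `L(1, χ) log(N/x)` up to a
small error, where `B` bounds the character sums and `y` is the cut between the two variables. -/
lemma logSum_nuR_le {D : ℕ} [NeZero D] {χ : DirichletCharacter ℂ D} (hq : χ.IsQuadratic)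
    (hχ : χ ≠ 1) {B : ℝ} (hB : ∀ M m : ℕ, ‖∑ n ∈ Finset.Ioc M m, χ n‖ ≤ B) {x : ℝ} {y N : ℕ}
    (hy : 1 ≤ y) (hyx : y ≤ x) (hxN : x ≤ N) :
    logSum (nuR χ) x N ≤ (DirichletCharacter.LFunction χ 1).re * Real.log (N / x)
      + 2 * y / x + (1 + 2 * Real.log N) * (B / y) := by
  classical
  have hB0 : 0 ≤ B := (norm_nonneg _).trans (hB 0 0)
  have hy0 : (0 : ℝ) < y := by exact_mod_cast hy
  have hy1 : (1 : ℝ) ≤ y := by exact_mod_cast hy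
  have hx0 : 0 < x := by linarith
  have hN0 : (0 : ℝ) < N := by linarith
  have hyN : y ≤ N := by exact_mod_cast hyx.trans hxN
  -- the sums of `χ(b)/b` beyond `y` and the tail of `L(1, χ)` are small by partial summation
  have htail : ∀ u v : ℕ, y ≤ u → |∑ b ∈ Finset.Ioc u v, chiR χ b / b| ≤ B / y := by
    intro u v hu
    have h1 := norm_sum_mul_antitone_le (a := fun n : ℕ => χ n) (w := fun n => 1 / (n : ℝ))
      (fun m => hB u m) (fun n hn => by
        have : (0 : ℝ) < n := by exact_mod_cast (by omega : 0 < n)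
        push_cast
        gcongr
        linarith) (fun n _ => by positivity) v
    have h2 : ((∑ b ∈ Finset.Ioc u v, chiR χ b / b : ℝ) : ℂ) =
        ∑ n ∈ Finset.Ioc u v, χ n * ((1 / (n : ℝ) : ℝ) : ℂ) := by
      push_cast
      refine Finset.sum_congr rfl fun n hn => ?_
      rw [chiR_cast hq (by have := (Finset.mem_Ioc.mp hn).1; omega)]
      ring
    rw [← h2, Complex.norm_real, Real.norm_eq_abs] at h1
    refine h1.trans ?_
    rw [div_eq_mul_one_div B]
    gcongr
    exact_mod_cast (by omega : y ≤ u + 1)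
  set LL := (DirichletCharacter.LFunction χ 1).re with hLL
  have hhead : |LL - ∑ b ∈ Finset.Icc 1 y, chiR χ b / b| ≤ B / y := by
    have h1 := norm_LFunction_one_sub_le hχ (fun m => hB y m)
    have h2 : ((∑ b ∈ Finset.Icc 1 y, chiR χ b / b : ℝ) : ℂ) =
        ∑ n ∈ Finset.Icc (1 : ℕ) y, χ (n : ℕ) * ((1 / (n : ℝ) : ℝ) : ℂ) := by
      push_cast
      refine Finset.sum_congr rfl fun n hn => ?_
      rw [chiR_cast hq (by have := (Finset.mem_Icc.mp hn).1; omega)]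
      ring
    rw [← h2] at h1
    have h3 := (Complex.abs_re_le_norm _).trans h1
    rw [Complex.sub_re, Complex.ofReal_re] at h3
    refine h3.trans ?_
    rw [div_eq_mul_one_div B]
    gcongr
    linarith
  rw [nuR, logSum_mul_eq, Finset.sum_comm]
  have hdisj : Finset.Icc 1 N = Finset.Icc 1 y ∪ Finset.Ioc y N := by
    ext; simp; omega
  rw [hdisj, Finset.sum_union (by
    rw [Finset.disjoint_left]; intro n h1 h2; simp at h1 h2; omega), ← hdisj]
  -- for `b ≤ y` the inner sum over `a` is `log(N/x) + O(b/x)`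
  have part1 : ∑ b ∈ Finset.Icc 1 y, ∑ a ∈ Finset.Icc 1 N,
      (if a * b ≤ N then (if x < (a * b : ℕ) then
        ((ArithmeticFunction.zeta : ArithmeticFunction ℕ) : ArithmeticFunction ℝ) a / a *
          (chiR χ b / b) else 0) else 0) ≤ LL * Real.log (N / x) + Real.log N * (B / y)
            + 2 * y / x := by
    have h1 : ∀ b ∈ Finset.Icc 1 y, ∑ a ∈ Finset.Icc 1 N,
        (if a * b ≤ N then (if x < (a * b : ℕ) then
        ((ArithmeticFunction.zeta : ArithmeticFunction ℕ) : ArithmeticFunction ℝ) a / a *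
          (chiR χ b / b) else 0) else 0) ≤ Real.log (N / x) * (chiR χ b / b) + 2 / x := by
      intro b hb
      obtain ⟨hb1, hby⟩ := Finset.mem_Icc.mp hb
      have hb0 : (0 : ℝ) < b := by exact_mod_cast hb1
      have hby' : (b : ℝ) ≤ y := by exact_mod_cast hby
      have hu : 1 ≤ x / b := by rw [one_le_div hb0]; linarith
      have huv : x / b ≤ N / b := by gcongr
      have e : ∑ a ∈ Finset.Icc 1 N, (if a * b ≤ N then (if x < (a * b : ℕ) then
        ((ArithmeticFunction.zeta : ArithmeticFunction ℕ) : ArithmeticFunction ℝ) a / a *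
          (chiR χ b / b) else 0) else 0) =
          (∑ a ∈ Finset.Ioc ⌊x / b⌋₊ ⌊(N : ℝ) / b⌋₊, (1 : ℝ) / a) * (chiR χ b / b) := by
        rw [Finset.sum_mul]
        symm
        refine Finset.sum_subset_zero_on_sdiff ?_ ?_ ?_
        · intro a ha
          obtain ⟨ha1, ha2⟩ := Finset.mem_Ioc.mp ha
          rw [Nat.le_floor_iff (by positivity), le_div_iff₀ hb0] at ha2
          rw [Finset.mem_Icc]
          have ha3 : a * b ≤ N := by exact_mod_cast ha2
          exact ⟨by omega, (Nat.le_mul_of_pos_right a hb1).trans ha3⟩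
        · intro a ha
          rw [Finset.mem_sdiff, Finset.mem_Ioc, Nat.floor_lt (by positivity),
            Nat.le_floor_iff (by positivity), le_div_iff₀ hb0, div_lt_iff₀ hb0] at ha
          by_cases h2 : a * b ≤ N
          · have h3 : (a : ℝ) * b ≤ N := by exact_mod_cast h2
            have h4 : ¬ x < (a * b : ℕ) := by
              push_cast
              tauto
            rw [if_pos h2, if_neg h4]
          · simp [h2]
        · intro a ha
          rw [Finset.mem_Ioc, Nat.floor_lt (by positivity),
            Nat.le_floor_iff (by positivity), le_div_iff₀ hb0, div_lt_iff₀ hb0] at ha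
          have ha0 : a ≠ 0 := by
            rintro rfl
            have := ha.1
            simp at this
            linarith
          rw [if_pos (by exact_mod_cast ha.2), if_pos (by push_cast; exact ha.1)]
          simp [ha0]
      rw [e]
      have h2 := abs_sum_inv_sub_log_le hu huv
      have h3 : (N : ℝ) / b / (x / b) = N / x := by field_simp
      have h4 : 2 / (x / b) = 2 * b / x := by field_simp
      rw [h3, h4] at h2
      set S := ∑ a ∈ Finset.Ioc ⌊x / b⌋₊ ⌊(N : ℝ) / b⌋₊, (1 : ℝ) / a
      have h5 : |chiR χ b / b| ≤ 1 / b := by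
        rw [abs_div, abs_of_pos hb0]
        gcongr
        rcases chiR_values hq b with h | h | h <;> simp [h]
      have h6 : (S - Real.log (N / x)) * (chiR χ b / b) ≤ 2 * b / x * (1 / b) := by
        refine (le_abs_self _).trans ?_
        rw [abs_mul]
        gcongr
      have h7 : 2 * b / x * (1 / b) = 2 / x := by field_simp
      rw [h7] at h6
      linarith
    refine (Finset.sum_le_sum h1).trans ?_
    rw [Finset.sum_add_distrib, ← Finset.mul_sum, Finset.sum_const, Nat.card_Icc, nsmul_eq_mul]
    have h8 : 0 ≤ Real.log (N / x) := Real.log_nonneg (by rw [one_le_div hx0]; exact hxN)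
    have h9 : Real.log (N / x) ≤ Real.log N := by
      apply Real.log_le_log (by positivity)
      exact div_le_self hN0.le (by linarith)
    have h10 := (abs_le.mp hhead).1
    have h11 : Real.log (N / x) * ∑ b ∈ Finset.Icc 1 y, chiR χ b / b ≤
        Real.log (N / x) * (LL + B / y) := by gcongr; linarith
    have h12 : Real.log (N / x) * (B / y) ≤ Real.log N * (B / y) := by gcongr
    have h13 : ((y + 1 - 1 : ℕ) : ℝ) * (2 / x) = 2 * y / x := by
      rw [Nat.add_sub_cancel]; ring
    rw [h13]
    linarith
  -- for `b > y` the sum over `b` is performed first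
  have part2 : ∑ b ∈ Finset.Ioc y N, ∑ a ∈ Finset.Icc 1 N,
      (if a * b ≤ N then (if x < (a * b : ℕ) then
        ((ArithmeticFunction.zeta : ArithmeticFunction ℕ) : ArithmeticFunction ℝ) a / a *
          (chiR χ b / b) else 0) else 0) ≤ (1 + Real.log N) * (B / y) := by
    rw [Finset.sum_comm]
    have h1 : ∀ a ∈ Finset.Icc 1 N, ∑ b ∈ Finset.Ioc y N,
        (if a * b ≤ N then (if x < (a * b : ℕ) then
        ((ArithmeticFunction.zeta : ArithmeticFunction ℕ) : ArithmeticFunction ℝ) a / a *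
          (chiR χ b / b) else 0) else 0) ≤ (a : ℝ)⁻¹ * (B / y) := by
      intro a ha
      obtain ⟨ha1, -⟩ := Finset.mem_Icc.mp ha
      have ha0 : (0 : ℝ) < a := by exact_mod_cast ha1
      have e : ∑ b ∈ Finset.Ioc y N, (if a * b ≤ N then (if x < (a * b : ℕ) then
        ((ArithmeticFunction.zeta : ArithmeticFunction ℕ) : ArithmeticFunction ℝ) a / a *
          (chiR χ b / b) else 0) else 0) =
          (a : ℝ)⁻¹ * ∑ b ∈ Finset.Ioc (max y ⌊x / a⌋₊) (N / a), chiR χ b / b := by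
        rw [Finset.mul_sum]
        symm
        refine Finset.sum_subset_zero_on_sdiff ?_ ?_ ?_
        · intro b hb
          obtain ⟨hb1, hb2⟩ := Finset.mem_Ioc.mp hb
          rw [Finset.mem_Ioc]
          exact ⟨(le_max_left _ _).trans_lt hb1, hb2.trans (Nat.div_le_self _ _)⟩
        · intro b hb
          rw [Finset.mem_sdiff, Finset.mem_Ioc, Finset.mem_Ioc, max_lt_iff,
            Nat.floor_lt (by positivity), Nat.le_div_iff_mul_le ha1, div_lt_iff₀ ha0,
            mul_comm b a, mul_comm (b : ℝ) a] at hb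
          by_cases h2 : a * b ≤ N
          · have h4 : ¬ x < (a * b : ℕ) := by
              push_cast
              tauto
            rw [if_pos h2, if_neg h4]
          · simp [h2]
        · intro b hb
          rw [Finset.mem_Ioc, max_lt_iff,
            Nat.floor_lt (by positivity), Nat.le_div_iff_mul_le ha1, div_lt_iff₀ ha0,
            mul_comm b a, mul_comm (b : ℝ) a] at hb
          rw [if_pos hb.2, if_pos (by push_cast; exact hb.1.2)]
          have ha' : a ≠ 0 := by omega
          rw [ArithmeticFunction.natCoe_apply, ArithmeticFunction.zeta_apply, if_neg ha',
            Nat.cast_one, one_div]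
      rw [e]
      gcongr
      exact (le_abs_self _).trans (htail _ _ (le_max_left _ _))
    refine (Finset.sum_le_sum h1).trans ?_
    rw [← Finset.sum_mul]
    gcongr
    have := harmonic_le_one_add_log N
    rw [harmonic_eq_sum_Icc] at this
    push_cast at this
    exact this
  linarith

/-- The trivial bound for `∑ ν(n)/n`. -/
lemma logSum_nuR_trivial {D : ℕ} {χ : DirichletCharacter ℂ D} (hq : χ.IsQuadratic) (N : ℕ) :
    logSum (nuR χ) 0 N ≤ (1 + Real.log N) ^ 2 := by
  have h1 : logSum (nuR χ) 0 N ≤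
      logSum (((ArithmeticFunction.zeta : ArithmeticFunction ℕ) : ArithmeticFunction ℝ) *
        ((ArithmeticFunction.zeta : ArithmeticFunction ℕ) : ArithmeticFunction ℝ)) 0 N := by
    refine logSum_mono (fun n => ?_) _ _
    rw [nuR, ArithmeticFunction.mul_apply, ArithmeticFunction.mul_apply]
    refine Finset.sum_le_sum fun p hp => ?_
    obtain ⟨h1, h2⟩ := Nat.ne_zero_of_mem_divisorsAntidiagonal hp
    simp only [ArithmeticFunction.natCoe_apply, ArithmeticFunction.zeta_apply, h1, h2, if_false,
      Nat.cast_one, one_mul]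
    rcases chiR_values hq p.2 with h | h | h <;> simp [h]
  have hz : ∀ n, 0 ≤ ((ArithmeticFunction.zeta : ArithmeticFunction ℕ) :
      ArithmeticFunction ℝ) n := fun n => by
    rw [ArithmeticFunction.natCoe_apply]; positivity
  have h2 := logSum_mul_zero_le hz hz N
  have h3 : logSum ((ArithmeticFunction.zeta : ArithmeticFunction ℕ) : ArithmeticFunction ℝ) 0 N
      ≤ 1 + Real.log N := by
    have := harmonic_le_one_add_log N
    rw [harmonic_eq_sum_Icc] at this
    push_cast at this
    refine le_trans (le_of_eq ?_) this
    rw [logSum_zero]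
    refine Finset.sum_congr rfl fun n hn => ?_
    have : n ≠ 0 := by have := (Finset.mem_Icc.mp hn).1; omega
    simp [this]
  have h4 := logSum_nonneg hz 0 N
  calc _ ≤ _ := h1
    _ ≤ _ := h2
    _ ≤ _ := by rw [sq]; gcongr

lemma logSum_split {f : ArithmeticFunction ℝ} (hf : ∀ n, 0 ≤ f n) (M N : ℕ) :
    logSum f 0 N ≤ logSum f 0 M + logSum f M N := by
  have h1 : ∀ n ∈ Finset.Icc 1 N, (if (0 : ℝ) < n then f n / n else 0) ≤
      (if n ≤ M then f n / n else 0) + (if (M : ℝ) < n then f n / n else 0) := by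
    intro n hn
    have : (0 : ℝ) < n := by exact_mod_cast (Finset.mem_Icc.mp hn).1
    rw [if_pos this]
    by_cases h : n ≤ M
    · rw [if_pos h, if_neg (by push Not; exact_mod_cast h), add_zero]
    · rw [if_neg h, if_pos (by exact_mod_cast not_le.mp h), zero_add]
  refine (Finset.sum_le_sum h1).trans ?_
  rw [Finset.sum_add_distrib]
  refine add_le_add ?_ le_rfl
  rw [logSum_zero, ← Finset.sum_filter]
  refine Finset.sum_le_sum_of_subset_of_nonneg ?_ fun n _ _ => div_nonneg (hf n) (by positivity)
  intro n hn
  simp only [Finset.mem_filter, Finset.mem_Icc] at hn ⊢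
  omega

/-! ### The large sieve inequality -/

open MeasureTheory

/-- The exponential sum `∑ aₙ e(nx)` over `1 ≤ n ≤ N`. -/
noncomputable def expSum (a : ℕ → ℂ) (N : ℕ) (x : ℝ) : ℂ :=
  ∑ n ∈ Finset.Icc 1 N, a n * Complex.exp (2 * Real.pi * Complex.I * n * x)

lemma continuous_expSum (a : ℕ → ℂ) (N : ℕ) : Continuous (expSum a N) := by
  unfold expSum
  fun_prop

lemma hasDerivAt_expSum (a : ℕ → ℂ) (N : ℕ) (x : ℝ) :
    HasDerivAt (expSum a N) (expSum (fun n => 2 * Real.pi * Complex.I * n * a n) N x) x := by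
  unfold expSum
  refine HasDerivAt.fun_sum fun n _ => ?_
  have h1 : HasDerivAt (fun y : ℝ => 2 * Real.pi * Complex.I * n * (y : ℂ))
      (2 * Real.pi * Complex.I * n) x := by
    simpa using (Complex.ofRealCLM.hasDerivAt (x := x)).const_mul (2 * Real.pi * Complex.I * n)
  have h2 := (h1.cexp).const_mul (a n)
  refine h2.congr_deriv ?_
  ring

lemma integral_exp_two_pi_int (k : ℤ) :
    ∫ x in (0 : ℝ)..1, Complex.exp (2 * Real.pi * Complex.I * k * x) = if k = 0 then 1 else 0 := by
  split_ifs with h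
  · subst h; simp
  · have hc : (2 * Real.pi * Complex.I * k : ℂ) ≠ 0 := by
      have : (k : ℂ) ≠ 0 := by exact_mod_cast h
      simp [Real.pi_ne_zero, this]
    rw [integral_exp_mul_complex hc]
    have : Complex.exp (2 * Real.pi * Complex.I * k * (1 : ℝ)) = 1 := by
      rw [Complex.exp_eq_one_iff]
      exact ⟨k, by push_cast; ring⟩
    rw [this]
    simp

/-- Parseval's identity. -/
lemma integral_norm_expSum_sq (a : ℕ → ℂ) (N : ℕ) :
    ∫ x in (0 : ℝ)..1, ‖expSum a N x‖ ^ 2 = ∑ n ∈ Finset.Icc 1 N, ‖a n‖ ^ 2 := by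
  have h1 : ∀ x : ℝ, ((‖expSum a N x‖ ^ 2 : ℝ) : ℂ) = ∑ n ∈ Finset.Icc 1 N, ∑ m ∈ Finset.Icc 1 N,
      a n * starRingEnd ℂ (a m) *
        Complex.exp (2 * Real.pi * Complex.I * ((n : ℤ) - (m : ℤ) : ℤ) * x) := by
    intro x
    push_cast
    rw [← Complex.mul_conj', expSum, map_sum, Finset.sum_mul_sum]
    refine Finset.sum_congr rfl fun n _ => Finset.sum_congr rfl fun m _ => ?_
    rw [map_mul, ← Complex.exp_conj]
    have : Complex.exp (2 * Real.pi * Complex.I * ((n : ℂ) - m) * x) =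
        Complex.exp (2 * Real.pi * Complex.I * n * x) *
        Complex.exp (starRingEnd ℂ (2 * Real.pi * Complex.I * m * x)) := by
      rw [← Complex.exp_add]
      congr 1
      simp [map_ofNat]
      ring
    rw [this]
    ring
  have h2 : ((∫ x in (0 : ℝ)..1, ‖expSum a N x‖ ^ 2 : ℝ) : ℂ) =
      ∑ n ∈ Finset.Icc 1 N, ((‖a n‖ ^ 2 : ℝ) : ℂ) := by
    rw [← intervalIntegral.integral_ofReal]
    simp_rw [h1]
    rw [intervalIntegral.integral_finsetSum fun n _ =>
      Continuous.intervalIntegrable (by fun_prop) _ _]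
    refine Finset.sum_congr rfl fun n hn => ?_
    rw [intervalIntegral.integral_finsetSum fun m _ =>
      Continuous.intervalIntegrable (by fun_prop) _ _]
    simp_rw [intervalIntegral.integral_const_mul, integral_exp_two_pi_int]
    rw [Finset.sum_eq_single n]
    · simp [Complex.mul_conj']
    · intro m _ hm
      rw [if_neg (by omega), mul_zero]
    · exact fun h => absurd hn h
  exact_mod_cast h2

/-- Gallagher's inequality: a value is bounded by a local mean and the variation. -/
lemma sobolev_pointwise {f f' : ℝ → ℝ} (hf : ∀ x, HasDerivAt f (f' x) x) (hf' : Continuous f')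
    (x : ℝ) {h : ℝ} (hh : 0 < h) :
    f x ≤ h⁻¹ * (∫ y in x..(x + h), f y) + ∫ y in x..(x + h), |f' y| := by
  have hfc : Continuous f := continuous_iff_continuousAt.mpr fun x => (hf x).continuousAt
  have h1 : ∀ y ∈ Set.Icc x (x + h), f x ≤ f y + ∫ z in x..(x + h), |f' z| := by
    intro y hy
    have h2 := intervalIntegral.integral_eq_sub_of_hasDerivAt (fun z _ => hf z)
      (hf'.intervalIntegrable x y)
    have h3 : |∫ z in x..y, f' z| ≤ ∫ z in x..y, |f' z| :=
      intervalIntegral.abs_integral_le_integral_abs hy.1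
    have h4 : ∫ z in x..y, |f' z| ≤ ∫ z in x..(x + h), |f' z| :=
      intervalIntegral.integral_mono_interval le_rfl hy.1 hy.2
        (Filter.Eventually.of_forall fun z => abs_nonneg _) (hf'.abs.intervalIntegrable _ _)
    have h5 := neg_abs_le (∫ z in x..y, f' z)
    linarith
  have h6 : ∫ y in x..(x + h), f x ≤ ∫ y in x..(x + h), (f y + ∫ z in x..(x + h), |f' z|) :=
    intervalIntegral.integral_mono_on (by linarith) (by simp)
      ((hfc.add continuous_const).intervalIntegrable _ _) h1
  rw [intervalIntegral.integral_add (hfc.intervalIntegrable _ _) (by simp),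
    intervalIntegral.integral_const, intervalIntegral.integral_const, add_sub_cancel_left,
    smul_eq_mul, smul_eq_mul] at h6
  have h7 := mul_le_mul_of_nonneg_left h6 (inv_pos.mpr hh).le
  rw [mul_add, inv_mul_cancel_left₀ hh.ne', inv_mul_cancel_left₀ hh.ne'] at h7
  exact h7

/-- The intervals of length `h` to the right of `h`-separated points are disjoint. -/
lemma sum_integral_separated_le {ι : Type*} (P : Finset ι) (x : ι → ℝ) {h : ℝ} (hh : 0 < h)
    (hsep : ∀ i ∈ P, ∀ j ∈ P, i ≠ j → h ≤ |x i - x j|) (h0 : ∀ i ∈ P, 0 ≤ x i)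
    (h1 : ∀ i ∈ P, x i + h ≤ 1) {g : ℝ → ℝ} (hg : Continuous g) (hg0 : ∀ y, 0 ≤ g y) :
    ∑ i ∈ P, ∫ y in (x i)..(x i + h), g y ≤ ∫ y in (0 : ℝ)..1, g y := by
  have e : ∀ i ∈ P, ∫ y in (x i)..(x i + h), g y = ∫ y in Set.Ioc (x i) (x i + h), g y :=
    fun i _ => intervalIntegral.integral_of_le (by linarith)
  rw [Finset.sum_congr rfl e, intervalIntegral.integral_of_le zero_le_one,
    ← integral_biUnion_finset P (fun i _ => measurableSet_Ioc) ?_ ?_]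
  · refine setIntegral_mono_set ?_ (Filter.Eventually.of_forall hg0) ?_
    · exact (hg.integrableOn_Icc (a := 0) (b := 1)).mono_set Set.Ioc_subset_Icc_self
    · refine Filter.Eventually.of_forall fun y hy => ?_
      obtain ⟨i, hi, hy⟩ := Set.mem_iUnion₂.mp hy
      exact ⟨(h0 i hi).trans_lt hy.1, hy.2.trans (h1 i hi)⟩
  · intro i hi j hj hij
    rw [Function.onFun, Set.disjoint_left]
    intro y hy hy'
    have := hsep i hi j hj hij
    rw [le_abs] at this
    rcases this with h | h
    · linarith [hy.1, hy'.2]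
    · linarith [hy.2, hy'.1]
  · intro i _
    exact (hg.integrableOn_Icc).mono_set Set.Ioc_subset_Icc_self

/-- The large sieve for additive characters at separated points. -/
lemma large_sieve_additive {ι : Type*} (P : Finset ι) (x : ι → ℝ) {h : ℝ} (hh : 0 < h)
    (hsep : ∀ i ∈ P, ∀ j ∈ P, i ≠ j → h ≤ |x i - x j|) (h0 : ∀ i ∈ P, 0 ≤ x i)
    (h1 : ∀ i ∈ P, x i + h ≤ 1) (a : ℕ → ℂ) {N : ℕ} (hN : 1 ≤ N) :
    ∑ i ∈ P, ‖expSum a N (x i)‖ ^ 2 ≤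
      (h⁻¹ + 4 * Real.pi * N) * ∑ n ∈ Finset.Icc 1 N, ‖a n‖ ^ 2 := by
  set b : ℕ → ℂ := fun n => 2 * Real.pi * Complex.I * n * a n with hb
  set M : ℝ := 2 * Real.pi * N with hM
  have hN' : (0 : ℝ) < N := by exact_mod_cast hN
  have hM0 : 0 < M := by positivity
  set f : ℝ → ℝ := fun y => ‖expSum a N y‖ ^ 2 with hf
  set f' : ℝ → ℝ := fun y => 2 * inner ℝ (expSum a N y) (expSum b N y) with hf'
  have hd : ∀ y, HasDerivAt f (f' y) y := fun y => (hasDerivAt_expSum a N y).norm_sq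
  have hcf' : Continuous f' :=
    continuous_const.mul ((continuous_expSum a N).inner (continuous_expSum b N))
  have hcf : Continuous f := (continuous_expSum a N).norm.pow 2
  set g : ℝ → ℝ := fun y => M * ‖expSum a N y‖ ^ 2 + M⁻¹ * ‖expSum b N y‖ ^ 2 with hg
  have hcg : Continuous g :=
    (continuous_const.mul ((continuous_expSum a N).norm.pow 2)).add
      (continuous_const.mul ((continuous_expSum b N).norm.pow 2))
  have hfg : ∀ y, |f' y| ≤ g y := by
    intro y
    simp only [hf', hg]
    rw [abs_mul, abs_two]
    have h2 := abs_real_inner_le_norm (expSum a N y) (expSum b N y)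
    set u := ‖expSum a N y‖
    set v := ‖expSum b N y‖
    have h3 : M * u ^ 2 + M⁻¹ * v ^ 2 - 2 * (u * v) = M⁻¹ * (M * u - v) ^ 2 := by
      field_simp
      ring
    have h4 : 0 ≤ M⁻¹ * (M * u - v) ^ 2 := by positivity
    linarith
  have hg0 : ∀ y, 0 ≤ g y := fun y => (abs_nonneg _).trans (hfg y)
  have step : ∀ i ∈ P, ‖expSum a N (x i)‖ ^ 2 ≤
      h⁻¹ * (∫ y in (x i)..(x i + h), f y) + ∫ y in (x i)..(x i + h), g y := by
    intro i _
    refine (sobolev_pointwise hd hcf' (x i) hh).trans ?_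
    gcongr
    exact intervalIntegral.integral_mono_on (by linarith) (hcf'.abs.intervalIntegrable _ _)
      (hcg.intervalIntegrable _ _) fun y _ => hfg y
  refine (Finset.sum_le_sum step).trans ?_
  rw [Finset.sum_add_distrib, ← Finset.mul_sum]
  have h2 := sum_integral_separated_le P x hh hsep h0 h1 hcf fun y => by positivity
  have h3 := sum_integral_separated_le P x hh hsep h0 h1 hcg hg0
  rw [hf] at h2
  rw [integral_norm_expSum_sq] at h2
  have h4 : ∫ y in (0 : ℝ)..1, g y ≤ 2 * M * ∑ n ∈ Finset.Icc 1 N, ‖a n‖ ^ 2 := by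
    have hca : Continuous fun y => M * ‖expSum a N y‖ ^ 2 :=
      continuous_const.mul ((continuous_expSum a N).norm.pow 2)
    have hcb : Continuous fun y => M⁻¹ * ‖expSum b N y‖ ^ 2 :=
      continuous_const.mul ((continuous_expSum b N).norm.pow 2)
    rw [hg, intervalIntegral.integral_add (f := fun y => M * ‖expSum a N y‖ ^ 2)
      (g := fun y => M⁻¹ * ‖expSum b N y‖ ^ 2) (hca.intervalIntegrable _ _)
      (hcb.intervalIntegrable _ _),
      intervalIntegral.integral_const_mul, intervalIntegral.integral_const_mul,
      integral_norm_expSum_sq, integral_norm_expSum_sq]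
    have h5 : ∑ n ∈ Finset.Icc 1 N, ‖b n‖ ^ 2 ≤ M ^ 2 * ∑ n ∈ Finset.Icc 1 N, ‖a n‖ ^ 2 := by
      rw [Finset.mul_sum]
      refine Finset.sum_le_sum fun n hn => ?_
      have hn' : (n : ℝ) ≤ N := by exact_mod_cast (Finset.mem_Icc.mp hn).2
      have : ‖b n‖ = 2 * Real.pi * n * ‖a n‖ := by
        simp [hb, abs_of_pos Real.pi_pos]
      rw [this, mul_pow]
      have := Real.pi_pos
      rw [hM]
      gcongr
    have h6 : M⁻¹ * ∑ n ∈ Finset.Icc 1 N, ‖b n‖ ^ 2 ≤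
        M⁻¹ * (M ^ 2 * ∑ n ∈ Finset.Icc 1 N, ‖a n‖ ^ 2) := by gcongr
    have h7 : M⁻¹ * (M ^ 2 * ∑ n ∈ Finset.Icc 1 N, ‖a n‖ ^ 2) =
        M * ∑ n ∈ Finset.Icc 1 N, ‖a n‖ ^ 2 := by field_simp
    linarith
  have h8 : h⁻¹ * ∑ i ∈ P, ∫ y in (x i)..(x i + h), ‖expSum a N y‖ ^ 2 ≤
      h⁻¹ * ∑ n ∈ Finset.Icc 1 N, ‖a n‖ ^ 2 :=
    mul_le_mul_of_nonneg_left h2 (inv_pos.mpr hh).le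
  calc _ ≤ h⁻¹ * ∑ n ∈ Finset.Icc 1 N, ‖a n‖ ^ 2 + 2 * M * ∑ n ∈ Finset.Icc 1 N, ‖a n‖ ^ 2 :=
        add_le_add h8 (h3.trans h4)
    _ = _ := by rw [hM]; ring

/-- Orthogonality of the characters modulo `q`, in the form of Parseval's identity. -/
lemma sum_characters_norm_sq (q : ℕ) [NeZero q] (s : ZMod q → ℂ) :
    ∑ χ : DirichletCharacter ℂ q, ‖∑ a : ZMod q, χ a * s a‖ ^ 2 =
      q.totient * ∑ a : ZMod q, ‖(1 : DirichletCharacter ℂ q) a‖ * ‖s a‖ ^ 2 := by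
  classical
  have h1 : ∀ χ : DirichletCharacter ℂ q, ((‖∑ a : ZMod q, χ a * s a‖ ^ 2 : ℝ) : ℂ) =
      ∑ a : ZMod q, ∑ b : ZMod q, s a * starRingEnd ℂ (s b) * (χ⁻¹ b * χ a) := by
    intro χ
    push_cast
    rw [← Complex.mul_conj', map_sum, Finset.sum_mul_sum]
    refine Finset.sum_congr rfl fun a _ => Finset.sum_congr rfl fun b _ => ?_
    rw [map_mul, star_mulChar_apply]
    ring
  have h2 : ((∑ χ : DirichletCharacter ℂ q, ‖∑ a : ZMod q, χ a * s a‖ ^ 2 : ℝ) : ℂ) =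
      ((q.totient * ∑ a : ZMod q, ‖(1 : DirichletCharacter ℂ q) a‖ * ‖s a‖ ^ 2 : ℝ) : ℂ) := by
    rw [Complex.ofReal_sum]
    simp_rw [h1]
    rw [Finset.sum_comm]
    push_cast
    rw [Finset.mul_sum]
    refine Finset.sum_congr rfl fun a _ => ?_
    rw [Finset.sum_comm]
    simp_rw [← Finset.mul_sum]
    rw [Finset.sum_eq_single a]
    · by_cases ha : IsUnit a
      · have h3 : ∀ χ : DirichletCharacter ℂ q, χ⁻¹ a * χ a = 1 := by
          intro χ
          rw [star_mulChar_apply, mul_comm, Complex.mul_conj', normSq_apply_of_isUnit χ ha]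
          simp
        simp_rw [h3]
        rw [normSq_apply_of_isUnit 1 ha, Finset.sum_const, Finset.card_univ,
          ← Nat.card_eq_fintype_card, DirichletCharacter.card_eq_totient_of_hasEnoughRootsOfUnity,
          Complex.mul_conj']
        simp
        ring
      · simp [MulChar.map_nonunit _ ha]
    · intro b _ hb
      by_cases hbu : IsUnit b
      · have h3 : ∀ χ : DirichletCharacter ℂ q, χ⁻¹ b * χ a = χ b⁻¹ * χ a := by
          intro χ
          have h4 : χ b * χ b⁻¹ = 1 := by
            rw [← map_mul, ZMod.mul_inv_of_unit b hbu, map_one]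
          have h5 : χ⁻¹ b * χ b = 1 := by
            rw [star_mulChar_apply, mul_comm, Complex.mul_conj', normSq_apply_of_isUnit χ hbu]
            simp
          rw [← one_mul (χ b⁻¹), ← h5, mul_assoc (χ⁻¹ b), h4, mul_one]
        simp_rw [h3]
        rw [DirichletCharacter.sum_char_inv_mul_char_eq ℂ hbu, if_neg hb, mul_zero]
      · simp [MulChar.map_nonunit _ hbu]
    · simp
  exact_mod_cast h2

/-- A sum over primitive characters modulo `q`, in terms of exponential sums at the reduced
fractions with denominator `q`. -/
lemma sum_primitive_le_expSum {q : ℕ} [NeZero q] (s : Finset (DirichletCharacter ℂ q))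
    (hs : ∀ χ ∈ s, χ.IsPrimitive) (a : ℕ → ℂ) (N : ℕ) :
    ∑ χ ∈ s, ‖∑ n ∈ Finset.Icc 1 N, a n * χ n‖ ^ 2 ≤
      ∑ b ∈ (Finset.range q).filter (Nat.Coprime · q), ‖expSum a N (b / q)‖ ^ 2 := by
  classical
  have hq0 : (0 : ℝ) < q := by exact_mod_cast Nat.pos_of_ne_zero (NeZero.ne q)
  set S : ZMod q → ℂ := fun c => expSum a N ((c.val : ℝ) / q) with hS
  have hSe : ∀ c : ZMod q, S c =
      ∑ n ∈ Finset.Icc 1 N, a n * ZMod.stdAddChar ((n : ZMod q) * c) := by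
    intro c
    rw [hS]
    refine Finset.sum_congr rfl fun n _ => ?_
    have := stdAddChar_natCast_mul (q := q) n c.val
    rw [ZMod.natCast_zmod_val] at this
    rw [this, ← Complex.exp_nat_mul]
    congr 2
    push_cast
    ring
  have h1 : ∀ χ ∈ s, (q : ℝ) * ‖∑ n ∈ Finset.Icc 1 N, a n * χ n‖ ^ 2 =
      ‖∑ c : ZMod q, χ⁻¹ c * S c‖ ^ 2 := by
    intro χ hχ
    rw [← norm_gaussSum_sq (isPrimitive_inv (hs χ hχ)), ← mul_pow, ← norm_mul, Finset.mul_sum]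
    congr 2
    simp_rw [hSe, Finset.mul_sum]
    rw [Finset.sum_comm]
    refine Finset.sum_congr rfl fun n _ => ?_
    rw [mul_comm (gaussSum _ _), mul_assoc, primitive_apply_mul_gaussSum (hs χ hχ), Finset.mul_sum]
    exact Finset.sum_congr rfl fun c _ => by ring
  have h2 : (q : ℝ) * ∑ χ ∈ s, ‖∑ n ∈ Finset.Icc 1 N, a n * χ n‖ ^ 2 ≤
      q.totient * ∑ c : ZMod q, ‖(1 : DirichletCharacter ℂ q) c‖ * ‖S c‖ ^ 2 := by
    rw [Finset.mul_sum, Finset.sum_congr rfl h1, ← sum_characters_norm_sq,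
      ← Equiv.sum_comp (Equiv.inv (DirichletCharacter ℂ q))]
    exact Finset.sum_le_univ_sum_of_nonneg fun χ => by positivity
  have h3 : ∑ c : ZMod q, ‖(1 : DirichletCharacter ℂ q) c‖ * ‖S c‖ ^ 2 =
      ∑ b ∈ (Finset.range q).filter (Nat.Coprime · q), ‖expSum a N (b / q)‖ ^ 2 := by
    rw [sum_zmod_eq_sum_range, Finset.sum_filter]
    refine Finset.sum_congr rfl fun b hb => ?_
    have hb' : b < q := by simpa using hb
    have h4 : S (b : ZMod q) = expSum a N (b / q) := by
      simp only [hS]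
      rw [ZMod.val_cast_of_lt hb']
    rw [h4]
    split_ifs with h
    · rw [normSq_apply_of_isUnit 1 ((ZMod.isUnit_iff_coprime b q).mpr h), one_mul]
    · rw [MulChar.map_nonunit _ (fun h' => h ((ZMod.isUnit_iff_coprime b q).mp h'))]
      simp
  rw [← h3]
  have h5 : (q.totient : ℝ) ≤ q := by exact_mod_cast Nat.totient_le q
  have h6 : 0 ≤ ∑ c : ZMod q, ‖(1 : DirichletCharacter ℂ q) c‖ * ‖S c‖ ^ 2 :=
    Finset.sum_nonneg fun _ _ => by positivity
  exact le_of_mul_le_mul_left (h2.trans (mul_le_mul_of_nonneg_right h5 h6)) hq0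

/-- Distinct reduced fractions with denominators below `R` are `R⁻²`-separated. -/
lemma reduced_fractions_separated {R : ℝ} {q q' b b' : ℕ} (hq0 : 0 < q) (hq0' : 0 < q')
    (hq : (q : ℝ) ≤ R) (hq' : (q' : ℝ) ≤ R) (hb : Nat.Coprime b q) (hb' : Nat.Coprime b' q')
    (hne : ¬ (q = q' ∧ b = b')) :
    (R ^ 2)⁻¹ ≤ |(b : ℝ) / q - b' / q'| := by
  have h1 : (0 : ℝ) < q := by exact_mod_cast hq0
  have h2 : (0 : ℝ) < q' := by exact_mod_cast hq0'
  rw [div_sub_div _ _ h1.ne' h2.ne', abs_div, abs_of_pos (mul_pos h1 h2)]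
  have h3 : (1 : ℝ) ≤ |(b : ℝ) * q' - q * b'| := by
    have h4 : ((b : ℤ) * q' - q * b') ≠ 0 := by
      intro h
      have h5 : b * q' = q * b' := by
        have : (b : ℤ) * q' = q * b' := by linarith
        exact_mod_cast this
      have h6 : q ∣ q' := hb.symm.dvd_of_dvd_mul_left ⟨b', h5⟩
      have h7 : q' ∣ q := hb'.symm.dvd_of_dvd_mul_right ⟨b, by rw [← h5, mul_comm]⟩
      have h8 : q = q' := Nat.dvd_antisymm h6 h7
      subst h8
      rw [mul_comm] at h5
      exact hne ⟨rfl, Nat.eq_of_mul_eq_mul_left hq0 h5⟩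
    have := Int.one_le_abs h4
    exact_mod_cast this
  rw [inv_eq_one_div]
  apply div_le_div₀ (abs_nonneg _) h3 (mul_pos h1 h2)
  rw [sq]
  exact mul_le_mul hq hq' h2.le (h1.le.trans hq)

/-- The large sieve inequality for primitive characters. -/
theorem large_sieve {R : ℝ} (F : Finset (Σ q : ℕ+, DirichletCharacter ℂ (q : ℕ)))
    (hF : ∀ p ∈ F, p.2.IsPrimitive ∧ ((p.1 : ℕ) : ℝ) ≤ R) (a : ℕ → ℂ) {N : ℕ} (hN : 1 ≤ N) :
    ∑ p ∈ F, ‖∑ n ∈ Finset.Icc 1 N, a n * p.2 n‖ ^ 2 ≤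
      (R ^ 2 + 4 * Real.pi * N) * ∑ n ∈ Finset.Icc 1 N, ‖a n‖ ^ 2 := by
  classical
  rcases F.eq_empty_or_nonempty with rfl | ⟨p₀, hp₀⟩
  · rw [Finset.sum_empty]
    positivity
  have hR : 1 ≤ R := le_trans (by exact_mod_cast p₀.1.pos) (hF p₀ hp₀).2
  set A := F.image Sigma.fst with hA
  have hFe : F = A.sigma fun q => Finset.univ.filter
      fun ψ : DirichletCharacter ℂ (q : ℕ) =>
        (⟨q, ψ⟩ : Σ q : ℕ+, DirichletCharacter ℂ (q : ℕ)) ∈ F := by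
    ext ⟨q, ψ⟩
    simp only [Finset.mem_sigma, Finset.mem_filter, Finset.mem_univ, true_and, hA,
      Finset.mem_image]
    exact ⟨fun h => ⟨⟨_, h, rfl⟩, h⟩, fun h => h.2⟩
  rw [hFe, Finset.sum_sigma]
  have h1 : ∀ q ∈ A, ∑ ψ ∈ Finset.univ.filter
      (fun ψ : DirichletCharacter ℂ (q : ℕ) =>
        (⟨q, ψ⟩ : Σ q : ℕ+, DirichletCharacter ℂ (q : ℕ)) ∈ F),
      ‖∑ n ∈ Finset.Icc 1 N, a n * ψ n‖ ^ 2 ≤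
      ∑ b ∈ (Finset.range q).filter (Nat.Coprime · q), ‖expSum a N (b / ((q : ℕ) : ℝ))‖ ^ 2 := by
    intro q _
    exact sum_primitive_le_expSum _ (fun ψ hψ => (hF _ (Finset.mem_filter.mp hψ).2).1) a N
  refine (Finset.sum_le_sum h1).trans ?_
  rw [← Finset.sum_sigma A (fun q : ℕ+ => (Finset.range q).filter (Nat.Coprime · q))
    (fun x => ‖expSum a N (x.2 / ((x.1 : ℕ) : ℝ))‖ ^ 2)]
  have hAR : ∀ q ∈ A, ((q : ℕ) : ℝ) ≤ R := by
    intro q hq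
    obtain ⟨p, hp, rfl⟩ := Finset.mem_image.mp hq
    exact (hF p hp).2
  have := large_sieve_additive (A.sigma fun q : ℕ+ => (Finset.range q).filter (Nat.Coprime · q))
    (fun x => (x.2 : ℝ) / ((x.1 : ℕ) : ℝ)) (h := (R ^ 2)⁻¹) (by positivity) ?_ ?_ ?_ a hN
  · rwa [inv_inv] at this
  · rintro ⟨q, b⟩ hi ⟨q', b'⟩ hj hne
    simp only [Finset.mem_sigma, Finset.mem_filter] at hi hj
    refine reduced_fractions_separated q.pos q'.pos (hAR q hi.1) (hAR q' hj.1) hi.2.2 hj.2.2 ?_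
    rintro ⟨h2, rfl⟩
    have h3 : q = q' := PNat.coe_inj.mp h2
    subst h3
    exact hne rfl
  · intro x _
    positivity
  · rintro ⟨q, b⟩ hi
    simp only [Finset.mem_sigma, Finset.mem_filter, Finset.mem_range] at hi
    have hq : (0 : ℝ) < ((q : ℕ) : ℝ) := by exact_mod_cast q.pos
    have hb : (b : ℝ) + 1 ≤ ((q : ℕ) : ℝ) := by exact_mod_cast hi.2.1
    have h2 : (R ^ 2)⁻¹ ≤ 1 / ((q : ℕ) : ℝ) := by
      rw [inv_eq_one_div]
      apply one_div_le_one_div_of_le hq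
      nlinarith [hAR q hi.1]
    have h3 : (b : ℝ) / ((q : ℕ) : ℝ) + 1 / ((q : ℕ) : ℝ) ≤ 1 := by
      rw [← add_div, div_le_one hq]
      exact hb
    simp only
    linarith

/-- The large sieve inequality with complex conjugate characters. -/
theorem large_sieve_star {R : ℝ} (F : Finset (Σ q : ℕ+, DirichletCharacter ℂ (q : ℕ)))
    (hF : ∀ p ∈ F, p.2.IsPrimitive ∧ ((p.1 : ℕ) : ℝ) ≤ R) (a : ℕ → ℂ) {N : ℕ} (hN : 1 ≤ N) :
    ∑ p ∈ F, ‖∑ n ∈ Finset.Icc 1 N, a n * (star p.2) n‖ ^ 2 ≤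
      (R ^ 2 + 4 * Real.pi * N) * ∑ n ∈ Finset.Icc 1 N, ‖a n‖ ^ 2 := by
  have h := large_sieve F hF (fun n => starRingEnd ℂ (a n)) hN
  simp only [RCLike.norm_conj] at h
  refine le_trans (le_of_eq (Finset.sum_congr rfl fun p _ => ?_)) h
  rw [← RCLike.norm_conj, map_sum]
  congr 2
  refine Finset.sum_congr rfl fun n _ => ?_
  rw [map_mul, MulChar.star_apply]
  congr 1
  exact Complex.conj_conj _

/-! ### Suprema of Dirichlet polynomials by the Poisson kernel -/

open MeasureTheory

lemma fourier_exp_neg_abs {δ : ℝ} (hδ : 0 < δ) (w : ℝ) :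
    FourierTransform.fourier (fun x : ℝ => (Real.exp (-δ * |x|) : ℂ)) w =
      ((2 * δ / (δ ^ 2 + (2 * Real.pi * w) ^ 2) : ℝ) : ℂ) := by
  rw [Real.fourier_eq']
  set a : ℂ := δ - 2 * Real.pi * w * Complex.I with ha
  set b : ℂ := -δ - 2 * Real.pi * w * Complex.I with hb
  have har : 0 < a.re := by simp [ha, hδ]
  have hbr : b.re < 0 := by simp [hb, hδ]
  have e1 : ∀ v ∈ Set.Iic (0 : ℝ), Complex.exp (((-2 * Real.pi * inner ℝ v w : ℝ) : ℂ) * Complex.I)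
      • (Real.exp (-δ * |v|) : ℂ) = Complex.exp (a * v) := by
    intro v hv
    rw [abs_of_nonpos hv, smul_eq_mul, Complex.ofReal_exp, ← Complex.exp_add]
    congr 1
    simp [ha]
    ring
  have e2 : ∀ v ∈ Set.Ioi (0 : ℝ), Complex.exp (((-2 * Real.pi * inner ℝ v w : ℝ) : ℂ) * Complex.I)
      • (Real.exp (-δ * |v|) : ℂ) = Complex.exp (b * v) := by
    intro v hv
    rw [abs_of_pos hv, smul_eq_mul, Complex.ofReal_exp, ← Complex.exp_add]
    congr 1
    simp [hb]
    ring
  rw [← intervalIntegral.integral_Iic_add_Ioi (b := 0)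
    ((integrableOn_congr_fun e1 measurableSet_Iic).mpr (integrableOn_exp_mul_complex_Iic har 0))
    ((integrableOn_congr_fun e2 measurableSet_Ioi).mpr (integrableOn_exp_mul_complex_Ioi hbr 0)),
    setIntegral_congr_fun measurableSet_Iic e1, setIntegral_congr_fun measurableSet_Ioi e2,
    integral_exp_mul_complex_Iic har, integral_exp_mul_complex_Ioi hbr]
  have ha0 : a ≠ 0 := fun h => by rw [h] at har; simp at har
  have hb0 : b ≠ 0 := fun h => by rw [h] at hbr; simp at hbr
  have hab : a * b = -((δ ^ 2 + (2 * Real.pi * w) ^ 2 : ℝ) : ℂ) := by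
    rw [ha, hb]
    push_cast
    linear_combination (4 * Real.pi ^ 2 * w ^ 2 : ℂ) * Complex.I_sq
  have hba : b - a = -(2 * δ : ℂ) := by rw [ha, hb]; ring
  simp only [Complex.ofReal_zero, mul_zero, Complex.exp_zero]
  rw [div_add_div _ _ ha0 hb0, hab, Complex.ofReal_div]
  have : (1 : ℂ) * b + a * -1 = -((2 * δ : ℝ) : ℂ) := by push_cast; rw [← hba]; ring
  rw [this, neg_div_neg_eq]

/-- The Poisson kernel `δ / (π (δ² + u²))`. -/
noncomputable def poissonKernel (δ u : ℝ) : ℝ := δ / (Real.pi * (δ ^ 2 + u ^ 2))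

lemma poissonKernel_nonneg {δ : ℝ} (hδ : 0 < δ) (u : ℝ) : 0 ≤ poissonKernel δ u := by
  have := Real.pi_pos
  unfold poissonKernel
  positivity

lemma integrable_poissonKernel {δ : ℝ} (hδ : 0 < δ) : Integrable (poissonKernel δ) := by
  have h := ((integrable_inv_one_add_sq).comp_mul_left' (inv_ne_zero hδ.ne')).const_mul
    (1 / (Real.pi * δ))
  refine h.congr (Filter.Eventually.of_forall fun u => ?_)
  have := Real.pi_pos
  simp only [poissonKernel]
  field_simp

lemma integral_poissonKernel_mul_exp {δ : ℝ} (hδ : 0 < δ) (x : ℝ) :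
    ∫ u : ℝ, (poissonKernel δ u : ℂ) * Complex.exp (u * x * Complex.I) =
      Complex.exp (-δ * |x|) := by
  have hcont : Continuous fun x : ℝ => (Real.exp (-δ * |x|) : ℂ) := by fun_prop
  have hint : Integrable fun x : ℝ => (Real.exp (-δ * |x|) : ℂ) := by
    refine Integrable.ofReal ?_
    rw [← integrableOn_univ, ← Set.Iic_union_Ioi (a := (0 : ℝ))]
    refine IntegrableOn.union ?_ ?_
    · refine (integrableOn_congr_fun (fun v hv => ?_) measurableSet_Iic).mpr
        (integrableOn_exp_mul_Iic hδ 0)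
      rw [abs_of_nonpos hv, neg_mul_neg]
      exact Complex.exp_ofReal_re _
    · refine (integrableOn_congr_fun (fun v hv => ?_) measurableSet_Ioi).mpr
        (integrableOn_exp_mul_Ioi (neg_neg_of_pos hδ) 0)
      rw [abs_of_pos hv]
      exact Complex.exp_ofReal_re _
  have hF : FourierTransform.fourier (fun x : ℝ => (Real.exp (-δ * |x|) : ℂ)) =
      fun w : ℝ => ((2 * Real.pi * poissonKernel δ (2 * Real.pi * w) : ℝ) : ℂ) := by
    ext w
    rw [fourier_exp_neg_abs hδ]
    congr 1
    have := Real.pi_pos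
    unfold poissonKernel
    have h2 : δ ^ 2 + (2 * Real.pi * w) ^ 2 ≠ 0 := by positivity
    field_simp
  have hFint : Integrable (FourierTransform.fourier (fun x : ℝ => (Real.exp (-δ * |x|) : ℂ))) := by
    rw [hF]
    exact (((integrable_poissonKernel hδ).comp_mul_left'
      (R := 2 * Real.pi) (by positivity)).const_mul _).ofReal
  have h1 := hint.fourierInv_fourier_eq hFint (v := x) hcont.continuousAt
  rw [Real.fourierInv_eq', hF] at h1
  set g : ℝ → ℂ := fun u => (2 * Real.pi : ℂ) * ((poissonKernel δ u : ℂ) *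
    Complex.exp (u * x * Complex.I)) with hg
  have h2 : (fun v : ℝ => Complex.exp (((2 * Real.pi * inner ℝ v x : ℝ) : ℂ) * Complex.I) •
      ((2 * Real.pi * poissonKernel δ (2 * Real.pi * v) : ℝ) : ℂ)) =
      fun v => g (2 * Real.pi * v) := by
    ext v
    simp only [hg, smul_eq_mul]
    push_cast
    rw [mul_comm, mul_assoc]
    congr 3
    simp
    ring_nf
  rw [h2, Measure.integral_comp_mul_left, hg, integral_const_mul] at h1
  have hpi : (0 : ℝ) < (2 * Real.pi)⁻¹ := by positivity
  rw [abs_of_pos hpi, Complex.real_smul, ← mul_assoc] at h1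
  have h3 : (((2 * Real.pi)⁻¹ : ℝ) : ℂ) * (2 * Real.pi) = 1 := by
    push_cast
    have : (2 * Real.pi : ℂ) ≠ 0 := by simp [Real.pi_ne_zero]
    exact inv_mul_cancel₀ this
  rw [h3, one_mul] at h1
  rw [h1]
  push_cast
  rfl

/-- A finite generalized Dirichlet polynomial `∑ bₙ exp(-s ℓₙ)`. -/
noncomputable def dirPoly (b : ℕ → ℂ) (ℓ : ℕ → ℝ) (N : ℕ) (s : ℂ) : ℂ :=
  ∑ n ∈ Finset.Icc 1 N, b n * Complex.exp (-s * ℓ n)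

lemma continuous_dirPoly (b : ℕ → ℂ) (ℓ : ℕ → ℝ) (N : ℕ) : Continuous (dirPoly b ℓ N) := by
  unfold dirPoly
  fun_prop

/-- The weighted mean square of a function on the vertical line `Re s = σ₀`, with a weight
concentrated on `|Im s - t₀| ≤ T`. -/
noncomputable def meanSq (σ₀ t₀ T : ℝ) (f : ℂ → ℂ) : ℝ :=
  ∫ y : ℝ, ‖f (σ₀ + y * Complex.I)‖ ^ 2 * (1 + ((y - t₀) / T) ^ 2)⁻¹

lemma norm_dirPoly_line_le (b : ℕ → ℂ) (ℓ : ℕ → ℝ) (N : ℕ) (σ₀ y : ℝ) :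
    ‖dirPoly b ℓ N (σ₀ + y * Complex.I)‖ ≤
      ∑ n ∈ Finset.Icc 1 N, ‖b n‖ * Real.exp (-σ₀ * ℓ n) := by
  refine (norm_sum_le _ _).trans (le_of_eq (Finset.sum_congr rfl fun n _ => ?_))
  rw [norm_mul, Complex.norm_exp]
  simp

lemma integrable_weight (t₀ : ℝ) {T : ℝ} (hT : 0 < T) :
    Integrable fun y : ℝ => (1 + ((y - t₀) / T) ^ 2)⁻¹ := by
  have h := ((integrable_inv_one_add_sq).comp_div hT.ne').comp_sub_right t₀
  exact h

lemma integral_weight (t₀ : ℝ) {T : ℝ} (hT : 0 < T) :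
    ∫ y : ℝ, (1 + ((y - t₀) / T) ^ 2)⁻¹ = Real.pi * T := by
  rw [integral_sub_right_eq_self (fun y : ℝ => (1 + (y / T) ^ 2)⁻¹) t₀,
    Measure.integral_comp_div (fun y : ℝ => (1 + y ^ 2)⁻¹) T, integral_univ_inv_one_add_sq,
    abs_of_pos hT, smul_eq_mul, mul_comm]

lemma integrable_meanSq (b : ℕ → ℂ) (ℓ : ℕ → ℝ) (N : ℕ) (σ₀ t₀ : ℝ) {T : ℝ} (hT : 0 < T) :
    Integrable fun y : ℝ => ‖dirPoly b ℓ N (σ₀ + y * Complex.I)‖ ^ 2 *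
      (1 + ((y - t₀) / T) ^ 2)⁻¹ := by
  refine Integrable.bdd_mul
    (c := (∑ n ∈ Finset.Icc 1 N, ‖b n‖ * Real.exp (-σ₀ * ℓ n)) ^ 2) (integrable_weight t₀ hT) ?_ ?_
  · have := continuous_dirPoly b ℓ N
    exact Continuous.aestronglyMeasurable (by fun_prop)
  · refine Filter.Eventually.of_forall fun y => ?_
    rw [Real.norm_of_nonneg (by positivity)]
    gcongr
    exact norm_dirPoly_line_le b ℓ N σ₀ y

/-- The Poisson formula for the square of a Dirichlet polynomial. -/
lemma dirPoly_sq_eq_integral (b : ℕ → ℂ) {ℓ : ℕ → ℝ} (N : ℕ) (hℓ : ∀ n ∈ Finset.Icc 1 N, 0 ≤ ℓ n)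
    (σ₀ t : ℝ) {δ : ℝ} (hδ : 0 < δ) :
    dirPoly b ℓ N (σ₀ + δ + t * Complex.I) ^ 2 =
      ∫ u : ℝ, (poissonKernel δ u : ℂ) * dirPoly b ℓ N (σ₀ + (t - u : ℝ) * Complex.I) ^ 2 := by
  have h1 : ∀ u : ℝ, (poissonKernel δ u : ℂ) * dirPoly b ℓ N (σ₀ + (t - u : ℝ) * Complex.I) ^ 2 =
      ∑ n ∈ Finset.Icc 1 N, ∑ m ∈ Finset.Icc 1 N,
        (b n * b m * Complex.exp (-(σ₀ + t * Complex.I) * (ℓ n + ℓ m : ℝ))) *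
        ((poissonKernel δ u : ℂ) * Complex.exp (u * (ℓ n + ℓ m : ℝ) * Complex.I)) := by
    intro u
    rw [sq, dirPoly, Finset.sum_mul_sum, Finset.mul_sum]
    refine Finset.sum_congr rfl fun n _ => ?_
    rw [Finset.mul_sum]
    refine Finset.sum_congr rfl fun m _ => ?_
    have : Complex.exp (-(σ₀ + (t - u : ℝ) * Complex.I) * ℓ n) *
        Complex.exp (-(σ₀ + (t - u : ℝ) * Complex.I) * ℓ m) =
        Complex.exp (-(σ₀ + t * Complex.I) * (ℓ n + ℓ m : ℝ)) *
        Complex.exp (u * (ℓ n + ℓ m : ℝ) * Complex.I) := by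
      rw [← Complex.exp_add, ← Complex.exp_add]
      congr 1
      push_cast
      ring
    linear_combination (poissonKernel δ u : ℂ) * b n * b m * this
  have hI : ∀ n m : ℕ, Integrable fun u : ℝ =>
      (b n * b m * Complex.exp (-(σ₀ + t * Complex.I) * (ℓ n + ℓ m : ℝ))) *
        ((poissonKernel δ u : ℂ) * Complex.exp (u * (ℓ n + ℓ m : ℝ) * Complex.I)) := by
    intro n m
    refine Integrable.const_mul ?_ _
    refine (integrable_poissonKernel hδ).ofReal.mul_bdd (c := 1) ?_ ?_
    · exact Continuous.aestronglyMeasurable (by fun_prop)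
    · refine Filter.Eventually.of_forall fun u => ?_
      rw [← Complex.ofReal_mul, Complex.norm_exp_ofReal_mul_I]
  simp_rw [h1]
  rw [integral_finsetSum _ fun n _ => integrable_finsetSum _ fun m _ => hI n m, sq, dirPoly,
    Finset.sum_mul_sum]
  refine Finset.sum_congr rfl fun n hn => ?_
  rw [integral_finsetSum _ fun m _ => hI n m]
  refine Finset.sum_congr rfl fun m hm => ?_
  rw [integral_const_mul, integral_poissonKernel_mul_exp hδ,
    abs_of_nonneg (add_nonneg (hℓ n hn) (hℓ m hm))]
  have : Complex.exp (-(σ₀ + δ + t * Complex.I) * ℓ n) *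
      Complex.exp (-(σ₀ + δ + t * Complex.I) * ℓ m) =
      Complex.exp (-(σ₀ + t * Complex.I) * (ℓ n + ℓ m : ℝ)) *
      Complex.exp (-δ * (ℓ n + ℓ m : ℝ)) := by
    rw [← Complex.exp_add, ← Complex.exp_add]
    congr 1
    push_cast
    ring
  linear_combination b n * b m * this

/-- A Dirichlet polynomial to the right of a vertical line is bounded by its mean square on that
line. -/
lemma norm_dirPoly_sq_le (b : ℕ → ℂ) {ℓ : ℕ → ℝ} (N : ℕ) (hℓ : ∀ n ∈ Finset.Icc 1 N, 0 ≤ ℓ n)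
    (σ₀ t₀ : ℝ) {T β : ℝ} (hT : 1 ≤ T) (hβ : 0 < β) {s : ℂ} (h1 : σ₀ + β ≤ s.re)
    (h2 : (s.re - σ₀) * β ≤ 1) :
    ‖dirPoly b ℓ N s‖ ^ 2 ≤
      2 / (Real.pi * β) * (1 + ((s.im - t₀) / T) ^ 2) * meanSq σ₀ t₀ T (dirPoly b ℓ N) := by
  set δ := s.re - σ₀ with hδ
  set t := s.im
  have hδβ : β ≤ δ := by linarith
  have hδ0 : 0 < δ := by linarith
  have hs : s = σ₀ + δ + t * Complex.I := by
    apply Complex.ext <;> simp [hδ, t]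
  have hpi := Real.pi_pos
  have hT0 : 0 < T := by linarith
  set K := 2 / (Real.pi * β) * (1 + ((t - t₀) / T) ^ 2) with hK
  have hker : ∀ u : ℝ, poissonKernel δ u ≤ K * (1 + ((t - u - t₀) / T) ^ 2)⁻¹ := by
    intro u
    rw [← div_eq_mul_inv, le_div_iff₀ (by positivity)]
    have e1 : 1 + ((t - u - t₀) / T) ^ 2 ≤ 2 * (1 + ((t - t₀) / T) ^ 2) * (1 + (u / T) ^ 2) := by
      have : (t - u - t₀) / T = (t - t₀) / T - u / T := by ring
      rw [this]
      set p := (t - t₀) / T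
      set r := u / T
      nlinarith [sq_nonneg (p + r), mul_nonneg (sq_nonneg p) (sq_nonneg r)]
    have e2 : poissonKernel δ u * (1 + (u / T) ^ 2) ≤ 1 / (Real.pi * β) := by
      rw [poissonKernel, div_mul_eq_mul_div, div_le_div_iff₀ (by positivity) (by positivity)]
      have e3 : (u / T) ^ 2 ≤ u ^ 2 := by
        rw [div_pow]
        apply div_le_self (sq_nonneg u)
        nlinarith
      have e4 : δ * β * (1 + (u / T) ^ 2) ≤ δ ^ 2 + u ^ 2 := by
        have : δ * β ≤ δ ^ 2 := by nlinarith
        nlinarith [mul_le_mul h2 e3 (sq_nonneg _) zero_le_one]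
      nlinarith
    have e5 := poissonKernel_nonneg hδ0 u
    calc poissonKernel δ u * (1 + ((t - u - t₀) / T) ^ 2)
        ≤ poissonKernel δ u * (2 * (1 + ((t - t₀) / T) ^ 2) * (1 + (u / T) ^ 2)) := by gcongr
      _ = 2 * (1 + ((t - t₀) / T) ^ 2) * (poissonKernel δ u * (1 + (u / T) ^ 2)) := by ring
      _ ≤ 2 * (1 + ((t - t₀) / T) ^ 2) * (1 / (Real.pi * β)) := by gcongr
      _ = K := by rw [hK]; ring
  have hint := (integrable_meanSq b ℓ N σ₀ t₀ hT0).comp_sub_left t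
  rw [← norm_pow, hs, dirPoly_sq_eq_integral b N hℓ σ₀ t hδ0]
  refine (norm_integral_le_of_norm_le (hint.const_mul K)
    (Filter.Eventually.of_forall fun u => ?_)).trans ?_
  · rw [norm_mul, norm_pow, Complex.norm_of_nonneg (poissonKernel_nonneg hδ0 u)]
    have := mul_le_mul_of_nonneg_right (hker u)
      (sq_nonneg ‖dirPoly b ℓ N (σ₀ + (t - u : ℝ) * Complex.I)‖)
    calc _ ≤ _ := this
      _ = _ := by ring
  · rw [integral_const_mul, integral_sub_left_eq_self
      (fun y : ℝ => ‖dirPoly b ℓ N (σ₀ + y * Complex.I)‖ ^ 2 * (1 + ((y - t₀) / T) ^ 2)⁻¹)]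
    exact le_rfl

/-- The mean squares of a family of Dirichlet polynomials, from a pointwise large sieve bound. -/
lemma sum_meanSq_le {ι : Type*} (F : Finset ι) (b : ι → ℕ → ℂ) (ℓ : ℕ → ℝ) (N : ℕ) (σ₀ t₀ : ℝ)
    {T K : ℝ} (hT : 0 < T)
    (hK : ∀ y : ℝ, ∑ p ∈ F, ‖dirPoly (b p) ℓ N (σ₀ + y * Complex.I)‖ ^ 2 ≤ K) :
    ∑ p ∈ F, meanSq σ₀ t₀ T (dirPoly (b p) ℓ N) ≤ Real.pi * T * K := by
  simp only [meanSq]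
  rw [← integral_finsetSum _ fun p _ => integrable_meanSq (b p) ℓ N σ₀ t₀ hT,
    ← integral_weight t₀ hT, ← integral_mul_const]
  refine integral_mono (integrable_finsetSum _ fun p _ => integrable_meanSq (b p) ℓ N σ₀ t₀ hT)
    ((integrable_weight t₀ hT).mul_const K) fun y => ?_
  simp only
  rw [← Finset.sum_mul, mul_comm]
  exact mul_le_mul_of_nonneg_left (hK y) (by positivity)

lemma meanSq_nonneg (σ₀ t₀ T : ℝ) (f : ℂ → ℂ) : 0 ≤ meanSq σ₀ t₀ T f :=
  integral_nonneg fun y => by positivity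

/-- Chebyshev's inequality. -/
lemma card_filter_lt_le {ι : Type*} [DecidableEq ι] (F : Finset ι) (J : ι → ℝ)
    (hJ : ∀ p ∈ F, 0 ≤ J p) {V S : ℝ} (hV : 0 < V) (hS : ∑ p ∈ F, J p ≤ S)
    [DecidablePred fun p => V < J p] : ((F.filter fun p => V < J p).card : ℝ) ≤ S / V := by
  rw [le_div_iff₀ hV]
  calc ((F.filter fun p => V < J p).card : ℝ) * V = ∑ p ∈ F.filter (fun p => V < J p), V := by
        rw [Finset.sum_const, nsmul_eq_mul]
    _ ≤ ∑ p ∈ F.filter (fun p => V < J p), J p :=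
        Finset.sum_le_sum fun p hp => (Finset.mem_filter.mp hp).2.le
    _ ≤ ∑ p ∈ F, J p := Finset.sum_le_sum_of_subset_of_nonneg (Finset.filter_subset _ _)
        fun p hp _ => hJ p hp
    _ ≤ S := hS

/-! ### The gamma quotient of the functional equation -/

open Complex in
/-- The quotient of gamma factors in the asymmetric functional equation of an even (`e = false`)
or odd (`e = true`) primitive character. -/
noncomputable def gammaQuot (e : Bool) (z : ℂ) : ℂ :=
  if e then Gammaℝ (2 - z) * (Gammaℝ (z + 1))⁻¹ else Gammaℝ (1 - z) * (Gammaℝ z)⁻¹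

open Complex in
/-- The reflection and duplication formulas give a form without poles in the half-plane
`Re z < 1`. -/
lemma gammaQuot_eq (e : Bool) {z : ℂ} (hz : z.re < 1) :
    gammaQuot e z = Gammaℂ (1 - z) *
      (if e then sin (Real.pi * (1 - z) / 2) else cos (Real.pi * (1 - z) / 2)) := by
  have h : ∀ n : ℕ, (1 - z) ≠ -n := by
    intro n hn
    have := congrArg Complex.re hn
    simp at this
    have : (0 : ℝ) ≤ n := n.cast_nonneg
    linarith
  have hr : 0 < (1 - z).re := by simp; linarith
  cases e with
  | false =>
    have h1 := inv_Gammaℝ_one_sub h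
    rw [sub_sub_cancel] at h1
    simp only [gammaQuot, Bool.false_eq_true, if_false]
    rw [h1]
    field_simp [Gammaℝ_ne_zero_of_re_pos hr]
  | true =>
    have h1 := inv_Gammaℝ_two_sub h
    have h2 : 2 - (1 - z) = z + 1 := by ring
    have h3 : 1 - z + 1 = 2 - z := by ring
    rw [h2, h3] at h1
    have h4 : Gammaℝ (2 - z) ≠ 0 := Gammaℝ_ne_zero_of_re_pos (by simp; linarith)
    simp only [gammaQuot, if_true]
    rw [h1]
    field_simp

open Complex in
lemma norm_Gammaℝ_conj (s : ℂ) : ‖Gammaℝ (starRingEnd ℂ s)‖ = ‖Gammaℝ s‖ := by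
  rw [Gammaℝ_def, Gammaℝ_def, norm_mul, norm_mul, Complex.norm_cpow_eq_rpow_re_of_pos Real.pi_pos,
    Complex.norm_cpow_eq_rpow_re_of_pos Real.pi_pos]
  have h1 : starRingEnd ℂ s / 2 = starRingEnd ℂ (s / 2) := by simp [map_ofNat]
  rw [h1, Gamma_conj, RCLike.norm_conj]
  congr 2
  simp

/-- On the critical line the numerator and the denominator are complex conjugates. -/
lemma norm_gammaQuot_half (e : Bool) (z : ℂ) (hz : z.re = 1 / 2) : ‖gammaQuot e z‖ = 1 := by
  have h1 : 1 - z = starRingEnd ℂ z := by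
    apply Complex.ext
    · simp [hz]; norm_num
    · simp
  have key : ∀ w : ℂ, 0 < w.re →
      ‖Complex.Gammaℝ (starRingEnd ℂ w) * (Complex.Gammaℝ w)⁻¹‖ = 1 := by
    intro w hw
    rw [norm_mul, norm_Gammaℝ_conj, norm_inv]
    exact mul_inv_cancel₀ (norm_ne_zero_iff.mpr (Complex.Gammaℝ_ne_zero_of_re_pos hw))
  cases e with
  | false =>
    simp only [gammaQuot, Bool.false_eq_true, if_false]
    rw [h1]
    exact key z (by rw [hz]; norm_num)
  | true =>
    have h2 : 2 - z = starRingEnd ℂ (z + 1) := by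
      rw [map_add, ← h1, map_one]; ring
    simp only [gammaQuot, if_true]
    rw [h2]
    exact key _ (by simp [hz]; norm_num)

/-- The recurrence of the gamma function, for a shift that preserves the parity. -/
lemma gammaQuot_sub_two (e : Bool) {z : ℂ} (hz : z.re < 1) :
    gammaQuot e (z - 2) = -(gammaQuot e z * ((1 - z) * (2 - z) / (4 * Real.pi ^ 2))) := by
  have h1 : (1 - z : ℂ) ≠ 0 := by
    intro h; have := congrArg Complex.re h; simp at this; linarith
  have h2 : (2 - z : ℂ) ≠ 0 := by
    intro h; have := congrArg Complex.re h; simp at this; linarith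
  have h3 : Complex.Gammaℂ (1 - (z - 2)) =
      Complex.Gammaℂ (1 - z) * ((1 - z) * (2 - z) / (4 * Real.pi ^ 2)) := by
    have e1 : (1 - (z - 2) : ℂ) = (1 - z + 1) + 1 := by ring
    have e2 : (1 - z + 1 : ℂ) = 2 - z := by ring
    rw [e1, Complex.Gammaℂ_add_one (by rw [e2]; exact h2), Complex.Gammaℂ_add_one h1, e2]
    have : (Real.pi : ℂ) ≠ 0 := by simp [Real.pi_ne_zero]
    field_simp
    ring
  rw [gammaQuot_eq e (by simp; linarith), gammaQuot_eq e hz, h3]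
  have e3 : (Real.pi : ℂ) * (1 - (z - 2)) / 2 = Real.pi * (1 - z) / 2 + Real.pi := by ring
  rw [e3, Complex.sin_add_pi, Complex.cos_add_pi]
  cases e <;> simp <;> ring

lemma differentiableAt_gammaQuot (e : Bool) {z : ℂ} (hz : z.re < 1) :
    DifferentiableAt ℂ (gammaQuot e) z := by
  have hG : ∀ w : ℂ, 0 < w.re → DifferentiableAt ℂ Complex.Gammaℝ w := by
    intro w hw
    have : Complex.Gammaℝ = fun s => (Real.pi : ℂ) ^ (-s / 2) * Complex.Gamma (s / 2) := by
      ext s; exact Complex.Gammaℝ_def s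
    rw [this]
    refine DifferentiableAt.mul ?_ ?_
    · exact DifferentiableAt.const_cpow (by fun_prop) (Or.inl (by simp [Real.pi_ne_zero]))
    · refine (Complex.differentiableAt_Gamma _ ?_).comp w (by fun_prop)
      intro m hm
      have := congrArg Complex.re hm
      simp at this
      have : (0 : ℝ) ≤ m := m.cast_nonneg
      linarith
  have hi : DifferentiableAt ℂ (fun s => (Complex.Gammaℝ s)⁻¹) z :=
    Complex.differentiable_Gammaℝ_inv z
  have hi' : DifferentiableAt ℂ (fun s => (Complex.Gammaℝ (s + 1))⁻¹) z :=
    DifferentiableAt.comp z (g := fun s => (Complex.Gammaℝ s)⁻¹) (f := fun s => s + 1)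
      (Complex.differentiable_Gammaℝ_inv (z + 1)) (by fun_prop)
  cases e with
  | false =>
    have : gammaQuot false = fun z => Complex.Gammaℝ (1 - z) * (Complex.Gammaℝ z)⁻¹ := by
      ext; simp [gammaQuot]
    rw [this]
    exact ((hG _ (by simp; linarith)).comp z (by fun_prop)).mul hi
  | true =>
    have : gammaQuot true = fun z => Complex.Gammaℝ (2 - z) * (Complex.Gammaℝ (z + 1))⁻¹ := by
      ext; simp [gammaQuot]
    rw [this]
    exact ((hG _ (by simp; linarith)).comp z (by fun_prop)).mul hi'

lemma norm_Gamma_le_Gamma_re {s : ℂ} (hs : 0 < s.re) : ‖Complex.Gamma s‖ ≤ Real.Gamma s.re := by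
  rw [Complex.Gamma_eq_integral hs, Real.Gamma_eq_integral hs, Complex.GammaIntegral]
  refine MeasureTheory.norm_integral_le_of_norm_le (Real.GammaIntegral_convergent hs) ?_
  filter_upwards [MeasureTheory.ae_restrict_mem measurableSet_Ioi] with x hx
  rw [norm_mul, Complex.norm_of_nonneg (Real.exp_pos _).le,
    Complex.norm_cpow_eq_rpow_re_of_pos hx]
  simp

lemma norm_cos_le (z : ℂ) : ‖Complex.cos z‖ ≤ Real.exp |z.im| := by
  rw [Complex.cos, norm_div]
  have h1 : ‖Complex.exp (z * Complex.I)‖ ≤ Real.exp |z.im| := by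
    rw [Complex.norm_exp]
    simp
    exact neg_le_abs _
  have h2 : ‖Complex.exp (-z * Complex.I)‖ ≤ Real.exp |z.im| := by
    rw [Complex.norm_exp]
    simp
    exact le_abs_self _
  have h3 := norm_add_le (Complex.exp (z * Complex.I)) (Complex.exp (-z * Complex.I))
  rw [Complex.norm_ofNat, div_le_iff₀ two_pos]
  linarith

lemma norm_sin_le (z : ℂ) : ‖Complex.sin z‖ ≤ Real.exp |z.im| := by
  have := norm_cos_le (z - Real.pi / 2)
  rw [Complex.cos_sub_pi_div_two] at this
  simpa using this

/-- A crude growth bound for the gamma quotient in a vertical strip. -/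
lemma exists_norm_gammaQuot_le_exp : ∃ C : ℝ, 0 < C ∧ ∀ (e : Bool) (z : ℂ), -(3 / 2) ≤ z.re →
    z.re ≤ 1 / 2 → ‖gammaQuot e z‖ ≤ C * Real.exp (2 * |z.im|) := by
  have hcont : ContinuousOn Real.Gamma (Set.Icc (1 / 2) (5 / 2)) := by
    intro x hx
    refine (Real.differentiableAt_Gamma fun m hm => ?_).continuousAt.continuousWithinAt
    have h1 := hx.1
    have : (0 : ℝ) ≤ m := m.cast_nonneg
    linarith
  obtain ⟨M, hM⟩ := (isCompact_Icc.bddAbove_image hcont)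
  have hM' : ∀ x ∈ Set.Icc (1 / 2 : ℝ) (5 / 2), Real.Gamma x ≤ M := fun x hx =>
    hM ⟨x, hx, rfl⟩
  have hM0 : 0 < M := (Real.Gamma_pos_of_pos one_pos).trans_le (hM' 1 (by norm_num))
  refine ⟨2 * M, by positivity, fun e z h1 h2 => ?_⟩
  rw [gammaQuot_eq e (by linarith), Complex.Gammaℂ_def, norm_mul, norm_mul, norm_mul]
  have hpi := Real.pi_gt_three
  have e1 : ‖(2 * Real.pi : ℂ) ^ (-(1 - z))‖ ≤ 1 := by
    have : (2 * Real.pi : ℂ) = ((2 * Real.pi : ℝ) : ℂ) := by push_cast; rfl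
    rw [this, Complex.norm_cpow_eq_rpow_re_of_pos (by positivity)]
    refine Real.rpow_le_one_of_one_le_of_nonpos (by linarith) ?_
    simp
    linarith
  have e2 : ‖Complex.Gamma (1 - z)‖ ≤ M := by
    refine (norm_Gamma_le_Gamma_re (by simp; linarith)).trans (hM' _ ?_)
    constructor <;> simp <;> linarith
  have e3 : |(Real.pi * (1 - z) / 2 : ℂ).im| ≤ 2 * |z.im| := by
    have : (Real.pi * (1 - z) / 2 : ℂ).im = -(Real.pi / 2 * z.im) := by
      have : (Real.pi * (1 - z) / 2 : ℂ) = ((Real.pi / 2 : ℝ) : ℂ) * (1 - z) := by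
        push_cast; ring
      rw [this, Complex.im_ofReal_mul]
      simp
    rw [this, abs_neg, abs_mul, abs_of_pos (by positivity)]
    have := Real.pi_lt_four
    gcongr
    linarith
  have e4 : ‖(if e then Complex.sin (Real.pi * (1 - z) / 2)
      else Complex.cos (Real.pi * (1 - z) / 2))‖ ≤ Real.exp (2 * |z.im|) := by
    split_ifs
    · exact (norm_sin_le _).trans (Real.exp_le_exp.mpr e3)
    · exact (norm_cos_le _).trans (Real.exp_le_exp.mpr e3)
  rw [Complex.norm_ofNat]
  calc _ ≤ 2 * 1 * M * Real.exp (2 * |z.im|) := by gcongr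
    _ = _ := by ring

/-- The Phragmén–Lindelöf principle between the lines `Re z = -3/2` and `Re z = 1/2`: on the
second one the gamma quotient has modulus `1`, and on the first one it is related to a point of
the second one by the recurrence for `z - 2`. -/
lemma norm_gammaQuot_le_left : ∀ (e : Bool) (z : ℂ), -(3 / 2) ≤ z.re → z.re ≤ 1 / 2 →
    ‖gammaQuot e z‖ ≤ Real.exp (9 / 4) * (1 + |z.im|) ^ (1 / 2 - z.re) := by
  intro e z₀ h1 h2
  obtain ⟨C, hC, hgr⟩ := exists_norm_gammaQuot_le_exp
  set t₀ := z₀.im with ht₀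
  set τ : ℝ := 1 + |t₀| with hτ
  have hτ1 : 1 ≤ τ := by rw [hτ]; linarith [abs_nonneg t₀]
  have hτ0 : 0 < τ := by linarith
  -- the Gaussian factor localizes the Phragmén–Lindelöf principle at height `t₀`
  set f : ℂ → ℂ := fun z => gammaQuot e z * (τ : ℂ) ^ (z - 1 / 2) *
    Complex.exp ((z - t₀ * Complex.I) ^ 2) with hf
  have hnorm : ∀ z : ℂ, ‖f z‖ = ‖gammaQuot e z‖ * τ ^ (z.re - 1 / 2) *
      Real.exp (z.re ^ 2 - (z.im - t₀) ^ 2) := by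
    intro z
    rw [hf, norm_mul, norm_mul, Complex.norm_cpow_eq_rpow_re_of_pos hτ0, Complex.norm_exp]
    congr 2
    · simp
    · rw [sq, Complex.mul_re]
      simp
      ring
  have hdiff : ∀ z : ℂ, z.re < 1 → DifferentiableAt ℂ f z := by
    intro z hz
    refine ((differentiableAt_gammaQuot e hz).mul ?_).mul (by fun_prop)
    exact DifferentiableAt.const_cpow (by fun_prop) (Or.inl (by exact_mod_cast hτ0.ne'))
  have key : ‖f z₀‖ ≤ Real.exp (9 / 4) := by
    refine PhragmenLindelof.vertical_strip (a := -(3 / 2)) (b := 1 / 2) ?_ ?_ ?_ ?_ h1 h2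
    · refine DifferentiableOn.diffContOnCl fun z hz => (hdiff z ?_).differentiableWithinAt
      have hcl : closure (Complex.re ⁻¹' Set.Ioo (-(3 / 2) : ℝ) (1 / 2)) ⊆
          Complex.re ⁻¹' Set.Icc (-(3 / 2) : ℝ) (1 / 2) :=
        closure_minimal (Set.preimage_mono Set.Ioo_subset_Icc_self)
          (isClosed_Icc.preimage Complex.continuous_re)
      have := (hcl hz).2
      linarith
    · refine ⟨1, ?_, 2, ?_⟩
      · have := Real.pi_gt_three
        norm_num
        linarith
      · refine Asymptotics.IsBigO.of_bound (C * Real.exp (9 / 4)) ?_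
        refine Filter.eventually_inf_principal.mpr (Filter.Eventually.of_forall fun z hz => ?_)
        rw [hnorm, Real.norm_of_nonneg (Real.exp_pos _).le]
        have e1 := hgr e z hz.1.le hz.2.le
        have e2 : τ ^ (z.re - 1 / 2) ≤ 1 :=
          Real.rpow_le_one_of_one_le_of_nonpos hτ1 (by linarith [hz.2])
        have e3 : Real.exp (z.re ^ 2 - (z.im - t₀) ^ 2) ≤ Real.exp (9 / 4) := by
          apply Real.exp_le_exp.mpr
          nlinarith [sq_nonneg (z.im - t₀), hz.1, hz.2]
        have e4 : Real.exp (2 * |z.im|) ≤ Real.exp (2 * Real.exp (1 * |z.im|)) := by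
          apply Real.exp_le_exp.mpr
          have := Real.add_one_le_exp (1 * |z.im|)
          linarith
        calc _ ≤ C * Real.exp (2 * |z.im|) * 1 * Real.exp (9 / 4) := by gcongr
          _ = C * Real.exp (9 / 4) * Real.exp (2 * |z.im|) := by ring
          _ ≤ _ := by gcongr
    · intro z hz
      -- on the left edge the recurrence leads back to the critical line
      have hw : (z + 2).re = 1 / 2 := by simp [hz]; norm_num
      have e1 := gammaQuot_sub_two e (z := z + 2) (by rw [hw]; norm_num)
      rw [add_sub_cancel_right] at e1
      rw [hnorm, e1, norm_neg, norm_mul, norm_gammaQuot_half e _ hw, one_mul, norm_div, norm_mul,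
        hz]
      have b1 : ‖(1 : ℂ) - (z + 2)‖ ≤ 2 + |z.im| := by
        refine (Complex.norm_le_abs_re_add_abs_im _).trans ?_
        simp [hz]
        norm_num
      have b2 : ‖(2 : ℂ) - (z + 2)‖ ≤ 2 + |z.im| := by
        refine (Complex.norm_le_abs_re_add_abs_im _).trans ?_
        simp [hz]
        norm_num
      have b3 : ‖(4 * Real.pi ^ 2 : ℂ)‖ = 4 * Real.pi ^ 2 := by
        rw [norm_mul, norm_pow, Complex.norm_real, Real.norm_of_nonneg Real.pi_pos.le]
        simp
      have b4 : 2 + |z.im| ≤ 2 * τ * (1 + |z.im - t₀|) := by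
        have := abs_sub_abs_le_abs_sub z.im t₀
        have h3 := abs_nonneg (z.im - t₀)
        have h4 := abs_nonneg t₀
        rw [hτ]
        nlinarith [mul_nonneg h3 h4]
      set u := |z.im - t₀| with hu
      have hu0 : 0 ≤ u := abs_nonneg _
      have b5 : (1 + u) ^ 2 ≤ 2 * Real.exp (u ^ 2) := by
        have := Real.add_one_le_exp (u ^ 2)
        nlinarith [sq_nonneg (1 - u)]
      have b6 : τ ^ (-(3 / 2) - 1 / 2 : ℝ) = (τ ^ 2)⁻¹ := by
        rw [← Real.rpow_natCast, ← Real.rpow_neg hτ0.le]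
        norm_num
      have b7 : Real.exp ((-(3 / 2)) ^ 2 - (z.im - t₀) ^ 2) =
          Real.exp (9 / 4) * (Real.exp (u ^ 2))⁻¹ := by
        rw [← Real.exp_neg, ← Real.exp_add, hu, sq_abs]
        norm_num
        ring_nf
      rw [b3, b6, b7]
      have hpi := Real.pi_gt_three
      have b8 : ‖(1 : ℂ) - (z + 2)‖ * ‖(2 : ℂ) - (z + 2)‖ ≤ (2 * τ * (1 + u)) ^ 2 := by
        rw [sq]
        gcongr
        · exact b1.trans b4
        · exact b2.trans b4
      calc _ ≤ (2 * τ * (1 + u)) ^ 2 / (4 * Real.pi ^ 2) * (τ ^ 2)⁻¹ *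
            (Real.exp (9 / 4) * (Real.exp (u ^ 2))⁻¹) := by gcongr
        _ = (1 + u) ^ 2 * (Real.exp (u ^ 2))⁻¹ * (Real.exp (9 / 4) / Real.pi ^ 2) := by
          field_simp
          ring
        _ ≤ 2 * Real.exp (u ^ 2) * (Real.exp (u ^ 2))⁻¹ * (Real.exp (9 / 4) / Real.pi ^ 2) := by
          gcongr
        _ = Real.exp (9 / 4) * (2 / Real.pi ^ 2) := by
          field_simp
        _ ≤ Real.exp (9 / 4) * 1 := by
          gcongr
          rw [div_le_one (by positivity)]
          nlinarith
        _ = _ := mul_one _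
    · intro z hz
      rw [hnorm, norm_gammaQuot_half e z hz, hz]
      simp only [sub_self, Real.rpow_zero, one_mul]
      apply Real.exp_le_exp.mpr
      nlinarith [sq_nonneg (z.im - t₀)]
  rw [hnorm] at key
  simp only [← ht₀, sub_self] at key
  have e1 : 1 ≤ Real.exp (z₀.re ^ 2 - 0 ^ 2) := Real.one_le_exp (by simp; positivity)
  have e2 : τ ^ (z₀.re - 1 / 2) * τ ^ (1 / 2 - z₀.re) = 1 := by
    rw [← Real.rpow_add hτ0]; simp
  have e3 : ‖gammaQuot e z₀‖ * τ ^ (z₀.re - 1 / 2) ≤ Real.exp (9 / 4) := by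
    refine le_trans ?_ key
    exact le_mul_of_one_le_right (by positivity) e1
  calc ‖gammaQuot e z₀‖ = ‖gammaQuot e z₀‖ * τ ^ (z₀.re - 1 / 2) * τ ^ (1 / 2 - z₀.re) := by
        rw [mul_assoc, e2, mul_one]
    _ ≤ _ := by gcongr

/-- The gamma quotient is `O((1 + |t|)^(1/2 - σ))` to the left of the critical line, and bounded
to the right of it, away from the pole at `1`. -/
lemma exists_norm_gammaQuot_le : ∃ C : ℝ, 0 < C ∧ ∀ (e : Bool) (z : ℂ), -(3 / 2) ≤ z.re →
    z.re < 1 → (z.re ≤ 19 / 20 ∨ 1 ≤ |z.im|) →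
    ‖gammaQuot e z‖ ≤ C * (1 + |z.im|) ^ max 0 (1 / 2 - z.re) := by
  set K : Set ℂ := Set.Icc (1 / 2) (19 / 20) ×ℂ Set.Icc (-1) 1 with hK
  have hKc : IsCompact K := isCompact_Icc.reProdIm isCompact_Icc
  have hb : ∀ e, ∃ M, ∀ z ∈ K, ‖gammaQuot e z‖ ≤ M := by
    intro e
    refine hKc.exists_bound_of_continuousOn fun z hz => ?_
    refine (differentiableAt_gammaQuot e ?_).continuousAt.continuousWithinAt
    have := hz.1.2
    linarith
  obtain ⟨M₁, hM₁⟩ := hb true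
  obtain ⟨M₂, hM₂⟩ := hb false
  set C := Real.exp (9 / 4) * (16 * Real.pi ^ 2) + |M₁| + |M₂| with hC
  have hpi := Real.pi_gt_three
  have hC0 : 0 < C := by positivity
  have hC1 : Real.exp (9 / 4) ≤ C := by
    have : Real.exp (9 / 4) * 1 ≤ Real.exp (9 / 4) * (16 * Real.pi ^ 2) := by
      gcongr; nlinarith
    rw [hC]
    linarith [abs_nonneg M₁, abs_nonneg M₂]
  refine ⟨C, hC0, fun e z h1 h2 h3 => ?_⟩
  rcases le_or_gt z.re (1 / 2) with h4 | h4
  · rw [max_eq_right (by linarith)]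
    refine (norm_gammaQuot_le_left e z h1 h4).trans ?_
    gcongr
  · rw [max_eq_left (by linarith), Real.rpow_zero, mul_one]
    -- away from the pole the recurrence is used, near it compactness
    rcases le_or_gt 1 |z.im| with h5 | h5
    · have e1 := gammaQuot_sub_two e h2
      have e2 := norm_gammaQuot_le_left e (z - 2) (by simp; linarith) (by simp; linarith)
      rw [e1, norm_neg, norm_mul, norm_div, norm_mul] at e2
      have b3 : ‖(4 * Real.pi ^ 2 : ℂ)‖ = 4 * Real.pi ^ 2 := by
        rw [norm_mul, norm_pow, Complex.norm_real, Real.norm_of_nonneg Real.pi_pos.le]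
        simp
      have him : (z - 2).im = z.im := by simp
      have hre : 1 / 2 - (z - 2).re = 5 / 2 - z.re := by simp; ring
      rw [b3, him, hre] at e2
      have b1 : |z.im| ≤ ‖1 - z‖ := by
        simpa using Complex.abs_im_le_norm (1 - z)
      have b2 : |z.im| ≤ ‖2 - z‖ := by
        simpa using Complex.abs_im_le_norm (2 - z)
      have b4 : (1 + |z.im|) ^ (5 / 2 - z.re) ≤ (2 * |z.im|) ^ 2 := by
        calc (1 + |z.im|) ^ (5 / 2 - z.re) ≤ (1 + |z.im|) ^ (2 : ℝ) :=
              Real.rpow_le_rpow_of_exponent_le (by linarith) (by linarith)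
          _ = (1 + |z.im|) ^ 2 := by norm_cast
          _ ≤ _ := by gcongr; linarith
      have hpos : 0 < |z.im| := by linarith
      have b5 : ‖gammaQuot e z‖ * (|z.im| * |z.im| / (4 * Real.pi ^ 2)) ≤
          Real.exp (9 / 4) * (2 * |z.im|) ^ 2 := by
        refine le_trans ?_ (e2.trans ?_)
        · gcongr
        · gcongr
      have b6 : ‖gammaQuot e z‖ ≤ Real.exp (9 / 4) * (16 * Real.pi ^ 2) := by
        have : 0 < |z.im| * |z.im| / (4 * Real.pi ^ 2) := by positivity
        refine le_of_mul_le_mul_right (b5.trans (le_of_eq ?_)) this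
        field_simp
        ring
      rw [hC]
      linarith [abs_nonneg M₁, abs_nonneg M₂]
    · have h6 : z.re ≤ 19 / 20 := by
        rcases h3 with h | h
        · exact h
        · linarith
      have hz : z ∈ K := by
        rw [hK, Complex.mem_reProdIm]
        exact ⟨⟨h4.le, h6⟩, (abs_le.mp h5.le)⟩
      have : 0 < Real.exp (9 / 4) * (16 * Real.pi ^ 2) := by positivity
      cases e with
      | true =>
        have := hM₁ z hz
        rw [hC]
        linarith [le_abs_self M₁, abs_nonneg M₂]
      | false =>
        have := hM₂ z hz
        rw [hC]
        linarith [le_abs_self M₂, abs_nonneg M₁]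

/-! ### The functional equation and the size of Dirichlet L-functions -/

lemma ne_one_of_isPrimitive {k : ℕ} [NeZero k] {ψ : DirichletCharacter ℂ k} (h : ψ.IsPrimitive)
    (hk : k ≠ 1) : ψ ≠ 1 := by
  rintro rfl
  rw [DirichletCharacter.isPrimitive_def, DirichletCharacter.conductor_one] at h
  exact hk h.symm

lemma norm_rootNumber {k : ℕ} [NeZero k] {ψ : DirichletCharacter ℂ k} (h : ψ.IsPrimitive) :
    ‖ψ.rootNumber‖ = 1 := by
  have hk : (0 : ℝ) < k := by exact_mod_cast Nat.pos_of_ne_zero (NeZero.ne k)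
  have h1 : ‖(k : ℂ) ^ (1 / 2 : ℂ)‖ = √k := by
    rw [← Complex.ofReal_natCast, Complex.norm_cpow_eq_rpow_re_of_pos hk, Real.sqrt_eq_rpow]
    norm_num
  have h2 : ‖gaussSum ψ (ZMod.stdAddChar (N := k))‖ = √k := by
    rw [← norm_gaussSum_sq h, Real.sqrt_sq (norm_nonneg _)]
  rw [DirichletCharacter.rootNumber, norm_div, norm_div, h1, h2, norm_pow, Complex.norm_I, one_pow,
    div_one, div_self (Real.sqrt_pos.mpr hk).ne']

open Classical in
/-- The factor `X(s)` of the asymmetric functional equation `L(s, ψ) = X(s) L(1 - s, ψ̄)`. -/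
noncomputable def feFactor {k : ℕ} [NeZero k] (ψ : DirichletCharacter ℂ k) (s : ℂ) : ℂ :=
  (k : ℂ) ^ (1 / 2 - s) * ψ.rootNumber * gammaQuot (decide (¬ ψ.Even)) s

lemma even_inv_iff {k : ℕ} [NeZero k] (ψ : DirichletCharacter ℂ k) : ψ⁻¹.Even ↔ ψ.Even := by
  rw [DirichletCharacter.Even, DirichletCharacter.Even, star_mulChar_apply]
  constructor
  · intro h
    have := congrArg (starRingEnd ℂ) h
    simpa using this
  · intro h; simp [h]

/-- The asymmetric functional equation. -/
lemma LFunction_eq_feFactor_mul {k : ℕ} [NeZero k] {ψ : DirichletCharacter ℂ k}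
    (h : ψ.IsPrimitive) (hk : k ≠ 1) {s : ℂ} (hs : s.re < 1) :
    DirichletCharacter.LFunction ψ s =
      feFactor ψ s * DirichletCharacter.LFunction ψ⁻¹ (1 - s) := by
  have h1 := h.completedLFunction_one_sub (1 - s)
  rw [sub_sub_cancel] at h1
  have h2 := DirichletCharacter.LFunction_eq_completed_div_gammaFactor ψ s (Or.inr hk)
  have h3 := DirichletCharacter.LFunction_eq_completed_div_gammaFactor ψ⁻¹ (1 - s) (Or.inr hk)
  have h4 : (1 : ℂ) - s - 1 / 2 = 1 / 2 - s := by ring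
  rw [h4] at h1
  have h5 : Complex.Gammaℝ (1 - s) ≠ 0 := Complex.Gammaℝ_ne_zero_of_re_pos (by simp; linarith)
  have h6 : Complex.Gammaℝ (2 - s) ≠ 0 := Complex.Gammaℝ_ne_zero_of_re_pos (by simp; linarith)
  rw [h2, h3, h1, feFactor]
  by_cases he : ψ.Even
  · have he' := (even_inv_iff ψ).mpr he
    simp only [he, not_true_eq_false, decide_false, gammaQuot, Bool.false_eq_true, if_false,
      he.gammaFactor_def, he'.gammaFactor_def]
    field_simp
  · have he' := (even_inv_iff ψ).not.mpr he
    have h7 : (1 : ℂ) - s + 1 = 2 - s := by ring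
    simp only [he, not_false_eq_true, decide_true, gammaQuot, if_true,
      DirichletCharacter.gammaFactor, he', if_false, h7]
    field_simp

lemma differentiableAt_feFactor {k : ℕ} [NeZero k] (ψ : DirichletCharacter ℂ k) {s : ℂ}
    (hs : s.re < 1) : DifferentiableAt ℂ (feFactor ψ) s := by
  have hk : (k : ℂ) ≠ 0 := by exact_mod_cast NeZero.ne k
  refine DifferentiableAt.mul (DifferentiableAt.mul ?_ (differentiableAt_const _))
    (differentiableAt_gammaQuot _ hs)
  exact DifferentiableAt.const_cpow (by fun_prop) (Or.inl hk)

open Classical in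
/-- The root number has modulus one, so that only the conductor and the gamma quotient matter. -/
lemma norm_feFactor {k : ℕ} [NeZero k] {ψ : DirichletCharacter ℂ k} (h : ψ.IsPrimitive) (s : ℂ) :
    ∃ e : Bool, ‖feFactor ψ s‖ = (k : ℝ) ^ (1 / 2 - s.re) * ‖gammaQuot e s‖ := by
  have hk : (0 : ℝ) < k := by exact_mod_cast Nat.pos_of_ne_zero (NeZero.ne k)
  refine ⟨decide (¬ ψ.Even), ?_⟩
  rw [feFactor, norm_mul, norm_mul, norm_rootNumber h, mul_one, ← Complex.ofReal_natCast,
    Complex.norm_cpow_eq_rpow_re_of_pos hk]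
  simp

open Filter Topology in
/-- To the left of `Re s = 1` the meromorphic function `Δ(s, ψ)` is the factor of the functional
equation, also at the zeros of `L(1 - s, ψ̄)`. -/
lemma Delta_eq_feFactor {k : ℕ} [NeZero k] {ψ : DirichletCharacter ℂ k}
    (h : ψ.IsPrimitive) (hk : k ≠ 1) {s : ℂ} (hs : s.re < 1) : Delta ψ s = feFactor ψ s := by
  have h1 : ψ ≠ 1 := ne_one_of_isPrimitive h hk
  have h2 : ψ⁻¹ ≠ 1 := inv_ne_one.mpr h1
  have d1 : Differentiable ℂ (DirichletCharacter.LFunction ψ) :=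
    DirichletCharacter.differentiable_LFunction h1
  have d2 : Differentiable ℂ (fun s => DirichletCharacter.LFunction ψ⁻¹ (1 - s)) :=
    (DirichletCharacter.differentiable_LFunction h2).comp (by fun_prop)
  set f : ℂ → ℂ := fun s => DirichletCharacter.LFunction ψ s /
    DirichletCharacter.LFunction (star ψ) (1 - s) with hf
  have hm : MeromorphicOn f Set.univ := by
    intro z _
    rw [hf, MulChar.star_eq_inv]
    exact (d1.analyticAt z).meromorphicAt.div (d2.analyticAt z).meromorphicAt
  have hopen : IsOpen {z : ℂ | z.re < 1} := isOpen_lt Complex.continuous_re continuous_const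
  have ha : AnalyticAt ℂ (feFactor ψ) s := by
    refine DifferentiableOn.analyticAt (s := {z : ℂ | z.re < 1}) (fun z hz => ?_)
      (hopen.mem_nhds hs)
    exact (differentiableAt_feFactor ψ hz).differentiableWithinAt
  have hne : ∀ᶠ z in 𝓝[≠] s, DirichletCharacter.LFunction ψ⁻¹ (1 - z) ≠ 0 := by
    rcases (d2.analyticAt s).eventually_eq_zero_or_eventually_ne_zero with h0 | h0
    · exfalso
      have h3 := AnalyticOnNhd.eqOn_zero_of_preconnected_of_eventuallyEq_zero
        (fun z _ => d2.analyticAt z) isPreconnected_univ (Set.mem_univ s) h0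
      have h4 := h3 (Set.mem_univ (-1))
      refine DirichletCharacter.LFunction_ne_zero_of_one_le_re ψ⁻¹ (s := 1 - (-1)) (Or.inl h2) ?_ h4
      simp
    · exact h0
  have heq : f =ᶠ[𝓝[≠] s] feFactor ψ := by
    filter_upwards [hne, mem_nhdsWithin_of_mem_nhds (hopen.mem_nhds hs)] with z hz hz1
    rw [hf]
    simp only [MulChar.star_eq_inv]
    rw [LFunction_eq_feFactor_mul h hk hz1, mul_div_cancel_right₀ _ hz]
  rw [Delta, toMeromorphicNFOn_eq_toMeromorphicNFAt hm (Set.mem_univ s)]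
  have h5 := (toMeromorphicNFAt_eventuallyEq_nhds_congr heq).self_of_nhds
  rw [h5, toMeromorphicNFAt_eq_self.mpr ha.meromorphicNFAt]

open MeasureTheory Set Filter Topology in
/-- Partial summation gives `L(s, ψ) = O(|s|)` to the right of the critical line. -/
lemma exists_norm_LFunction_le_right {k : ℕ} [NeZero k] {ψ : DirichletCharacter ℂ k} {B : ℝ}
    (h1 : ψ ≠ 1) (hB : ∀ M N : ℕ, ‖∑ n ∈ Finset.Ioc M N, ψ n‖ ≤ B) {s : ℂ} (hs : 1 / 2 ≤ s.re) :
    ‖DirichletCharacter.LFunction ψ s‖ ≤ ‖s‖ * (2 * B) := by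
  set S : ℝ → ℂ := fun t => ∑ n ∈ Finset.Icc 1 ⌊t⌋₊, ψ n with hS
  have hSB : ∀ t, ‖S t‖ ≤ B := fun t => by
    have : Finset.Icc 1 ⌊t⌋₊ = Finset.Ioc 0 ⌊t⌋₊ := by ext; simp; omega
    simp only [hS, this]
    exact hB 0 _
  have hB0 : 0 ≤ B := (norm_nonneg _).trans (hSB 0)
  have hmeas : Measurable S :=
    (measurable_from_nat (f := fun m : ℕ => ∑ n ∈ Finset.Icc 1 m, ψ n)).comp Nat.measurable_floor
  have hS0 : ∀ t, t < 1 → S t = 0 := by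
    intro t ht
    simp only [hS]
    rw [Nat.floor_eq_zero.mpr ht]
    simp
  set M : ℂ → ℂ := fun s => s * mellin S (-s) with hM
  have hloc : LocallyIntegrableOn S (Ioi 0) := by
    refine LocallyIntegrable.locallyIntegrableOn ?_ _
    refine (locallyIntegrable_const B).mono hmeas.aestronglyMeasurable ?_
    exact Eventually.of_forall fun t => by
      rw [Real.norm_of_nonneg hB0]; exact hSB t
  have hMd : DifferentiableOn ℂ M {z | 0 < z.re} := by
    intro z hz
    have hz : 0 < z.re := hz
    refine (DifferentiableAt.mul differentiableAt_id ?_).differentiableWithinAt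
    have : DifferentiableAt ℂ (mellin S) (-z) := by
      refine mellin_differentiableAt_of_isBigO_rpow (a := 0) (b := -z.re - 1) hloc ?_ ?_ ?_ ?_
      · simp only [neg_zero, Real.rpow_zero]
        exact Asymptotics.IsBigO.of_bound B (Eventually.of_forall fun t => by simpa using hSB t)
      · simpa using hz
      · refine Asymptotics.IsBigO.of_bound 1 ?_
        have : Iio (1 : ℝ) ∈ 𝓝[>] (0 : ℝ) := mem_nhdsWithin_of_mem_nhds (Iio_mem_nhds one_pos)
        filter_upwards [this] with t ht
        rw [hS0 t ht]
        simp
      · simp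
    exact this.comp z differentiableAt_id.neg
  have hmel : ∀ z : ℂ, mellin S (-z) = ∫ t in Ioi (1 : ℝ), S t * (t : ℂ) ^ (-(z + 1)) := by
    intro z
    rw [mellin, ← integral_indicator measurableSet_Ioi, ← integral_indicator measurableSet_Ioi]
    refine integral_congr_ae ?_
    have : ∀ᵐ t : ℝ, t ≠ 1 := by simp [ae_iff]
    filter_upwards [this] with t ht
    by_cases h3 : 1 < t
    · rw [indicator_of_mem (show t ∈ Ioi (0 : ℝ) from one_pos.trans h3),
        indicator_of_mem (show t ∈ Ioi (1 : ℝ) from h3), smul_eq_mul, mul_comm]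
      congr 2
      ring
    · rw [indicator_of_notMem (show t ∉ Ioi (1 : ℝ) from h3)]
      have h4 : t < 1 := lt_of_le_of_ne (not_lt.mp h3) ht
      by_cases h5 : 0 < t
      · rw [indicator_of_mem (show t ∈ Ioi (0 : ℝ) from h5), hS0 t h4, smul_zero]
      · rw [indicator_of_notMem (show t ∉ Ioi (0 : ℝ) from h5)]
  have hseries : ∀ z : ℂ, 1 < z.re → DirichletCharacter.LFunction ψ z = M z := by
    intro z hz
    rw [DirichletCharacter.LFunction_eq_LSeries ψ hz, hM]
    simp only
    rw [hmel]
    refine LSeries_eq_mul_integral _ le_rfl (by linarith)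
      (DirichletCharacter.LSeriesSummable_of_one_lt_re ψ hz) ?_
    simp only [Real.rpow_zero]
    refine Asymptotics.IsBigO.of_bound B (Eventually.of_forall fun n => ?_)
    have := hSB n
    simpa [hS] using this
  have hconv : IsPreconnected {z : ℂ | 0 < z.re} := (convex_halfSpace_re_gt 0).isPreconnected
  have hop : ∀ c : ℝ, IsOpen {z : ℂ | c < z.re} := fun c =>
    isOpen_lt continuous_const Complex.continuous_re
  have hL := DirichletCharacter.differentiable_LFunction h1
  have hEq := AnalyticOnNhd.eqOn_of_preconnected_of_eventuallyEq (z₀ := 2)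
    (fun z _ => hL.analyticAt z) (hMd.analyticOnNhd (hop 0)) hconv
    (by simp) (by
      have : {z : ℂ | 1 < z.re} ∈ 𝓝 (2 : ℂ) := (hop 1).mem_nhds (by simp)
      filter_upwards [this] with z hz using hseries z hz)
  have hs0 : 0 < s.re := by linarith
  rw [hEq (show s ∈ {z : ℂ | 0 < z.re} from hs0), hM]
  simp only
  rw [norm_mul, hmel]
  refine mul_le_mul_of_nonneg_left ?_ (norm_nonneg _)
  have hint : IntegrableOn (fun t : ℝ => B * t ^ (-(s.re + 1))) (Ioi 1) :=
    (integrableOn_Ioi_rpow_of_lt (by linarith) one_pos).const_mul B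
  refine (norm_integral_le_of_norm_le hint ?_).trans ?_
  · filter_upwards [ae_restrict_mem measurableSet_Ioi] with t ht
    have ht0 : 0 < t := one_pos.trans ht
    rw [norm_mul, Complex.norm_cpow_eq_rpow_re_of_pos ht0]
    simp only [Complex.neg_re, Complex.add_re, Complex.one_re]
    gcongr
    exact hSB t
  · rw [integral_const_mul, integral_Ioi_rpow_of_lt (by linarith) one_pos, Real.one_rpow]
    have : -1 / (-(s.re + 1) + 1) = 1 / s.re := by
      rw [show -(s.re + 1) + 1 = -s.re by ring, neg_div_neg_eq]
    rw [this, mul_comm]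
    gcongr
    rw [div_le_iff₀ hs0]
    linarith

/-- Primitive L-functions grow polynomially in vertical strips. -/
lemma exists_norm_LFunction_le {k : ℕ} [NeZero k] {ψ : DirichletCharacter ℂ k}
    (h : ψ.IsPrimitive) (hk : 1 < k) : ∃ A : ℝ, 0 < A ∧ ∀ z : ℂ, -(3 / 2) ≤ z.re → z.re ≤ 5 / 2 →
      ‖DirichletCharacter.LFunction ψ z‖ ≤ A * (1 + |z.im|) ^ 3 := by
  obtain ⟨C, hC0, hC⟩ := exists_norm_gammaQuot_le
  set B := √k * (1 + Real.log k) with hBdef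
  have hk1 : (1 : ℝ) ≤ k := by exact_mod_cast hk.le
  have hlog : 0 ≤ Real.log k := Real.log_nonneg hk1
  have hB0 : 0 < B := by positivity
  have h1 := ne_one_of_isPrimitive h hk.ne'
  have hr := fun s (hs : 1 / 2 ≤ s.re) =>
    exists_norm_LFunction_le_right h1 (polya_vinogradov h hk) (s := s) hs
  have hr' := fun s (hs : 1 / 2 ≤ s.re) => exists_norm_LFunction_le_right (inv_ne_one.mpr h1)
    (polya_vinogradov (isPrimitive_inv h) hk) (s := s) hs
  have hn : ∀ s : ℂ, -(5 / 2) ≤ s.re → s.re ≤ 5 / 2 → ‖s‖ ≤ 3 * (1 + |s.im|) := by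
    intro s h1 h2
    have h3 := Complex.norm_le_abs_re_add_abs_im s
    have : |s.re| ≤ 5 / 2 := abs_le.mpr ⟨h1, h2⟩
    have := abs_nonneg s.im
    linarith
  refine ⟨6 * B + (k : ℝ) ^ (2 : ℝ) * C * (6 * B), by positivity, fun z hz1 hz2 => ?_⟩
  set u := |z.im| with hu
  have hu0 : 0 ≤ u := abs_nonneg _
  have hu1 : 1 ≤ 1 + u := by linarith
  rcases le_or_gt (1 / 2) z.re with h4 | h4
  · calc _ ≤ ‖z‖ * (2 * B) := hr z h4
      _ ≤ 3 * (1 + u) * (2 * B) := by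
        gcongr; exact hn z (by linarith) hz2
      _ = 6 * B * (1 + u) ^ 1 := by ring
      _ ≤ 6 * B * (1 + u) ^ 3 := by gcongr; norm_num
      _ ≤ _ := by gcongr; linarith [show 0 ≤ (k : ℝ) ^ (2 : ℝ) * C * (6 * B) by positivity]
  · obtain ⟨e, he⟩ := norm_feFactor h z
    rw [LFunction_eq_feFactor_mul h hk.ne' (by linarith), norm_mul, he]
    have h5 := hC e z hz1 (by linarith) (Or.inl (by linarith))
    have h6 : ‖DirichletCharacter.LFunction ψ⁻¹ (1 - z)‖ ≤ 6 * B * (1 + u) := by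
      refine (hr' (1 - z) (by simp; linarith)).trans ?_
      have := hn (1 - z) (by simp; linarith) (by simp; linarith)
      have h7 : |(1 - z).im| = u := by simp [hu]
      rw [h7] at this
      nlinarith
    have h8 : (1 + u) ^ max 0 (1 / 2 - z.re) ≤ (1 + u) ^ 2 := by
      rw [← Real.rpow_natCast]
      refine Real.rpow_le_rpow_of_exponent_le hu1 ?_
      push_cast
      exact max_le (by norm_num) (by linarith)
    have h9 : (k : ℝ) ^ (1 / 2 - z.re) ≤ (k : ℝ) ^ (2 : ℝ) :=
      Real.rpow_le_rpow_of_exponent_le hk1 (by linarith)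
    calc _ ≤ (k : ℝ) ^ (2 : ℝ) * (C * (1 + u) ^ 2) * (6 * B * (1 + u)) := by
          gcongr
          exact h5.trans (by gcongr)
      _ = (k : ℝ) ^ (2 : ℝ) * C * (6 * B) * (1 + u) ^ 3 := by ring
      _ ≤ _ := by gcongr; linarith

/-! ### Smoothed Perron integrals -/

lemma integrable_exp_neg_abs :
    MeasureTheory.Integrable (fun v : ℝ => Real.exp (-|v|)) := by
  refine (integrable_inv_one_add_sq.const_mul 2).mono' (by fun_prop)
    (Filter.Eventually.of_forall fun v => ?_)
  rw [Real.norm_of_nonneg (Real.exp_pos _).le, Real.exp_neg, ← div_eq_mul_inv,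
    inv_le_comm₀ (Real.exp_pos _) (by positivity), inv_div]
  have := Real.quadratic_le_exp_of_nonneg (abs_nonneg v)
  rw [sq_abs] at this
  linarith [abs_nonneg v]

open MeasureTheory Filter Topology Complex in
/-- Cauchy's theorem for a vertical strip. -/
lemma integral_vertical_eq {f : ℂ → ℂ} {a b M : ℝ} (hab : a ≤ b)
    (hf : ∀ z : ℂ, a ≤ z.re → z.re ≤ b → DifferentiableAt ℂ f z)
    (hM : ∀ z : ℂ, a ≤ z.re → z.re ≤ b → ‖f z‖ ≤ M * Real.exp (-|z.im|)) :
    ∫ v : ℝ, f (a + v * I) = ∫ v : ℝ, f (b + v * I) := by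
  have hint : ∀ c, a ≤ c → c ≤ b → Integrable (fun v : ℝ => f (c + v * I)) := by
    intro c hc1 hc2
    have h1 : Integrable (fun v : ℝ => M * Real.exp (-|v|)) := integrable_exp_neg_abs.const_mul M
    refine h1.mono' ?_ (Eventually.of_forall fun v => ?_)
    · refine Continuous.aestronglyMeasurable (continuous_iff_continuousAt.mpr fun v => ?_)
      have := (hf (c + v * I) (by simpa using hc1) (by simpa using hc2)).continuousAt
      exact ContinuousAt.comp (f := fun v : ℝ => (c : ℂ) + v * I) this (by fun_prop)
    · have := hM (c + v * I) (by simpa using hc1) (by simpa using hc2)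
      simpa using this
  have lim : ∀ c, a ≤ c → c ≤ b → Tendsto (fun T : ℝ => ∫ v in (-T)..T, f (c + v * I)) atTop
      (𝓝 (∫ v : ℝ, f (c + v * I))) := fun c hc1 hc2 =>
    intervalIntegral_tendsto_integral (hint c hc1 hc2) tendsto_neg_atTop_atBot tendsto_id
  have hor : ∀ T : ℝ, ‖∫ x in a..b, f (x + (T : ℝ) * I)‖ ≤ M * Real.exp (-|T|) * |b - a| := by
    intro T
    refine intervalIntegral.norm_integral_le_of_norm_le_const fun x hx => ?_
    rw [Set.uIoc_of_le hab] at hx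
    have := hM (x + T * I) (by simpa using hx.1.le) (by simpa using hx.2)
    simpa using this
  have heq : ∀ T : ℝ, (∫ v in (-T)..T, f (b + v * I)) - ∫ v in (-T)..T, f (a + v * I) =
      I * ((∫ x in a..b, f (x + (-T : ℝ) * I)) - ∫ x in a..b, f (x + (T : ℝ) * I)) := by
    intro T
    have h := Complex.integral_boundary_rect_eq_zero_of_differentiableOn f (a + (-T : ℝ) * I)
      (b + T * I) (by
        intro z hz
        rw [Complex.mem_reProdIm] at hz
        have h1 := hz.1
        simp only [add_re, ofReal_re, mul_re, I_re, mul_zero, ofReal_im, I_im, mul_one, sub_self,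
          add_zero, Set.uIcc_of_le hab] at h1
        exact (hf z h1.1 h1.2).differentiableWithinAt)
    simp only [add_re, ofReal_re, mul_re, I_re, mul_zero, ofReal_im, I_im, mul_one, sub_self,
      add_zero, add_im, mul_im, zero_add, smul_eq_mul] at h
    have hI : I * I = -1 := I_mul_I
    linear_combination (-I) * h + ((∫ v in (-T)..T, f (b + v * I)) -
      ∫ v in (-T)..T, f (a + v * I)) * hI
  have l1 := (lim b hab le_rfl).sub (lim a le_rfl hab)
  have l2 : Tendsto (fun T : ℝ => (∫ v in (-T)..T, f (b + v * I)) -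
      ∫ v in (-T)..T, f (a + v * I)) atTop (𝓝 0) := by
    refine squeeze_zero_norm (a := fun T : ℝ => 2 * (M * |b - a|) * Real.exp (-|T|)) ?_ ?_
    · intro T
      rw [heq, norm_mul, norm_I, one_mul]
      refine (norm_sub_le _ _).trans ?_
      have h1 := hor T
      have h2 := hor (-T)
      rw [abs_neg] at h2
      linarith
    · have : Tendsto (fun T : ℝ => Real.exp (-|T|)) atTop (𝓝 0) :=
        Real.tendsto_exp_neg_atTop_nhds_zero.comp tendsto_abs_atTop_atTop
      simpa using this.const_mul (2 * (M * |b - a|))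
  have := tendsto_nhds_unique l1 l2
  exact (sub_eq_zero.mp this).symm

/-- The Gaussian Perron kernel `exp(w² + U w)`. -/
noncomputable def gaussKernel (U : ℝ) (w : ℂ) : ℂ := Complex.exp (w ^ 2 + U * w)

/-- The integral `(1 / 2πi) ∫ h(w) exp(w² + U w) dw / w` over the line `Re w = c`. -/
noncomputable def lineInt (U c : ℝ) (h : ℂ → ℂ) : ℂ :=
  (2 * Real.pi : ℂ)⁻¹ * ∫ v : ℝ, h (c + v * Complex.I) * gaussKernel U (c + v * Complex.I) /
    (c + v * Complex.I)

lemma norm_gaussKernel (U : ℝ) (w : ℂ) :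
    ‖gaussKernel U w‖ = Real.exp (w.re ^ 2 + U * w.re) * Real.exp (-w.im ^ 2) := by
  rw [gaussKernel, Complex.norm_exp, ← Real.exp_add]
  congr 1
  simp [sq]
  ring

lemma differentiable_gaussKernel (U : ℝ) : Differentiable ℂ (gaussKernel U) := by
  unfold gaussKernel
  fun_prop

lemma norm_mul_gaussKernel_le {U A : ℝ} {x : ℂ} {w : ℂ} (hA : ‖x‖ ≤ A * Real.exp |w.im|) :
    ‖x * gaussKernel U w‖ ≤
      A * Real.exp (w.re ^ 2 + U * w.re + 1) * Real.exp (-|w.im|) := by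
  have hA0 : 0 ≤ A := by
    have := (norm_nonneg _).trans hA
    exact nonneg_of_mul_nonneg_left this (Real.exp_pos _)
  rw [norm_mul, norm_gaussKernel]
  calc _ ≤ A * Real.exp |w.im| * (Real.exp (w.re ^ 2 + U * w.re) * Real.exp (-w.im ^ 2)) := by
        gcongr
    _ = A * (Real.exp |w.im| * Real.exp (w.re ^ 2 + U * w.re) * Real.exp (-w.im ^ 2)) := by ring
    _ ≤ A * (Real.exp (w.re ^ 2 + U * w.re + 1) * Real.exp (-|w.im|)) := by
        refine mul_le_mul_of_nonneg_left ?_ hA0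
        rw [← Real.exp_add, ← Real.exp_add, ← Real.exp_add]
        apply Real.exp_le_exp.mpr
        have := sq_abs w.im
        nlinarith [sq_nonneg (|w.im| - 1)]
    _ = _ := by ring

lemma exists_strip_bound {h : ℂ → ℂ} {a b A U : ℝ}
    (hA : ∀ w : ℂ, a ≤ w.re → w.re ≤ b → ‖h w‖ ≤ A * Real.exp |w.im|) :
    ∃ M, 0 ≤ M ∧ ∀ w : ℂ, a ≤ w.re → w.re ≤ b →
      ‖h w * gaussKernel U w‖ ≤ M * Real.exp (-|w.im|) := by
  obtain ⟨E, hE⟩ := (isCompact_Icc (a := a) (b := b)).exists_bound_of_continuousOn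
    (f := fun x : ℝ => Real.exp (x ^ 2 + U * x + 1)) (by fun_prop)
  refine ⟨|A| * |E|, by positivity, fun w h1 h2 => ?_⟩
  refine (norm_mul_gaussKernel_le (A := |A|) ?_).trans ?_
  · exact (hA w h1 h2).trans (by gcongr; exact le_abs_self A)
  · gcongr
    have := hE w.re ⟨h1, h2⟩
    rw [Real.norm_of_nonneg (Real.exp_pos _).le] at this
    exact this.trans (le_abs_self E)

open MeasureTheory in
lemma integrable_lineInt {h : ℂ → ℂ} {c A U : ℝ} (hc : c ≠ 0)
    (hd : ∀ w : ℂ, w.re = c → DifferentiableAt ℂ h w)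
    (hA : ∀ w : ℂ, w.re = c → ‖h w‖ ≤ A * Real.exp |w.im|) :
    Integrable (fun v : ℝ => h (c + v * Complex.I) * gaussKernel U (c + v * Complex.I) /
      (c + v * Complex.I)) := by
  obtain ⟨M, hM0, hM⟩ := exists_strip_bound (h := h) (a := c) (b := c) (A := A) (U := U)
    (fun w h1 h2 => hA w (le_antisymm h2 h1))
  have h1 : Integrable (fun v : ℝ => M * |c|⁻¹ * Real.exp (-|v|)) :=
    integrable_exp_neg_abs.const_mul _
  have hne : ∀ v : ℝ, (c : ℂ) + v * Complex.I ≠ 0 := fun v hv => by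
    have := congrArg Complex.re hv
    simp at this
    exact hc this
  refine h1.mono' ?_ (Filter.Eventually.of_forall fun v => ?_)
  · refine Continuous.aestronglyMeasurable (continuous_iff_continuousAt.mpr fun v => ?_)
    refine ContinuousAt.div (ContinuousAt.mul ?_ ?_) (by fun_prop) (hne v)
    · exact ContinuousAt.comp (f := fun v : ℝ => (c : ℂ) + v * Complex.I)
        (hd _ (by simp)).continuousAt (by fun_prop)
    · exact ContinuousAt.comp (f := fun v : ℝ => (c : ℂ) + v * Complex.I)
        (differentiable_gaussKernel U _).continuousAt (by fun_prop)
  · have h2 := hM (c + v * Complex.I) (by simp) (by simp)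
    have h3 : |c| ≤ ‖(c : ℂ) + v * Complex.I‖ := by
      simpa using Complex.abs_re_le_norm ((c : ℂ) + v * Complex.I)
    have h4 : 0 < |c| := abs_pos.mpr hc
    rw [norm_div, div_eq_mul_inv]
    simp only [Complex.add_im, Complex.ofReal_im, Complex.mul_im, Complex.ofReal_re, Complex.I_im,
      mul_one, Complex.I_re, mul_zero, add_zero, zero_add] at h2
    calc _ ≤ M * Real.exp (-|v|) * |c|⁻¹ := by gcongr
      _ = _ := by ring

/-- The line of integration may be moved as long as it does not cross the pole at `0`. -/
lemma lineInt_eq_of_same_side {h : ℂ → ℂ} {a b A U : ℝ} (hab : a ≤ b) (h0 : 0 < a ∨ b < 0)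
    (hd : ∀ w : ℂ, a ≤ w.re → w.re ≤ b → DifferentiableAt ℂ h w)
    (hA : ∀ w : ℂ, a ≤ w.re → w.re ≤ b → ‖h w‖ ≤ A * Real.exp |w.im|) :
    lineInt U a h = lineInt U b h := by
  obtain ⟨M, hM0, hM⟩ := exists_strip_bound (U := U) hA
  have hδ : ∃ δ : ℝ, 0 < δ ∧ ∀ w : ℂ, a ≤ w.re → w.re ≤ b → δ ≤ ‖w‖ := by
    rcases h0 with h0 | h0
    · exact ⟨a, h0, fun w h1 _ => h1.trans (Complex.re_le_norm w)⟩
    · refine ⟨-b, by linarith, fun w _ h2 => ?_⟩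
      have := Complex.abs_re_le_norm w
      have := neg_le_abs w.re
      linarith
  obtain ⟨δ, hδ0, hδ⟩ := hδ
  rw [lineInt, lineInt]
  congr 1
  refine integral_vertical_eq (f := fun w => h w * gaussKernel U w / w) (M := M * δ⁻¹) hab ?_ ?_
  · intro w h1 h2
    have hw : w ≠ 0 := norm_pos_iff.mp (hδ0.trans_le (hδ w h1 h2))
    exact ((hd w h1 h2).mul (differentiable_gaussKernel U w)).div differentiableAt_id hw
  · intro w h1 h2
    rw [norm_div, div_eq_mul_inv]
    have := hδ w h1 h2
    calc _ ≤ M * Real.exp (-|w.im|) * δ⁻¹ := by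
          gcongr
          exact hM w h1 h2
      _ = _ := by ring

open MeasureTheory Complex Set in
/-- The value `1/2` is half the residue of `exp(w²) / w`; it is computed by writing `1 / w` as
a Laplace integral and evaluating Gaussian integrals. -/
lemma lineInt_one_one : lineInt 0 1 (fun _ => 1) = 1 / 2 := by
  have key : ∀ u : ℝ, ∫ v : ℝ, cexp ((1 + v * I) ^ 2 - u * (1 + v * I)) =
      √Real.pi * cexp (-(1 / 4 : ℝ) * (u : ℂ) ^ 2) := by
    intro u
    have h1 : ∀ v : ℝ, cexp ((1 + v * I) ^ 2 - u * (1 + v * I)) =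
        cexp (-1 * (v : ℂ) ^ 2 + (2 - u) * I * v + (1 - u)) := by
      intro v
      congr 1
      ring_nf
      rw [I_sq]
      ring
    simp_rw [h1]
    rw [integral_cexp_quadratic (by simp)]
    congr 1
    · rw [neg_neg, div_one, Real.sqrt_eq_rpow, ofReal_cpow Real.pi_pos.le]
      norm_num
    · congr 1
      rw [mul_pow, I_sq]
      push_cast
      ring
  have e1 : ∀ v : ℝ, (1 : ℂ) * gaussKernel 0 ((1 : ℝ) + v * I) / ((1 : ℝ) + v * I) =
      ∫ u in Ioi (0 : ℝ), cexp ((1 + v * I) ^ 2 - u * (1 + v * I)) := by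
    intro v
    have h2 : ∀ u : ℝ, cexp ((1 + v * I) ^ 2 - u * (1 + v * I)) =
        cexp ((1 + v * I) ^ 2) * cexp (-(1 + v * I) * u) := by
      intro u
      rw [← Complex.exp_add]; congr 1; ring
    simp_rw [h2]
    rw [integral_const_mul, integral_exp_mul_complex_Ioi (by simp)]
    simp only [gaussKernel, ofReal_zero, zero_mul, add_zero, ofReal_one, mul_zero, Complex.exp_zero,
      one_mul]
    rw [neg_div_neg_eq, mul_one_div]
  have hint : Integrable (Function.uncurry fun (v u : ℝ) =>
      cexp ((1 + v * I) ^ 2 - u * (1 + v * I))) (volume.prod (volume.restrict (Ioi 0))) := by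
    have h1 : Integrable (fun v : ℝ => Real.exp 1 * Real.exp (-1 * v ^ 2)) :=
      (integrable_exp_neg_mul_sq one_pos).const_mul _
    have h2 : Integrable (fun u : ℝ => Real.exp (-u)) (volume.restrict (Ioi 0)) :=
      integrableOn_exp_neg_Ioi 0
    refine (h1.mul_prod h2).mono' ?_ (Filter.Eventually.of_forall fun p => ?_)
    · exact Continuous.aestronglyMeasurable (by unfold Function.uncurry; fun_prop)
    · simp only [Function.uncurry]
      rw [Complex.norm_exp, ← Real.exp_add, ← Real.exp_add]
      apply Real.exp_le_exp.mpr
      apply le_of_eq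
      simp [sq]
      ring
  rw [lineInt]
  simp_rw [e1]
  rw [integral_integral_swap hint]
  simp_rw [key]
  rw [integral_const_mul]
  have h3 : ∫ u in Ioi (0 : ℝ), cexp (-(1 / 4 : ℝ) * (u : ℂ) ^ 2) = (√Real.pi : ℂ) := by
    have := integral_gaussian_complex_Ioi (b := ((1 / 4 : ℝ) : ℂ)) (by simp)
    rw [this]
    have h4 : (Real.pi / ((1 / 4 : ℝ) : ℂ)) = ((Real.pi * 4 : ℝ) : ℂ) := by push_cast; ring
    have h5 : ((Real.pi * 4 : ℝ) : ℂ) ^ (1 / 2 : ℂ) = ((√(Real.pi * 4) : ℝ) : ℂ) := by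
      rw [Real.sqrt_eq_rpow, ofReal_cpow (by positivity)]
      norm_num
    rw [h4, h5, Real.sqrt_mul Real.pi_pos.le, show (4 : ℝ) = 2 ^ 2 by norm_num,
      Real.sqrt_sq (by norm_num)]
    push_cast
    ring
  rw [h3, ← ofReal_mul, Real.mul_self_sqrt Real.pi_pos.le]
  have : (Real.pi : ℂ) ≠ 0 := by exact_mod_cast Real.pi_ne_zero
  field_simp

lemma lineInt_zero_neg (c : ℝ) :
    lineInt 0 (-c) (fun _ => 1) = -lineInt 0 c (fun _ => 1) := by
  rw [lineInt, lineInt, ← mul_neg, ← MeasureTheory.integral_neg,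
    ← MeasureTheory.integral_neg_eq_self]
  congr 1
  refine MeasureTheory.integral_congr_ae (Filter.Eventually.of_forall fun v => ?_)
  have h1 : ((-c : ℝ) : ℂ) + (-v : ℝ) * Complex.I = -(c + v * Complex.I) := by push_cast; ring
  simp only [h1]
  simp only [gaussKernel, neg_sq, Complex.ofReal_zero, zero_mul, add_zero, div_neg]

lemma lineInt_zero_one {c : ℝ} (hc : 0 < c) : lineInt 0 c (fun _ => 1) = 1 / 2 := by
  have hA : ∀ w : ℂ, ‖(1 : ℂ)‖ ≤ 1 * Real.exp |w.im| := fun w => by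
    rw [norm_one, one_mul]; exact Real.one_le_exp (abs_nonneg _)
  rw [← lineInt_one_one]
  rcases le_total c 1 with h | h
  · exact lineInt_eq_of_same_side (A := 1) h (Or.inl hc) (fun _ _ _ => differentiableAt_const _)
      (fun w _ _ => hA w)
  · exact (lineInt_eq_of_same_side (A := 1) h (Or.inl one_pos)
      (fun _ _ _ => differentiableAt_const _) (fun w _ _ => hA w)).symm

open Topology in
/-- Moving the line of integration across the pole at `0` picks up the residue `h(0)`. -/
lemma lineInt_sub_lineInt {h : ℂ → ℂ} {c d A U : ℝ} (hc : 0 < c) (hd0 : 0 < d)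
    (hd : ∀ w : ℂ, -d ≤ w.re → w.re ≤ c → DifferentiableAt ℂ h w)
    (hA : ∀ w : ℂ, -d ≤ w.re → w.re ≤ c → ‖h w‖ ≤ A * Real.exp |w.im|) :
    lineInt U c h - lineInt U (-d) h = h 0 := by
  -- subtract a multiple of `exp(w²)` so that the integrand becomes regular at `0`; for the kernel
  -- `exp(w²)` itself the two integrals are `±h(0)/2`
  set f : ℂ → ℂ := fun w => h w * gaussKernel U w - h 0 * (1 * gaussKernel 0 w) with hf
  have hf0 : f 0 = 0 := by simp [hf, gaussKernel]
  have hfd : ∀ w : ℂ, -d ≤ w.re → w.re ≤ c → DifferentiableAt ℂ f w := fun w h1 h2 =>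
    ((hd w h1 h2).mul (differentiable_gaussKernel U w)).sub
      (((differentiableAt_const _).mul (differentiable_gaussKernel 0 w)).const_mul _)
  have hA1 : ∀ w : ℂ, ‖(1 : ℂ)‖ ≤ 1 * Real.exp |w.im| := fun w => by
    rw [norm_one, one_mul]; exact Real.one_le_exp (abs_nonneg _)
  obtain ⟨M₁, hM₁0, hM₁⟩ := exists_strip_bound (U := U) hA
  obtain ⟨M₂, hM₂0, hM₂⟩ := exists_strip_bound (h := fun _ => 1) (a := -d) (b := c) (A := 1)
    (U := 0) (fun w _ _ => hA1 w)
  set m : ℂ → ℂ := dslope f 0 with hm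
  have hmne : ∀ w : ℂ, w ≠ 0 → m w = f w / w := by
    intro w hw
    rw [hm, dslope_of_ne _ hw, slope_def_field, hf0, sub_zero, sub_zero]
  have hopen : IsOpen {w : ℂ | -d < w.re ∧ w.re < c} :=
    (isOpen_lt continuous_const Complex.continuous_re).inter
      (isOpen_lt Complex.continuous_re continuous_const)
  have hmd : ∀ w : ℂ, -d ≤ w.re → w.re ≤ c → DifferentiableAt ℂ m w := by
    intro w h1 h2
    rcases eq_or_ne w 0 with rfl | hw
    · have h0 : {w : ℂ | -d < w.re ∧ w.re < c} ∈ 𝓝 (0 : ℂ) :=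
        hopen.mem_nhds ⟨by simpa using hd0, by simpa using hc⟩
      have : DifferentiableOn ℂ m {w : ℂ | -d < w.re ∧ w.re < c} :=
        (Complex.differentiableOn_dslope h0).mpr
          fun w hw => (hfd w hw.1.le hw.2.le).differentiableWithinAt
      exact this.differentiableAt h0
    · exact (differentiableAt_dslope_of_ne hw).mpr (hfd w h1 h2)
  have hfb : ∀ w : ℂ, -d ≤ w.re → w.re ≤ c →
      ‖f w‖ ≤ (M₁ + ‖h 0‖ * M₂) * Real.exp (-|w.im|) := by
    intro w h1 h2
    refine (norm_sub_le _ _).trans ?_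
    rw [norm_mul (h 0)]
    have e1 := hM₁ w h1 h2
    have e2 := mul_le_mul_of_nonneg_left (hM₂ w h1 h2) (norm_nonneg (h 0))
    linarith
  set K : Set ℂ := Set.Icc (-d) c ×ℂ Set.Icc (-1) 1 with hK
  have hKc : IsCompact K := isCompact_Icc.reProdIm isCompact_Icc
  obtain ⟨M₃, hM₃⟩ := hKc.exists_bound_of_continuousOn (f := m) fun w hw =>
    (hmd w hw.1.1 hw.1.2).continuousAt.continuousWithinAt
  set M := (M₁ + ‖h 0‖ * M₂) + |M₃| * Real.exp 1 with hMdef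
  have hmb : ∀ w : ℂ, -d ≤ w.re → w.re ≤ c → ‖m w‖ ≤ M * Real.exp (-|w.im|) := by
    intro w h1 h2
    have hp := Real.exp_pos (-|w.im|)
    rcases le_total |w.im| 1 with h3 | h3
    · have e1 := hM₃ w ⟨⟨h1, h2⟩, abs_le.mp h3⟩
      have e2 : 1 ≤ Real.exp 1 * Real.exp (-|w.im|) := by
        rw [← Real.exp_add]; exact Real.one_le_exp (by linarith)
      calc ‖m w‖ ≤ |M₃| * 1 := by rw [mul_one]; exact e1.trans (le_abs_self _)
        _ ≤ |M₃| * (Real.exp 1 * Real.exp (-|w.im|)) := by gcongr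
        _ ≤ M * Real.exp (-|w.im|) := by
          rw [hMdef, ← mul_assoc]
          gcongr
          linarith [show 0 ≤ M₁ + ‖h 0‖ * M₂ by positivity]
    · have hw : 1 ≤ ‖w‖ := h3.trans (Complex.abs_im_le_norm w)
      have hw0 : w ≠ 0 := norm_pos_iff.mp (one_pos.trans_le hw)
      rw [hmne w hw0, norm_div]
      refine (div_le_self (norm_nonneg _) hw).trans ((hfb w h1 h2).trans ?_)
      gcongr
      rw [hMdef]
      linarith [show 0 ≤ |M₃| * Real.exp 1 by positivity]
  have hdc : -d ≤ c := by linarith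
  have key := integral_vertical_eq hdc hmd hmb
  have expand : ∀ x : ℝ, x ≠ 0 → -d ≤ x → x ≤ c →
      (2 * Real.pi : ℂ)⁻¹ * ∫ v : ℝ, m (x + v * Complex.I) =
        lineInt U x h - h 0 * lineInt 0 x (fun _ => 1) := by
    intro x hx h1 h2
    have hne : ∀ v : ℝ, (x : ℂ) + v * Complex.I ≠ 0 := fun v hv => by
      have := congrArg Complex.re hv
      simp at this
      exact hx this
    have i1 := integrable_lineInt (h := h) (A := A) (U := U) hx
      (fun w hw => hd w (by rw [hw]; exact h1) (by rw [hw]; exact h2))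
      (fun w hw => hA w (by rw [hw]; exact h1) (by rw [hw]; exact h2))
    have i2 := (integrable_lineInt (h := fun _ => 1) (A := 1) (U := 0) hx
      (fun w hw => differentiableAt_const _) (fun w hw => hA1 w)).const_mul (h 0)
    rw [lineInt, lineInt, mul_left_comm, ← mul_sub, ← MeasureTheory.integral_const_mul (h 0),
      ← MeasureTheory.integral_sub i1 i2]
    congr 1
    refine MeasureTheory.integral_congr_ae (Filter.Eventually.of_forall fun v => ?_)
    simp only
    rw [hmne _ (hne v), hf]
    simp only
    ring
  have e1 := expand c hc.ne' hdc le_rfl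
  have e2 := expand (-d) (by linarith) le_rfl hdc
  rw [lineInt_zero_one hc] at e1
  rw [lineInt_zero_neg, lineInt_zero_one hd0] at e2
  rw [key] at e2
  linear_combination e2 - e1

/-! ### The product of L-functions attached to `ψ` and `ψχ` -/

lemma card_divisorsAntidiagonal (n : ℕ) : n.divisorsAntidiagonal.card = n.divisors.card := by
  rw [← Nat.map_div_right_divisors, Finset.card_map]

lemma summable_tau :
    Summable (fun n : ℕ => (n.divisors.card : ℝ) * (n : ℝ) ^ (-(11 / 10) : ℝ)) := by
  have h1 : LSeriesSummable 1 ((11 / 10 : ℝ) : ℂ) :=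
    LSeriesSummable_one_iff.mpr (by rw [Complex.ofReal_re]; norm_num)
  have h := (h1.convolution h1).norm
  refine h.congr fun n => ?_
  rw [LSeries.norm_term_eq]
  split_ifs with h0
  · simp [h0]
  · rw [LSeries.convolution_def]
    have : (n : ℝ) ^ (-(11 / 10) : ℝ) = ((n : ℝ) ^ (11 / 10 : ℝ))⁻¹ :=
      Real.rpow_neg (by positivity) _
    rw [this, Complex.ofReal_re, ← div_eq_mul_inv, ← card_divisorsAntidiagonal]
    simp

/-- The constant `∑ d(n) n^(-11/10)`, where `d` is the number of divisors. -/
noncomputable def tauConst : ℝ := ∑' n : ℕ, (n.divisors.card : ℝ) * (n : ℝ) ^ (-(11 / 10) : ℝ)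

lemma sum_tau_le (s : Finset ℕ) :
    ∑ n ∈ s, (n.divisors.card : ℝ) * (n : ℝ) ^ (-(11 / 10) : ℝ) ≤ tauConst :=
  summable_tau.sum_le_tsum s fun n _ => by positivity

lemma tauConst_pos : 0 < tauConst :=
  summable_tau.tsum_pos (fun n => by positivity) 1 (by simp)

lemma norm_nu_le {D : ℕ} (χ : DirichletCharacter ℂ D) (n : ℕ) : ‖nu χ n‖ ≤ n.divisors.card := by
  rw [nu]
  refine (norm_sum_le _ _).trans ?_
  calc _ ≤ ∑ p ∈ n.divisorsAntidiagonal, (1 : ℝ) :=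
        Finset.sum_le_sum fun p _ => DirichletCharacter.norm_le_one χ _
    _ = _ := by simp [← card_divisorsAntidiagonal]

lemma norm_nu_mul_le {D q : ℕ} (χ : DirichletCharacter ℂ D) (ψ : DirichletCharacter ℂ q) (n : ℕ) :
    ‖nu χ n * ψ n‖ ≤ n.divisors.card := by
  rw [norm_mul]
  exact (mul_le_of_le_one_right (norm_nonneg _) (DirichletCharacter.norm_le_one ψ _)).trans
    (norm_nu_le χ n)

lemma nu_zero {D : ℕ} (χ : DirichletCharacter ℂ D) : nu χ 0 = 0 := by simp [nu]

/-- On natural numbers the product character, of modulus the least common multiple, takes the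
product of the values. -/
lemma dirichletMul_apply {D q : ℕ} (χ : DirichletCharacter ℂ D) (ψ : DirichletCharacter ℂ q)
    [NeZero D] [NeZero q] (n : ℕ) : (ψ.mul χ) n = ψ n * χ n := by
  by_cases h : n.Coprime (q.lcm D)
  · have hu : IsUnit (n : ZMod (q.lcm D)) := (ZMod.isUnit_iff_coprime n _).mpr h
    have e1 := DirichletCharacter.changeLevel_eq_cast_of_dvd ψ (Nat.dvd_lcm_left q D) hu.unit
    have e2 := DirichletCharacter.changeLevel_eq_cast_of_dvd χ (Nat.dvd_lcm_right q D) hu.unit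
    rw [hu.unit_spec] at e1 e2
    rw [DirichletCharacter.mul, MulChar.mul_apply, e1, e2,
      ZMod.cast_natCast (Nat.dvd_lcm_left q D), ZMod.cast_natCast (Nat.dvd_lcm_right q D)]
  · have h1 : (ψ.mul χ) n = 0 :=
      MulChar.map_nonunit _ fun hu => h ((ZMod.isUnit_iff_coprime n _).mp hu)
    rw [h1]
    by_cases h2 : n.Coprime q
    · have h3 : ¬ n.Coprime D := fun h3 => h
        ((Nat.Coprime.mul_right h2 h3).coprime_dvd_right (Nat.lcm_dvd_mul q D))
      have : χ n = 0 := MulChar.map_nonunit _ fun hu => h3 ((ZMod.isUnit_iff_coprime n _).mp hu)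
      rw [this, mul_zero]
    · have : ψ n = 0 := MulChar.map_nonunit _ fun hu => h2 ((ZMod.isUnit_iff_coprime n _).mp hu)
      rw [this, zero_mul]

lemma dirichletMul_inv_apply {D q : ℕ} {χ : DirichletCharacter ℂ D} (hχ : χ.IsQuadratic)
    (ψ : DirichletCharacter ℂ q) [NeZero D] [NeZero q] (n : ℕ) :
    (ψ.mul χ)⁻¹ n = ψ⁻¹ n * χ n := by
  rw [star_mulChar_apply, dirichletMul_apply, map_mul, ← star_mulChar_apply, ← star_mulChar_apply]
  rw [MulChar.IsQuadratic.inv hχ]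

open LSeries.notation in
/-- The coefficients of `L(z, ψ) L(z, ψχ)` are `ν ψ`. -/
lemma hasSum_nu_mul {D q m : ℕ} [NeZero q] [NeZero m] (χ : DirichletCharacter ℂ D)
    (ψ : DirichletCharacter ℂ q) (θ : DirichletCharacter ℂ m) (hθ : ∀ n : ℕ, θ n = ψ n * χ n)
    {z : ℂ} (hz : 1 < z.re) :
    HasSum (fun n : ℕ => nu χ n * ψ n / (n : ℂ) ^ z)
      (DirichletCharacter.LFunction ψ z * DirichletCharacter.LFunction θ z) := by
  have h1 := DirichletCharacter.LSeriesSummable_of_one_lt_re ψ hz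
  have h2 := DirichletCharacter.LSeriesSummable_of_one_lt_re θ hz
  have h := h1.LSeriesHasSum.convolution h2.LSeriesHasSum
  rw [← DirichletCharacter.LFunction_eq_LSeries ψ hz,
    ← DirichletCharacter.LFunction_eq_LSeries θ hz] at h
  refine h.congr_fun fun n => ?_
  rcases eq_or_ne n 0 with rfl | h0
  · simp [nu_zero]
  · rw [LSeries.term_of_ne_zero h0, LSeries.convolution_def, nu, Finset.sum_mul]
    congr 1
    refine Finset.sum_congr rfl fun p hp => ?_
    have := (Nat.mem_divisorsAntidiagonal.mp hp).1
    rw [hθ, ← this]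
    push_cast
    rw [map_mul]
    ring

/-- The function `Δ₁` is given by the factors of the functional equation and satisfies
`L(z, ψ) L(z, ψχ) = Δ₁(z) L(1 - z, ψ̄) L(1 - z, ψ̄χ)`. -/
lemma Lprod_eq {D q : ℕ} [NeZero D] [NeZero q] {χ : DirichletCharacter ℂ D}
    {ψ : DirichletCharacter ℂ q} (hψ : ψ.IsPrimitive) (hψχ : (ψ.mul χ).IsPrimitive) (hq : 1 < q)
    {z : ℂ} (hz : z.re < 1) :
    DirichletCharacter.LFunction ψ z * DirichletCharacter.LFunction (ψ.mul χ) z =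
      Delta1 χ z ψ * (DirichletCharacter.LFunction ψ⁻¹ (1 - z) *
        DirichletCharacter.LFunction (ψ.mul χ)⁻¹ (1 - z)) := by
  have hm : q.lcm D ≠ 1 := fun h => by
    have := Nat.dvd_lcm_left q D
    rw [h, Nat.dvd_one] at this
    omega
  rw [Delta1, Delta_eq_feFactor hψ hq.ne' hz, Delta_eq_feFactor hψχ hm hz,
    LFunction_eq_feFactor_mul hψ hq.ne' hz, LFunction_eq_feFactor_mul hψχ hm hz]
  ring

lemma differentiableAt_Delta1 {D q : ℕ} [NeZero D] [NeZero q] {χ : DirichletCharacter ℂ D}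
    {ψ : DirichletCharacter ℂ q} (hψ : ψ.IsPrimitive) (hψχ : (ψ.mul χ).IsPrimitive) (hq : 1 < q)
    {z : ℂ} (hz : z.re < 1) : DifferentiableAt ℂ (fun z => Delta1 χ z ψ) z := by
  have hm : q.lcm D ≠ 1 := fun h => by
    have := Nat.dvd_lcm_left q D
    rw [h, Nat.dvd_one] at this
    omega
  have hopen : IsOpen {z : ℂ | z.re < 1} := isOpen_lt Complex.continuous_re continuous_const
  have : (fun z => Delta1 χ z ψ) =ᶠ[nhds z] fun z => feFactor ψ z * feFactor (ψ.mul χ) z := by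
    filter_upwards [hopen.mem_nhds hz] with w hw
    rw [Delta1, Delta_eq_feFactor hψ hq.ne' hw, Delta_eq_feFactor hψχ hm hw]
  exact ((differentiableAt_feFactor ψ hz).mul
    (differentiableAt_feFactor _ hz)).congr_of_eventuallyEq this

/-- Size of `Δ₁`: on the left of the critical line the conductor has size about `q² D (1 + |t|)²`;
on the right only the saving in `q` is kept. -/
lemma exists_norm_Delta1_le : ∃ C : ℝ, 0 < C ∧ ∀ (D q : ℕ) [NeZero D] [NeZero q]
    (χ : DirichletCharacter ℂ D) (ψ : DirichletCharacter ℂ q) (H : ℝ), ψ.IsPrimitive →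
    (ψ.mul χ).IsPrimitive → 1 < q → Real.exp H ≤ q → q ≤ 2 * Real.exp H → ∀ z : ℂ,
    -(3 / 2) ≤ z.re → z.re < 1 → (z.re ≤ 19 / 20 ∨ 1 ≤ |z.im|) →
    ‖Delta1 χ z ψ‖ ≤ C * Real.exp (H * (1 - 2 * z.re)) *
      (4 * D * (1 + |z.im|) ^ 2) ^ max 0 (1 / 2 - z.re) := by
  obtain ⟨C, hC0, hC⟩ := exists_norm_gammaQuot_le
  refine ⟨C ^ 2, by positivity, ?_⟩
  intro D q _ _ χ ψ H hψ hψχ hq hq1 hq2 z hz1 hz2 hz3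
  have hm : q.lcm D ≠ 1 := fun h => by
    have := Nat.dvd_lcm_left q D
    rw [h, Nat.dvd_one] at this
    omega
  have hD0 : (1 : ℝ) ≤ D := by exact_mod_cast Nat.one_le_iff_ne_zero.mpr (NeZero.ne D)
  have hq0 : (0 : ℝ) < q := by exact_mod_cast (by omega : 0 < q)
  have hl1 : (q : ℝ) ≤ (q.lcm D : ℕ) := by
    exact_mod_cast Nat.le_of_dvd (Nat.pos_of_ne_zero (NeZero.ne _)) (Nat.dvd_lcm_left q D)
  have hl2 : ((q.lcm D : ℕ) : ℝ) ≤ q * D := by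
    exact_mod_cast Nat.le_of_dvd (Nat.mul_pos (by omega) (Nat.pos_of_ne_zero (NeZero.ne D)))
      (Nat.lcm_dvd_mul q D)
  -- the conductors `q` and `[q, D]` satisfy `q ≤ [q, D] ≤ qD`
  obtain ⟨e₁, he₁⟩ := norm_feFactor hψ z
  obtain ⟨e₂, he₂⟩ := norm_feFactor hψχ z
  rw [Delta1, Delta_eq_feFactor hψ hq.ne' hz2, Delta_eq_feFactor hψχ hm hz2, norm_mul, he₁, he₂]
  set u := 1 + |z.im| with hu
  have hu0 : 0 < u := by positivity
  set μ := max 0 (1 / 2 - z.re) with hμ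
  have g1 := hC e₁ z hz1 hz2 hz3
  have g2 := hC e₂ z hz1 hz2 hz3
  have key : (q : ℝ) ^ (1 / 2 - z.re) * ((q.lcm D : ℕ) : ℝ) ^ (1 / 2 - z.re) ≤
      Real.exp (H * (1 - 2 * z.re)) * (4 * D) ^ μ := by
    have hexp : Real.exp (H * (1 - 2 * z.re)) =
        Real.exp H ^ (1 / 2 - z.re) * Real.exp H ^ (1 / 2 - z.re) := by
      rw [← Real.rpow_add (Real.exp_pos _), ← Real.exp_mul]
      congr 1
      ring
    have hE := Real.exp_pos H
    rcases le_total z.re (1 / 2) with h | h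
    · have h' : 0 ≤ 1 / 2 - z.re := by linarith
      rw [hμ, max_eq_right h', hexp, ← Real.mul_rpow hq0.le (by positivity),
        ← Real.mul_rpow hE.le hE.le, ← Real.mul_rpow (by positivity) (by positivity)]
      refine Real.rpow_le_rpow (by positivity) ?_ h'
      calc (q : ℝ) * ((q.lcm D : ℕ) : ℝ) ≤ q * (q * D) := by gcongr
        _ ≤ (2 * Real.exp H) * ((2 * Real.exp H) * D) := by gcongr
        _ = _ := by ring
    · have h' : 1 / 2 - z.re ≤ 0 := by linarith
      rw [hμ, max_eq_left h', Real.rpow_zero, mul_one, hexp]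
      gcongr 1
      · exact Real.rpow_le_rpow_of_nonpos hE hq1 h'
      · exact Real.rpow_le_rpow_of_nonpos hE (hq1.trans hl1) h'
  have hmul : (4 * (D : ℝ) * u ^ 2) ^ μ = (4 * (D : ℝ)) ^ μ * (u ^ μ * u ^ μ) := by
    rw [Real.mul_rpow (by positivity) (by positivity), sq, Real.mul_rpow hu0.le hu0.le]
  rw [hmul]
  calc _ ≤ (q : ℝ) ^ (1 / 2 - z.re) * (C * u ^ μ) *
        (((q.lcm D : ℕ) : ℝ) ^ (1 / 2 - z.re) * (C * u ^ μ)) := by gcongr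
    _ = (q : ℝ) ^ (1 / 2 - z.re) * ((q.lcm D : ℕ) : ℝ) ^ (1 / 2 - z.re) *
        (C ^ 2 * (u ^ μ * u ^ μ)) := by ring
    _ ≤ Real.exp (H * (1 - 2 * z.re)) * (4 * D) ^ μ * (C ^ 2 * (u ^ μ * u ^ μ)) := by gcongr
    _ = _ := by ring

lemma one_add_pow_le_exp {u : ℝ} (hu : 0 ≤ u) (n : ℕ) :
    (1 + u) ^ n ≤ n.factorial * Real.exp 1 * Real.exp u := by
  have := Real.pow_div_factorial_le_exp (1 + u) (by linarith) n
  rw [div_le_iff₀ (by positivity), Real.exp_add] at this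
  linarith

/-- Growth in vertical strips, in the form needed for moving lines of integration. -/
lemma exists_norm_Lprod_le {D q : ℕ} [NeZero D] [NeZero q] {χ : DirichletCharacter ℂ D}
    {ψ : DirichletCharacter ℂ q} (hψ : ψ.IsPrimitive) (hψχ : (ψ.mul χ).IsPrimitive) (hq : 1 < q) :
    ∃ A : ℝ, ∀ z : ℂ, -(3 / 2) ≤ z.re → z.re ≤ 5 / 2 →
      ‖DirichletCharacter.LFunction ψ z * DirichletCharacter.LFunction (ψ.mul χ) z‖ ≤
        A * Real.exp |z.im| := by
  have hm : 1 < q.lcm D := by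
    have := Nat.le_of_dvd (Nat.pos_of_ne_zero (NeZero.ne (q.lcm D))) (Nat.dvd_lcm_left q D)
    omega
  obtain ⟨A₁, hA₁0, hA₁⟩ := exists_norm_LFunction_le hψ hq
  obtain ⟨A₂, hA₂0, hA₂⟩ := exists_norm_LFunction_le hψχ hm
  refine ⟨A₁ * A₂ * ((6 : ℕ).factorial * Real.exp 1), fun z h1 h2 => ?_⟩
  have hu := abs_nonneg z.im
  rw [norm_mul]
  calc _ ≤ A₁ * (1 + |z.im|) ^ 3 * (A₂ * (1 + |z.im|) ^ 3) := by
        gcongr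
        · exact hA₁ z h1 h2
        · exact hA₂ z h1 h2
    _ = A₁ * A₂ * (1 + |z.im|) ^ 6 := by ring
    _ ≤ A₁ * A₂ * ((6 : ℕ).factorial * Real.exp 1 * Real.exp |z.im|) := by
        gcongr
        exact one_add_pow_le_exp hu 6
    _ = _ := by ring

/-! ### Bounds for the Perron integrals -/

open MeasureTheory

lemma integrable_pow_mul_gauss : Integrable (fun v : ℝ => (1 + |v|) ^ 4 * Real.exp (-v ^ 2)) := by
  refine (integrable_exp_neg_abs.const_mul (24 * Real.exp 1 * Real.exp 1)).mono' (by fun_prop)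
    (Filter.Eventually.of_forall fun v => ?_)
  rw [Real.norm_of_nonneg (by positivity)]
  have h1 := one_add_pow_le_exp (abs_nonneg v) 4
  have h2 : Real.exp |v| * Real.exp (-v ^ 2) ≤ Real.exp 1 * Real.exp (-|v|) := by
    rw [← Real.exp_add, ← Real.exp_add]
    apply Real.exp_le_exp.mpr
    have := sq_abs v
    nlinarith [sq_nonneg (|v| - 1)]
  have h3 : ((4 : ℕ).factorial : ℝ) = 24 := by norm_num [Nat.factorial]
  rw [h3] at h1
  calc _ ≤ 24 * Real.exp 1 * Real.exp |v| * Real.exp (-v ^ 2) := by gcongr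
    _ = 24 * Real.exp 1 * (Real.exp |v| * Real.exp (-v ^ 2)) := by ring
    _ ≤ 24 * Real.exp 1 * (Real.exp 1 * Real.exp (-|v|)) := by gcongr
    _ = _ := by ring

/-- The constant `∫ (1 + |v|)⁴ exp(-v²) dv`. -/
noncomputable def gaussMoment : ℝ := ∫ v : ℝ, (1 + |v|) ^ 4 * Real.exp (-v ^ 2)

lemma gaussMoment_nonneg : 0 ≤ gaussMoment := integral_nonneg fun v => by positivity

lemma norm_two_pi_inv_le : ‖(2 * Real.pi : ℂ)⁻¹‖ ≤ 1 := by
  rw [norm_inv, norm_mul, Complex.norm_real, Real.norm_of_nonneg Real.pi_pos.le]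
  refine inv_le_one_of_one_le₀ ?_
  simp only [Complex.norm_ofNat]
  linarith [Real.pi_gt_three]

/-- A line at distance `|c|` from the pole, estimated by the absolute value. -/
lemma norm_lineInt_le {h : ℂ → ℂ} {U c B : ℝ} (hc : c ≠ 0)
    (hB : ∀ v : ℝ, ‖h (c + v * Complex.I)‖ ≤ B * (1 + |v|) ^ 4) :
    ‖lineInt U c h‖ ≤ gaussMoment * (B * Real.exp (c ^ 2 + U * c) / |c|) := by
  rw [lineInt, norm_mul]
  refine (mul_le_of_le_one_left (norm_nonneg _) norm_two_pi_inv_le).trans ?_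
  rw [mul_comm gaussMoment, gaussMoment, ← integral_const_mul]
  refine norm_integral_le_of_norm_le (integrable_pow_mul_gauss.const_mul _)
    (Filter.Eventually.of_forall fun v => ?_)
  have h3 : |c| ≤ ‖(c : ℂ) + v * Complex.I‖ := by
    simpa using Complex.abs_re_le_norm ((c : ℂ) + v * Complex.I)
  have h4 : 0 < |c| := abs_pos.mpr hc
  rw [norm_div, norm_mul, norm_gaussKernel]
  simp only [Complex.add_re, Complex.ofReal_re, Complex.mul_re, Complex.I_re, mul_zero,
    Complex.ofReal_im, Complex.I_im, mul_one, sub_self, add_zero, Complex.add_im, Complex.mul_im,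
    zero_add]
  calc _ ≤ B * (1 + |v|) ^ 4 * (Real.exp (c ^ 2 + U * c) * Real.exp (-v ^ 2)) / |c| := by
        gcongr
        · exact mul_nonneg ((norm_nonneg _).trans (hB v)) (by positivity)
        · exact hB v
    _ = _ := by ring

/-- The integral of `1 / |c + iv|` over `|v| ≤ 1` is logarithmic in `c`. -/
lemma integral_inv_sqrt_le {c : ℝ} (hc : 0 < c) (hc1 : c ≤ 1) :
    ∫ v in (-1 : ℝ)..1, (√(c ^ 2 + v ^ 2))⁻¹ ≤ 4 + 2 * Real.log c⁻¹ := by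
  have hd : ∀ v ∈ Set.uIcc (-1 : ℝ) 1,
      HasDerivAt (fun v => Real.arsinh (v / c)) (√(c ^ 2 + v ^ 2))⁻¹ v := by
    intro v _
    have h1 := (Real.hasDerivAt_arsinh (v / c)).comp v ((hasDerivAt_id v).div_const c)
    refine h1.congr_deriv ?_
    have h2 : √(c ^ 2 + v ^ 2) = c * √(1 + (v / c) ^ 2) := by
      rw [← Real.sqrt_sq hc.le, ← Real.sqrt_mul (by positivity), Real.sqrt_sq hc.le]
      congr 1
      field_simp
    rw [h2, mul_inv]
    ring
  have hpos : ∀ v : ℝ, √(c ^ 2 + v ^ 2) ≠ 0 := fun v => by positivity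
  rw [intervalIntegral.integral_eq_sub_of_hasDerivAt hd]
  · rw [neg_div, Real.arsinh_neg, sub_neg_eq_add, Real.arsinh]
    have h1 : √(1 + (1 / c) ^ 2) ≤ 2 * c⁻¹ := by
      rw [Real.sqrt_le_left (by positivity)]
      have : 1 ≤ c⁻¹ := (one_le_inv₀ hc).mpr hc1
      rw [one_div]
      nlinarith
    have h2 : Real.log (1 / c + √(1 + (1 / c) ^ 2)) ≤ 2 + Real.log c⁻¹ := by
      calc _ ≤ Real.log (3 * c⁻¹) := by
            apply Real.log_le_log (by positivity)
            rw [one_div] at h1 ⊢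
            linarith
        _ = Real.log 3 + Real.log c⁻¹ := Real.log_mul (by norm_num) (by positivity)
        _ ≤ _ := by
          have : Real.log 3 ≤ 3 - 1 := Real.log_le_sub_one_of_pos (by norm_num)
          linarith
    linarith
  · exact (ContinuousOn.inv₀ (by fun_prop) fun v _ => hpos v).intervalIntegrable

open Set in
/-- A line close to the pole costs only a logarithm. -/
lemma norm_lineInt_near_le {h : ℂ → ℂ} {U c B : ℝ} (hc : c ≠ 0) (hc1 : |c| ≤ 1)
    (hB : ∀ v : ℝ, ‖h (c + v * Complex.I)‖ ≤ B * (1 + |v|) ^ 2) :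
    ‖lineInt U c h‖ ≤
      B * Real.exp (c ^ 2 + U * c) * (16 + 8 * Real.log |c|⁻¹ + gaussMoment) := by
  have h4 : 0 < |c| := abs_pos.mpr hc
  have hB0 : 0 ≤ B := by
    have := (norm_nonneg _).trans (hB 0)
    simpa using this
  rw [lineInt, norm_mul]
  refine (mul_le_of_le_one_left (norm_nonneg _) norm_two_pi_inv_le).trans ?_
  set g : ℝ → ℝ := fun v => (Ioc (-1) 1).indicator (fun v => 4 * (√(|c| ^ 2 + v ^ 2))⁻¹) v with hg
  have hgint : IntegrableOn (fun v : ℝ => 4 * (√(|c| ^ 2 + v ^ 2))⁻¹) (Ioc (-1) 1) := by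
    refine (ContinuousOn.integrableOn_Icc (a := -1) (b := 1) ?_).mono_set Ioc_subset_Icc_self
    exact continuousOn_const.mul (ContinuousOn.inv₀ (by fun_prop) fun v _ => by positivity)
  have hgI : Integrable g := hgint.integrable_indicator measurableSet_Ioc
  have hint := hgI.add integrable_pow_mul_gauss
  have hval : ∫ v, (g v + (1 + |v|) ^ 4 * Real.exp (-v ^ 2)) ≤
      16 + 8 * Real.log |c|⁻¹ + gaussMoment := by
    rw [integral_add hgI integrable_pow_mul_gauss, hg, integral_indicator measurableSet_Ioc,
      ← intervalIntegral.integral_of_le (by norm_num), intervalIntegral.integral_const_mul]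
    have := integral_inv_sqrt_le h4 hc1
    rw [gaussMoment]
    linarith
  refine le_trans ?_ (mul_le_mul_of_nonneg_left hval (by positivity :
    0 ≤ B * Real.exp (c ^ 2 + U * c)))
  rw [← integral_const_mul]
  refine norm_integral_le_of_norm_le (hint.const_mul _) (Filter.Eventually.of_forall fun v => ?_)
  have hnorm : ‖(c : ℂ) + v * Complex.I‖ = √(|c| ^ 2 + v ^ 2) := by
    rw [Complex.norm_def, Complex.normSq_add_mul_I, sq_abs]
  rw [norm_div, norm_mul, norm_gaussKernel, hnorm]
  simp only [Complex.add_re, Complex.ofReal_re, Complex.mul_re, Complex.I_re, mul_zero,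
    Complex.ofReal_im, Complex.I_im, mul_one, sub_self, add_zero, Complex.add_im, Complex.mul_im,
    zero_add]
  have hs : 0 < √(|c| ^ 2 + v ^ 2) := by positivity
  have hE := Real.exp_pos (-v ^ 2)
  have key : (1 + |v|) ^ 2 * Real.exp (-v ^ 2) / √(|c| ^ 2 + v ^ 2) ≤
      g v + (1 + |v|) ^ 4 * Real.exp (-v ^ 2) := by
    have hv := abs_nonneg v
    by_cases h1 : v ∈ Ioc (-1 : ℝ) 1
    · rw [hg]
      simp only [indicator_of_mem h1]
      have h2 : |v| ≤ 1 := abs_le.mpr ⟨h1.1.le, h1.2⟩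
      have h3 : Real.exp (-v ^ 2) ≤ 1 := Real.exp_le_one_iff.mpr (by nlinarith [sq_nonneg v])
      have h5 : (1 + |v|) ^ 2 ≤ 4 := by nlinarith
      have : (1 + |v|) ^ 2 * Real.exp (-v ^ 2) / √(|c| ^ 2 + v ^ 2) ≤
          4 * (√(|c| ^ 2 + v ^ 2))⁻¹ := by
        rw [div_eq_mul_inv]
        gcongr
        nlinarith
      have : 0 ≤ (1 + |v|) ^ 4 * Real.exp (-v ^ 2) := by positivity
      linarith
    · rw [hg]
      simp only [indicator_of_notMem h1, zero_add]
      have h2 : 1 ≤ |v| := by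
        by_contra h2
        rw [not_le, abs_lt] at h2
        exact h1 ⟨h2.1, h2.2.le⟩
      have h3 : 1 ≤ √(|c| ^ 2 + v ^ 2) := by
        rw [Real.one_le_sqrt]
        have := sq_abs v
        nlinarith [sq_nonneg |c|]
      refine (div_le_self (by positivity) h3).trans ?_
      gcongr 1
      exact pow_le_pow_right₀ (by linarith) (by norm_num)
  calc _ ≤ B * (1 + |v|) ^ 2 * (Real.exp (c ^ 2 + U * c) * Real.exp (-v ^ 2)) /
        √(|c| ^ 2 + v ^ 2) := by
        gcongr
        exact hB v
    _ = B * Real.exp (c ^ 2 + U * c) *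
        ((1 + |v|) ^ 2 * Real.exp (-v ^ 2) / √(|c| ^ 2 + v ^ 2)) := by ring
    _ ≤ _ := by
      refine mul_le_mul_of_nonneg_left key (by positivity)

/-- The smooth cut-off weight of `n` produced by the kernel `exp(w² + U w)`: close to `1` for
`n` much smaller than `exp U`, and close to `0` for `n` much larger. -/
noncomputable def perronWeight (U : ℝ) (n : ℕ) : ℂ := lineInt (U - Real.log n) 1 (fun _ => 1)

lemma norm_lineInt_one_le {y c : ℝ} (hc : 1 ≤ |c|) :
    ‖lineInt y c (fun _ => 1)‖ ≤ gaussMoment * Real.exp (c ^ 2 + y * c) := by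
  have h0 : c ≠ 0 := by rintro rfl; norm_num at hc
  have := norm_lineInt_le (h := fun _ => 1) (U := y) (B := 1) h0 fun v => by
    rw [norm_one, one_mul]
    exact one_le_pow₀ (by linarith [abs_nonneg v])
  refine this.trans (mul_le_mul_of_nonneg_left ?_ gaussMoment_nonneg)
  rw [one_mul]
  exact div_le_self (Real.exp_pos _).le hc

lemma norm_perronWeight_le {U c : ℝ} (hc : 1 ≤ c) (n : ℕ) :
    ‖perronWeight U n‖ ≤ gaussMoment * Real.exp (c ^ 2 + (U - Real.log n) * c) := by
  have h1 : perronWeight U n = lineInt (U - Real.log n) c (fun _ => 1) := by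
    refine lineInt_eq_of_same_side (A := 1) hc (Or.inl one_pos)
      (fun _ _ _ => differentiableAt_const _) (fun w _ _ => ?_)
    rw [norm_one, one_mul]
    exact Real.one_le_exp (abs_nonneg _)
  rw [h1]
  exact norm_lineInt_one_le (hc.trans (le_abs_self c))

lemma norm_perronWeight_sub_one_le (U : ℝ) (n : ℕ) :
    ‖perronWeight U n - 1‖ ≤ gaussMoment * Real.exp (1 - (U - Real.log n)) := by
  have h1 := lineInt_sub_lineInt (h := fun _ => 1) (c := 1) (d := 1) (A := 1)
    (U := U - Real.log n) one_pos one_pos (fun _ _ _ => differentiableAt_const _) (fun w _ _ => by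
      rw [norm_one, one_mul]
      exact Real.one_le_exp (abs_nonneg _))
  have h2 : perronWeight U n - 1 = lineInt (U - Real.log n) (-1) (fun _ => 1) := by
    rw [perronWeight]
    linear_combination h1
  rw [h2]
  refine (norm_lineInt_one_le (by simp)).trans (le_of_eq ?_)
  ring_nf

lemma norm_perronWeight_le_const (U : ℝ) (n : ℕ) :
    ‖perronWeight U n‖ ≤ 1 + gaussMoment * Real.exp 1 := by
  rcases le_total (U - Real.log n) 0 with h | h
  · refine (norm_perronWeight_le le_rfl n).trans ?_
    have : gaussMoment * Real.exp (1 ^ 2 + (U - Real.log n) * 1) ≤ gaussMoment * Real.exp 1 := by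
      refine mul_le_mul_of_nonneg_left (Real.exp_le_exp.mpr ?_) gaussMoment_nonneg
      linarith
    linarith
  · have h1 := norm_perronWeight_sub_one_le U n
    have h2 : gaussMoment * Real.exp (1 - (U - Real.log n)) ≤ gaussMoment * Real.exp 1 := by
      refine mul_le_mul_of_nonneg_left (Real.exp_le_exp.mpr ?_) gaussMoment_nonneg
      linarith
    have h3 := norm_add_le (perronWeight U n - 1) 1
    rw [sub_add_cancel, norm_one] at h3
    linarith

lemma cpow_mul_gaussKernel {n : ℕ} (hn : n ≠ 0) (U : ℝ) (s w : ℂ) (x : ℂ) :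
    x / (n : ℂ) ^ (s + w) * gaussKernel U w = x / (n : ℂ) ^ s * gaussKernel (U - Real.log n) w := by
  have hn' : (n : ℂ) ≠ 0 := by exact_mod_cast hn
  have h1 : (n : ℂ) ^ w = Complex.exp (Real.log n * w) := by
    rw [Complex.cpow_def_of_ne_zero hn', ← Complex.natCast_log]
  have h2 : gaussKernel U w = gaussKernel (U - Real.log n) w * (n : ℂ) ^ w := by
    rw [h1, gaussKernel, gaussKernel, ← Complex.exp_add]
    congr 1
    push_cast
    ring
  have h3 : (n : ℂ) ^ w ≠ 0 := by rw [h1]; exact Complex.exp_ne_zero _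
  rw [h2, Complex.cpow_add _ _ hn', mul_comm (gaussKernel _ _), ← mul_assoc, ← div_div,
    div_mul_cancel₀ _ h3]

lemma norm_natCast_cpow_inv {n : ℕ} (hn : n ≠ 0) (x s : ℂ) :
    ‖x / (n : ℂ) ^ s‖ = ‖x‖ * (n : ℝ) ^ (-s.re) := by
  have : (0 : ℝ) < n := by exact_mod_cast Nat.pos_of_ne_zero hn
  rw [norm_div, ← Complex.ofReal_natCast, Complex.norm_cpow_eq_rpow_re_of_pos this,
    Real.rpow_neg this.le, div_eq_mul_inv]

/-- The smoothed partial sums of a Dirichlet series as a Perron integral. -/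
lemma hasSum_lineInt {a : ℕ → ℂ} (ha : ∀ n, ‖a n‖ ≤ n.divisors.card) {f : ℂ → ℂ}
    (hf : ∀ z : ℂ, 1 < z.re → HasSum (fun n : ℕ => a n / (n : ℂ) ^ z) (f z)) {s : ℂ}
    (hs : 1 / 10 ≤ s.re) (U : ℝ) :
    HasSum (fun n : ℕ => a n / (n : ℂ) ^ s * perronWeight U n)
      (lineInt U 1 (fun w => f (s + w))) := by
  have ha0 : a 0 = 0 := by simpa using ha 0
  set F : ℕ → ℝ → ℂ := fun n v => a n / (n : ℂ) ^ (s + ((1 : ℝ) + v * Complex.I)) *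
    gaussKernel U ((1 : ℝ) + v * Complex.I) / ((1 : ℝ) + v * Complex.I) with hF
  have hFeq : ∀ n v, F n v = a n / (n : ℂ) ^ s * (1 * gaussKernel (U - Real.log n)
      ((1 : ℝ) + v * Complex.I) / ((1 : ℝ) + v * Complex.I)) := by
    intro n v
    simp only [hF]
    rcases eq_or_ne n 0 with rfl | hn
    · simp [ha0]
    · rw [cpow_mul_gaussKernel hn, one_mul, mul_div_assoc]
  have hone : ∀ w : ℂ, w.re = 1 → ‖(1 : ℂ)‖ ≤ 1 * Real.exp |w.im| := fun w _ => by
    rw [norm_one, one_mul]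
    exact Real.one_le_exp (abs_nonneg _)
  have hbase : ∀ V : ℝ, Integrable (fun v : ℝ => (1 : ℂ) * gaussKernel V
      ((1 : ℝ) + v * Complex.I) / ((1 : ℝ) + v * Complex.I)) := fun V =>
    integrable_lineInt (h := fun _ => 1) (A := 1) one_ne_zero
      (fun _ _ => differentiableAt_const _) hone
  have hFint : ∀ n, Integrable (F n) := fun n => by
    have : F n = fun v : ℝ => a n / (n : ℂ) ^ s * (1 * gaussKernel (U - Real.log n)
      ((1 : ℝ) + v * Complex.I) / ((1 : ℝ) + v * Complex.I)) := funext (hFeq n)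
    rw [this]
    exact (hbase _).const_mul _
  have hFnorm : ∀ n v, ‖F n v‖ ≤ (n.divisors.card : ℝ) * (n : ℝ) ^ (-(11 / 10) : ℝ) *
      ‖(1 : ℂ) * gaussKernel U ((1 : ℝ) + v * Complex.I) / ((1 : ℝ) + v * Complex.I)‖ := by
    intro n v
    simp only [hF]
    rcases eq_or_ne n 0 with rfl | hn
    · simp [ha0]
    · have hn1 : (1 : ℝ) ≤ n := by exact_mod_cast Nat.one_le_iff_ne_zero.mpr hn
      rw [mul_div_assoc, norm_mul, norm_natCast_cpow_inv hn, one_mul]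
      gcongr
      · exact ha n
      · simp
        linarith
  have hsum : Summable fun n => ∫ v, ‖F n v‖ := by
    refine Summable.of_nonneg_of_le (fun n => integral_nonneg fun v => norm_nonneg _) (fun n => ?_)
      (summable_tau.mul_right (∫ v : ℝ, ‖(1 : ℂ) * gaussKernel U ((1 : ℝ) + v * Complex.I) /
        ((1 : ℝ) + v * Complex.I)‖))
    rw [← integral_const_mul]
    exact integral_mono (hFint n).norm ((hbase U).norm.const_mul _) (hFnorm n)
  have h1 := (hasSum_integral_of_summable_integral_norm hFint hsum).mul_left
    (2 * Real.pi : ℂ)⁻¹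
  have h2 : lineInt U 1 (fun w => f (s + w)) = (2 * Real.pi : ℂ)⁻¹ * ∫ v, ∑' n, F n v := by
    rw [lineInt]
    congr 1
    refine integral_congr_ae (Filter.Eventually.of_forall fun v => ?_)
    have h3 := hf (s + ((1 : ℝ) + v * Complex.I)) (by simp; linarith)
    have h4 := (h3.mul_right (gaussKernel U ((1 : ℝ) + v * Complex.I))).div_const
      ((1 : ℝ) + v * Complex.I)
    exact h4.tsum_eq.symm
  rw [h2]
  refine h1.congr_fun fun n => ?_
  rw [show F n = fun v : ℝ => a n / (n : ℂ) ^ s * (1 * gaussKernel (U - Real.log n)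
      ((1 : ℝ) + v * Complex.I) / ((1 : ℝ) + v * Complex.I)) from funext (hFeq n),
    integral_const_mul, perronWeight, lineInt]
  ring

/-- A tail of a series dominated by `d(n) n^(-11/10)`. -/
lemma norm_sub_sum_le_of_hasSum {g : ℕ → ℂ} {G : ℂ} (hg : HasSum g G) (hg0 : g 0 = 0) {N : ℕ}
    {C : ℝ} (h : ∀ n, N < n → ‖g n‖ ≤ C * ((n.divisors.card : ℝ) * (n : ℝ) ^ (-(11 / 10) : ℝ)))
    (hC : 0 ≤ C) : ‖G - ∑ n ∈ Finset.Icc 1 N, g n‖ ≤ C * tauConst := by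
  have h1 : HasSum (fun n => if n ∈ Finset.Icc 1 N then g n else 0)
      (∑ n ∈ Finset.Icc 1 N, g n) := by
    have := hasSum_sum_of_ne_finset_zero (f := fun n => if n ∈ Finset.Icc 1 N then g n else 0)
      (s := Finset.Icc 1 N) (L := SummationFilter.unconditional ℕ) (fun n hn => if_neg hn)
    rwa [Finset.sum_ite_mem, Finset.inter_self] at this
  refine (hg.sub h1).norm_le_of_bounded (summable_tau.hasSum.mul_left C) fun n => ?_
  split_ifs with hn
  · rw [sub_self, norm_zero]
    positivity
  · rw [sub_zero]
    rcases eq_or_ne n 0 with rfl | h0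
    · rw [hg0, norm_zero]
      positivity
    · refine h n ?_
      rw [Finset.mem_Icc] at hn
      omega

/-- The Perron integral on the right reproduces the partial sum up to `M`, a weighted sum over
`M < n ≤ N`, and negligible terms. -/
lemma norm_lineInt_sub_le {a : ℕ → ℂ} (ha : ∀ n, ‖a n‖ ≤ n.divisors.card) {f : ℂ → ℂ}
    (hf : ∀ z : ℂ, 1 < z.re → HasSum (fun n : ℕ => a n / (n : ℂ) ^ z) (f z)) {s : ℂ}
    (hs : 1 / 10 ≤ s.re) (U : ℝ) {M N : ℕ} (hMN : M ≤ N) {x : ℝ} (hx0 : 0 < x)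
    (hx : ∀ n : ℕ, N < n → x ≤ n) :
    ‖lineInt U 1 (fun w => f (s + w)) - ∑ n ∈ Finset.Icc 1 M, a n / (n : ℂ) ^ s -
      ∑ n ∈ Finset.Ioc M N, a n / (n : ℂ) ^ s * perronWeight U n‖ ≤
      gaussMoment * tauConst *
        ((M : ℝ) ^ 2 * Real.exp (1 - U) + Real.exp (256 + 16 * U) * (x ^ 15)⁻¹) := by
  have ha0 : a 0 = 0 := by simpa using ha 0
  have hK := gaussMoment_nonneg
  have hS := tauConst_pos
  have h1 := norm_sub_sum_le_of_hasSum (hasSum_lineInt ha hf hs U) (by simp [ha0]) (N := N)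
    (C := gaussMoment * (Real.exp (256 + 16 * U) * (x ^ 15)⁻¹)) (by
      intro n hn
      have hn0 : n ≠ 0 := by omega
      have hn1 : (1 : ℝ) ≤ n := by exact_mod_cast Nat.one_le_iff_ne_zero.mpr hn0
      have hnpos : (0 : ℝ) < n := by linarith
      rw [norm_mul, norm_natCast_cpow_inv hn0]
      -- moving the line to `Re w = 16` makes the weight decay like `n⁻¹⁶`
      have e1 := norm_perronWeight_le (U := U) (c := 16) (by norm_num) n
      have e2 : Real.exp (16 ^ 2 + (U - Real.log n) * 16) =
          Real.exp (256 + 16 * U) * ((n : ℝ) ^ 16)⁻¹ := by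
        have : ((n : ℝ) ^ 16)⁻¹ = Real.exp (-(16 * Real.log n)) := by
          rw [Real.exp_neg, ← Real.exp_log hnpos, ← Real.exp_nat_mul, Real.log_exp]
          norm_num
        rw [this, ← Real.exp_add]
        congr 1
        ring
      rw [e2] at e1
      have e3 : (n : ℝ) ^ (-s.re) * ((n : ℝ) ^ 16)⁻¹ ≤ (n : ℝ) ^ (-(11 / 10) : ℝ) * (x ^ 15)⁻¹ := by
        have e4 : ((n : ℝ) ^ 16)⁻¹ = (n : ℝ) ^ (-1 : ℝ) * ((n : ℝ) ^ 15)⁻¹ := by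
          rw [Real.rpow_neg_one, ← mul_inv]
          ring
        rw [e4, ← mul_assoc, ← Real.rpow_add hnpos]
        gcongr
        · linarith
        · exact hx n hn
      calc _ ≤ (n.divisors.card : ℝ) * (n : ℝ) ^ (-s.re) *
            (gaussMoment * (Real.exp (256 + 16 * U) * ((n : ℝ) ^ 16)⁻¹)) := by
            gcongr
            exact ha n
        _ = gaussMoment * Real.exp (256 + 16 * U) * n.divisors.card *
            ((n : ℝ) ^ (-s.re) * ((n : ℝ) ^ 16)⁻¹) := by ring
        _ ≤ gaussMoment * Real.exp (256 + 16 * U) * n.divisors.card *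
            ((n : ℝ) ^ (-(11 / 10) : ℝ) * (x ^ 15)⁻¹) := by gcongr
        _ = _ := by ring) (by positivity)
  have h2 : ‖∑ n ∈ Finset.Icc 1 M, a n / (n : ℂ) ^ s * (perronWeight U n - 1)‖ ≤
      gaussMoment * ((M : ℝ) ^ 2 * Real.exp (1 - U)) * tauConst := by
    refine (norm_sum_le _ _).trans (le_trans ?_ (mul_le_mul_of_nonneg_left
      (sum_tau_le (Finset.Icc 1 M)) (by positivity)))
    rw [Finset.mul_sum]
    refine Finset.sum_le_sum fun n hn => ?_
    rw [Finset.mem_Icc] at hn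
    have hn0 : n ≠ 0 := by omega
    have hn1 : (1 : ℝ) ≤ n := by exact_mod_cast hn.1
    have hnpos : (0 : ℝ) < n := by linarith
    have hnM : (n : ℝ) ≤ M := by exact_mod_cast hn.2
    rw [norm_mul, norm_natCast_cpow_inv hn0]
    have e1 := norm_perronWeight_sub_one_le U n
    have e2 : Real.exp (1 - (U - Real.log n)) = Real.exp (1 - U) * n := by
      nth_rw 2 [← Real.exp_log hnpos]
      rw [← Real.exp_add]
      congr 1
      ring
    rw [e2] at e1
    have e3 : (n : ℝ) ^ (-s.re) * n ≤ (n : ℝ) ^ (-(11 / 10) : ℝ) * (M : ℝ) ^ 2 := by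
      calc (n : ℝ) ^ (-s.re) * n = (n : ℝ) ^ (-s.re + 1) := by
            rw [Real.rpow_add hnpos, Real.rpow_one]
        _ ≤ (n : ℝ) ^ (-(11 / 10) + 2 : ℝ) := by
            -- uses `s.re ≥ 1/10`, which makes `1 - s.re ≤ 9/10`
            exact Real.rpow_le_rpow_of_exponent_le hn1 (by linarith)
        _ = (n : ℝ) ^ (-(11 / 10) : ℝ) * (n : ℝ) ^ 2 := by
            rw [Real.rpow_add hnpos]; norm_cast
        _ ≤ _ := by gcongr
    calc _ ≤ (n.divisors.card : ℝ) * (n : ℝ) ^ (-s.re) *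
          (gaussMoment * (Real.exp (1 - U) * n)) := by
          gcongr
          exact ha n
      _ = gaussMoment * Real.exp (1 - U) * n.divisors.card * ((n : ℝ) ^ (-s.re) * n) := by ring
      _ ≤ gaussMoment * Real.exp (1 - U) * n.divisors.card *
          ((n : ℝ) ^ (-(11 / 10) : ℝ) * (M : ℝ) ^ 2) := by gcongr
      _ = _ := by ring
  have hsplit : ∑ n ∈ Finset.Icc 1 N, a n / (n : ℂ) ^ s * perronWeight U n =
      ∑ n ∈ Finset.Icc 1 M, a n / (n : ℂ) ^ s * perronWeight U n +
      ∑ n ∈ Finset.Ioc M N, a n / (n : ℂ) ^ s * perronWeight U n := by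
    rw [← Finset.sum_union]
    · congr 1
      ext n
      simp only [Finset.mem_Icc, Finset.mem_union, Finset.mem_Ioc]
      omega
    · rw [Finset.disjoint_left]
      intro n h3 h4
      simp only [Finset.mem_Icc, Finset.mem_Ioc] at h3 h4
      omega
  rw [hsplit] at h1
  simp_rw [mul_sub, mul_one] at h2
  rw [Finset.sum_sub_distrib] at h2
  have h3 := norm_add_le _ _ |>.trans (add_le_add h1 h2)
  refine le_trans (le_of_eq ?_) (h3.trans (le_of_eq ?_))
  · congr 1
    ring
  · ring

/-! ### The smoothed approximate functional equation -/

/-- A pair of Dirichlet series `Λ = ∑ a(n) n⁻ˢ` and `Λ' = ∑ b(n) n⁻ˢ` with coefficients bounded by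
the divisor function, related by a functional equation `Λ(z) = Δ(z) Λ'(1 - z)` of degree two.
Here `exp(2H)` is the main part of the conductor, and `D` controls its remaining part. -/
structure FunEqPair (a b : ℕ → ℂ) (Λ Λ' Δ : ℂ → ℂ) (H D C : ℝ) : Prop where
  norm_a : ∀ n, ‖a n‖ ≤ n.divisors.card
  norm_b : ∀ n, ‖b n‖ ≤ n.divisors.card
  hasSum_a : ∀ z : ℂ, 1 < z.re → HasSum (fun n : ℕ => a n / (n : ℂ) ^ z) (Λ z)
  hasSum_b : ∀ z : ℂ, 1 < z.re → HasSum (fun n : ℕ => b n / (n : ℂ) ^ z) (Λ' z)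
  differentiable : Differentiable ℂ Λ
  differentiableAt_factor : ∀ z : ℂ, z.re < 1 → DifferentiableAt ℂ Δ z
  funEq : ∀ z : ℂ, z.re < 1 → Λ z = Δ z * Λ' (1 - z)
  growth : ∃ A : ℝ, ∀ z : ℂ, -(3 / 2) ≤ z.re → z.re ≤ 5 / 2 → ‖Λ z‖ ≤ A * Real.exp |z.im|
  norm_factor : ∀ z : ℂ, -(3 / 2) ≤ z.re → z.re < 1 → (z.re ≤ 19 / 20 ∨ 1 ≤ |z.im|) →
    ‖Δ z‖ ≤ C * Real.exp (H * (1 - 2 * z.re)) * (4 * D * (1 + |z.im|) ^ 2) ^ max 0 (1 / 2 - z.re)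
  hC : 0 < C
  hH : 0 ≤ H
  hD : 36 ≤ D

/-- The polynomial `∑_{M < n ≤ N} b(n) n^(z - 1)` occurring on the dual side. -/
noncomputable def dualPoly (b : ℕ → ℂ) (M N : ℕ) (z : ℂ) : ℂ :=
  ∑ n ∈ Finset.Ioc M N, b n / (n : ℂ) ^ (1 - z)

lemma differentiable_dualPoly (b : ℕ → ℂ) (M N : ℕ) : Differentiable ℂ (dualPoly b M N) := by
  unfold dualPoly
  refine Differentiable.fun_sum fun n hn => ?_
  have hn0 : (n : ℂ) ≠ 0 := by
    have := (Finset.mem_Ioc.mp hn).1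
    exact_mod_cast (by omega : n ≠ 0)
  intro z
  refine DifferentiableAt.div (differentiableAt_const _) ?_ ?_
  · exact DifferentiableAt.const_cpow (by fun_prop) (Or.inl hn0)
  · rw [Complex.cpow_def_of_ne_zero hn0]
    exact Complex.exp_ne_zero _

lemma norm_dualPoly_le {b : ℕ → ℂ} (hb : ∀ n, ‖b n‖ ≤ n.divisors.card) (M N : ℕ) {z : ℂ}
    (hz : -(1 / 10) ≤ z.re) : ‖dualPoly b M N z‖ ≤ tauConst * (N : ℝ) ^ (z.re + 1 / 10) := by
  refine (norm_sum_le _ _).trans (le_trans ?_ (mul_le_mul_of_nonneg_right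
    (sum_tau_le (Finset.Ioc M N)) (by positivity)))
  rw [Finset.sum_mul]
  refine Finset.sum_le_sum fun n hn => ?_
  rw [Finset.mem_Ioc] at hn
  have hn0 : n ≠ 0 := by omega
  have hnpos : (0 : ℝ) < n := by exact_mod_cast Nat.pos_of_ne_zero hn0
  have hnN : (n : ℝ) ≤ N := by exact_mod_cast hn.2
  rw [norm_natCast_cpow_inv hn0, mul_assoc]
  gcongr
  · exact hb n
  · calc (n : ℝ) ^ (-(1 - z).re) = (n : ℝ) ^ (-(11 / 10) : ℝ) * (n : ℝ) ^ (z.re + 1 / 10) := by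
          rw [← Real.rpow_add hnpos]
          congr 1
          simp
          ring
      _ ≤ _ := by gcongr; linarith

lemma exists_norm_dualPoly_le (b : ℕ → ℂ) (M N : ℕ) :
    ∃ A : ℝ, 0 ≤ A ∧ ∀ z : ℂ, z.re ≤ 1 → ‖dualPoly b M N z‖ ≤ A := by
  refine ⟨∑ n ∈ Finset.Ioc M N, ‖b n‖, by positivity, fun z hz => ?_⟩
  refine (norm_sum_le _ _).trans (Finset.sum_le_sum fun n hn => ?_)
  rw [Finset.mem_Ioc] at hn
  have hn0 : n ≠ 0 := by omega
  have hn1 : (1 : ℝ) ≤ n := by exact_mod_cast Nat.one_le_iff_ne_zero.mpr hn0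
  rw [norm_natCast_cpow_inv hn0]
  refine mul_le_of_le_one_right (norm_nonneg _) ?_
  exact Real.rpow_le_one_of_one_le_of_nonpos hn1 (by simp; linarith)

lemma dualPoly_add {b : ℕ → ℂ} {K M N : ℕ} (h1 : K ≤ M) (h2 : M ≤ N) (z : ℂ) :
    dualPoly b K M z + dualPoly b M N z = dualPoly b K N z := by
  rw [dualPoly, dualPoly, dualPoly, Finset.sum_Ioc_consecutive _ h1 h2]

lemma lineInt_add {h₁ h₂ : ℂ → ℂ} {c A₁ A₂ U : ℝ} (hc : c ≠ 0)
    (hd₁ : ∀ w : ℂ, w.re = c → DifferentiableAt ℂ h₁ w)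
    (hA₁ : ∀ w : ℂ, w.re = c → ‖h₁ w‖ ≤ A₁ * Real.exp |w.im|)
    (hd₂ : ∀ w : ℂ, w.re = c → DifferentiableAt ℂ h₂ w)
    (hA₂ : ∀ w : ℂ, w.re = c → ‖h₂ w‖ ≤ A₂ * Real.exp |w.im|) :
    lineInt U c (fun w => h₁ w + h₂ w) = lineInt U c h₁ + lineInt U c h₂ := by
  rw [lineInt, lineInt, lineInt, ← mul_add,
    ← MeasureTheory.integral_add (integrable_lineInt hc hd₁ hA₁) (integrable_lineInt hc hd₂ hA₂)]
  congr 1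
  refine MeasureTheory.integral_congr_ae (Filter.Eventually.of_forall fun v => ?_)
  simp only
  ring

namespace FunEqPair

variable {a b : ℕ → ℂ} {Λ Λ' Δ : ℂ → ℂ} {H D C : ℝ}

/-- The size of the factor at `s + w`, for `s` of height `O(D)`. -/
lemma norm_factor_add_le (P : FunEqPair a b Λ Λ' Δ H D C) {s : ℂ} (hs : |s.im| ≤ 2 * D) {w : ℂ}
    (h1 : -(3 / 2) ≤ s.re + w.re) (h2 : s.re + w.re < 1)
    (h3 : s.re + w.re ≤ 19 / 20 ∨ 1 ≤ |s.im + w.im|) :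
    ‖Δ (s + w)‖ ≤ C * Real.exp (H * (1 - 2 * (s.re + w.re))) *
      (D ^ 4 * (1 + |w.im|) ^ 2) ^ max 0 (1 / 2 - (s.re + w.re)) := by
  have hD := P.hD
  have hC := P.hC
  refine (P.norm_factor (s + w) (by simpa using h1) (by simpa using h2)
    (by simpa using h3)).trans ?_
  simp only [Complex.add_re, Complex.add_im]
  gcongr ?_ * ?_ ^ _
  have e1 : 1 + |s.im + w.im| ≤ 3 * D * (1 + |w.im|) := by
    have := abs_add_le s.im w.im
    have := abs_nonneg w.im
    nlinarith
  calc 4 * D * (1 + |s.im + w.im|) ^ 2 ≤ 4 * D * (3 * D * (1 + |w.im|)) ^ 2 := by gcongr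
    _ = 36 * D ^ 3 * (1 + |w.im|) ^ 2 := by ring
    _ ≤ D * D ^ 3 * (1 + |w.im|) ^ 2 := by gcongr
    _ = _ := by ring

/-- The crude form of the bound, used where a power of `D` is harmless. -/
lemma norm_factor_add_le_pow (P : FunEqPair a b Λ Λ' Δ H D C) {s : ℂ} (hs : |s.im| ≤ 2 * D) {w : ℂ}
    (h1 : -(3 / 2) ≤ s.re + w.re) (h2 : s.re + w.re < 1)
    (h3 : s.re + w.re ≤ 19 / 20 ∨ 1 ≤ |s.im + w.im|) :
    ‖Δ (s + w)‖ ≤ C * Real.exp (H * (1 - 2 * (s.re + w.re))) * (D ^ 8 * (1 + |w.im|) ^ 4) := by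
  have hD := P.hD
  have hC := P.hC
  refine (P.norm_factor_add_le hs h1 h2 h3).trans ?_
  gcongr
  have e1 : 1 ≤ D ^ 4 * (1 + |w.im|) ^ 2 := by
    have : 1 ≤ D ^ 4 := one_le_pow₀ (by linarith)
    have : 1 ≤ (1 + |w.im|) ^ 2 := one_le_pow₀ (by linarith [abs_nonneg w.im])
    nlinarith
  calc _ ≤ (D ^ 4 * (1 + |w.im|) ^ 2) ^ (2 : ℝ) :=
        Real.rpow_le_rpow_of_exponent_le e1 (max_le (by norm_num) (by linarith))
    _ = _ := by
      rw [Real.rpow_two]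
      ring

lemma norm_dual_le (P : FunEqPair a b Λ Λ' Δ H D C) {z : ℂ} (hz : 11 / 10 ≤ z.re) :
    ‖Λ' z‖ ≤ tauConst := by
  refine (P.hasSum_b z (by linarith)).norm_le_of_bounded summable_tau.hasSum fun n => ?_
  rcases eq_or_ne n 0 with rfl | hn
  · have := P.norm_b 0
    simp at this
    simp [this]
  · have hn1 : (1 : ℝ) ≤ n := by exact_mod_cast Nat.one_le_iff_ne_zero.mpr hn
    rw [norm_natCast_cpow_inv hn]
    gcongr
    · exact P.norm_b n

/-- The tail of the dual series. -/
lemma norm_dual_sub_le (P : FunEqPair a b Λ Λ' Δ H D C) {z : ℂ} (hz : z.re ≤ -(1 / 10)) {N : ℕ}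
    {x : ℝ} (hx0 : 0 < x) (hx : ∀ n : ℕ, N < n → x ≤ n) :
    ‖Λ' (1 - z) - dualPoly b 0 N z‖ ≤ x ^ (z.re + 1 / 10) * tauConst := by
  have hb0 : b 0 = 0 := by simpa using P.norm_b 0
  have h1 := norm_sub_sum_le_of_hasSum (P.hasSum_b (1 - z) (by simp; linarith)) (by simp [hb0])
    (N := N) (C := x ^ (z.re + 1 / 10)) (by
      intro n hn
      have hn0 : n ≠ 0 := by omega
      have hnpos : (0 : ℝ) < n := by exact_mod_cast Nat.pos_of_ne_zero hn0
      rw [norm_natCast_cpow_inv hn0]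
      have e1 : (n : ℝ) ^ (-(1 - z).re) ≤ x ^ (z.re + 1 / 10) * (n : ℝ) ^ (-(11 / 10) : ℝ) := by
        calc (n : ℝ) ^ (-(1 - z).re) = (n : ℝ) ^ (z.re + 1 / 10) * (n : ℝ) ^ (-(11 / 10) : ℝ) := by
              rw [← Real.rpow_add hnpos]
              congr 1
              simp
              ring
          _ ≤ _ := by
              refine mul_le_mul_of_nonneg_right ?_ (by positivity)
              exact Real.rpow_le_rpow_of_nonpos hx0 (hx n hn) (by linarith)
      calc _ ≤ (n.divisors.card : ℝ) * (x ^ (z.re + 1 / 10) * (n : ℝ) ^ (-(11 / 10) : ℝ)) := by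
            gcongr
            exact P.norm_b n
        _ = _ := by ring) (by positivity)
  have : Finset.Icc 1 N = Finset.Ioc 0 N := by ext; simp; omega
  rwa [this] at h1

/-- To the right of the region of interest the whole dual side is negligible. -/
lemma norm_lineInt_left_le (P : FunEqPair a b Λ Λ' Δ H D C) {s : ℂ} (hs : |s.im| ≤ 2 * D)
    (h1 : 9 / 10 ≤ s.re) (h2 : s.re < 1) :
    ‖lineInt (3 / 2 * H) (-(3 / 2)) (fun w => Λ (s + w))‖ ≤
      gaussMoment * C * tauConst * Real.exp 3 * D ^ 8 * Real.exp (-H / 20) := by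
  have hC := P.hC
  have hH := P.hH
  have hS := tauConst_pos
  have hK := gaussMoment_nonneg
  have hD0 : 0 ≤ D := by linarith [P.hD]
  have hb := norm_lineInt_le (h := fun w => Λ (s + w)) (U := 3 / 2 * H) (c := -(3 / 2))
    (B := C * Real.exp (H * (1 - 2 * (s.re - 3 / 2))) * D ^ 8 * tauConst) (by norm_num) (by
      intro v
      set w : ℂ := ((-(3 / 2) : ℝ) : ℂ) + v * Complex.I with hw
      have hre : w.re = -(3 / 2) := by simp [hw]
      have him : w.im = v := by simp [hw]
      have e1 := P.norm_factor_add_le_pow hs (w := w) (by rw [hre]; linarith)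
        (by rw [hre]; linarith) (Or.inl (by rw [hre]; linarith))
      have e2 := P.norm_dual_le (z := 1 - (s + w)) (by simp [hre]; linarith)
      rw [P.funEq (s + w) (by simp [hre]; linarith), norm_mul]
      rw [hre, him] at e1
      calc _ ≤ C * Real.exp (H * (1 - 2 * (s.re + -(3 / 2)))) * (D ^ 8 * (1 + |v|) ^ 4) *
            tauConst := by gcongr
        _ = _ := by ring_nf)
  refine hb.trans ?_
  -- the exponents add up to `H (4 - 2σ - 9/4) ≤ -H/20`, as `σ ≥ 9/10`
  have e3 : Real.exp (H * (1 - 2 * (s.re - 3 / 2))) *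
      Real.exp ((-(3 / 2)) ^ 2 + 3 / 2 * H * -(3 / 2)) ≤ Real.exp 3 * Real.exp (-H / 20) := by
    rw [← Real.exp_add, ← Real.exp_add]
    apply Real.exp_le_exp.mpr
    nlinarith
  have e4 : |(-(3 / 2) : ℝ)| = 3 / 2 := by norm_num
  rw [e4]
  calc _ ≤ gaussMoment * (C * Real.exp (H * (1 - 2 * (s.re - 3 / 2))) * D ^ 8 * tauConst *
        Real.exp ((-(3 / 2)) ^ 2 + 3 / 2 * H * -(3 / 2))) := by
        gcongr
        exact div_le_self (by positivity) (by norm_num)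
    _ = gaussMoment * C * tauConst * D ^ 8 * (Real.exp (H * (1 - 2 * (s.re - 3 / 2))) *
      Real.exp ((-(3 / 2)) ^ 2 + 3 / 2 * H * -(3 / 2))) := by ring
    _ ≤ gaussMoment * C * tauConst * D ^ 8 * (Real.exp 3 * Real.exp (-H / 20)) := by gcongr
    _ = _ := by ring

lemma exists_growth_factor_mul (P : FunEqPair a b Λ Λ' Δ H D C) {s : ℂ} (hs : |s.im| ≤ 2 * D)
    (h0 : 0 ≤ s.re) (M N : ℕ) : ∃ A : ℝ, ∀ w : ℂ, -(3 / 2) ≤ w.re → s.re + w.re ≤ 19 / 20 →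
      ‖Δ (s + w) * dualPoly b M N (s + w)‖ ≤ A * Real.exp |w.im| := by
  have hC := P.hC
  have hH := P.hH
  have hD0 : 0 ≤ D := by linarith [P.hD]
  obtain ⟨A, hA0, hA⟩ := exists_norm_dualPoly_le b M N
  refine ⟨C * Real.exp (H * 4) * D ^ 8 * ((4 : ℕ).factorial * Real.exp 1) * A, fun w h1 h2 => ?_⟩
  have e1 := P.norm_factor_add_le_pow hs (w := w) (by linarith) (by linarith) (Or.inl h2)
  have e2 := hA (s + w) (by simp; linarith)
  rw [norm_mul]
  calc _ ≤ C * Real.exp (H * (1 - 2 * (s.re + w.re))) * (D ^ 8 * (1 + |w.im|) ^ 4) * A := by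
        gcongr
    _ ≤ C * Real.exp (H * 4) * (D ^ 8 * ((4 : ℕ).factorial * Real.exp 1 * Real.exp |w.im|)) *
        A := by
        gcongr
        · linarith
        · exact one_add_pow_le_exp (abs_nonneg _) 4
    _ = _ := by ring

lemma differentiableAt_factor_mul (P : FunEqPair a b Λ Λ' Δ H D C) {s w : ℂ}
    (h : s.re + w.re < 1) (M N : ℕ) :
    DifferentiableAt ℂ (fun w => Δ (s + w) * dualPoly b M N (s + w)) w := by
  refine DifferentiableAt.mul ?_ ?_
  · exact (P.differentiableAt_factor (s + w) (by simpa using h)).comp w (by fun_prop)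
  · exact (differentiable_dualPoly b M N (s + w)).comp w (by fun_prop)

/-- The short part of the dual series: the line can be moved to the right of the pole, where the
integral is negligible. -/
lemma norm_lineInt_short_le (P : FunEqPair a b Λ Λ' Δ H D C) {s : ℂ} (hs : |s.im| ≤ 2 * D)
    (h1 : 99 / 200 ≤ s.re) (h2 : s.re ≤ 9 / 10) {M : ℕ} (hM : (M : ℝ) ≤ Real.exp (H / 1000)) :
    ‖lineInt (3 / 2 * H) (-(3 / 2)) (fun w => Δ (s + w) * dualPoly b 0 M (s + w)) +
      Δ s * dualPoly b 0 M s‖ ≤ gaussMoment * C * tauConst * 60 * Real.exp (-H / 100) := by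
  have hC := P.hC
  have hH := P.hH
  have hS := tauConst_pos
  have hK := gaussMoment_nonneg
  obtain ⟨A, hA⟩ := P.exists_growth_factor_mul hs (by linarith) 0 M
  have e1 := lineInt_sub_lineInt (h := fun w => Δ (s + w) * dualPoly b 0 M (s + w))
    (c := 1 / 20) (d := 3 / 2) (A := A) (U := 3 / 2 * H) (by norm_num) (by norm_num)
    (fun w _ hw2 => P.differentiableAt_factor_mul (by linarith) 0 M)
    (fun w hw1 hw2 => hA w hw1 (by linarith))
  have e2 : lineInt (3 / 2 * H) (-(3 / 2)) (fun w => Δ (s + w) * dualPoly b 0 M (s + w)) +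
      Δ s * dualPoly b 0 M s =
      lineInt (3 / 2 * H) (1 / 20) (fun w => Δ (s + w) * dualPoly b 0 M (s + w)) := by
    simp only [add_zero] at e1
    linear_combination -e1
  rw [e2]
  have hb := norm_lineInt_le (h := fun w => Δ (s + w) * dualPoly b 0 M (s + w)) (U := 3 / 2 * H)
    (c := 1 / 20)
    (B := C * Real.exp (H * (1 - 2 * (s.re + 1 / 20))) * (tauConst * Real.exp (H * (11 / 10000))))
    (by norm_num) (by
      intro v
      set w : ℂ := ((1 / 20 : ℝ) : ℂ) + v * Complex.I with hw
      have hre : w.re = 1 / 20 := by simp [hw]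
      have e3 := P.norm_factor_add_le hs (w := w) (by rw [hre]; linarith)
        (by rw [hre]; linarith) (Or.inl (by rw [hre]; linarith))
      rw [hre, max_eq_left (by linarith), Real.rpow_zero, mul_one] at e3
      have e4 := norm_dualPoly_le P.norm_b 0 M (z := s + w) (by simp [hre]; linarith)
      have e5 : (M : ℝ) ^ ((s + w).re + 1 / 10) ≤ Real.exp (H * (11 / 10000)) := by
        have hre' : (s + w).re + 1 / 10 = s.re + 3 / 20 := by simp [hre]; ring
        rw [hre']
        calc _ ≤ Real.exp (H / 1000) ^ (s.re + 3 / 20) := by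
              refine Real.rpow_le_rpow (by positivity) hM (by linarith)
          _ = Real.exp (H / 1000 * (s.re + 3 / 20)) := by rw [← Real.exp_mul]
          _ ≤ _ := by
              apply Real.exp_le_exp.mpr
              nlinarith
      rw [norm_mul]
      calc _ ≤ C * Real.exp (H * (1 - 2 * (s.re + 1 / 20))) *
            (tauConst * Real.exp (H * (11 / 10000))) := by
            gcongr
            exact e4.trans (by gcongr)
        _ ≤ _ := le_mul_of_one_le_right (by positivity)
            (one_le_pow₀ (by linarith [abs_nonneg v])))
  refine hb.trans ?_
  -- with `σ ≥ 99/200` the exponent of `H` is at most `1 - 2σ - 1/10 + 11/10000 + 3/40 < -1/100`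
  have e3 : Real.exp (H * (1 - 2 * (s.re + 1 / 20))) * Real.exp (H * (11 / 10000)) *
      Real.exp ((1 / 20) ^ 2 + 3 / 2 * H * (1 / 20)) ≤ 3 * Real.exp (-H / 100) := by
    have h3 : (3 : ℝ) ≥ Real.exp 1 := by linarith [Real.exp_one_lt_d9]
    refine le_trans ?_ (mul_le_mul_of_nonneg_right h3 (Real.exp_pos _).le)
    rw [← Real.exp_add, ← Real.exp_add, ← Real.exp_add]
    apply Real.exp_le_exp.mpr
    nlinarith
  have e4 : |(1 / 20 : ℝ)| = 1 / 20 := by norm_num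
  rw [e4]
  calc _ = gaussMoment * C * tauConst * 20 * (Real.exp (H * (1 - 2 * (s.re + 1 / 20))) *
      Real.exp (H * (11 / 10000)) * Real.exp ((1 / 20) ^ 2 + 3 / 2 * H * (1 / 20))) := by
        ring
    _ ≤ gaussMoment * C * tauConst * 20 * (3 * Real.exp (-H / 100)) := by gcongr
    _ = _ := by ring

/-- The medium part of the dual series: the line is moved close to the pole. -/
lemma norm_lineInt_medium_le (P : FunEqPair a b Λ Λ' Δ H D C) {s : ℂ} (hs : |s.im| ≤ 2 * D)
    (h1 : 99 / 200 ≤ s.re) (h2 : s.re ≤ 9 / 10) {M N : ℕ} {α K : ℝ} (hα0 : 0 < α)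
    (hα1 : α ≤ 1 / 10) (hδ : (D ^ 4) ^ max 0 (1 / 2 - (s.re - α)) ≤ Real.exp 1)
    (hK : ∀ v : ℝ, ‖dualPoly b M N (s + ((-α : ℝ) + v * Complex.I))‖ ≤
      K * (1 + |v|) * Real.exp (2 * H * (s.re - α))) :
    ‖lineInt (3 / 2 * H) (-(3 / 2)) (fun w => Δ (s + w) * dualPoly b M N (s + w))‖ ≤
      C * Real.exp 2 * K * Real.exp H * (16 + 8 * Real.log α⁻¹ + gaussMoment) := by
  have hC := P.hC
  have hH := P.hH
  have hD0 : 0 ≤ D := by linarith [P.hD]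
  have hgM := gaussMoment_nonneg
  have hK0 : 0 ≤ K := by
    have := (norm_nonneg _).trans (hK 0)
    simp only [abs_zero, add_zero, mul_one] at this
    exact nonneg_of_mul_nonneg_left this (Real.exp_pos _)
  have hlog : 0 ≤ Real.log α⁻¹ := Real.log_nonneg ((one_le_inv₀ hα0).mpr (by linarith))
  obtain ⟨A, hA⟩ := P.exists_growth_factor_mul hs (by linarith) M N
  have e1 := lineInt_eq_of_same_side (h := fun w => Δ (s + w) * dualPoly b M N (s + w))
    (a := -(3 / 2)) (b := -α) (A := A) (U := 3 / 2 * H) (by linarith) (Or.inr (by linarith))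
    (fun w _ hw2 => P.differentiableAt_factor_mul (by linarith) M N)
    (fun w hw1 hw2 => hA w hw1 (by linarith))
  rw [e1]
  have hb := norm_lineInt_near_le (h := fun w => Δ (s + w) * dualPoly b M N (s + w))
    (U := 3 / 2 * H) (c := -α) (B := C * Real.exp 1 * K * Real.exp H)
    (by linarith) (by rw [abs_neg, abs_of_pos hα0]; linarith) (by
      intro v
      set w : ℂ := ((-α : ℝ) : ℂ) + v * Complex.I with hw
      have hre : w.re = -α := by simp [hw]
      have him : w.im = v := by simp [hw]
      have hv := abs_nonneg v
      have e3 := P.norm_factor_add_le hs (w := w) (by rw [hre]; linarith)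
        (by rw [hre]; linarith) (Or.inl (by rw [hre]; linarith))
      rw [hre, him, ← sub_eq_add_neg] at e3
      have e4 : (D ^ 4 * (1 + |v|) ^ 2) ^ max 0 (1 / 2 - (s.re - α)) ≤
          Real.exp 1 * (1 + |v|) := by
        rw [Real.mul_rpow (by positivity) (by positivity)]
        gcongr
        calc ((1 + |v|) ^ 2) ^ max 0 (1 / 2 - (s.re - α)) ≤ ((1 + |v|) ^ 2) ^ (1 / 2 : ℝ) := by
              refine Real.rpow_le_rpow_of_exponent_le (one_le_pow₀ (by linarith)) ?_
              exact max_le (by norm_num) (by linarith)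
          _ = 1 + |v| := by
              rw [← Real.sqrt_eq_rpow, Real.sqrt_sq (by linarith)]
      rw [norm_mul]
      calc _ ≤ C * Real.exp (H * (1 - 2 * (s.re - α))) * (Real.exp 1 * (1 + |v|)) *
            (K * (1 + |v|) * Real.exp (2 * H * (s.re - α))) := by
            gcongr
            · exact e3.trans (by gcongr)
            · exact hK v
        _ = C * Real.exp 1 * K * (Real.exp (H * (1 - 2 * (s.re - α))) *
            Real.exp (2 * H * (s.re - α))) * (1 + |v|) ^ 2 := by ring
        _ = _ := by
            rw [← Real.exp_add]
            ring_nf)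
  refine hb.trans ?_
  rw [abs_neg, abs_of_pos hα0]
  gcongr ?_ * _
  have e5 : Real.exp 1 * Real.exp ((-α) ^ 2 + 3 / 2 * H * -α) ≤ Real.exp 2 := by
    rw [← Real.exp_add]
    apply Real.exp_le_exp.mpr
    nlinarith [mul_nonneg hH hα0.le]
  calc _ = C * K * Real.exp H * (Real.exp 1 * Real.exp ((-α) ^ 2 + 3 / 2 * H * -α)) := by ring
    _ ≤ C * K * Real.exp H * Real.exp 2 := by gcongr
    _ = _ := by ring

/-- The long part of the dual series is negligible on the line `Re w = -3/2`. -/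
lemma norm_lineInt_long_le (P : FunEqPair a b Λ Λ' Δ H D C) {s : ℂ} (hs : |s.im| ≤ 2 * D)
    (h1 : 99 / 200 ≤ s.re) (h2 : s.re ≤ 9 / 10) {N : ℕ}
    (hN : ∀ n : ℕ, N < n → Real.exp (2 * H) ≤ n) :
    ‖lineInt (3 / 2 * H) (-(3 / 2)) (fun w => Λ (s + w) - Δ (s + w) * dualPoly b 0 N (s + w))‖ ≤
      gaussMoment * C * tauConst * Real.exp 3 * D ^ 8 * Real.exp (-H / 20) := by
  have hC := P.hC
  have hH := P.hH
  have hS := tauConst_pos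
  have hK := gaussMoment_nonneg
  have hD0 : 0 ≤ D := by linarith [P.hD]
  have hb := norm_lineInt_le
    (h := fun w => Λ (s + w) - Δ (s + w) * dualPoly b 0 N (s + w)) (U := 3 / 2 * H)
    (c := -(3 / 2)) (B := C * Real.exp (H * (1 - 2 * (s.re - 3 / 2))) * D ^ 8 *
      (Real.exp (2 * H * (s.re - 7 / 5)) * tauConst)) (by norm_num) (by
      intro v
      set w : ℂ := ((-(3 / 2) : ℝ) : ℂ) + v * Complex.I with hw
      have hre : w.re = -(3 / 2) := by simp [hw]
      have him : w.im = v := by simp [hw]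
      have e1 := P.norm_factor_add_le_pow hs (w := w) (by rw [hre]; linarith)
        (by rw [hre]; linarith) (Or.inl (by rw [hre]; linarith))
      have e2 := P.norm_dual_sub_le (z := s + w) (by simp [hre]; linarith) (Real.exp_pos _) hN
      have e3 : Real.exp (2 * H) ^ ((s + w).re + 1 / 10) = Real.exp (2 * H * (s.re - 7 / 5)) := by
        have hre' : (s + w).re = s.re - 3 / 2 := by simp [hre]; ring
        rw [← Real.exp_mul, hre']
        congr 1
        ring
      rw [e3] at e2
      rw [P.funEq (s + w) (by simp [hre]; linarith), ← mul_sub, norm_mul]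
      rw [hre, him] at e1
      calc _ ≤ C * Real.exp (H * (1 - 2 * (s.re + -(3 / 2)))) * (D ^ 8 * (1 + |v|) ^ 4) *
            (Real.exp (2 * H * (s.re - 7 / 5)) * tauConst) := by gcongr
        _ = _ := by ring_nf)
  refine hb.trans ?_
  have e3 : Real.exp (H * (1 - 2 * (s.re - 3 / 2))) * Real.exp (2 * H * (s.re - 7 / 5)) *
      Real.exp ((-(3 / 2)) ^ 2 + 3 / 2 * H * -(3 / 2)) ≤ Real.exp 3 * Real.exp (-H / 20) := by
    rw [← Real.exp_add, ← Real.exp_add, ← Real.exp_add]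
    apply Real.exp_le_exp.mpr
    nlinarith
  have e4 : |(-(3 / 2) : ℝ)| = 3 / 2 := by norm_num
  rw [e4]
  calc _ ≤ gaussMoment * (C * Real.exp (H * (1 - 2 * (s.re - 3 / 2))) * D ^ 8 *
        (Real.exp (2 * H * (s.re - 7 / 5)) * tauConst) *
        Real.exp ((-(3 / 2)) ^ 2 + 3 / 2 * H * -(3 / 2))) := by
        gcongr
        exact div_le_self (by positivity) (by norm_num)
    _ = gaussMoment * C * tauConst * D ^ 8 * (Real.exp (H * (1 - 2 * (s.re - 3 / 2))) *
      Real.exp (2 * H * (s.re - 7 / 5)) * Real.exp ((-(3 / 2)) ^ 2 + 3 / 2 * H * -(3 / 2))) := by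
        ring
    _ ≤ gaussMoment * C * tauConst * D ^ 8 * (Real.exp 3 * Real.exp (-H / 20)) := by gcongr
    _ = _ := by ring

/-- Moving the line of integration from `Re w = 1` to `Re w = -3/2` picks up the residue `Λ(s)`. -/
lemma eq_lineInt_sub (P : FunEqPair a b Λ Λ' Δ H D C) {s : ℂ} (h1 : 0 ≤ s.re) (h2 : s.re ≤ 1)
    (U : ℝ) :
    Λ s = lineInt U 1 (fun w => Λ (s + w)) - lineInt U (-(3 / 2)) (fun w => Λ (s + w)) := by
  obtain ⟨A, hA⟩ := P.growth
  have := lineInt_sub_lineInt (h := fun w => Λ (s + w)) (c := 1) (d := 3 / 2)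
    (A := A * Real.exp |s.im|) (U := U) (by norm_num) (by norm_num)
    (fun w _ _ => (P.differentiable (s + w)).comp w (by fun_prop)) (by
      intro w hw1 hw2
      have e := hA (s + w) (by simp; linarith) (by simp; linarith)
      have hA0 : 0 ≤ A := nonneg_of_mul_nonneg_left ((norm_nonneg _).trans e) (Real.exp_pos _)
      refine e.trans ?_
      rw [mul_assoc, ← Real.exp_add]
      gcongr
      simpa using abs_add_le s.im w.im)
  simpa using this.symm

/-- The decomposition of the left-hand Perron integral according to the length of the dual sum. -/
lemma norm_lineInt_add_le (P : FunEqPair a b Λ Λ' Δ H D C) {s : ℂ} (hs : |s.im| ≤ 2 * D)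
    (h1 : 99 / 200 ≤ s.re) (h2 : s.re ≤ 9 / 10) {M N : ℕ} (hMN : M ≤ N)
    (hM : (M : ℝ) ≤ Real.exp (H / 1000)) (hN : ∀ n : ℕ, N < n → Real.exp (2 * H) ≤ n)
    {α K : ℝ} (hα0 : 0 < α)
    (hα1 : α ≤ 1 / 10) (hδ : (D ^ 4) ^ max 0 (1 / 2 - (s.re - α)) ≤ Real.exp 1)
    (hK : ∀ v : ℝ, ‖dualPoly b M N (s + ((-α : ℝ) + v * Complex.I))‖ ≤
      K * (1 + |v|) * Real.exp (2 * H * (s.re - α))) :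
    ‖lineInt (3 / 2 * H) (-(3 / 2)) (fun w => Λ (s + w)) + Δ s * dualPoly b 0 M s‖ ≤
      gaussMoment * C * tauConst * 60 * Real.exp (-H / 100) +
      C * Real.exp 2 * K * Real.exp H * (16 + 8 * Real.log α⁻¹ + gaussMoment) +
      gaussMoment * C * tauConst * Real.exp 3 * D ^ 8 * Real.exp (-H / 20) := by
  have b1 := P.norm_lineInt_short_le hs h1 h2 hM
  have b2 := P.norm_lineInt_medium_le hs h1 h2 hα0 hα1 hδ hK
  have b3 := P.norm_lineInt_long_le hs h1 h2 hN
  obtain ⟨A₁, hA₁⟩ := P.exists_growth_factor_mul hs (by linarith) 0 M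
  obtain ⟨A₂, hA₂⟩ := P.exists_growth_factor_mul hs (by linarith) M N
  obtain ⟨A₃, hA₃⟩ := P.exists_growth_factor_mul hs (by linarith) 0 N
  obtain ⟨A, hA⟩ := P.growth
  have dΛ : ∀ w : ℂ, DifferentiableAt ℂ (fun w => Λ (s + w)) w := fun w =>
    (P.differentiable (s + w)).comp w (by fun_prop)
  have gΛ : ∀ w : ℂ, w.re = -(3 / 2) → ‖Λ (s + w)‖ ≤ A * Real.exp |s.im| * Real.exp |w.im| := by
    intro w hw
    have e := hA (s + w) (by simp; linarith) (by simp; linarith)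
    have hA0 : 0 ≤ A := nonneg_of_mul_nonneg_left ((norm_nonneg _).trans e) (Real.exp_pos _)
    refine e.trans ?_
    rw [mul_assoc, ← Real.exp_add]
    gcongr
    simpa using abs_add_le s.im w.im
  have c0 : (-(3 / 2) : ℝ) ≠ 0 := by norm_num
  have e1 : lineInt (3 / 2 * H) (-(3 / 2)) (fun w => Λ (s + w)) =
      lineInt (3 / 2 * H) (-(3 / 2)) (fun w => Δ (s + w) * dualPoly b 0 M (s + w)) +
      lineInt (3 / 2 * H) (-(3 / 2)) (fun w => Δ (s + w) * dualPoly b M N (s + w)) +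
      lineInt (3 / 2 * H) (-(3 / 2))
        (fun w => Λ (s + w) - Δ (s + w) * dualPoly b 0 N (s + w)) := by
    have d12 := fun (w : ℂ) (hw : w.re = -(3 / 2)) (K L : ℕ) =>
      P.differentiableAt_factor_mul (s := s) (w := w) (by rw [hw]; linarith) K L
    rw [← lineInt_add c0 (fun w hw => d12 w hw 0 M)
      (fun w hw => hA₁ w (by rw [hw]) (by rw [hw]; linarith))
      (fun w hw => d12 w hw M N) (fun w hw => hA₂ w (by rw [hw]) (by rw [hw]; linarith)),
      ← lineInt_add (A₁ := A₁ + A₂) (A₂ := A * Real.exp |s.im| + A₃) c0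
      (fun w hw => (d12 w hw 0 M).fun_add (d12 w hw M N)) ?_
      (fun w hw => (dΛ w).fun_sub (d12 w hw 0 N)) ?_]
    · congr 1
      funext w
      rw [← dualPoly_add (Nat.zero_le M) hMN]
      ring
    · intro w hw
      refine (norm_add_le _ _).trans ?_
      rw [add_mul]
      exact add_le_add (hA₁ w (by rw [hw]) (by rw [hw]; linarith))
        (hA₂ w (by rw [hw]) (by rw [hw]; linarith))
    · intro w hw
      refine (norm_sub_le _ _).trans ?_
      rw [add_mul]
      exact add_le_add (gΛ w hw) (hA₃ w (by rw [hw]) (by rw [hw]; linarith))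
  rw [e1]
  have n1 := norm_add₃_le (a := lineInt (3 / 2 * H) (-(3 / 2))
    (fun w => Δ (s + w) * dualPoly b 0 M (s + w)) + Δ s * dualPoly b 0 M s)
    (b := lineInt (3 / 2 * H) (-(3 / 2)) (fun w => Δ (s + w) * dualPoly b M N (s + w)))
    (c := lineInt (3 / 2 * H) (-(3 / 2))
        (fun w => Λ (s + w) - Δ (s + w) * dualPoly b 0 N (s + w)))
  refine le_trans (le_of_eq ?_) (n1.trans (add_le_add (add_le_add b1 b2) b3))
  congr 1
  ring

end FunEqPair

/-! ### The approximate functional equation for `L(s, ψ) L(s, ψχ)` -/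

/-- The pair of Dirichlet series `L(s, ψ) L(s, ψχ)` and `L(s, ψ̄) L(s, ψ̄χ)`. -/
lemma exists_funEqPair : ∃ C : ℝ, 0 < C ∧ ∀ (D q : ℕ) [NeZero D] [NeZero q]
    (χ : DirichletCharacter ℂ D) (ψ : DirichletCharacter ℂ q) (H : ℝ), χ.IsQuadratic →
    ψ.IsPrimitive → (ψ.mul χ).IsPrimitive → 1 < q → Real.exp H ≤ q → q ≤ 2 * Real.exp H → 0 ≤ H →
    36 ≤ D → FunEqPair (fun n => nu χ n * ψ n) (fun n => nu χ n * (star ψ) n)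
      (fun z => DirichletCharacter.LFunction ψ z * DirichletCharacter.LFunction (ψ.mul χ) z)
      (fun z => DirichletCharacter.LFunction ψ⁻¹ z * DirichletCharacter.LFunction (ψ.mul χ)⁻¹ z)
      (fun z => Delta1 χ z ψ) H D C := by
  obtain ⟨C, hC0, hC⟩ := exists_norm_Delta1_le
  refine ⟨C, hC0, ?_⟩
  intro D q _ _ χ ψ H hχ hψ hψχ hq hq1 hq2 hH hD
  have hm : q.lcm D ≠ 1 := fun h => by
    have := Nat.dvd_lcm_left q D
    rw [h, Nat.dvd_one] at this
    omega
  rw [MulChar.star_eq_inv]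
  exact
    { norm_a := norm_nu_mul_le χ ψ
      norm_b := norm_nu_mul_le χ ψ⁻¹
      hasSum_a := fun z hz => hasSum_nu_mul χ ψ _ (fun n => dirichletMul_apply χ ψ n) hz
      hasSum_b := fun z hz => hasSum_nu_mul χ ψ⁻¹ _ (fun n => dirichletMul_inv_apply hχ ψ n) hz
      differentiable :=
        (DirichletCharacter.differentiable_LFunction (ne_one_of_isPrimitive hψ hq.ne')).mul
          (DirichletCharacter.differentiable_LFunction (ne_one_of_isPrimitive hψχ hm))
      differentiableAt_factor := fun z hz => differentiableAt_Delta1 hψ hψχ hq hz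
      funEq := fun z hz => Lprod_eq hψ hψχ hq hz
      growth := exists_norm_Lprod_le hψ hψχ hq
      norm_factor := hC D q χ ψ H hψ hψχ hq hq1 hq2
      hC := hC0
      hH := hH
      hD := by exact_mod_cast hD }

/-- The length `Q²` of the sums in the approximate functional equation. -/
noncomputable def longLen (D : ℕ) : ℕ := ⌊Real.exp (2 * ell D ^ 2)⌋₊

/-- The length `Q^(1/1000)` at which the dual sum is divided. -/
noncomputable def shortLen (D : ℕ) : ℕ := ⌊Real.exp (ell D ^ 2 / 1000)⌋₊

/-- The left edge `1/2 - (α log 𝓛) / 10` of `Ω₂`. -/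
noncomputable def edge (D : ℕ) : ℝ := 1 / 2 - alpha D * Real.log (ell D) / 10

/-- The coefficients of the direct sum over `D⁵ < n ≤ Q²`, without the character `ψ`. -/
noncomputable def directCoeff {D : ℕ} (χ : DirichletCharacter ℂ D) (n : ℕ) : ℂ :=
  if D ^ 5 < n then nu χ n * perronWeight (3 / 2 * ell D ^ 2) n else 0

/-- The coefficients of a dual sum over `n > M`, without the character `ψ`. -/
noncomputable def dualCoeff {D : ℕ} (χ : DirichletCharacter ℂ D) (M n : ℕ) : ℂ :=
  if M < n then nu χ n / n else 0

/-- The mean square of the direct sum over `D⁵ < n ≤ Q²`. -/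
noncomputable def directMeanSq {D q : ℕ} (χ : DirichletCharacter ℂ D)
    (ψ : DirichletCharacter ℂ q) : ℝ :=
  meanSq (edge D - alpha D) D (ell D) (dirPoly (fun n => directCoeff χ n * ψ n)
    (fun n => Real.log n) (longLen D))

/-- The mean square of the dual sum over `D⁵ < n ≤ Q^(1/1000)`, scaled by its length. -/
noncomputable def shortMeanSq {D q : ℕ} (χ : DirichletCharacter ℂ D)
    (ψ : DirichletCharacter ℂ q) : ℝ :=
  meanSq (edge D - alpha D) D (ell D) (dirPoly (fun n => dualCoeff χ (D ^ 5) n * (star ψ) n)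
    (fun n => ell D ^ 2 / 1000 - Real.log n) (shortLen D))

/-- The mean square of the dual sum over `Q^(1/1000) < n ≤ Q²`, scaled by its length. -/
noncomputable def mediumMeanSq {D q : ℕ} (χ : DirichletCharacter ℂ D)
    (ψ : DirichletCharacter ℂ q) : ℝ :=
  meanSq (edge D - 2 * alpha D) D (ell D)
    (dirPoly (fun n => dualCoeff χ (shortLen D) n * (star ψ) n)
    (fun n => 2 * ell D ^ 2 - Real.log n) (longLen D))

/-- The dual polynomial has exponents `log n` of the wrong sign; multiplication by `exp(-Lz)`
turns them into `L - log n`, which is nonnegative for `n ≤ exp L`. -/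
lemma dualPoly_eq_dirPoly {D q : ℕ} (χ : DirichletCharacter ℂ D) (ψ : DirichletCharacter ℂ q)
    (M N : ℕ) (L : ℝ) (z : ℂ) :
    dualPoly (fun n => nu χ n * ψ n) M N z =
      Complex.exp (L * z) * dirPoly (fun n => dualCoeff χ M n * ψ n)
        (fun n => L - Real.log n) N z := by
  rw [dualPoly, dirPoly, Finset.mul_sum]
  have hsub : Finset.Ioc M N ⊆ Finset.Icc 1 N := by
    intro n hn
    rw [Finset.mem_Ioc] at hn
    rw [Finset.mem_Icc]
    omega
  rw [← Finset.sum_subset hsub]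
  · refine Finset.sum_congr rfl fun n hn => ?_
    rw [Finset.mem_Ioc] at hn
    have hn0 : (n : ℂ) ≠ 0 := by exact_mod_cast (by omega : n ≠ 0)
    have e1 : (n : ℂ) ^ (1 - z) = n * Complex.exp (-(Real.log n * z)) := by
      rw [Complex.cpow_sub _ _ hn0, Complex.cpow_one, Complex.cpow_def_of_ne_zero hn0,
        ← Complex.natCast_log, Complex.exp_neg, div_eq_mul_inv]
    have e2 : Complex.exp (L * z) * Complex.exp (-z * ((L - Real.log n : ℝ) : ℂ)) =
        Complex.exp (Real.log n * z) := by
      rw [← Complex.exp_add]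
      congr 1
      push_cast
      ring
    rw [dualCoeff, if_pos hn.1, mul_left_comm, e2, e1, Complex.exp_neg]
    field_simp
  · intro n hn hn'
    rw [Finset.mem_Icc] at hn
    rw [Finset.mem_Ioc] at hn'
    rw [dualCoeff, if_neg (by omega)]
    ring

lemma sum_eq_dirPoly {D q : ℕ} (χ : DirichletCharacter ℂ D) (ψ : DirichletCharacter ℂ q)
    (N : ℕ) (z : ℂ) :
    ∑ n ∈ Finset.Ioc (D ^ 5) N, nu χ n * ψ n / (n : ℂ) ^ z * perronWeight (3 / 2 * ell D ^ 2) n =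
      dirPoly (fun n => directCoeff χ n * ψ n) (fun n => Real.log n) N z := by
  rw [dirPoly]
  have hsub : Finset.Ioc (D ^ 5) N ⊆ Finset.Icc 1 N := by
    intro n hn
    rw [Finset.mem_Ioc] at hn
    rw [Finset.mem_Icc]
    omega
  rw [← Finset.sum_subset hsub]
  · refine Finset.sum_congr rfl fun n hn => ?_
    rw [Finset.mem_Ioc] at hn
    have hn0 : (n : ℂ) ≠ 0 := by exact_mod_cast (by omega : n ≠ 0)
    have e1 : (n : ℂ) ^ z = (Complex.exp (-z * Real.log n))⁻¹ := by
      rw [← Complex.exp_neg, Complex.cpow_def_of_ne_zero hn0, ← Complex.natCast_log]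
      congr 1
      ring
    rw [directCoeff, if_pos hn.1, e1, div_inv_eq_mul]
    ring
  · intro n hn hn'
    rw [Finset.mem_Icc] at hn
    rw [Finset.mem_Ioc] at hn'
    rw [directCoeff, if_neg (by omega)]
    ring

/-- The supremum bound for a Dirichlet polynomial at height `D + O(𝓛)`, at distance `α` to the
right of the line of the mean square. -/
lemma norm_dirPoly_le_sqrt (b : ℕ → ℂ) {ℓ : ℕ → ℝ} (N : ℕ) (hℓ : ∀ n ∈ Finset.Icc 1 N, 0 ≤ ℓ n)
    {D : ℕ} (hD : 1 ≤ ell D) {σ₀ u : ℝ} {z : ℂ} (h1 : σ₀ + alpha D ≤ z.re) (h2 : z.re - σ₀ ≤ 1)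
    (hu : 0 ≤ u) (h3 : |z.im - D| ≤ 11 * ell D * (1 + u)) :
    ‖dirPoly b ℓ N z‖ ≤ 10 * ell D * (1 + u) * √(meanSq σ₀ D (ell D) (dirPoly b ℓ N)) := by
  have hℓ0 : 0 < ell D := by linarith
  have hα : 0 < alpha D := by rw [alpha]; positivity
  have hα1 : alpha D ≤ 1 := by
    rw [alpha]
    exact inv_le_one_of_one_le₀ (one_le_pow₀ hD)
  have hJ := meanSq_nonneg σ₀ D (ell D) (dirPoly b ℓ N)
  have h := norm_dirPoly_sq_le b N hℓ σ₀ D hD hα h1 (by nlinarith)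
  refine le_of_sq_le_sq ?_ (by positivity)
  rw [mul_pow, Real.sq_sqrt hJ]
  refine h.trans (mul_le_mul_of_nonneg_right ?_ hJ)
  have e1 : ((z.im - D) / ell D) ^ 2 ≤ (11 * (1 + u)) ^ 2 := by
    rw [← sq_abs, abs_div, abs_of_pos hℓ0]
    gcongr
    rw [div_le_iff₀ hℓ0]
    linarith
  have hpi := Real.pi_gt_three
  have e2 : 2 / (Real.pi * alpha D) ≤ 2 / 3 * ell D ^ 2 := by
    rw [alpha, ← div_eq_mul_inv, div_div_eq_mul_div, mul_div_right_comm]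
    gcongr
  have e3 : 1 + ((z.im - D) / ell D) ^ 2 ≤ 122 * (1 + u) ^ 2 := by
    nlinarith
  calc _ ≤ 2 / 3 * ell D ^ 2 * (122 * (1 + u) ^ 2) := by gcongr
    _ ≤ _ := by
      have : 0 ≤ (ell D * (1 + u)) ^ 2 := by positivity
      nlinarith

lemma exp_ell {D : ℕ} [NeZero D] : Real.exp (ell D) = D :=
  Real.exp_log (by exact_mod_cast Nat.pos_of_ne_zero (NeZero.ne D))

lemma bigF_eq_dualPoly {D q : ℕ} (χ : DirichletCharacter ℂ D) (ψ : DirichletCharacter ℂ q) (s : ℂ) :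
    bigF χ (1 - s) ψ = dualPoly (fun n => nu χ n * ψ n) 0 (D ^ 5) s := by
  rw [bigF, dualPoly]
  congr 1

set_option maxHeartbeats 800000 in
/-- For large `D` the error in the approximate functional equation on `Ω₂` is controlled by three
mean squares. -/
lemma exists_norm_Lprod_sub_calF_le : ∃ K : ℝ, 0 < K ∧ ∀ (D q : ℕ) [NeZero D] [NeZero q]
    (χ : DirichletCharacter ℂ D) (ψ : DirichletCharacter ℂ q), χ.IsQuadratic →
    ψ.IsPrimitive → (ψ.mul χ).IsPrimitive → 1 < q → bigQ D ≤ q → q ≤ 2 * bigQ D →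
    5000 ≤ ell D → ∀ s ∈ Omega2 D,
    ‖DirichletCharacter.LFunction ψ s * DirichletCharacter.LFunction (ψ.mul χ) s - calF χ s ψ‖ ≤
      K * (ell D * √(directMeanSq χ ψ) +
        ell D * ell D ^ (1 / 5 : ℝ) * Real.exp (edge D * (ell D ^ 2 / 1000)) *
          √(shortMeanSq χ ψ) +
        ell D * Real.log (ell D) * bigQ D * √(mediumMeanSq χ ψ) +
        D ^ 10 * Real.exp (-ell D ^ 2 / 100)) := by
  obtain ⟨C, hC0, hC⟩ := exists_funEqPair
  have hS := tauConst_pos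
  have hgM := gaussMoment_nonneg
  set c₁ := gaussMoment * tauConst * (Real.exp 1 + Real.exp 256) with hc₁
  set c₂ := gaussMoment * C * tauConst * 60 with hc₂
  set c₃ := gaussMoment * C * tauConst * Real.exp 3 with hc₃
  set c₄ := C * tauConst with hc₄
  set c₅ := C * Real.exp 1 * 10 with hc₅
  set c₆ := C * Real.exp 2 * 10 * (32 + gaussMoment) with hc₆
  refine ⟨10 + c₁ + c₂ + c₃ + c₄ + c₅ + c₆, by positivity, ?_⟩
  intro D q _ _ χ ψ hχ hψ hψχ hq hq1 hq2 hL s hs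
  have hD5000 : (5000 : ℝ) ≤ D := by
    rw [← exp_ell (D := D)]
    linarith [Real.add_one_le_exp (ell D)]
  have hD36 : 36 ≤ D := by
    have : ((36 : ℕ) : ℝ) ≤ D := by push_cast; linarith
    exact_mod_cast this
  set ℓ := ell D with hℓ
  set H := ℓ ^ 2 with hH
  set lam := Real.log ℓ with hlam
  set α := alpha D with hα
  have hℓ0 : 0 < ℓ := by linarith
  have hH0 : 0 ≤ H := by positivity
  have P := hC D q χ ψ H hχ hψ hψχ hq hq1 hq2 hH0 hD36
  have hlam1 : 1 ≤ lam := by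
    rw [hlam, Real.le_log_iff_exp_le hℓ0]
    linarith [Real.exp_one_lt_d9]
  have hlamle : lam ≤ ℓ - 1 := Real.log_le_sub_one_of_pos hℓ0
  have hαe : α = (ℓ ^ 2)⁻¹ := rfl
  have hα0 : 0 < α := by rw [hαe]; positivity
  have hαH : α * H = 1 := by rw [hαe, hH]; exact inv_mul_cancel₀ (by positivity)
  have hαℓ : α * ℓ = ℓ⁻¹ := by rw [hαe]; field_simp
  have hℓinv : ℓ⁻¹ ≤ 1 / 5000 := by
    rw [one_div]; exact inv_anti₀ (by norm_num) hL
  have hαℓ' : α * ℓ ≤ 1 / 5000 := by rw [hαℓ]; exact hℓinv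
  have hα1 : α ≤ 1 / 1000 := by nlinarith only [hα0, hαℓ', hL]
  have hαlam : α * lam ≤ 1 / 5000 := (mul_le_mul_of_nonneg_left (by linarith) hα0.le).trans hαℓ'
  -- the shape of `Ω₂`
  have hs1 : edge D < s.re := by
    have := hs.1
    simp only [sZero, Complex.sub_re, Complex.add_re, Complex.mul_re, Complex.I_re, Complex.I_im,
      Complex.natCast_re, Complex.natCast_im] at this
    norm_num at this
    rw [edge]
    linarith
  have hs2 : s.re < 1 := by
    have := hs.2.1
    simp only [sZero, Complex.sub_re, Complex.add_re, Complex.mul_re, Complex.I_re, Complex.I_im,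
      Complex.natCast_re, Complex.natCast_im] at this
    norm_num at this
    linarith
  have hs3 : |s.im - D| < 1 + 10 * ℓ := by
    have := hs.2.2
    simpa [sZero] using this
  have hedge : edge D = 1 / 2 - α * lam / 10 := rfl
  have hs99 : 99 / 200 ≤ s.re := by rw [hedge] at hs1; linarith
  -- hence the height of `s` is between `1` and `2D`
  have hDℓ : 20 * ℓ + 2 ≤ D := by
    rw [← exp_ell (D := D)]
    have := Real.quadratic_le_exp_of_nonneg hℓ0.le
    nlinarith only [this, hL]
  have him := abs_lt.mp hs3
  have hims : |s.im| ≤ 2 * D := by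
    rw [abs_le]
    constructor <;> linarith
  have him1 : 1 ≤ |s.im| := by
    refine le_trans ?_ (le_abs_self _)
    linarith
  -- lengths
  have hN : ∀ n : ℕ, longLen D < n → Real.exp (2 * H) ≤ n := fun n hn =>
    ((Nat.floor_lt (Real.exp_pos _).le).mp hn).le
  have hM : ((shortLen D : ℕ) : ℝ) ≤ Real.exp (H / 1000) := Nat.floor_le (Real.exp_pos _).le
  have hNle : ((longLen D : ℕ) : ℝ) ≤ Real.exp (2 * H) := Nat.floor_le (Real.exp_pos _).le
  have hM5 : D ^ 5 ≤ shortLen D := by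
    refine Nat.le_floor ?_
    push_cast
    rw [← exp_ell (D := D), ← Real.exp_nat_mul]
    apply Real.exp_le_exp.mpr
    push_cast
    rw [← hℓ]
    nlinarith only [hL]
  have hMN : shortLen D ≤ longLen D := by
    refine Nat.floor_le_floor (Real.exp_le_exp.mpr ?_)
    rw [← hℓ, ← hH]
    linarith
  -- the direct side
  have hdir := norm_lineInt_sub_le P.norm_a P.hasSum_a (s := s) (by linarith) (3 / 2 * H)
    (M := D ^ 5) (N := longLen D) (hM5.trans hMN) (Real.exp_pos _) hN
  rw [sum_eq_dirPoly] at hdir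
  set A := dirPoly (fun n => directCoeff χ n * ψ n) (fun n => Real.log n) (longLen D) s with hA
  have hAle : ‖A‖ ≤ 10 * ℓ * √(directMeanSq χ ψ) := by
    have := norm_dirPoly_le_sqrt (fun n => directCoeff χ n * ψ n) (longLen D)
      (ℓ := fun n => Real.log n) (D := D)
      (fun n hn => Real.log_nonneg (by exact_mod_cast (Finset.mem_Icc.mp hn).1))
      (by linarith) (σ₀ := edge D - α) (u := 0) (z := s) (by linarith)
      (by rw [hedge]; linarith) le_rfl
      (by rw [add_zero, mul_one]; linarith)
    rw [add_zero, mul_one] at this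
    exact this
  set E := (D : ℝ) ^ 10 * Real.exp (-ℓ ^ 2 / 100) with hE
  have hE0 : 0 ≤ E := by positivity
  have hD1 : (1 : ℝ) ≤ D := by linarith
  have hexp20 : Real.exp (-H / 20) ≤ Real.exp (-ℓ ^ 2 / 100) := by
    apply Real.exp_le_exp.mpr
    rw [← hH]
    linarith
  have htiny1 : gaussMoment * tauConst * (((D ^ 5 : ℕ) : ℝ) ^ 2 * Real.exp (1 - 3 / 2 * H) +
      Real.exp (256 + 16 * (3 / 2 * H)) * (Real.exp (2 * H) ^ 15)⁻¹) ≤ c₁ * E := by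
    rw [hc₁, mul_assoc _ _ E]
    refine mul_le_mul_of_nonneg_left ?_ (by positivity)
    rw [add_mul]
    have e1 : ((D ^ 5 : ℕ) : ℝ) ^ 2 = (D : ℝ) ^ 10 := by push_cast; ring
    have e2 : (Real.exp (2 * H) ^ 15)⁻¹ = Real.exp (-(30 * H)) := by
      rw [Real.exp_neg, ← Real.exp_nat_mul]
      norm_num
      ring_nf
    rw [e1, e2]
    refine add_le_add ?_ ?_
    · calc _ = (D : ℝ) ^ 10 * (Real.exp 1 * Real.exp (-(3 / 2 * H))) := by
            rw [← Real.exp_add]; ring_nf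
        _ ≤ (D : ℝ) ^ 10 * (Real.exp 1 * Real.exp (-ℓ ^ 2 / 100)) := by
            gcongr
            rw [← hH]
            linarith
        _ = _ := by rw [hE]; ring
    · calc _ = Real.exp 256 * (1 * Real.exp (-(6 * H))) := by
            rw [one_mul, ← Real.exp_add, ← Real.exp_add]; ring_nf
        _ ≤ Real.exp 256 * ((D : ℝ) ^ 10 * Real.exp (-ℓ ^ 2 / 100)) := by
            gcongr
            · exact one_le_pow₀ hD1
            · rw [← hH]
              linarith
        _ = _ := by rw [hE]
  have hFeq : ∑ n ∈ Finset.Icc 1 (D ^ 5), nu χ n * ψ n / (n : ℂ) ^ s = bigF χ s ψ := rfl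
  rw [hFeq] at hdir
  replace hdir := hdir.trans htiny1
  have hmain := P.eq_lineInt_sub (s := s) (by linarith) hs2.le (3 / 2 * H)
  set L₁ := lineInt (3 / 2 * H) 1 (fun w => DirichletCharacter.LFunction ψ (s + w) *
    DirichletCharacter.LFunction (ψ.mul χ) (s + w)) with hL₁
  set L₂ := lineInt (3 / 2 * H) (-(3 / 2)) (fun w => DirichletCharacter.LFunction ψ (s + w) *
    DirichletCharacter.LFunction (ψ.mul χ) (s + w)) with hL₂
  rw [hmain, calF, bigF_eq_dualPoly]
  set b : ℕ → ℂ := fun n => nu χ n * (star ψ) n with hb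
  have hJ1 := Real.sqrt_nonneg (directMeanSq χ ψ)
  have hJ2 := Real.sqrt_nonneg (shortMeanSq χ ψ)
  have hJ3 := Real.sqrt_nonneg (mediumMeanSq χ ψ)
  have hbigQ : bigQ D = Real.exp H := rfl
  have hbQ0 : 0 < bigQ D := Real.exp_pos _
  set X1 := ℓ * √(directMeanSq χ ψ) with hX1
  set X2 := ℓ * ℓ ^ (1 / 5 : ℝ) * Real.exp (edge D * (ℓ ^ 2 / 1000)) * √(shortMeanSq χ ψ) with hX2
  set X3 := ℓ * lam * bigQ D * √(mediumMeanSq χ ψ) with hX3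
  have hX10 : 0 ≤ X1 := by positivity
  have hX20 : 0 ≤ X2 := by positivity
  have hX30 : 0 ≤ X3 := by positivity
  -- powers of `D` are harmless, since the edge is within `O((log 𝓛) / 𝓛²)` of the critical line
  have hδ' : ∀ x : ℝ, edge D - α ≤ x →
      ((D : ℝ) ^ 4) ^ max 0 (1 / 2 - x) ≤ Real.exp 1 := by
    intro x hx
    rw [← exp_ell (D := D), ← Real.exp_nat_mul, ← Real.exp_mul]
    apply Real.exp_le_exp.mpr
    have : max 0 (1 / 2 - x) ≤ α * lam / 10 + α := by
      refine max_le (by positivity) ?_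
      rw [hedge] at hx
      linarith
    rw [← hℓ]
    push_cast
    have h4 : 4 * ℓ * (α * lam / 10 + α) ≤ 1 := by
      have : ℓ * α = ℓ⁻¹ := by rw [mul_comm]; exact hαℓ
      have h5 : 4 * ℓ * (α * lam / 10 + α) = 4 * (lam / 10 + 1) * (ℓ * α) := by ring
      rw [h5, this, ← div_eq_mul_inv, div_le_one hℓ0]
      linarith
    refine le_trans ?_ h4
    gcongr
  rcases le_total (9 / 10) s.re with h9 | h9
  · -- far to the right both dual terms are negligible
    have hl := P.norm_lineInt_left_le hims h9 hs2
    rw [← hL₂] at hl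
    have hl2 : ‖L₂‖ ≤ c₃ * E := by
      refine hl.trans ?_
      rw [← hc₃, mul_assoc]
      refine mul_le_mul_of_nonneg_left ?_ (by positivity)
      exact mul_le_mul (pow_le_pow_right₀ hD1 (by norm_num)) hexp20 (Real.exp_pos _).le
        (by positivity)
    have hΔ : ‖Delta1 χ s ψ * dualPoly b 0 (D ^ 5) s‖ ≤ c₄ * E := by
      have e1 := P.norm_factor_add_le hims (w := 0) (by simp; linarith) (by simp; linarith)
        (Or.inr (by simpa using him1))
      simp only [add_zero, Complex.zero_re, Complex.zero_im, abs_zero] at e1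
      rw [max_eq_left (by linarith), Real.rpow_zero, mul_one] at e1
      have e2 := norm_dualPoly_le P.norm_b 0 (D ^ 5) (z := s) (by linarith)
      have e3 : ((D ^ 5 : ℕ) : ℝ) ^ (s.re + 1 / 10) ≤ (D : ℝ) ^ 10 := by
        push_cast
        calc ((D : ℝ) ^ 5) ^ (s.re + 1 / 10) ≤ ((D : ℝ) ^ 5) ^ (2 : ℝ) :=
              Real.rpow_le_rpow_of_exponent_le (one_le_pow₀ hD1) (by linarith)
          _ = _ := by rw [Real.rpow_two]; ring
      rw [norm_mul]
      calc _ ≤ C * Real.exp (-ℓ ^ 2 / 100) * (tauConst * (D : ℝ) ^ 10) := by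
            gcongr
            · refine e1.trans ?_
              gcongr
              rw [← hH]
              nlinarith only [hH0, h9]
            · exact e2.trans (by gcongr)
        _ = _ := by rw [hc₄, hE]; ring
    have n1 : ‖L₁ - L₂ - (bigF χ s ψ + Delta1 χ s ψ * dualPoly b 0 (D ^ 5) s)‖ ≤
        ‖L₁ - bigF χ s ψ - A‖ + ‖A‖ + ‖L₂‖ + ‖Delta1 χ s ψ * dualPoly b 0 (D ^ 5) s‖ := by
      have : L₁ - L₂ - (bigF χ s ψ + Delta1 χ s ψ * dualPoly b 0 (D ^ 5) s) =
          (L₁ - bigF χ s ψ - A) + A - L₂ - Delta1 χ s ψ * dualPoly b 0 (D ^ 5) s := by ring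
      rw [this]
      refine (norm_sub_le _ _).trans (add_le_add_left ((norm_sub_le _ _).trans
        (add_le_add_left (norm_add_le _ _) _)) _)
    refine n1.trans ?_
    have : ‖A‖ ≤ 10 * X1 := by rw [hX1]; linarith
    calc _ ≤ c₁ * E + 10 * X1 + c₃ * E + c₄ * E := by linarith
      _ ≤ _ := by
        have hh : 0 ≤ (c₁ + c₂ + c₃ + c₄ + c₅ + c₆) * X1 := by positivity
        have h2 : 0 ≤ (10 + c₁ + c₂ + c₃ + c₄ + c₅ + c₆) * (X2 + X3) := by positivity
        have h3 : 0 ≤ (10 + c₂ + c₅ + c₆) * E := by positivity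
        linarith
  · -- near the critical line the dual sum is divided into three ranges
    have hK : ∀ v : ℝ, ‖dualPoly b (shortLen D) (longLen D) (s + ((-α : ℝ) + v * Complex.I))‖ ≤
        10 * ℓ * √(mediumMeanSq χ ψ) * (1 + |v|) * Real.exp (2 * H * (s.re - α)) := by
      intro v
      set z : ℂ := s + ((-α : ℝ) + v * Complex.I) with hz
      have hzre : z.re = s.re - α := by simp [hz]; ring
      have hzim : z.im = s.im + v := by simp [hz]
      have e1 := norm_dirPoly_le_sqrt (fun n => dualCoeff χ (shortLen D) n * (star ψ) n) (longLen D)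
        (ℓ := fun n => 2 * ℓ ^ 2 - Real.log n) (D := D) (by
          intro n hn
          rw [Finset.mem_Icc] at hn
          have h1 : (1 : ℝ) ≤ n := by exact_mod_cast hn.1
          have h2 : (n : ℝ) ≤ longLen D := by exact_mod_cast hn.2
          have := Real.log_le_log (by linarith) (h2.trans hNle)
          rw [Real.log_exp] at this
          rw [sub_nonneg]
          exact this) (by linarith) (σ₀ := edge D - 2 * α) (u := |v|) (z := z)
        (by rw [hzre]; linarith) (by rw [hzre, hedge]; linarith) (abs_nonneg v) (by
          rw [hzim]
          have h1 : s.im + v - D = (s.im - D) + v := by ring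
          rw [h1]
          have := abs_add_le (s.im - D) v
          have := abs_nonneg v
          nlinarith only [this, hs3, hL, ‹|s.im - D + v| ≤ |s.im - D| + |v|›])
      rw [hb, dualPoly_eq_dirPoly χ (star ψ) _ _ (2 * ℓ ^ 2) z, norm_mul, Complex.norm_exp]
      have e2 : (((2 * ℓ ^ 2 : ℝ) : ℂ) * z).re = 2 * H * (s.re - α) := by
        rw [Complex.re_ofReal_mul, hzre]
      rw [e2, mul_comm]
      refine mul_le_mul_of_nonneg_right (e1.trans (le_of_eq ?_)) (Real.exp_pos _).le
      rw [mediumMeanSq]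
      ring
    have hl := P.norm_lineInt_add_le hims hs99 h9 hMN hM hN hα0 (by linarith) (hδ' _ (by linarith))
      hK
    rw [← hL₂] at hl
    have e1 : Real.log α⁻¹ = 2 * lam := by
      rw [hαe, inv_inv, Real.log_pow]
      norm_num
      rw [hlam]
    have e2 : C * Real.exp 2 * (10 * ℓ * √(mediumMeanSq χ ψ)) * Real.exp H *
        (16 + 8 * Real.log α⁻¹ + gaussMoment) ≤ c₆ * X3 := by
      rw [e1]
      have : 16 + 8 * (2 * lam) + gaussMoment ≤ (32 + gaussMoment) * lam := by
        have := mul_le_mul_of_nonneg_left hlam1 hgM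
        linarith
      calc _ ≤ C * Real.exp 2 * (10 * ℓ * √(mediumMeanSq χ ψ)) * Real.exp H *
            ((32 + gaussMoment) * lam) := by gcongr
        _ = _ := by rw [hc₆, hX3, hbigQ]; ring
    have e3 : gaussMoment * C * tauConst * 60 * Real.exp (-H / 100) ≤ c₂ * E := by
      rw [← hc₂, hE]
      gcongr
      exact le_mul_of_one_le_left (Real.exp_pos _).le (one_le_pow₀ hD1)
    have e4 : gaussMoment * C * tauConst * Real.exp 3 * D ^ 8 * Real.exp (-H / 20) ≤ c₃ * E := by
      rw [← hc₃, mul_assoc]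
      refine mul_le_mul_of_nonneg_left ?_ (by positivity)
      exact mul_le_mul (pow_le_pow_right₀ hD1 (by norm_num)) hexp20 (Real.exp_pos _).le
        (by positivity)
    set B := dualPoly b (D ^ 5) (shortLen D) s with hB
    have hsplit : dualPoly b 0 (shortLen D) s = dualPoly b 0 (D ^ 5) s + B :=
      (dualPoly_add (Nat.zero_le _) hM5 s).symm
    have hΔB : ‖Delta1 χ s ψ * B‖ ≤ c₅ * X2 := by
      have f1 := P.norm_factor_add_le hims (w := 0) (by simp; linarith) (by simp; linarith)
        (Or.inr (by simpa using him1))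
      simp only [add_zero, Complex.zero_re, Complex.zero_im, abs_zero, one_pow, mul_one] at f1
      have f2 := f1.trans (mul_le_mul_of_nonneg_left (hδ' s.re (by linarith)) (by positivity))
      have f3 := norm_dirPoly_le_sqrt (fun n => dualCoeff χ (D ^ 5) n * (star ψ) n) (shortLen D)
        (ℓ := fun n => ℓ ^ 2 / 1000 - Real.log n) (D := D) (by
          intro n hn
          rw [Finset.mem_Icc] at hn
          have h1 : (1 : ℝ) ≤ n := by exact_mod_cast hn.1
          have h2 : (n : ℝ) ≤ shortLen D := by exact_mod_cast hn.2
          have := Real.log_le_log (by linarith) (h2.trans hM)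
          rw [Real.log_exp] at this
          rw [sub_nonneg]
          exact this) (by linarith) (σ₀ := edge D - α) (u := 0) (z := s) (by linarith)
        (by rw [hedge]; linarith) le_rfl
        (by rw [add_zero, mul_one]; linarith)
      rw [add_zero, mul_one] at f3
      rw [hB, hb, dualPoly_eq_dirPoly χ (star ψ) _ _ (ℓ ^ 2 / 1000) s, norm_mul, norm_mul,
        Complex.norm_exp, Complex.re_ofReal_mul]
      -- the product of the exponentials is largest at the left edge of `Ω₂`
      have f4 : Real.exp (H * (1 - 2 * s.re)) * Real.exp (ℓ ^ 2 / 1000 * s.re) ≤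
          ℓ ^ (1 / 5 : ℝ) * Real.exp (edge D * (ℓ ^ 2 / 1000)) := by
        rw [Real.rpow_def_of_pos hℓ0, ← Real.exp_add, ← Real.exp_add]
        apply Real.exp_le_exp.mpr
        rw [← hlam, ← hH]
        have g1 : H * (1 - 2 * edge D) = lam / 5 := by
          rw [hedge]
          linear_combination (lam / 5) * hαH
        nlinarith only [g1, mul_nonneg hH0 (sub_nonneg.mpr hs1.le)]
      calc _ ≤ C * Real.exp (H * (1 - 2 * s.re)) * Real.exp 1 *
            (Real.exp (ℓ ^ 2 / 1000 * s.re) * (10 * ℓ * √(shortMeanSq χ ψ))) := by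
            gcongr
            exact f3
        _ = C * Real.exp 1 * 10 * ℓ * √(shortMeanSq χ ψ) * (Real.exp (H * (1 - 2 * s.re)) *
            Real.exp (ℓ ^ 2 / 1000 * s.re)) := by ring
        _ ≤ C * Real.exp 1 * 10 * ℓ * √(shortMeanSq χ ψ) * (ℓ ^ (1 / 5 : ℝ) *
            Real.exp (edge D * (ℓ ^ 2 / 1000))) := by gcongr
        _ = _ := by rw [hc₅, hX2]; ring
    rw [hsplit] at hl
    have n1 : ‖L₁ - L₂ - (bigF χ s ψ + Delta1 χ s ψ * dualPoly b 0 (D ^ 5) s)‖ ≤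
        ‖L₁ - bigF χ s ψ - A‖ + ‖A‖ +
        ‖L₂ + Delta1 χ s ψ * (dualPoly b 0 (D ^ 5) s + B)‖ + ‖Delta1 χ s ψ * B‖ := by
      have : L₁ - L₂ - (bigF χ s ψ + Delta1 χ s ψ * dualPoly b 0 (D ^ 5) s) =
          (L₁ - bigF χ s ψ - A) + A - (L₂ + Delta1 χ s ψ * (dualPoly b 0 (D ^ 5) s + B)) +
          Delta1 χ s ψ * B := by ring
      rw [this]
      refine (norm_add_le _ _).trans (add_le_add_left ((norm_sub_le _ _).trans
        (add_le_add_left (norm_add_le _ _) _)) _)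
    refine n1.trans ?_
    have : ‖A‖ ≤ 10 * X1 := by rw [hX1]; linarith
    calc _ ≤ c₁ * E + 10 * X1 + (c₂ * E + c₆ * X3 + c₃ * E) + c₅ * X2 := by linarith
      _ ≤ _ := by
        have hh : 0 ≤ (c₁ + c₂ + c₃ + c₄ + c₅ + c₆) * X1 := by positivity
        have h2 : 0 ≤ (10 + c₁ + c₂ + c₃ + c₄ + c₆) * X2 := by positivity
        have h4 : 0 ≤ (10 + c₁ + c₂ + c₃ + c₄ + c₅) * X3 := by positivity
        have h3 : 0 ≤ (10 + c₄ + c₅ + c₆) * E := by positivity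
        linarith

/-! ### Mean values of the coefficients under the hypothesis on `L(1, χ)` -/

open Filter Topology in
/-- The errors from the Pólya–Vinogradov inequality are below `𝓛⁻¹⁸`. -/
lemma exists_tiny_tail : ∃ L₀ : ℝ, 5000 ≤ L₀ ∧ ∀ ℓ : ℝ, L₀ ≤ ℓ →
    2 * Real.exp (-ℓ / 16) + (1 + 4 * ℓ ^ 2) * (2 * (1 + ℓ) * Real.exp (-ℓ / 16)) ≤
      (ℓ ^ 18)⁻¹ := by
  have h1 : Tendsto (fun ℓ : ℝ => (ℓ / 16) ^ 21 * Real.exp (-(ℓ / 16))) atTop (𝓝 0) :=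
    (Real.tendsto_pow_mul_exp_neg_atTop_nhds_zero 21).comp
      (tendsto_id.atTop_div_const (by norm_num))
  obtain ⟨L₁, hL₁⟩ := eventually_atTop.mp (h1.eventually (gt_mem_nhds (by positivity :
    (0 : ℝ) < 1 / (100 * 16 ^ 21))))
  refine ⟨max 5000 L₁, le_max_left _ _, fun ℓ hℓ => ?_⟩
  have h2 := hL₁ ℓ ((le_max_right _ _).trans hℓ)
  have h3 : 5000 ≤ ℓ := (le_max_left _ _).trans hℓ
  rw [← neg_div, div_pow, lt_div_iff₀ (by positivity)] at h2
  set E := Real.exp (-ℓ / 16) with hE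
  have hE0 : 0 < E := Real.exp_pos _
  rw [← one_div, le_div_iff₀ (by positivity)]
  have h4 : 2 * E + (1 + 4 * ℓ ^ 2) * (2 * (1 + ℓ) * E) ≤ 100 * (ℓ ^ 3 * E) := by
    have : 2 + (1 + 4 * ℓ ^ 2) * (2 * (1 + ℓ)) ≤ 100 * ℓ ^ 3 := by nlinarith [sq_nonneg ℓ]
    calc _ = (2 + (1 + 4 * ℓ ^ 2) * (2 * (1 + ℓ))) * E := by ring
      _ ≤ 100 * ℓ ^ 3 * E := by gcongr
      _ = _ := by ring
  calc _ ≤ 100 * (ℓ ^ 3 * E) * ℓ ^ 18 := by gcongr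
    _ = 100 * (ℓ ^ 21 * E) := by ring
    _ = ℓ ^ 21 / 16 ^ 21 * E * (100 * 16 ^ 21) := by field_simp
    _ ≤ 1 := h2.le

lemma logSum_anti {f : ArithmeticFunction ℝ} (hf : ∀ n, 0 ≤ f n) {x y : ℝ} (h : x ≤ y) (N : ℕ) :
    logSum f y N ≤ logSum f x N := by
  refine Finset.sum_le_sum fun n _ => ?_
  by_cases h1 : y < n
  · rw [if_pos h1, if_pos (h.trans_lt h1)]
  · rw [if_neg h1]
    split_ifs
    · exact div_nonneg (hf n) (by positivity)
    · exact le_rfl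

/-- Beyond `D^(5/8)` the function `ν` is small on average when `L(1, χ)` is small. -/
lemma exists_logSum_nuR_tail_le : ∃ L₀ : ℝ, 5000 ≤ L₀ ∧ ∀ (D : ℕ) [NeZero D]
    (χ : DirichletCharacter ℂ D), χ.IsPrimitive → χ.IsQuadratic → A1 χ → L₀ ≤ ell D → ∀ N : ℕ,
    Real.exp (5 / 8 * ell D) ≤ N → Real.log N ≤ 2 * ell D ^ 2 →
    logSum (nuR χ) (Real.exp (5 / 8 * ell D)) N ≤
      (ell D ^ 17)⁻¹ * (Real.log (ell D))⁻¹ * (Real.log N + 1) := by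
  obtain ⟨L₀, hL₀, htiny⟩ := exists_tiny_tail
  refine ⟨L₀, hL₀, ?_⟩
  intro D _ χ hχp hχ hA hL N hN hNlog
  have hA' : (DirichletCharacter.LFunction χ 1).re < (ell D ^ 17)⁻¹ * (Real.log (ell D))⁻¹ := hA
  set ℓ := ell D with hℓ
  have hℓ5 : 5000 ≤ ℓ := hL₀.trans hL
  have hDe : Real.exp ℓ = D := exp_ell
  have hD1 : 1 < D := by
    have : (1 : ℝ) < D := by rw [← hDe]; linarith [Real.add_one_le_exp ℓ]
    exact_mod_cast this
  have hχ1 : χ ≠ 1 := ne_one_of_isPrimitive hχp (by omega)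
  set y := ⌊Real.exp (9 / 16 * ℓ)⌋₊ with hy
  have hyle : (y : ℝ) ≤ Real.exp (9 / 16 * ℓ) := Nat.floor_le (Real.exp_pos _).le
  have hylt : Real.exp (9 / 16 * ℓ) < y + 1 := Nat.lt_floor_add_one _
  have he2 : 2 ≤ Real.exp (9 / 16 * ℓ) := by linarith [Real.add_one_le_exp (9 / 16 * ℓ)]
  have hyge : Real.exp (9 / 16 * ℓ) / 2 ≤ y := by linarith
  have hy1 : 1 ≤ y := by
    have : (0 : ℝ) < y := by linarith
    exact_mod_cast this
  have hlam1 : 1 ≤ Real.log ℓ := by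
    rw [Real.le_log_iff_exp_le (by linarith)]
    linarith [Real.exp_one_lt_d9]
  have hlamle : Real.log ℓ ≤ ℓ := by
    linarith [Real.log_le_sub_one_of_pos (show 0 < ℓ by linarith)]
  have hmain := logSum_nuR_le hχ hχ1 (polya_vinogradov hχp hD1) (x := Real.exp (5 / 8 * ℓ)) hy1
    (hyle.trans (Real.exp_le_exp.mpr (by linarith))) hN
  refine hmain.trans ?_
  have hX := Real.exp_pos (5 / 8 * ℓ)
  have hNX : 1 ≤ (N : ℝ) / Real.exp (5 / 8 * ℓ) := (one_le_div hX).mpr hN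
  have hN0 : (0 : ℝ) < N := hX.trans_le hN
  have t1 : (DirichletCharacter.LFunction χ 1).re * Real.log (N / Real.exp (5 / 8 * ℓ)) ≤
      (ℓ ^ 17)⁻¹ * (Real.log ℓ)⁻¹ * Real.log N := by
    have h0 := Real.log_nonneg hNX
    refine (mul_le_mul_of_nonneg_right hA'.le h0).trans ?_
    gcongr
    exact div_le_self hN0.le (Real.one_le_exp (by linarith))
  have t2 : 2 * (y : ℝ) / Real.exp (5 / 8 * ℓ) ≤ 2 * Real.exp (-ℓ / 16) := by
    rw [div_le_iff₀ hX, mul_assoc, ← Real.exp_add]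
    refine mul_le_mul_of_nonneg_left (hyle.trans (le_of_eq ?_)) (by norm_num)
    congr 1
    ring
  have hsq : √(D : ℝ) = Real.exp (ℓ / 2) := by
    rw [← hDe, Real.exp_half]
  have hlogD : Real.log D = ℓ := rfl
  have t3 : √(D : ℝ) * (1 + Real.log D) / y ≤ 2 * (1 + ℓ) * Real.exp (-ℓ / 16) := by
    rw [hsq, hlogD, div_le_iff₀ (by linarith)]
    have e1 : Real.exp (ℓ / 2) = Real.exp (-ℓ / 16) * Real.exp (9 / 16 * ℓ) := by
      rw [← Real.exp_add]; congr 1; ring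
    calc _ = (1 + ℓ) * Real.exp (-ℓ / 16) * Real.exp (9 / 16 * ℓ) := by rw [e1]; ring
      _ ≤ (1 + ℓ) * Real.exp (-ℓ / 16) * (2 * y) := by
        gcongr
        linarith
      _ = _ := by ring
  have t4 : (1 + 2 * Real.log N) * (√(D : ℝ) * (1 + Real.log D) / y) ≤
      (1 + 4 * ℓ ^ 2) * (2 * (1 + ℓ) * Real.exp (-ℓ / 16)) := by
    refine mul_le_mul (by linarith) t3 (by rw [hlogD]; positivity) (by positivity)
  have t5 : (ℓ ^ 18)⁻¹ ≤ (ℓ ^ 17)⁻¹ * (Real.log ℓ)⁻¹ := by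
    rw [← mul_inv]
    refine inv_anti₀ (by positivity) ?_
    calc ℓ ^ 17 * Real.log ℓ ≤ ℓ ^ 17 * ℓ := by gcongr
      _ = ℓ ^ 18 := by ring
  have t6 := htiny ℓ hL
  linarith

/-- The three mean values of coefficients that enter the proof. -/
lemma exists_energy_le : ∃ L₀ C : ℝ, 5000 ≤ L₀ ∧ 0 < C ∧ ∀ (D : ℕ) [NeZero D]
    (χ : DirichletCharacter ℂ D), χ.IsPrimitive → χ.IsQuadratic → A1 χ → L₀ ≤ ell D →
    (∑ n ∈ Finset.Icc 1 (D ^ 5), nuR χ n ^ 2 / n ≤ C * ell D ^ 4) ∧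
    (∑ n ∈ Finset.Icc 1 (D ^ 10), (if D ^ 5 < n then (nuR χ ^ 2) n ^ 2 / n else 0) ≤
      C * (ell D ^ 2)⁻¹ * (Real.log (ell D))⁻¹) ∧
    (∑ n ∈ Finset.Icc 1 (longLen D), (if D ^ 5 < n then nuR χ n ^ 2 / n else 0) ≤
      C * (ell D ^ 13)⁻¹ * (Real.log (ell D))⁻¹) := by
  obtain ⟨L₀, hL₀, htail⟩ := exists_logSum_nuR_tail_le
  refine ⟨L₀, 8 * 11 ^ 15, hL₀, by norm_num, ?_⟩
  intro D _ χ hχp hχ hA hL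
  have ht := htail D χ hχp hχ hA hL
  set ℓ := ell D with hℓ
  have hℓ5 : 5000 ≤ ℓ := hL₀.trans hL
  have hℓ0 : 0 < ℓ := by linarith
  have hDe : Real.exp ℓ = D := exp_ell
  have hf := nuR_nonneg hχ
  have hlam1 : 1 ≤ Real.log ℓ := by
    rw [Real.le_log_iff_exp_le (by linarith)]
    linarith [Real.exp_one_lt_d9]
  have hlinv : (Real.log ℓ)⁻¹ ≤ 1 := inv_le_one_of_one_le₀ hlam1
  have hlinv0 : 0 < (Real.log ℓ)⁻¹ := by positivity
  have hpow : ∀ k : ℕ, ((D ^ k : ℕ) : ℝ) = Real.exp (k * ℓ) := fun k => by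
    push_cast
    rw [← hDe, ← Real.exp_nat_mul]
  have hlogpow : ∀ k : ℕ, Real.log ((D ^ k : ℕ) : ℝ) = k * ℓ := fun k => by
    rw [hpow, Real.log_exp]
  have hsq2 : ∀ n, nuR χ n ^ 2 ≤ (nuR χ ^ 2) n := fun n => by
    have := nuR_pow_sq_le hχ (a := 1) (b := 2) one_ne_zero (by norm_num) n
    rwa [pow_one] at this
  have h1ℓ : ∀ k : ℝ, 0 ≤ k → 1 + k * ℓ ≤ (1 + k) * ℓ := fun k hk => by nlinarith
  refine ⟨?_, ?_, ?_⟩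
  · have e1 : ∑ n ∈ Finset.Icc 1 (D ^ 5), nuR χ n ^ 2 / n ≤ logSum (nuR χ ^ (1 + 1)) 0 (D ^ 5) := by
      rw [logSum_zero]
      refine Finset.sum_le_sum fun n _ => ?_
      gcongr
      exact hsq2 n
    refine e1.trans ((logSum_pow_zero_le hf 1 _).trans ?_)
    have e2 := logSum_nuR_trivial hχ (D ^ 5)
    rw [hlogpow] at e2
    have e3 := h1ℓ 5 (by norm_num)
    calc _ ≤ ((1 + (5 : ℕ) * ℓ) ^ 2) ^ (1 + 1) := by
          gcongr
          exact logSum_nonneg hf _ _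
      _ ≤ ((6 * ℓ) ^ 2) ^ (1 + 1) := by
          gcongr
          push_cast
          linarith
      _ = 6 ^ 4 * ℓ ^ 4 := by ring
      _ ≤ _ := by gcongr; norm_num
  · have e1 : ∑ n ∈ Finset.Icc 1 (D ^ 10), (if D ^ 5 < n then (nuR χ ^ 2) n ^ 2 / n else 0) ≤
        logSum (nuR χ ^ (7 + 1)) (Real.exp (5 / 8 * ℓ) ^ (7 + 1)) (D ^ 10) := by
      refine Finset.sum_le_sum fun n _ => ?_
      have e2 : Real.exp (5 / 8 * ℓ) ^ (7 + 1) = ((D ^ 5 : ℕ) : ℝ) := by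
        rw [hpow, ← Real.exp_nat_mul]
        congr 1
        push_cast
        ring
      rw [e2]
      simp only [Nat.cast_lt]
      split_ifs
      · gcongr
        exact nuR_pow_sq_le hχ (a := 2) (b := 7 + 1) two_ne_zero (by norm_num) n
      · exact le_rfl
    refine e1.trans ((logSum_pow_le hf (Real.exp_pos _).le 7 _).trans ?_)
    have e2 := logSum_nuR_trivial hχ (D ^ 10)
    have e3 := ht (D ^ 10) (by
      rw [hpow]
      apply Real.exp_le_exp.mpr
      push_cast
      linarith) (by
      rw [hlogpow]
      push_cast
      nlinarith)
    rw [hlogpow] at e2 e3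
    push_cast at e2 e3 ⊢
    have e4 := h1ℓ 10 (by norm_num)
    have h0 := logSum_nonneg hf 0 (D ^ 10)
    have h0' := logSum_nonneg hf (Real.exp (5 / 8 * ℓ)) (D ^ 10)
    calc _ ≤ (7 + 1) * ((1 + 10 * ℓ) ^ 2) ^ 7 * ((ℓ ^ 17)⁻¹ * (Real.log ℓ)⁻¹ * (10 * ℓ + 1)) := by
          gcongr
      _ ≤ (7 + 1) * ((11 * ℓ) ^ 2) ^ 7 * ((ℓ ^ 17)⁻¹ * (Real.log ℓ)⁻¹ * (11 * ℓ)) := by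
          gcongr <;> linarith
      _ = _ := by
          field_simp
          norm_num
  · have hNle : ((longLen D : ℕ) : ℝ) ≤ Real.exp (2 * ℓ ^ 2) := Nat.floor_le (Real.exp_pos _).le
    have hDN : D ≤ longLen D := by
      refine Nat.le_floor ?_
      rw [← hDe]
      apply Real.exp_le_exp.mpr
      nlinarith
    have hDN' : (D : ℝ) ≤ longLen D := by exact_mod_cast hDN
    have hD0 : (0 : ℝ) < D := by rw [← hDe]; exact Real.exp_pos _
    have hXD : Real.exp (5 / 8 * ℓ) ≤ D := by
      rw [← hDe]
      apply Real.exp_le_exp.mpr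
      linarith
    have hlogN : Real.log (longLen D) ≤ 2 * ℓ ^ 2 := by
      have := Real.log_le_log (hD0.trans_le hDN') hNle
      rwa [Real.log_exp] at this
    have e3 := ht (longLen D) (hXD.trans hDN') hlogN
    have e5 : logSum (nuR χ) (Real.exp (5 / 8 * ℓ)) (longLen D) ≤
        (ℓ ^ 17)⁻¹ * (Real.log ℓ)⁻¹ * (3 * ℓ ^ 2) := by
      refine e3.trans ?_
      gcongr
      nlinarith
    have e6 : logSum (nuR χ) (Real.exp (5 / 8 * ℓ)) (longLen D) ≤ 1 := by
      refine e5.trans ?_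
      have : (ℓ ^ 17)⁻¹ * (Real.log ℓ)⁻¹ * (3 * ℓ ^ 2) ≤ (ℓ ^ 17)⁻¹ * 1 * (ℓ ^ 15 * ℓ ^ 2) := by
        gcongr
        calc (3 : ℝ) ≤ ℓ := by linarith
          _ ≤ ℓ ^ 15 := le_self_pow₀ (by linarith) (by norm_num)
      refine this.trans (le_of_eq ?_)
      field_simp
    have e7 : logSum (nuR χ) 0 (longLen D) ≤ 2 * ℓ ^ 2 := by
      have s1 := logSum_split hf D (longLen D)
      have s2 := logSum_anti hf hXD (longLen D)
      have s3 := logSum_nuR_trivial hχ D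
      have hlogD : Real.log D = ℓ := rfl
      rw [hlogD] at s3
      nlinarith
    have e1 : ∑ n ∈ Finset.Icc 1 (longLen D), (if D ^ 5 < n then nuR χ n ^ 2 / n else 0) ≤
        logSum (nuR χ ^ (1 + 1)) (Real.exp (5 / 2 * ℓ) ^ (1 + 1)) (longLen D) := by
      refine Finset.sum_le_sum fun n _ => ?_
      have e2 : Real.exp (5 / 2 * ℓ) ^ (1 + 1) = ((D ^ 5 : ℕ) : ℝ) := by
        rw [hpow, ← Real.exp_nat_mul]
        congr 1
        push_cast
        ring
      rw [e2]
      simp only [Nat.cast_lt]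
      split_ifs
      · gcongr
        exact hsq2 n
      · exact le_rfl
    refine e1.trans ((logSum_pow_le hf (Real.exp_pos _).le 1 _).trans ?_)
    have e8 : logSum (nuR χ) (Real.exp (5 / 2 * ℓ)) (longLen D) ≤
        (ℓ ^ 17)⁻¹ * (Real.log ℓ)⁻¹ * (3 * ℓ ^ 2) :=
      (logSum_anti hf (Real.exp_le_exp.mpr (by linarith)) _).trans e5
    have h0 := logSum_nonneg hf 0 (longLen D)
    have h0' := logSum_nonneg hf (Real.exp (5 / 2 * ℓ)) (longLen D)
    calc _ ≤ ((1 : ℕ) + 1) * (2 * ℓ ^ 2) ^ 1 * ((ℓ ^ 17)⁻¹ * (Real.log ℓ)⁻¹ * (3 * ℓ ^ 2)) := by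
          gcongr
      _ = 12 * (ℓ ^ 13)⁻¹ * (Real.log ℓ)⁻¹ := by
          field_simp
          norm_num
      _ ≤ _ := by gcongr; norm_num

/-! ### Counting the characters with a large mean square -/

/-- The large sieve, integrated along a vertical line and combined with Chebyshev's inequality.
The values `u p n` stand for `ψ(n)` or for `ψ̄(n)`. -/
lemma card_lt_meanSq_le_of_largeSieve {ι : Type*} [DecidableEq ι] (F : Finset ι) (u : ι → ℕ → ℂ)
    {N : ℕ} {A : ℝ} (hA : 0 ≤ A)
    (hu : ∀ a : ℕ → ℂ, ∑ p ∈ F, ‖∑ n ∈ Finset.Icc 1 N, a n * u p n‖ ^ 2 ≤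
      A * ∑ n ∈ Finset.Icc 1 N, ‖a n‖ ^ 2)
    (c : ℕ → ℂ) (ℓ : ℕ → ℝ) (σ₀ t₀ : ℝ) {T V E : ℝ} (hT : 0 < T) (hV : 0 < V)
    (hE : ∑ n ∈ Finset.Icc 1 N, ‖c n‖ ^ 2 * Real.exp (-2 * σ₀ * ℓ n) ≤ E)
    [DecidablePred fun p => V < meanSq σ₀ t₀ T (dirPoly (fun n => c n * u p n) ℓ N)] :
    ((F.filter fun p => V < meanSq σ₀ t₀ T (dirPoly (fun n => c n * u p n) ℓ N)).card : ℝ) ≤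
      Real.pi * T * (A * E) / V := by
  refine card_filter_lt_le F _ (fun p _ => meanSq_nonneg _ _ _ _) hV
    (sum_meanSq_le F (fun p n => c n * u p n) ℓ N σ₀ t₀ hT fun y => ?_)
  refine le_trans (le_of_eq ?_) ((hu fun n => c n * Complex.exp (-(σ₀ + y * Complex.I) * ℓ n)).trans
    (mul_le_mul_of_nonneg_left (le_trans (le_of_eq ?_) hE) hA))
  · refine Finset.sum_congr rfl fun p _ => ?_
    rw [dirPoly]
    congr 2
    exact Finset.sum_congr rfl fun n _ => by ring
  · refine Finset.sum_congr rfl fun n _ => ?_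
    rw [norm_mul, mul_pow, Complex.norm_exp, ← Real.exp_nat_mul]
    congr 2
    simp
    ring

lemma largeSieve_const_le {R : ℝ} {N : ℕ} (hN : (N : ℝ) ≤ R ^ 2) {T E V : ℝ} (hT : 0 < T)
    (hE : 0 ≤ E) (hV : 0 < V) :
    Real.pi * T * (((2 * R) ^ 2 + 4 * Real.pi * N) * E) / V ≤ 60 * T * R ^ 2 * E / V := by
  have hpi := Real.pi_lt_d2
  have hpi0 := Real.pi_pos
  have h1 : Real.pi * ((2 * R) ^ 2 + 4 * Real.pi * N) ≤ 60 * R ^ 2 := by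
    calc Real.pi * ((2 * R) ^ 2 + 4 * Real.pi * N)
        ≤ 3.15 * ((2 * R) ^ 2 + 4 * 3.15 * R ^ 2) := by gcongr
      _ ≤ 60 * R ^ 2 := by nlinarith [sq_nonneg R]
  refine div_le_div_of_nonneg_right ?_ hV.le
  calc _ = Real.pi * ((2 * R) ^ 2 + 4 * Real.pi * N) * (T * E) := by ring
    _ ≤ 60 * R ^ 2 * (T * E) := by gcongr
    _ = _ := by ring

open Classical in
lemma card_lt_meanSq_le {R : ℝ} (F : Finset (Σ q : ℕ+, DirichletCharacter ℂ (q : ℕ)))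
    (hF : ∀ p ∈ F, p.2.IsPrimitive ∧ ((p.1 : ℕ) : ℝ) ≤ 2 * R) {N : ℕ} (hN : 1 ≤ N)
    (hNR : (N : ℝ) ≤ R ^ 2) (c : ℕ → ℂ) (ℓ : ℕ → ℝ) (σ₀ t₀ : ℝ) {T V E : ℝ} (hT : 0 < T)
    (hV : 0 < V) (hE : ∑ n ∈ Finset.Icc 1 N, ‖c n‖ ^ 2 * Real.exp (-2 * σ₀ * ℓ n) ≤ E) :
    ((F.filter fun p => V < meanSq σ₀ t₀ T (dirPoly (fun n => c n * p.2 n) ℓ N)).card : ℝ) ≤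
      60 * T * R ^ 2 * E / V :=
  (card_lt_meanSq_le_of_largeSieve F (fun p n => p.2 n) (by positivity)
    (fun a => large_sieve F hF a hN) c ℓ σ₀ t₀ hT hV hE).trans
    (largeSieve_const_le hNR hT ((Finset.sum_nonneg fun n _ => by positivity).trans hE) hV)

open Classical in
lemma card_lt_meanSq_star_le {R : ℝ} (F : Finset (Σ q : ℕ+, DirichletCharacter ℂ (q : ℕ)))
    (hF : ∀ p ∈ F, p.2.IsPrimitive ∧ ((p.1 : ℕ) : ℝ) ≤ 2 * R) {N : ℕ} (hN : 1 ≤ N)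
    (hNR : (N : ℝ) ≤ R ^ 2) (c : ℕ → ℂ) (ℓ : ℕ → ℝ) (σ₀ t₀ : ℝ) {T V E : ℝ} (hT : 0 < T)
    (hV : 0 < V) (hE : ∑ n ∈ Finset.Icc 1 N, ‖c n‖ ^ 2 * Real.exp (-2 * σ₀ * ℓ n) ≤ E) :
    ((F.filter fun p => V < meanSq σ₀ t₀ T (dirPoly (fun n => c n * (star p.2) n) ℓ N)).card : ℝ) ≤
      60 * T * R ^ 2 * E / V :=
  (card_lt_meanSq_le_of_largeSieve F (fun p n => (star p.2) n) (by positivity)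
    (fun a => large_sieve_star F hF a hN) c ℓ σ₀ t₀ hT hV hE).trans
    (largeSieve_const_le hNR hT ((Finset.sum_nonneg fun n _ => by positivity).trans hE) hV)

lemma exp_neg_mul_log_le {δ a : ℝ} (hδ : 0 ≤ δ) {n : ℕ} (hn : 1 ≤ n) (ha : Real.log n ≤ a) :
    Real.exp (-2 * (1 / 2 - δ) * Real.log n) ≤ Real.exp (2 * δ * a) / n := by
  have hn0 : (0 : ℝ) < n := by exact_mod_cast hn
  rw [le_div_iff₀ hn0]
  nth_rw 2 [← Real.exp_log hn0]
  rw [← Real.exp_add]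
  apply Real.exp_le_exp.mpr
  nlinarith

section Lengths

variable {D : ℕ}

lemma log_le_of_le_pow [NeZero D] {n k : ℕ} (hn : 1 ≤ n) (h : n ≤ D ^ k) :
    Real.log n ≤ k * ell D := by
  have hn0 : (0 : ℝ) < n := by exact_mod_cast hn
  rw [Real.log_le_iff_le_exp hn0, Real.exp_nat_mul, exp_ell]
  exact_mod_cast h

lemma pow_eq_exp [NeZero D] (k : ℕ) : ((D ^ k : ℕ) : ℝ) = Real.exp (k * ell D) := by
  rw [Real.exp_nat_mul, exp_ell, Nat.cast_pow]

lemma bigQ_sq : bigQ D ^ 2 = Real.exp (2 * ell D ^ 2) := by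
  rw [bigQ, ← Real.exp_nat_mul]
  norm_num

lemma pow_le_bigQ_sq [NeZero D] {k : ℕ} (hk : k ≤ 10) (hL : 5000 ≤ ell D) :
    ((D ^ k : ℕ) : ℝ) ≤ bigQ D ^ 2 := by
  rw [pow_eq_exp, bigQ_sq]
  apply Real.exp_le_exp.mpr
  have : (k : ℝ) ≤ 10 := by exact_mod_cast hk
  nlinarith

lemma longLen_le : (longLen D : ℝ) ≤ bigQ D ^ 2 := by
  rw [bigQ_sq]
  exact Nat.floor_le (Real.exp_pos _).le

lemma shortLen_le_longLen : shortLen D ≤ longLen D := by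
  refine Nat.floor_le_floor (Real.exp_le_exp.mpr ?_)
  nlinarith [sq_nonneg (ell D)]

lemma one_le_shortLen : 1 ≤ shortLen D := by
  refine Nat.le_floor ?_
  rw [Nat.cast_one]
  exact Real.one_le_exp (by positivity)

lemma pow_five_le_shortLen [NeZero D] (hL : 5000 ≤ ell D) : D ^ 5 ≤ shortLen D := by
  refine Nat.le_floor ?_
  rw [pow_eq_exp]
  apply Real.exp_le_exp.mpr
  push_cast
  nlinarith

lemma le_log_of_shortLen_lt {n : ℕ} (h : shortLen D < n) : ell D ^ 2 / 1000 ≤ Real.log n := by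
  have h1 := (Nat.floor_lt (Real.exp_pos _).le).mp h
  rw [Real.le_log_iff_exp_le ((Real.exp_pos _).trans h1)]
  exact h1.le

lemma log_le_of_le_longLen {n : ℕ} (hn : 1 ≤ n) (h : n ≤ longLen D) :
    Real.log n ≤ 2 * ell D ^ 2 := by
  have hn0 : (0 : ℝ) < n := by exact_mod_cast hn
  rw [Real.log_le_iff_le_exp hn0]
  exact (Nat.le_floor_iff (Real.exp_pos _).le).mp h

lemma one_le_log_ell (hL : 5000 ≤ ell D) : 1 ≤ Real.log (ell D) := by
  rw [Real.le_log_iff_exp_le (by linarith)]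
  linarith [Real.exp_one_lt_d9]

end Lengths

/-! ### The exceptional characters -/

lemma exp_zpow_neg_two (x : ℝ) : Real.exp x ^ (-2 : ℤ) = Real.exp (-2 * x) := by
  rw [zpow_neg, zpow_ofNat, ← Real.exp_nat_mul, ← Real.exp_neg]
  congr 1
  push_cast
  ring

section Counts

variable {D : ℕ} {χ : DirichletCharacter ℂ D}
  {F : Finset (Σ q : ℕ+, DirichletCharacter ℂ (q : ℕ))}

open Classical in
/-- The characters for which `F` or `G` has a large mean square. On `n ≤ D⁵` the line
`Re s = 1/2 - 3/𝓛` costs only the constant factor `exp 30` in the energy. -/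
lemma card_short_poly_le [NeZero D] (hL : 5000 ≤ ell D)
    (hF : ∀ p ∈ F, p.2.IsPrimitive ∧ ((p.1 : ℕ) : ℝ) ≤ 2 * bigQ D) {C : ℝ} (hC : 0 < C)
    (hE : ∑ n ∈ Finset.Icc 1 (D ^ 5), nuR χ n ^ 2 / n ≤ C * ell D ^ 4)
    {c : ℕ → ℂ} (hc : ∀ n, ‖c n‖ ≤ nuR χ n) :
    ((F.filter fun p => ell D ^ 5 * Real.log (ell D) ^ 2 / 4800 <
      meanSq (1 / 2 - 3 / ell D) D (ell D)
      (dirPoly (fun n => c n * p.2 n) (fun n => Real.log n) (D ^ 5))).card : ℝ) ≤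
      288000 * Real.exp 30 * C * (Real.log (ell D))⁻¹ * bigQ D ^ 2 := by
  set ℓ := ell D with hℓ
  have hℓ0 : 0 < ℓ := by linarith
  have hl1 := one_le_log_ell hL
  rw [← hℓ] at hl1
  set l := Real.log ℓ with hl
  have hl0 : 0 < l := by linarith
  have h := card_lt_meanSq_le F hF (N := D ^ 5) (Nat.one_le_pow _ _ (NeZero.pos D))
    (pow_le_bigQ_sq (by norm_num) hL) c (fun n => Real.log n) (1 / 2 - 3 / ℓ) D hℓ0
    (V := ℓ ^ 5 * l ^ 2 / 4800) (E := Real.exp 30 * (C * ℓ ^ 4)) (by positivity) ?_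
  · refine h.trans ?_
    have e : 60 * ℓ * bigQ D ^ 2 * (Real.exp 30 * (C * ℓ ^ 4)) / (ℓ ^ 5 * l ^ 2 / 4800) =
        288000 * Real.exp 30 * C * bigQ D ^ 2 * (l⁻¹ * l⁻¹) := by
      field_simp
      ring
    rw [e]
    have : l⁻¹ * l⁻¹ ≤ l⁻¹ * 1 := by
      gcongr
      exact inv_le_one_of_one_le₀ hl1
    calc _ ≤ 288000 * Real.exp 30 * C * bigQ D ^ 2 * (l⁻¹ * 1) := by gcongr
      _ = _ := by ring
  · refine le_trans ?_ (mul_le_mul_of_nonneg_left hE (Real.exp_pos 30).le)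
    rw [Finset.mul_sum]
    refine Finset.sum_le_sum fun n hn => ?_
    obtain ⟨h1, h2⟩ := Finset.mem_Icc.mp hn
    have h3 := exp_neg_mul_log_le (δ := 3 / ℓ) (by positivity) h1 (log_le_of_le_pow h1 h2)
    have e : 2 * (3 / ℓ) * (((5 : ℕ) : ℝ) * ell D) = 30 := by
      rw [← hℓ]
      field_simp
      ring
    rw [e] at h3
    have h4 : ‖c n‖ ^ 2 ≤ nuR χ n ^ 2 := by
      gcongr
      exact hc n
    calc _ ≤ nuR χ n ^ 2 * (Real.exp 30 / n) := by gcongr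
      _ = _ := by ring

open Classical in
/-- The characters for which `F G - 1` has a large mean square. On `n ≤ D¹⁰` the line
`Re s = 1/2 - 3/𝓛` costs only the constant factor `exp 60` in the energy. -/
lemma card_product_le [NeZero D] (hL : 5000 ≤ ell D)
    (hF : ∀ p ∈ F, p.2.IsPrimitive ∧ ((p.1 : ℕ) : ℝ) ≤ 2 * bigQ D) {C : ℝ}
    (hE : ∑ n ∈ Finset.Icc 1 (D ^ 10), (if D ^ 5 < n then (nuR χ ^ 2) n ^ 2 / n else 0) ≤
      C * (ell D ^ 2)⁻¹ * (Real.log (ell D))⁻¹)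
    {c : ℕ → ℂ} (hc : ∀ n, ‖c n‖ ≤ if D ^ 5 < n then (nuR χ ^ 2) n else 0) :
    ((F.filter fun p => 1 / (4800 * ell D) < meanSq (1 / 2 - 3 / ell D) D (ell D)
      (dirPoly (fun n => c n * p.2 n) (fun n => Real.log n) (D ^ 10))).card : ℝ) ≤
      288000 * Real.exp 60 * C * (Real.log (ell D))⁻¹ * bigQ D ^ 2 := by
  set ℓ := ell D with hℓ
  have hℓ0 : 0 < ℓ := by linarith
  set l := Real.log ℓ with hl
  have h := card_lt_meanSq_le F hF (N := D ^ 10) (Nat.one_le_pow _ _ (NeZero.pos D))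
    (pow_le_bigQ_sq (by norm_num) hL) c (fun n => Real.log n) (1 / 2 - 3 / ℓ) D hℓ0
    (V := 1 / (4800 * ℓ)) (E := Real.exp 60 * (C * (ℓ ^ 2)⁻¹ * l⁻¹)) (by positivity) ?_
  · refine h.trans (le_of_eq ?_)
    field_simp
    ring
  · refine le_trans ?_ (mul_le_mul_of_nonneg_left hE (Real.exp_pos 60).le)
    rw [Finset.mul_sum]
    refine Finset.sum_le_sum fun n hn => ?_
    obtain ⟨h1, h2⟩ := Finset.mem_Icc.mp hn
    have h3 := exp_neg_mul_log_le (δ := 3 / ℓ) (by positivity) h1 (log_le_of_le_pow h1 h2)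
    have e : 2 * (3 / ℓ) * (((10 : ℕ) : ℝ) * ell D) = 60 := by
      rw [← hℓ]
      field_simp
      ring
    rw [e] at h3
    have h4 := hc n
    split_ifs at h4 ⊢ with h5
    · have h6 : ‖c n‖ ^ 2 ≤ (nuR χ ^ 2) n ^ 2 := by gcongr
      calc _ ≤ (nuR χ ^ 2) n ^ 2 * (Real.exp 60 / n) := by gcongr
        _ = _ := by ring
    · rw [norm_le_zero_iff.mp h4]
      simp

open Classical in
/-- The characters for which the direct sum has a large mean square. The threshold is chosen so
that `K 𝓛` times its square root is `𝓛^(-24/5) / 10`; on `n ≤ Q²` the line of integration costs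
a factor `𝓛^(2/5)` in the energy, and the powers of `𝓛` cancel exactly. -/
lemma card_direct_le (hχ : χ.IsQuadratic) (hL : 5000 ≤ ell D)
    (hF : ∀ p ∈ F, p.2.IsPrimitive ∧ ((p.1 : ℕ) : ℝ) ≤ 2 * bigQ D) {C K : ℝ} (hK : 0 < K)
    (hE : ∑ n ∈ Finset.Icc 1 (longLen D), (if D ^ 5 < n then nuR χ n ^ 2 / n else 0) ≤
      C * (ell D ^ 13)⁻¹ * (Real.log (ell D))⁻¹) :
    ((F.filter fun p => ell D ^ (-(58 / 5) : ℝ) / (100 * K ^ 2) < directMeanSq χ p.2).card : ℝ) ≤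
      6000 * ((1 + gaussMoment * Real.exp 1) ^ 2 * Real.exp 4) * K ^ 2 * C *
        (Real.log (ell D))⁻¹ * bigQ D ^ 2 := by
  have hHα : alpha D * ell D ^ 2 = 1 := inv_mul_cancel₀ (by positivity)
  have hα0 : 0 < alpha D := inv_pos.mpr (by positivity)
  have hl1 := one_le_log_ell hL
  simp only [directMeanSq]
  have hℓ0 : 0 < ell D := by linarith
  set W := 1 + gaussMoment * Real.exp 1 with hW
  have h := card_lt_meanSq_le F hF (N := longLen D) (one_le_shortLen.trans shortLen_le_longLen)
    longLen_le (directCoeff χ) (fun n => Real.log n) (edge D - alpha D) D hℓ0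
    (V := ell D ^ (-(58 / 5) : ℝ) / (100 * K ^ 2))
    (E := W ^ 2 * Real.exp 4 * ell D ^ (2 / 5 : ℝ) * (C * (ell D ^ 13)⁻¹ * (Real.log (ell D))⁻¹))
    (by positivity) ?_
  · refine h.trans (le_of_eq ?_)
    have e : ell D ^ (2 / 5 : ℝ) = ell D ^ (-(58 / 5) : ℝ) * ell D ^ 12 := by
      rw [← Real.rpow_natCast, ← Real.rpow_add hℓ0]
      norm_num
    have : 0 < ell D ^ (-(58 / 5) : ℝ) := by positivity
    rw [e]
    field_simp
    ring
  · refine le_trans ?_ (mul_le_mul_of_nonneg_left hE (by positivity))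
    rw [Finset.mul_sum]
    refine Finset.sum_le_sum fun n hn => ?_
    obtain ⟨h1, h2⟩ := Finset.mem_Icc.mp hn
    have h3 := exp_neg_mul_log_le (δ := alpha D * (Real.log (ell D) / 10 + 1)) (by positivity) h1
      (log_le_of_le_longLen h1 h2)
    have e : 2 * (alpha D * (Real.log (ell D) / 10 + 1)) * (2 * ell D ^ 2) =
        4 + Real.log (ell D) * (2 / 5) := by
      linear_combination (4 * (Real.log (ell D) / 10 + 1)) * hHα
    have e2 : 1 / 2 - alpha D * (Real.log (ell D) / 10 + 1) = edge D - alpha D := by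
      rw [edge]
      ring
    rw [e, e2, Real.exp_add, ← Real.rpow_def_of_pos hℓ0] at h3
    rw [directCoeff]
    split_ifs with h5
    · have h6 : ‖nu χ n * perronWeight (3 / 2 * ell D ^ 2) n‖ ≤ nuR χ n * W := by
        rw [norm_mul, nu_eq hχ, Complex.norm_real, Real.norm_of_nonneg (nuR_nonneg hχ n)]
        exact mul_le_mul_of_nonneg_left (norm_perronWeight_le_const _ n) (nuR_nonneg hχ n)
      calc _ ≤ (nuR χ n * W) ^ 2 * (Real.exp 4 * ell D ^ (2 / 5 : ℝ) / n) := by gcongr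
        _ = _ := by ring
    · simp

/-- The first `D ^ 5` terms are removed, so the energy is that of the tail of `ν(n)² / n`. -/
lemma norm_dualCoeff_sq_mul_le (hχ : χ.IsQuadratic) {M n : ℕ} (hM : D ^ 5 ≤ M) (hn : 1 ≤ n)
    {σ L B : ℝ} (hB : 0 ≤ B)
    (hσ : M < n → Real.exp (-2 * σ * (L - Real.log n)) ≤ B * n) :
    ‖dualCoeff χ M n‖ ^ 2 * Real.exp (-2 * σ * (L - Real.log n)) ≤
      B * (if D ^ 5 < n then nuR χ n ^ 2 / n else 0) := by
  have hn0 : (0 : ℝ) < n := by exact_mod_cast hn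
  rw [dualCoeff]
  split_ifs with h1 h2 h2
  · rw [norm_div, nu_eq hχ, Complex.norm_real, Real.norm_of_nonneg (nuR_nonneg hχ n),
      Complex.norm_natCast]
    calc _ ≤ (nuR χ n / n) ^ 2 * (B * n) := by
          gcongr
          exact hσ h1
      _ = _ := by field_simp
  · exact absurd (hM.trans_lt h1) h2
  · rw [norm_zero, zero_pow two_ne_zero, zero_mul]
    positivity
  · simp

open Classical in
/-- The characters for which the short dual sum has a large mean square. The exponential factor
of the threshold is matched by the normalization of the exponents `log (Q^(1/1000) / n)`. -/
lemma card_dual_short_le (hχ : χ.IsQuadratic) (hL : 5000 ≤ ell D)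
    (hF : ∀ p ∈ F, p.2.IsPrimitive ∧ ((p.1 : ℕ) : ℝ) ≤ 2 * bigQ D) {C K : ℝ} (hK : 0 < K)
    (hE : ∑ n ∈ Finset.Icc 1 (longLen D), (if D ^ 5 < n then nuR χ n ^ 2 / n else 0) ≤
      C * (ell D ^ 13)⁻¹ * (Real.log (ell D))⁻¹) :
    ((F.filter fun p => ell D ^ (-12 : ℝ) * Real.exp (edge D * (ell D ^ 2 / 1000)) ^ (-2 : ℤ) /
      (100 * K ^ 2) < shortMeanSq χ p.2).card : ℝ) ≤
      6000 * Real.exp 1 * K ^ 2 * C * (Real.log (ell D))⁻¹ * bigQ D ^ 2 := by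
  have hHα : alpha D * ell D ^ 2 = 1 := inv_mul_cancel₀ (by positivity)
  have hα0 : 0 < alpha D := inv_pos.mpr (by positivity)
  have hl1 := one_le_log_ell hL
  simp only [shortMeanSq]
  have hℓ0 : 0 < ell D := by linarith
  set X := Real.exp (edge D * (ell D ^ 2 / 1000)) with hX
  have hX0 : 0 < X := Real.exp_pos _
  have h := card_lt_meanSq_star_le F hF (N := shortLen D) one_le_shortLen
    (le_trans (by exact_mod_cast shortLen_le_longLen) longLen_le) (dualCoeff χ (D ^ 5))
    (fun n => ell D ^ 2 / 1000 - Real.log n) (edge D - alpha D) D hℓ0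
    (V := ell D ^ (-12 : ℝ) * X ^ (-2 : ℤ) / (100 * K ^ 2))
    (E := Real.exp 1 * X ^ (-2 : ℤ) * (C * (ell D ^ 13)⁻¹ * (Real.log (ell D))⁻¹))
    (by positivity) ?_
  · refine h.trans (le_of_eq ?_)
    have e : ell D ^ (-12 : ℝ) = (ell D ^ 12)⁻¹ := by
      rw [Real.rpow_neg hℓ0.le]
      norm_cast
    rw [e]
    field_simp
    ring
  · refine le_trans ?_ (mul_le_mul_of_nonneg_left (le_trans (Finset.sum_le_sum_of_subset_of_nonneg
      (Finset.Icc_subset_Icc_right shortLen_le_longLen) fun n _ _ => ?_) hE) (by positivity))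
    · rw [Finset.mul_sum]
      refine Finset.sum_le_sum fun n hn => ?_
      obtain ⟨h1, h2⟩ := Finset.mem_Icc.mp hn
      have hn0 : (0 : ℝ) < n := by exact_mod_cast h1
      refine norm_dualCoeff_sq_mul_le hχ le_rfl h1 (by positivity) fun _ => ?_
      have hlog : 0 ≤ Real.log n := Real.log_natCast_nonneg n
      have e : X ^ (-2 : ℤ) = Real.exp (-2 * (edge D * (ell D ^ 2 / 1000))) := by
        rw [hX, exp_zpow_neg_two]
      rw [e]
      nth_rw 2 [← Real.exp_log hn0]
      rw [← Real.exp_add, ← Real.exp_add]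
      apply Real.exp_le_exp.mpr
      have h4 : edge D ≤ 1 / 2 := by
        rw [edge]
        have : 0 ≤ alpha D * Real.log (ell D) / 10 := by positivity
        linarith
      nlinarith
    · split_ifs <;> positivity

open Classical in
/-- The characters for which the medium dual sum has a large mean square. The factor
`(log 𝓛)²` from the threshold is absorbed by `𝓛^(-1/5000)`, which is gained from the weight
`n^(-2δ)` to the left of the critical line because `n > Q^(1/1000)`. -/
lemma card_dual_medium_le [NeZero D] (hχ : χ.IsQuadratic) (hL : 5000 ≤ ell D)
    (hF : ∀ p ∈ F, p.2.IsPrimitive ∧ ((p.1 : ℕ) : ℝ) ≤ 2 * bigQ D) {C K : ℝ} (hC : 0 < C)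
    (hK : 0 < K)
    (hE : ∑ n ∈ Finset.Icc 1 (longLen D), (if D ^ 5 < n then nuR χ n ^ 2 / n else 0) ≤
      C * (ell D ^ 13)⁻¹ * (Real.log (ell D))⁻¹) :
    ((F.filter fun p => ell D ^ (-(58 / 5) : ℝ) * (Real.log (ell D) * bigQ D) ^ (-2 : ℤ) /
      (100 * K ^ 2) < mediumMeanSq χ p.2).card : ℝ) ≤
      6000 * (50000000 * Real.exp 8) * K ^ 2 * C * (Real.log (ell D))⁻¹ * bigQ D ^ 2 := by
  have hHα : alpha D * ell D ^ 2 = 1 := inv_mul_cancel₀ (by positivity)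
  have hα0 : 0 < alpha D := inv_pos.mpr (by positivity)
  have hl1 := one_le_log_ell hL
  simp only [mediumMeanSq]
  have hℓ0 : 0 < ell D := by linarith
  have hQ0 : 0 < bigQ D := Real.exp_pos _
  set l := Real.log (ell D) with hl
  have hl0 : 0 < l := by linarith
  have h := card_lt_meanSq_star_le F hF (N := longLen D) (one_le_shortLen.trans shortLen_le_longLen)
    longLen_le (dualCoeff χ (shortLen D))
    (fun n => 2 * ell D ^ 2 - Real.log n) (edge D - 2 * alpha D) D hℓ0
    (V := ell D ^ (-(58 / 5) : ℝ) * (l * bigQ D) ^ (-2 : ℤ) / (100 * K ^ 2))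
    (E := Real.exp 8 * bigQ D ^ (-2 : ℤ) * ell D ^ (2 / 5 : ℝ) * Real.exp (-l / 5000) *
      (C * (ell D ^ 13)⁻¹ * l⁻¹)) (by positivity) ?_
  · refine h.trans ?_
    have e : ell D ^ (2 / 5 : ℝ) = ell D ^ (-(58 / 5) : ℝ) * ell D ^ 12 := by
      rw [← Real.rpow_natCast, ← Real.rpow_add hℓ0]
      norm_num
    have : 0 < ell D ^ (-(58 / 5) : ℝ) := by positivity
    have h2 : l ^ 2 * Real.exp (-l / 5000) ≤ 50000000 := by
      have h3 := Real.quadratic_le_exp_of_nonneg (show 0 ≤ l / 5000 by positivity)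
      rw [neg_div, Real.exp_neg, ← div_eq_mul_inv, div_le_iff₀ (Real.exp_pos _)]
      nlinarith
    calc _ = 6000 * Real.exp 8 * K ^ 2 * C * l⁻¹ * bigQ D ^ 2 * (l ^ 2 * Real.exp (-l / 5000)) := by
          rw [e]
          field_simp
          ring
      _ ≤ 6000 * Real.exp 8 * K ^ 2 * C * l⁻¹ * bigQ D ^ 2 * 50000000 := by gcongr
      _ = _ := by ring
  · refine le_trans ?_ (mul_le_mul_of_nonneg_left hE (by positivity))
    rw [Finset.mul_sum]
    refine Finset.sum_le_sum fun n hn => ?_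
    obtain ⟨h1, h2⟩ := Finset.mem_Icc.mp hn
    have hn0 : (0 : ℝ) < n := by exact_mod_cast h1
    refine norm_dualCoeff_sq_mul_le hχ (pow_five_le_shortLen hL) h1 (by positivity) fun h5 => ?_
    have h6 := le_log_of_shortLen_lt h5
    have e : bigQ D ^ (-2 : ℤ) = Real.exp (-2 * ell D ^ 2) := by
      rw [bigQ, exp_zpow_neg_two]
    rw [e, Real.rpow_def_of_pos hℓ0, ← hl]
    nth_rw 2 [← Real.exp_log hn0]
    rw [← Real.exp_add, ← Real.exp_add, ← Real.exp_add, ← Real.exp_add]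
    apply Real.exp_le_exp.mpr
    rw [edge, ← hl]
    have h7 : l / 5000 ≤ 2 * (alpha D * (l / 10 + 2)) * Real.log n := by
      calc l / 5000 ≤ 2 * (l / 10 + 2) * (1 / 1000) := by linarith
        _ = 2 * (alpha D * (l / 10 + 2)) * (ell D ^ 2 / 1000) := by
          linear_combination (-(2 * (l / 10 + 2) / 1000)) * hHα
        _ ≤ _ := by gcongr
    have e3 : alpha D * l * ell D ^ 2 = l := by linear_combination l * hHα
    nlinarith

end Counts

/-! ### From small mean squares to the three inequalities -/

section Inverse

variable {D : ℕ} {χ : DirichletCharacter ℂ D}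

/-- `ζ * μ = 1`, and twisting this identity by the completely multiplicative function `χ`
preserves it. -/
lemma nuR_mul_upsilonR (hχ : χ.IsQuadratic) : nuR χ * upsilonR χ = 1 := by
  have h1 : (ArithmeticFunction.zeta : ArithmeticFunction ℝ) *
      (ArithmeticFunction.moebius : ArithmeticFunction ℝ) = 1 :=
    ArithmeticFunction.coe_zeta_mul_coe_moebius
  have h2 : chiR χ * (chiR χ).pmul (ArithmeticFunction.moebius : ArithmeticFunction ℝ) = 1 := by
    ext n
    rw [ArithmeticFunction.mul_apply]
    have e : ∀ p ∈ n.divisorsAntidiagonal, chiR χ p.1 *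
        (chiR χ).pmul (ArithmeticFunction.moebius : ArithmeticFunction ℝ) p.2 =
        chiR χ n * ((ArithmeticFunction.zeta : ArithmeticFunction ℝ) p.1 *
          (ArithmeticFunction.moebius : ArithmeticFunction ℝ) p.2) := by
      intro p hp
      obtain ⟨rfl, hn⟩ := Nat.mem_divisorsAntidiagonal.mp hp
      obtain ⟨ha, hb⟩ := mul_ne_zero_iff.mp hn
      rw [chiR_mul hχ ha hb, ArithmeticFunction.pmul_apply,
        ArithmeticFunction.natCoe_apply, ArithmeticFunction.zeta_apply_ne ha]
      push_cast
      ring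
    rw [Finset.sum_congr rfl e, ← Finset.mul_sum, ← ArithmeticFunction.mul_apply, h1]
    rcases eq_or_ne n 1 with rfl | hn
    · rw [chiR_apply one_ne_zero]
      simp
    · rw [ArithmeticFunction.one_apply_ne hn, mul_zero]
  rw [nuR, upsilonR]
  calc _ = ((ArithmeticFunction.zeta : ArithmeticFunction ℝ) *
      (ArithmeticFunction.moebius : ArithmeticFunction ℝ)) * (chiR χ *
      (chiR χ).pmul (ArithmeticFunction.moebius : ArithmeticFunction ℝ)) := by ring
    _ = 1 := by rw [h1, h2, mul_one]

end Inverse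

/-- The coefficient of `n⁻ˢ` in `F(s, ψ) G(s, ψ) - 1`, without the character `ψ`. -/
noncomputable def prodCoeff {D : ℕ} (χ : DirichletCharacter ℂ D) (n : ℕ) : ℂ :=
  if D ^ 5 < n then ∑ p ∈ n.divisorsAntidiagonal,
    (if p.1 ≤ D ^ 5 ∧ p.2 ≤ D ^ 5 then nu χ p.1 * upsilon χ p.2 else 0) else 0

section Sup

variable {D : ℕ} {χ : DirichletCharacter ℂ D}

/-- From `|υ| ≤ ν`, the coefficients are bounded by the full convolution `ν * ν`. -/
lemma norm_prodCoeff_le (hχ : χ.IsQuadratic) (n : ℕ) :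
    ‖prodCoeff χ n‖ ≤ if D ^ 5 < n then (nuR χ ^ 2) n else 0 := by
  rw [prodCoeff]
  split_ifs
  · rw [sq, ArithmeticFunction.mul_apply]
    refine (norm_sum_le _ _).trans (Finset.sum_le_sum fun p _ => ?_)
    have h1 := nuR_nonneg hχ p.1
    have h2 := nuR_nonneg hχ p.2
    split_ifs
    · rw [norm_mul, nu_eq hχ, upsilon_eq hχ, Complex.norm_real, Complex.norm_real,
        Real.norm_of_nonneg h1]
      exact mul_le_mul_of_nonneg_left (abs_upsilonR_le hχ _) h1
    · rw [norm_zero]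
      positivity
  · rw [norm_zero]

lemma div_natCast_cpow (a : ℂ) {n : ℕ} (hn : 1 ≤ n) (s : ℂ) :
    a / (n : ℂ) ^ s = a * Complex.exp (-s * (Real.log n : ℝ)) := by
  have hn0 : (n : ℂ) ≠ 0 := by exact_mod_cast (Nat.one_le_iff_ne_zero.mp hn)
  rw [Complex.cpow_def_of_ne_zero hn0, div_eq_mul_inv, ← Complex.exp_neg, Complex.ofReal_log
    (Nat.cast_nonneg n), Complex.ofReal_natCast]
  congr 2
  ring

lemma bigF_eq_dirPoly {q : ℕ} (χ : DirichletCharacter ℂ D) (ψ : DirichletCharacter ℂ q) (s : ℂ) :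
    bigF χ s ψ = dirPoly (fun n => nu χ n * ψ n) (fun n => Real.log n) (D ^ 5) s :=
  Finset.sum_congr rfl fun _ hn => div_natCast_cpow _ (Finset.mem_Icc.mp hn).1 s

lemma bigG_eq_dirPoly {q : ℕ} (χ : DirichletCharacter ℂ D) (ψ : DirichletCharacter ℂ q) (s : ℂ) :
    bigG χ s ψ = dirPoly (fun n => upsilon χ n * ψ n) (fun n => Real.log n) (D ^ 5) s :=
  Finset.sum_congr rfl fun _ hn => div_natCast_cpow _ (Finset.mem_Icc.mp hn).1 s

/-- The truncations at `D⁵` do not affect the coefficients up to `D⁵`, which are those of the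
constant `1` because `ν` and `υ` are inverse to each other. -/
lemma bigF_mul_bigG_sub_one [NeZero D] {q : ℕ} (hχ : χ.IsQuadratic) (ψ : DirichletCharacter ℂ q)
    (s : ℂ) : bigF χ s ψ * bigG χ s ψ - 1 =
      dirPoly (fun n => prodCoeff χ n * ψ n) (fun n => Real.log n) (D ^ 10) s := by
  have hD : 1 ≤ D := NeZero.pos D
  have h510 : D ^ 5 ≤ D ^ 10 := Nat.pow_le_pow_right hD (by norm_num)
  set e : ℕ → ℂ := fun n => ψ n * Complex.exp (-s * (Real.log n : ℝ)) with he
  have e_mul : ∀ a b : ℕ, a ≠ 0 → b ≠ 0 → e (a * b) = e a * e b := by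
    intro a b ha hb
    simp only [he]
    rw [Nat.cast_mul, Nat.cast_mul, map_mul, Real.log_mul (by exact_mod_cast ha)
      (by exact_mod_cast hb), Complex.ofReal_add, mul_add, Complex.exp_add]
    ring
  have e_one : e 1 = 1 := by simp [he]
  set c : ℕ → ℂ := fun n => ∑ p ∈ n.divisorsAntidiagonal,
    (if p.1 ≤ D ^ 5 ∧ p.2 ≤ D ^ 5 then nu χ p.1 * upsilon χ p.2 else 0) with hc
  have hprod : bigF χ s ψ * bigG χ s ψ = ∑ n ∈ Finset.Icc 1 (D ^ 10), c n * e n := by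
    have h1 : ∀ n ∈ Finset.Icc 1 (D ^ 10), c n * e n = ∑ p ∈ n.divisorsAntidiagonal,
        (if p.1 ≤ D ^ 5 ∧ p.2 ≤ D ^ 5 then (nu χ p.1 * e p.1) * (upsilon χ p.2 * e p.2)
          else 0) := by
      intro n _
      simp only [hc]
      rw [Finset.sum_mul]
      refine Finset.sum_congr rfl fun p hp => ?_
      obtain ⟨rfl, hn⟩ := Nat.mem_divisorsAntidiagonal.mp hp
      obtain ⟨ha, hb⟩ := mul_ne_zero_iff.mp hn
      split_ifs
      · rw [e_mul _ _ ha hb]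
        ring
      · rw [zero_mul]
    rw [Finset.sum_congr rfl h1, sum_divisorsAntidiagonal_eq_double_sum (D ^ 10) fun a b =>
      if a ≤ D ^ 5 ∧ b ≤ D ^ 5 then (nu χ a * e a) * (upsilon χ b * e b) else 0,
      bigF_eq_dirPoly, bigG_eq_dirPoly, dirPoly, dirPoly, Finset.sum_mul_sum]
    have hsub := Finset.Icc_subset_Icc_right (a := 1) h510
    have out : ∀ a ∈ Finset.Icc 1 (D ^ 10), a ∉ Finset.Icc 1 (D ^ 5) → ¬ a ≤ D ^ 5 :=
      fun a h1 h2 h3 => h2 (Finset.mem_Icc.mpr ⟨(Finset.mem_Icc.mp h1).1, h3⟩)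
    rw [← Finset.sum_subset hsub fun a h1 h2 => Finset.sum_eq_zero fun b _ => by
      simp [out a h1 h2]]
    refine Finset.sum_congr rfl fun a ha => ?_
    rw [← Finset.sum_subset hsub fun b h1 h2 => by simp [out b h1 h2]]
    refine Finset.sum_congr rfl fun b hb => ?_
    have ha2 := (Finset.mem_Icc.mp ha).2
    have hb2 := (Finset.mem_Icc.mp hb).2
    have hab : a * b ≤ D ^ 10 := (Nat.mul_le_mul ha2 hb2).trans (le_of_eq (by ring))
    rw [if_pos hab, if_pos ⟨ha2, hb2⟩]
    simp only [he]
    ring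
  have hsmall : ∀ n : ℕ, n ≤ D ^ 5 → c n = if n = 1 then 1 else 0 := by
    intro n hn
    have h1 : c n = (((nuR χ * upsilonR χ) n : ℝ) : ℂ) := by
      rw [ArithmeticFunction.mul_apply, Complex.ofReal_sum]
      refine Finset.sum_congr rfl fun p hp => ?_
      have h2 := Nat.mem_divisorsAntidiagonal.mp hp
      have hn0 : 0 < n := Nat.pos_of_ne_zero h2.2
      rw [if_pos ⟨(Nat.le_of_dvd hn0 ⟨_, h2.1.symm⟩).trans hn,
        (Nat.le_of_dvd hn0 (Dvd.intro_left _ h2.1)).trans hn⟩, nu_eq hχ, upsilon_eq hχ,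
        Complex.ofReal_mul]
    rw [h1, nuR_mul_upsilonR hχ, ArithmeticFunction.one_apply]
    split_ifs <;> simp
  have h1mem : 1 ∈ Finset.Icc 1 (D ^ 10) := Finset.mem_Icc.mpr ⟨le_rfl, Nat.one_le_pow _ _ hD⟩
  have hone : (1 : ℂ) = ∑ n ∈ Finset.Icc 1 (D ^ 10), if n = 1 then 1 else 0 := by
    rw [Finset.sum_ite_eq' _ 1, if_pos h1mem]
  rw [hprod, hone, ← Finset.sum_sub_distrib, dirPoly]
  refine Finset.sum_congr rfl fun n hn => ?_
  rw [prodCoeff, mul_assoc]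
  split_ifs with h1 h2 h2
  · subst h1
    exact absurd h2 (not_lt.mpr (Nat.one_le_pow _ _ hD))
  · subst h1
    rw [hsmall 1 (not_lt.mp h2), e_one]
    simp
  · rw [sub_zero]
  · rw [hsmall n (not_lt.mp h2), if_neg h1]
    simp

lemma supLT_of_le {S : Set ℂ} {f : ℂ → ℝ} {B' B : ℝ} (h0 : 0 ≤ B') (hB : B' < B)
    (h : ∀ s ∈ S, f s ≤ B') : SupLT S f B := by
  have h1 : ∀ x ∈ f '' S, x ≤ B' := by
    rintro _ ⟨s, hs, rfl⟩
    exact h s hs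
  exact ⟨⟨B', h1⟩, (Real.sSup_le h1 h0).trans_lt hB⟩

/-- The Poisson kernel bound on `Ω₁`, with the line of integration moved by `1 / 𝓛` to the left
of the boundary. -/
lemma norm_dirPoly_sq_le_of_mem_Omega1 (hL : 5000 ≤ ell D) (b : ℕ → ℂ) (N : ℕ) {s : ℂ}
    (hs : s ∈ Omega1 D) :
    ‖dirPoly b (fun n => Real.log n) N s‖ ^ 2 ≤ 300 * ell D *
      meanSq (1 / 2 - 3 / ell D) D (ell D) (dirPoly b (fun n => Real.log n) N) := by
  have hℓ0 : 0 < ell D := by linarith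
  obtain ⟨h1, h2, h3⟩ := hs
  have hα : √(alpha D) = 1 / ell D := by
    rw [alpha, ← inv_pow, Real.sqrt_sq (by positivity), one_div]
  have hre : (s - sZero D).re = s.re - 1 / 2 := by simp [sZero]
  have him : (s - sZero D).im = s.im - D := by simp [sZero]
  rw [hre, hα] at h1
  rw [hre] at h2
  rw [him] at h3
  have h := norm_dirPoly_sq_le b N (ℓ := fun n => Real.log n)
    (fun n _ => Real.log_natCast_nonneg n) (1 / 2 - 3 / ell D) D (T := ell D) (β := 1 / ell D)
    (by linarith) (by positivity) (s := s)
    (by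
      have : 3 / ell D = 3 * (1 / ell D) := by ring
      linarith)
    (by
      have : 3 / ell D ≤ 1 := by
        rw [div_le_one hℓ0]
        linarith
      rw [mul_one_div, div_le_one hℓ0]
      linarith)
  refine h.trans (mul_le_mul_of_nonneg_right ?_ (meanSq_nonneg _ _ _ _))
  have h4 : ((s.im - D) / ell D) ^ 2 ≤ 21 ^ 2 := by
    rw [sq_le_sq, abs_div, abs_of_pos hℓ0, abs_of_pos (by norm_num : (0 : ℝ) < 21),
      div_le_iff₀ hℓ0]
    linarith
  have hpi := Real.pi_gt_three
  calc 2 / (Real.pi * (1 / ell D)) * (1 + ((s.im - D) / ell D) ^ 2)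
      ≤ 2 / (3 * (1 / ell D)) * (1 + 21 ^ 2) := by gcongr
    _ = 884 / 3 * ell D := by
      field_simp
      norm_num
    _ ≤ 300 * ell D := by nlinarith

/-- The threshold is `300 𝓛` times smaller than the square of `𝓛³ log 𝓛 / 4`. -/
lemma I1_of_meanSq_le {q : ℕ} (hL : 5000 ≤ ell D) (ψ : DirichletCharacter ℂ q)
    (hF : meanSq (1 / 2 - 3 / ell D) D (ell D)
      (dirPoly (fun n => nu χ n * ψ n) (fun n => Real.log n) (D ^ 5)) ≤
        ell D ^ 5 * Real.log (ell D) ^ 2 / 4800)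
    (hG : meanSq (1 / 2 - 3 / ell D) D (ell D)
      (dirPoly (fun n => upsilon χ n * ψ n) (fun n => Real.log n) (D ^ 5)) ≤
        ell D ^ 5 * Real.log (ell D) ^ 2 / 4800) : I1 χ ψ := by
  have hℓ0 : 0 < ell D := by linarith
  have hl1 := one_le_log_ell hL
  have hB : 0 < ell D ^ 3 * Real.log (ell D) := by positivity
  have key : ∀ {b : ℕ → ℂ} {s : ℂ}, s ∈ Omega1 D → meanSq (1 / 2 - 3 / ell D) D (ell D)
      (dirPoly b (fun n => Real.log n) (D ^ 5)) ≤ ell D ^ 5 * Real.log (ell D) ^ 2 / 4800 →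
      ‖dirPoly b (fun n => Real.log n) (D ^ 5) s‖ ≤ ell D ^ 3 * Real.log (ell D) / 4 := by
    intro b s hs h
    refine abs_le_of_sq_le_sq' ?_ (by positivity) |>.2
    calc _ ≤ _ := norm_dirPoly_sq_le_of_mem_Omega1 hL b _ hs
      _ ≤ 300 * ell D * (ell D ^ 5 * Real.log (ell D) ^ 2 / 4800) := by gcongr
      _ = _ := by ring
  refine supLT_of_le (B' := ell D ^ 3 * Real.log (ell D) / 2) (by positivity) (by linarith)
    fun s hs => ?_
  rw [bigF_eq_dirPoly, bigG_eq_dirPoly]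
  have h1 := key hs hF
  have h2 := key hs hG
  linarith

lemma I2_of_meanSq_le [NeZero D] {q : ℕ} (hχ : χ.IsQuadratic) (hL : 5000 ≤ ell D)
    (ψ : DirichletCharacter ℂ q)
    (h : meanSq (1 / 2 - 3 / ell D) D (ell D)
      (dirPoly (fun n => prodCoeff χ n * ψ n) (fun n => Real.log n) (D ^ 10)) ≤
        1 / (4800 * ell D)) : I2 χ ψ := by
  have hℓ0 : 0 < ell D := by linarith
  refine supLT_of_le (B' := 1 / 4) (by norm_num) (by norm_num) fun s hs => ?_
  rw [bigF_mul_bigG_sub_one hχ]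
  refine abs_le_of_sq_le_sq' ?_ (by positivity) |>.2
  calc _ ≤ _ := norm_dirPoly_sq_le_of_mem_Omega1 hL _ _ hs
    _ ≤ 300 * ell D * (1 / (4800 * ell D)) := by gcongr
    _ = _ := by
      field_simp
      norm_num

lemma mul_sqrt_le {a c V J K : ℝ} (ha : 0 < a) (hK : 0 < K) (hc : 0 < c)
    (hV : V = c ^ 2 * a ^ (-2 : ℤ) / (100 * K ^ 2)) (hJ : J ≤ V) :
    K * (a * √J) ≤ c / 10 := by
  have h1 : √J ≤ c / (10 * K * a) := by
    rw [Real.sqrt_le_left (by positivity)]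
    refine hJ.trans (le_of_eq ?_)
    rw [hV]
    field_simp
    norm_num
  calc K * (a * √J) ≤ K * (a * (c / (10 * K * a))) := by gcongr
    _ = c / 10 := by field_simp

end Sup

section Conclusion

variable {D : ℕ} {χ : DirichletCharacter ℂ D}

/-- The error `D¹⁰ exp(-𝓛²/100)` is at most `exp(-40 𝓛)`. -/
lemma mul_pow_mul_exp_le [NeZero D] {K : ℝ} (hK : 10 * K ≤ ell D) (hL : 5000 ≤ ell D) :
    K * (D ^ 10 * Real.exp (-ell D ^ 2 / 100)) ≤ ell D ^ (-(24 / 5) : ℝ) / 10 := by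
  have hℓ0 : 0 < ell D := by linarith
  have h1 : (D : ℝ) ^ 10 * Real.exp (-ell D ^ 2 / 100) ≤ Real.exp (-40 * ell D) := by
    rw [← exp_ell, ← Real.exp_nat_mul, ← Real.exp_add]
    apply Real.exp_le_exp.mpr
    push_cast
    nlinarith
  have h2 : Real.exp (-(24 / 5) * ell D) ≤ ell D ^ (-(24 / 5) : ℝ) := by
    rw [Real.rpow_def_of_pos hℓ0]
    apply Real.exp_le_exp.mpr
    linarith [Real.log_le_sub_one_of_pos hℓ0]
  have h3 : 10 * K ≤ Real.exp (ell D) := hK.trans (by linarith [Real.add_one_le_exp (ell D)])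
  have h4 : 10 * (K * (D ^ 10 * Real.exp (-ell D ^ 2 / 100))) ≤ ell D ^ (-(24 / 5) : ℝ) := by
    calc _ = 10 * K * (D ^ 10 * Real.exp (-ell D ^ 2 / 100)) := by ring
      _ ≤ Real.exp (ell D) * Real.exp (-40 * ell D) := by gcongr
      _ ≤ Real.exp (-(24 / 5) * ell D) := by
        rw [← Real.exp_add]
        apply Real.exp_le_exp.mpr
        linarith
      _ ≤ _ := h2
  linarith

lemma I3_of_meanSq_le [NeZero D] {q : ℕ} [NeZero q] (hL : 5000 ≤ ell D) {K : ℝ} (hK : 0 < K)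
    (hKL : 10 * K ≤ ell D) (ψ : DirichletCharacter ℂ q)
    (hsup : ∀ s ∈ Omega2 D,
      ‖DirichletCharacter.LFunction ψ s * DirichletCharacter.LFunction (ψ.mul χ) s - calF χ s ψ‖ ≤
      K * (ell D * √(directMeanSq χ ψ) +
        ell D * ell D ^ (1 / 5 : ℝ) * Real.exp (edge D * (ell D ^ 2 / 1000)) *
          √(shortMeanSq χ ψ) +
        ell D * Real.log (ell D) * bigQ D * √(mediumMeanSq χ ψ) +
        D ^ 10 * Real.exp (-ell D ^ 2 / 100)))
    (h1 : directMeanSq χ ψ ≤ ell D ^ (-(58 / 5) : ℝ) / (100 * K ^ 2))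
    (h2 : shortMeanSq χ ψ ≤ ell D ^ (-12 : ℝ) *
      Real.exp (edge D * (ell D ^ 2 / 1000)) ^ (-2 : ℤ) / (100 * K ^ 2))
    (h3 : mediumMeanSq χ ψ ≤ ell D ^ (-(58 / 5) : ℝ) * (Real.log (ell D) * bigQ D) ^ (-2 : ℤ) /
      (100 * K ^ 2)) : I3 χ ψ := by
  have hℓ0 : 0 < ell D := by linarith
  have hl0 : 0 < Real.log (ell D) := by linarith [one_le_log_ell hL]
  have hQ0 : 0 < bigQ D := Real.exp_pos _
  set X := Real.exp (edge D * (ell D ^ 2 / 1000)) with hX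
  have hX0 : 0 < X := Real.exp_pos _
  set c := ell D ^ (-(24 / 5) : ℝ) with hc
  have hc0 : 0 < c := by positivity
  have hc2 : ∀ x : ℝ, c ^ 2 * ell D ^ x = ell D ^ (-(48 / 5) + x : ℝ) := by
    intro x
    rw [hc, ← Real.rpow_natCast, ← Real.rpow_mul hℓ0.le, ← Real.rpow_add hℓ0]
    norm_num
  have hm2 : ell D ^ (-2 : ℤ) = ell D ^ (-2 : ℝ) := by
    rw [← Real.rpow_intCast]
    norm_num
  have e58 : ell D ^ (-(58 / 5) : ℝ) = c ^ 2 * ell D ^ (-2 : ℤ) := by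
    rw [hm2, hc2]
    norm_num
  have k1 := mul_sqrt_le hℓ0 hK hc0 (by rw [e58]) h1
  have k2 := mul_sqrt_le (a := ell D * ell D ^ (1 / 5 : ℝ) * X) (by positivity) hK hc0 (by
    have : (ell D ^ (1 / 5 : ℝ)) ^ (-2 : ℤ) = ell D ^ (-(2 / 5) : ℝ) := by
      rw [← Real.rpow_intCast, ← Real.rpow_mul hℓ0.le]
      norm_num
    rw [mul_zpow, mul_zpow, this, hm2, ← Real.rpow_add hℓ0, ← mul_assoc, hc2]
    norm_num) h2
  have k3 := mul_sqrt_le (a := ell D * Real.log (ell D) * bigQ D) (by positivity) hK hc0 (by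
    rw [mul_assoc (ell D), mul_zpow (ell D), e58, mul_assoc]) h3
  have k4 := mul_pow_mul_exp_le hKL hL
  refine supLT_of_le (B' := c / 10 * 4) (by positivity) (by linarith) fun s hs => ?_
  refine (hsup s hs).trans ?_
  rw [mul_add, mul_add, mul_add]
  linarith

/-- There are finitely many moduli below `2Q`, and finitely many characters of each modulus. -/
lemma finite_Psi (χ : DirichletCharacter ℂ D) : (Psi χ).Finite := by
  classical
  let N : ℕ+ := ⟨⌊2 * bigQ D⌋₊ + 1, Nat.succ_pos _⟩
  refine Set.Finite.subset (Finset.finite_toSet ((Finset.Icc 1 N).sigma fun q : ℕ+ =>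
    (Finset.univ : Finset (DirichletCharacter ℂ (q : ℕ))))) ?_
  rintro ⟨q, ψ⟩ ⟨hq, -⟩
  rw [Finset.mem_coe, Finset.mem_sigma]
  refine ⟨Finset.mem_Icc.mpr ⟨one_le, ?_⟩, Finset.mem_univ _⟩
  rw [← PNat.coe_le_coe]
  exact (Nat.le_floor hq.2.1.le).trans (Nat.le_succ _)

lemma exists_finset_of_card_filter_le {ι : Type*} {F : Finset ι} {P : ι → Prop} [DecidablePred P]
    {S : ℝ} (h : ((F.filter P).card : ℝ) ≤ S) :
    ∃ B : Finset ι, (B.card : ℝ) ≤ S ∧ ∀ p ∈ F, p ∉ B → ¬ P p :=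
  ⟨F.filter P, h, fun _ hp hB hP => hB (Finset.mem_filter.mpr ⟨hp, hP⟩)⟩

/-- The exceptional set is covered by six sets of characters for which one of the mean squares
is large. -/
theorem exists_card_PsiStarStar_le : ∃ L₀ C : ℝ, 0 < C ∧ ∀ (D : ℕ) [NeZero D]
    (χ : DirichletCharacter ℂ D), L₀ ≤ ell D → χ.IsPrimitive → χ.IsQuadratic → A1 χ →
      (PsiStarStar χ).Finite ∧
        ((PsiStarStar χ).ncard : ℝ) ≤ C * (Real.log (ell D))⁻¹ * bigQ D ^ 2 := by
  classical
  obtain ⟨L₀, C, hL₀, hC, hE⟩ := exists_energy_le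
  obtain ⟨K, hK, hsup⟩ := exists_norm_Lprod_sub_calF_le
  set C₁ := 288000 * Real.exp 30 * C with hC₁
  set C₂ := 288000 * Real.exp 60 * C with hC₂
  set C₃ := 6000 * ((1 + gaussMoment * Real.exp 1) ^ 2 * Real.exp 4) * K ^ 2 * C with hC₃
  set C₄ := 6000 * Real.exp 1 * K ^ 2 * C with hC₄
  set C₅ := 6000 * (50000000 * Real.exp 8) * K ^ 2 * C with hC₅
  have hg := gaussMoment_nonneg
  refine ⟨max L₀ (10 * K), 2 * C₁ + C₂ + C₃ + C₄ + C₅, by positivity, ?_⟩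
  intro D _ χ hD hχp hχ hA
  have hL0 : L₀ ≤ ell D := (le_max_left _ _).trans hD
  have hKL : 10 * K ≤ ell D := (le_max_right _ _).trans hD
  have hL : 5000 ≤ ell D := hL₀.trans hL0
  obtain ⟨E1, E2, E3⟩ := hE D χ hχp hχ hA hL0
  have hfin := finite_Psi χ
  refine ⟨hfin.subset Set.sdiff_subset, ?_⟩
  set F := hfin.toFinset with hF
  have hFm : ∀ p ∈ F, p.2.IsPrimitive ∧ ((p.1 : ℕ) : ℝ) ≤ 2 * bigQ D := by
    intro p hp
    obtain ⟨h1, h2, -⟩ := hfin.mem_toFinset.mp hp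
    exact ⟨h2, h1.2.1.le⟩
  obtain ⟨B1, c1, b1⟩ := exists_finset_of_card_filter_le
    (card_short_poly_le hL hFm hC E1 (c := nu χ) fun n => by
      rw [nu_eq hχ, Complex.norm_real, Real.norm_of_nonneg (nuR_nonneg hχ n)])
  obtain ⟨B2, c2, b2⟩ := exists_finset_of_card_filter_le
    (card_short_poly_le hL hFm hC E1 (c := upsilon χ) fun n => by
      rw [upsilon_eq hχ, Complex.norm_real]
      exact abs_upsilonR_le hχ n)
  obtain ⟨B3, c3, b3⟩ := exists_finset_of_card_filter_le
    (card_product_le hL hFm E2 (norm_prodCoeff_le hχ))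
  obtain ⟨B4, c4, b4⟩ := exists_finset_of_card_filter_le (card_direct_le hχ hL hFm hK E3)
  obtain ⟨B5, c5, b5⟩ := exists_finset_of_card_filter_le (card_dual_short_le hχ hL hFm hK E3)
  obtain ⟨B6, c6, b6⟩ := exists_finset_of_card_filter_le (card_dual_medium_le hχ hL hFm hC hK E3)
  have hcover : PsiStarStar χ ⊆ ((B1 ∪ B2 ∪ B3 ∪ B4 ∪ B5 ∪ B6 : Finset _) : Set _) := by
    rintro p ⟨hp, hp'⟩
    by_contra hcon
    apply hp'
    have hpF : p ∈ F := hfin.mem_toFinset.mpr hp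
    simp only [Finset.coe_union, Set.mem_union, Finset.mem_coe, not_or] at hcon
    obtain ⟨⟨⟨⟨⟨n1, n2⟩, n3⟩, n4⟩, n5⟩, n6⟩ := hcon
    refine ⟨hp, I1_of_meanSq_le hL p.2 (not_lt.mp (b1 p hpF n1)) (not_lt.mp (b2 p hpF n2)),
      I2_of_meanSq_le hχ hL p.2 (not_lt.mp (b3 p hpF n3)),
      I3_of_meanSq_le hL hK hKL p.2 ?_ (not_lt.mp (b4 p hpF n4)) (not_lt.mp (b5 p hpF n5))
        (not_lt.mp (b6 p hpF n6))⟩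
    have hq : (1 : ℝ) < ((p.1 : ℕ) : ℝ) := (Real.one_le_exp (sq_nonneg _)).trans_lt hp.1.1
    exact hsup D p.1 χ p.2 hχ hp.2.1 hp.2.2 (by exact_mod_cast hq) hp.1.1.le hp.1.2.1.le hL
  have hcard : (PsiStarStar χ).ncard ≤
      B1.card + B2.card + B3.card + B4.card + B5.card + B6.card := by
    refine (Set.ncard_le_ncard hcover (Finset.finite_toSet _)).trans ?_
    rw [Set.ncard_coe_finset]
    have := Finset.card_union_le B1 B2
    have := Finset.card_union_le (B1 ∪ B2) B3
    have := Finset.card_union_le (B1 ∪ B2 ∪ B3) B4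
    have := Finset.card_union_le (B1 ∪ B2 ∪ B3 ∪ B4) B5
    have := Finset.card_union_le (B1 ∪ B2 ∪ B3 ∪ B4 ∪ B5) B6
    omega
  have hcard' : ((PsiStarStar χ).ncard : ℝ) ≤
      B1.card + B2.card + B3.card + B4.card + B5.card + B6.card := by exact_mod_cast hcard
  refine hcard'.trans ?_
  calc _ ≤ C₁ * (Real.log (ell D))⁻¹ * bigQ D ^ 2 + C₁ * (Real.log (ell D))⁻¹ * bigQ D ^ 2 +
        C₂ * (Real.log (ell D))⁻¹ * bigQ D ^ 2 + C₃ * (Real.log (ell D))⁻¹ * bigQ D ^ 2 +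
        C₄ * (Real.log (ell D))⁻¹ * bigQ D ^ 2 + C₅ * (Real.log (ell D))⁻¹ * bigQ D ^ 2 := by
        gcongr
    _ = _ := by ring

end Conclusion

end LandauSiegel

theorem proposition2p7 :
    ∃ C : ℝ, 0 < C ∧ ∃ D₀ : ℕ, ∀ (D : ℕ) [NeZero D], D₀ ≤ D →
      ∀ χ : DirichletCharacter ℂ D, χ.IsPrimitive → χ.IsQuadratic → LandauSiegel.A1 χ →
        (LandauSiegel.PsiStarStar χ).Finite ∧
          ((LandauSiegel.PsiStarStar χ).ncard : ℝ)
            ≤ C * (Real.log (LandauSiegel.ell D))⁻¹ * LandauSiegel.bigQ D ^ 2 := by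
  obtain ⟨L₀, C, hC, h⟩ := LandauSiegel.exists_card_PsiStarStar_le
  refine ⟨C, hC, ⌈Real.exp L₀⌉₊, fun D _ hD χ hχp hχ hA => h D χ ?_ hχp hχ hA⟩
  have hD0 : (0 : ℝ) < D := by exact_mod_cast NeZero.pos D
  rw [LandauSiegel.ell, Real.le_log_iff_exp_le hD0]
  exact (Nat.le_ceil _).trans (by exact_mod_cast hD)
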